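/- **Definitions.** For a tree $G$ on $N$ nodes, an Euler tour of $G$ is a sequence of $2N-2$ directed edges of $G$, each ending where its cyclic successor starts, that contains each of $(x,y)$ and $(y,x)$ exactly once for every edge $\{x,y\}$ of $G$ (it is empty if $N=1$). It has root $v$ if it is empty or its first edge leaves $v$. For a sequence $A$ of directed edges, $\mathrm{first}_A(x)$ is the first position of an edge of $A$ leaving $x$. An instance of the Euler tour join problem on a set $V$ of $n\ge 1$ nodes consists of (1) a partition $\mathcal C=\{C_1,\dots,C_k\}$ of $V$, given by a leader map $\ell:V\to V$ with $\ell\circ\ell=\ell$ ($u,v$ are in the same cluster iff $\ell(u)=\ell(v)$, and a cluster is named by its leader); (2) a tree $T=(\mathcal C,E)$ and an Euler tour $A$ of $T$; (3) a map $g$ assigning to each $\{C_i,C_j\}\in E$ a pair with $g(C_i,C_j)=(x,y)$, $g(C_j,C_i)=(y,x)$, $x\in C_i$, $y\in C_j$; (4) for each $i$ a spanning tree $T_i=(C_i,E_i)$ of $C_i$ and an Euler tour $A_i$ of $T_i$. Let $\hat E=\{g(e)\mid e\in E\}$ (as undirected edges), let $\hat V$ be the set of endpoints of edges in $\hat E$,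 and let $T'=(V,\hat E\cup\bigcup_i E_i)$. **Algorithm EulerTourJoin.** If $k=1$, output $T'=T_1$ and $A'=A_1$. If $k\ge2$: choose any root $C\in\mathcal C$ of $T$, shift $A$ cyclically to root $C$, and let $\mathrm{par}$ be the parent map. Shift each $A_i$ cyclically to the root $x$ with $(x,y)=g(C_i,\mathrm{par}(C_i))$ if $C_i\neq C$, and to any node of $\hat V\cap C$ as root if $C_i=C$. Order the children $C_j$ of each $C_i$ by $\mathrm{first}_{A_i}(x)$, where $(x,y)=g(C_i,C_j)$, breaking ties arbitrarily. Take an Euler tour $\bar A$ of $T$ with root $C$ in which the first appearances of the children of each cluster follow this order. Let $\hat A$ be $\bar A$ with each $(C_p,C_q)$ replaced by $g(C_p,C_q)$. For $x\in\hat V\cap C_i$ let $A_x$ be the piece of $A_i$ from position $\mathrm{first}_{A_i}(x)$ up to, but not including, the next position of the form $\mathrm{first}_{A_i}(x')$, $x'\in\hat V\cap C_i$, or up to the end of $A_i$ if there is none ($A_x$ is empty if $|C_i|=1$). Obtain $A'$ from $\hat A$ by inserting each $A_x$ directly after the last edge of $\hat A$ that ends at $x$. Output $T'$ and $A'$. **MPC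 model.** There are $p$ machines, each with a local memory of $s$ words of $O(\log(ps))$ bits. In each round every machine performs an arbitrary (deterministic) local computation on its memory and then sends words to other machines; a machine sends at most $s$ and receives at most $s$ words per round, and in the next round it holds exactly the words it received. The input is stored as tuples distributed arbitrarily over the machines: $(x,\ell(x))$ for $x\in V$; the edges of $T$; $(t,e)$ for the $t$-th entry $e$ of $A$; $(e,g(e))$ for $e\in E$; the edges of each $T_i$ tagged with $i$; $(i,t,e)$ for the $t$-th entry $e$ of $A_i$. The output is stored likewise: the edges of $T'$ and $(t,e)$ for the $t$-th entry $e$ of $A'$. **Theorem.** (a) For every instance, $T'$ is a spanning tree of $V$ whose edge set is $\{g(e)\mid e\in E\}\cup\bigcup_i E_i$; EulerTourJoin can be executed, and for all choices it makes, its output $A'$ is an Euler tour of $T'$. (b) EulerTourJoin can be implemented in the MPC model by a fully scalable algorithm with $O(1)$ rounds and $O(n)$ total space. Precisely: for all constants $\varepsilon\in(0,1)$ and $c,L\in\mathbb N$ there are constants $R,K$ and, for each $n\ge1$, a program with local memory $s\le Kn^{\varepsilon}$ and $p$ machines, $ps\le Kn$, such that the following holds for every instance on $n$ nodes whose names are distinct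 natural numbers less than $(n+1)^c$. For every distribution of its input over $m$ machines with $m\lceil n^\varepsilon\rceil\le Ln$ and at most $L\lceil n^\varepsilon\rceil$ input words on each, we have $m\le p$, and after exactly $R$ rounds, which respect the model with all words less than $(ps+2)^K$, the machines hold exactly $T'$ and some possible output $A'$ of EulerTourJoin on that instance. -/

import Mathlib

universe u

/-! ### Euler tours -/

/-- `A` is an Euler tour of the tree `G`: a cyclic sequence of `2|V| - 2` directed edges, each ending
where its cyclic successor starts, that contains each of the two directions of every edge of `G`
exactly once. -/
structure IsEulerTour {α : Type u} (G : SimpleGraph α) (A : List (α × α)) : Prop where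
  length_eq : A.length = 2 * Nat.card α - 2
  adj : ∀ e ∈ A, G.Adj e.1 e.2
  cyclic : ∀ (i : ℕ) (hi : i < A.length),
    (A[i]).2 = (A[(i + 1) % A.length]'(Nat.mod_lt _ (Nat.zero_lt_of_lt hi))).1
  once : ∀ x y, G.Adj x y → ∃! i : Fin A.length, A.get i = (x, y)

/-- The sequence of directed edges `A` starts at the node `x` (no condition if `A` is empty, which
for an Euler tour means that the tree has one node). -/
def StartsAt {α : Type u} (A : List (α × α)) (x : α) : Prop :=
  ∀ e ∈ A.head?, e.1 = x

/-- The first position (counted from `0`) at which `x` is the source of an edge of `A`;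
it is `A.length` if there is none. -/
def firstPos {α : Type u} [DecidableEq α] (A : List (α × α)) (x : α) : ℕ :=
  A.findIdx (fun e => decide (e.1 = x))

/-! ### The Euler tour join problem -/

/-- The clusters of the partition given by a leader map, each represented by its leader. -/
abbrev Cluster {V : Type u} (leader : V → V) : Type u := {c : V // leader c = c}

/-- The nodes of the cluster `c`. -/
abbrev Members {V : Type u} (leader : V → V) (c : Cluster leader) : Type u :=
  {v : V // leader v = c.1}

/-- An input of the Euler tour join problem on the node set `V`. -/
structure JoinInstance (V : Type u) where
  /-- the partition: `u`, `v` are in the same cluster iff `leader u = leader v` -/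
  leader : V → V
  leader_leader : ∀ v, leader (leader v) = leader v
  /-- the spanning tree over the clusters, and an Euler tour of it -/
  T : SimpleGraph (Cluster leader)
  T_isTree : T.IsTree
  A : List (Cluster leader × Cluster leader)
  A_isEulerTour : IsEulerTour T A
  /-- the edge map in its directed form; its values off the edges of `T` are never used -/
  g : Cluster leader → Cluster leader → V × V
  g_mem : ∀ a b, T.Adj a b → leader (g a b).1 = a.1 ∧ leader (g a b).2 = b.1
  g_symm : ∀ a b, T.Adj a b → g b a = (g a b).swap
  /-- the spanning tree of each cluster, and an Euler tour of it -/
  tree : (c : Cluster leader) → SimpleGraph (Members leader c)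
  tree_isTree : ∀ c, (tree c).IsTree
  tour : (c : Cluster leader) → List (Members leader c × Members leader c)
  tour_isEulerTour : ∀ c, IsEulerTour (tree c) (tour c)

namespace JoinInstance

variable {V : Type u} (I : JoinInstance V)

/-- The cluster that contains the node `v`. -/
def clusterOf (v : V) : Cluster I.leader := ⟨I.leader v, I.leader_leader v⟩

/-- The inter-cluster edges `{g(e) | e ∈ E(T)}`. -/
def crossEdges : Set (Sym2 V) :=
  {e | ∃ a b, I.T.Adj a b ∧ e = s((I.g a b).1, (I.g a b).2)}

/-- The union of the inter-cluster edges and of the edges of all cluster trees. -/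
def joinedEdges : Set (Sym2 V) :=
  I.crossEdges ∪ ⋃ c, Sym2.map Subtype.val '' (I.tree c).edgeSet

/-- The joined graph on `V`. -/
def joinedTree : SimpleGraph V := SimpleGraph.fromEdgeSet I.joinedEdges

/-- The endpoints of the inter-cluster edges. -/
def terminals : Set V := {x | ∃ y, s(x, y) ∈ I.crossEdges}

/-- The given tour of the cluster `c`, as a sequence of pairs of nodes of `V`. -/
def tourOn (c : Cluster I.leader) : List (V × V) :=
  (I.tour c).map (Prod.map Subtype.val Subtype.val)

end JoinInstance

/-! ### The algorithm -/

/-- The piece of `B` that starts at the first appearance of `x` and stops just before the next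
position that is the first appearance of a node of `H`, or else at the end of `B`. -/
noncomputable def tourPiece {V : Type u} [DecidableEq V] (H : Set V) (B : List (V × V)) (x : V) :
    List (V × V) :=
  (B.take (sInf {j | firstPos B x < j ∧ (j = B.length ∨ ∃ y ∈ H, j = firstPos B y)})).drop
    (firstPos B x)

/-- Insert, for each node `x` that is the head of an edge of the sequence, the sequence `seg x`
directly after the last edge whose head is `x`. -/
def insertAfterLast {V : Type u} [DecidableEq V] (seg : V → List (V × V)) :
    List (V × V) → List (V × V)
  | [] => []
  | e :: l => e :: ((if ∃ d ∈ l, d.2 = e.2 then [] else seg e.2) ++ insertAfterLast seg l)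

/-- The choices made in one execution of `EulerTourJoin` on `I` (with at least two clusters). -/
structure JoinRun {V : Type u} [DecidableEq V] (I : JoinInstance V) where
  /-- an arbitrary root of `T`, and `A` shifted to that root -/
  root : Cluster I.leader
  shiftedA : List (Cluster I.leader × Cluster I.leader)
  shiftedA_isRotated : shiftedA.IsRotated I.A
  shiftedA_startsAt : StartsAt shiftedA root
  /-- the parents in `T` with respect to the root -/
  par : Cluster I.leader → Cluster I.leader
  par_root : par root = root
  par_adj : ∀ c, c ≠ root → I.T.Adj c (par c) ∧ I.T.dist root c = I.T.dist root (par c) + 1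
  /-- the root node of each cluster: the terminal towards the parent, or an arbitrary terminal
  for the root cluster -/
  base : Cluster I.leader → V
  base_eq : ∀ c, c ≠ root → base c = (I.g c (par c)).1
  base_root : base root ∈ I.terminals ∧ I.leader (base root) = root.1
  /-- the tours of the clusters, shifted to these root nodes -/
  localTour : Cluster I.leader → List (V × V)
  localTour_isRotated : ∀ c, (localTour c).IsRotated (I.tourOn c)
  localTour_startsAt : ∀ c, StartsAt (localTour c) (base c)
  /-- the ranks among siblings, consistent with the first appearances of the terminals in the
  tour of the parent cluster, ties being broken arbitrarily -/
  rank : Cluster I.leader → ℕ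
  rank_injective : ∀ a b, a ≠ root → b ≠ root → par a = par b → rank a = rank b → a = b
  rank_lt : ∀ a b, a ≠ root → b ≠ root → par a = par b →
    firstPos (localTour (par a)) (I.g (par a) a).1 <
      firstPos (localTour (par b)) (I.g (par b) b).1 → rank a < rank b
  /-- a new Euler tour of `T` from the root that visits siblings by increasing rank -/
  newA : List (Cluster I.leader × Cluster I.leader)
  newA_isEulerTour : IsEulerTour I.T newA
  newA_startsAt : StartsAt newA root
  newA_ordered : ∀ a b, a ≠ root → b ≠ root → par a = par b → rank a < rank b →
    firstPos newA a < firstPos newA b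

/-- The sequence produced by an execution: every edge of the new tour of `T` is replaced by its
image under `g`, and the pieces of the cluster tours are inserted. -/
noncomputable def JoinRun.output {V : Type u} [DecidableEq V] {I : JoinInstance V}
    (r : JoinRun I) : List (V × V) :=
  insertAfterLast (fun x => tourPiece I.terminals (r.localTour (I.clusterOf x)) x)
    (r.newA.map (fun e => I.g e.1 e.2))

/-- `B` is a possible output tour of `EulerTourJoin` on `I`. If there is only one cluster, there
is nothing to join and the given tour of that cluster is returned. -/
def JoinInstance.IsOutput {V : Type u} [DecidableEq V] (I : JoinInstance V)
    (B : List (V × V)) : Prop :=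
  (∃ c : Cluster I.leader, (∀ d, d = c) ∧ B = I.tourOn c) ∨
    (Nontrivial (Cluster I.leader) ∧ ∃ r : JoinRun I, B = r.output)

/-! ### The MPC model -/

/-- A program for `p` machines with local memory of `s` words; words are natural numbers, and the
content of a memory is a list of words. In round `t`, machine `i` with memory content `M` sends
the words `send t i M j` to machine `j`; the local computation is arbitrary. -/
structure MPCProgram where
  p : ℕ
  s : ℕ
  send : ℕ → Fin p → List ℕ → Fin p → List ℕ

/-- The memory contents after `t` rounds: a machine holds exactly the words that it received in
the last round, ordered by sender. -/
def MPCProgram.mem (P : MPCProgram) (init : Fin P.p → List ℕ) : ℕ → Fin P.p → List ℕ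
  | 0 => init
  | t + 1 => fun j =>
      (List.finRange P.p).flatMap (fun i => P.send t i (P.mem init t i) j)

/-- The first `R` rounds respect the model: memories (hence also the messages received by a machine
in a round) never exceed `s` words, all words are smaller than `W`, and no machine sends more than
`s` words in a round. -/
structure MPCProgram.Respects (P : MPCProgram) (W R : ℕ) (init : Fin P.p → List ℕ) : Prop where
  mem_length : ∀ t ≤ R, ∀ i, (P.mem init t i).length ≤ P.s
  word_lt : ∀ t ≤ R, ∀ i, ∀ w ∈ P.mem init t i, w < W
  sent_length : ∀ t < R, ∀ i, ∑ j, (P.send t i (P.mem init t i) j).length ≤ P.s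

/-- The initial memory contents when the records `inp i` are stored on machine `i`, for `i < m`, and
the other machines are empty. -/
def MPCProgram.load (P : MPCProgram) {m : ℕ} (inp : Fin m → List (List ℕ)) : Fin P.p → List ℕ :=
  fun i => if h : i.1 < m then (inp ⟨i.1, h⟩).flatten else []

/-! ### Representation of the input and of the output

A record is a short list of words, the first of which tells its kind. A graph is stored as the
collection of its edges, each once and in an arbitrary orientation, and a sequence is stored as the
collection of its entries together with their positions `1, 2, …`. -/

/-- `l` lists every edge of `G` exactly once, in some orientation. -/
def IsEdgeList {α : Type u} (G : SimpleGraph α) (l : List (α × α)) : Prop :=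
  (l.map (fun e => s(e.1, e.2))).Nodup ∧
    ∀ e : Sym2 α, e ∈ l.map (fun e => s(e.1, e.2)) ↔ e ∈ G.edgeSet

/-- `D` is the collection of the records that represent the input `I`, where the node `v` is called
`name v`. -/
def JoinInstance.IsInputData {V : Type u} [Fintype V] [DecidableEq V] (I : JoinInstance V)
    (name : V ↪ ℕ) (D : Multiset (List ℕ)) : Prop :=
  ∃ (eT eg : List (Cluster I.leader × Cluster I.leader))
    (el : (c : Cluster I.leader) → List (Members I.leader c × Members I.leader c)),
    IsEdgeList I.T eT ∧ IsEdgeList I.T eg ∧ (∀ c, IsEdgeList (I.tree c) (el c)) ∧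
    D = (Finset.univ : Finset V).val.map (fun v => [0, name v, name (I.leader v)])
      + (eT.map (fun e => [1, name e.1.1, name e.2.1]) : List (List ℕ))
      + ((I.A.zipIdx 1).map (fun q => [2, q.2, name q.1.1.1, name q.1.2.1]) : List (List ℕ))
      + (eg.map (fun e => [3, name e.1.1, name e.2.1,
          name (I.g e.1 e.2).1, name (I.g e.1 e.2).2]) : List (List ℕ))
      + ∑ c : Cluster I.leader,
          (((el c).map (fun e => [4, name c.1, name e.1.1, name e.2.1]) : List (List ℕ)) :
            Multiset (List ℕ))
      + ∑ c : Cluster I.leader,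
          ((((I.tour c).zipIdx 1).map
            (fun q => [5, name c.1, q.2, name q.1.1.1, name q.1.2.1]) : List (List ℕ)) :
            Multiset (List ℕ))

/-- `D` is the collection of the records that represent the joined tree of `I` and the sequence `B`
of directed edges. -/
def JoinInstance.IsOutputData {V : Type u} (I : JoinInstance V)
    (name : V ↪ ℕ) (B : List (V × V)) (D : Multiset (List ℕ)) : Prop :=
  ∃ e' : List (V × V), IsEdgeList I.joinedTree e' ∧
    D = ((e'.map (fun e => [6, name e.1, name e.2]) : List (List ℕ)) : Multiset (List ℕ))
      + ((B.zipIdx 1).map (fun q => [7, q.2, name q.1.1, name q.1.2]) : List (List ℕ))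

/-! ### Oblivious networks of local maps -/

/-! Correctness. T' is connected, and it has (k − 1) + Σ (|C_i| − 1) = n − 1 edges, so it is a tree.
For the tour, consider the arrivals of the new tour of T at one cluster, each at a terminal. The
first one comes from the parent (except at the root cluster) and hits the root of the shifted local
tour, at position 0. The later ones come from the children, which are ordered by the first positions
of their terminals. So the positions of successive arrivals never decrease
(`JoinRun.pos_le_of_arrives`), and each departure to a child uses the terminal of the next arrival
at the cluster. The piece inserted after the last arrival at x therefore leads from x to the next
terminal, or at the end back to the base (`JoinRun.isWalk_inserted`), and the output is a closed
walk. Every local entry belongs to the piece of the last terminal before it. The output is sorted by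
the keys (last arrival, index in the local tour) of `JoinRun.pairwise_output`, so nothing is
repeated.

Implementation. No pointer is followed. Every number that determines a final position is a sum of
weights over the records whose key lies in an interval: looking up a position, the length of a
subtree (an interval of A), the preceding siblings, the number of smaller keys. The position at
which a cluster is entered is the sum of the offsets of its ancestors; by the bracket structure of A
this is the sum over edges already entered minus the sum over edges already left. Eighteen such sums
(`JoinSteps.steps`) suffice. They are shown to describe one particular execution, in which A fixes
the root and breaks ties (`JoinRun.IsCanonical`).

A range sum is a difference of two dominance sums. A dominance sum is obtained by sorting data and
queries together, taking prefix sums and sorting back (`exists_isNet_dominanceStep`). An array of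
length b^(k+3) is sorted with blocks of b^3 slots in depth 4^k by iterated Columnsort
(`IsSorter.columnsort`), and prefix sums take depth k + 3. All this is an oblivious network of maps
acting inside small blocks. Its distribution over machines is known in advance, so a machine program
executes one layer per round (`layerProgram_spec`). With b^3 of order n^ε and k = ⌈3/ε⌉ the depth is
constant and the space linear. -/

section Net

variable {ι ι' κ α : Type}

/-- Apply `Φ` to each of the copies `e (k, ·)`, and leave the other slots unchanged. -/
noncomputable def inParallel (e : κ × ι' → ι) (Φ : (ι' → α) → ι' → α) (x : ι → α) (i : ι) : α :=
  open Classical in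
  if h : ∃ q, e q = i then Φ (fun j => x (e (h.choose.1, j))) h.choose.2 else x i

theorem inParallel_apply {e : κ × ι' → ι} (he : Function.Injective e)
    (Φ : (ι' → α) → ι' → α) (x : ι → α) (k : κ) (j : ι') :
    inParallel e Φ x (e (k, j)) = Φ (fun j => x (e (k, j))) j := by
  have h : ∃ q, e q = e (k, j) := ⟨_, rfl⟩
  have h2 : h.choose = (k, j) := he h.choose_spec
  rw [inParallel, dif_pos h, h2]

theorem inParallel_of_notMem {e : κ × ι' → ι} (Φ : (ι' → α) → ι' → α) (x : ι → α) {i : ι}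
    (h : ¬ ∃ q, e q = i) : inParallel e Φ x i = x i := by
  rw [inParallel, dif_neg h]

theorem inParallel_id {e : κ × ι' → ι} (he : Function.Injective e) :
    inParallel e (id : (ι' → α) → ι' → α) = id := by
  funext x i
  by_cases h : ∃ q, e q = i
  · obtain ⟨⟨k, j⟩, rfl⟩ := h
    simp [inParallel_apply he]
  · simp [inParallel_of_notMem _ _ h]

theorem inParallel_comp {e : κ × ι' → ι} (he : Function.Injective e)
    (Φ Ψ : (ι' → α) → ι' → α) :
    inParallel e (Ψ ∘ Φ) = inParallel e Ψ ∘ inParallel e Φ := by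
  funext x i
  by_cases h : ∃ q, e q = i
  · obtain ⟨⟨k, j⟩, rfl⟩ := h
    simp only [Function.comp, inParallel_apply he]
  · simp [inParallel_of_notMem _ _ h]

variable [Fintype ι] [DecidableEq ι] [Fintype ι'] [DecidableEq ι']

/-- The slots are partitioned into blocks of at most `B` slots, and the new content of a slot
depends only on the contents of its block. -/
def IsLocal (B : ℕ) (Φ : (ι → α) → ι → α) : Prop :=
  ∃ blk : ι → ι, (∀ i, (Finset.univ.filter (fun j => blk j = i)).card ≤ B) ∧
    ∀ x y i, (∀ j, blk j = blk i → x j = y j) → Φ x i = Φ y i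

/-- `Φ` is a composition of `d` local maps. -/
inductive IsNet (B : ℕ) : ℕ → ((ι → α) → ι → α) → Prop
  | refl : IsNet B 0 id
  | step {d : ℕ} {Φ Ψ : (ι → α) → ι → α} (h : IsLocal B Φ) (h' : IsNet B d Ψ) :
      IsNet B (d + 1) (Ψ ∘ Φ)

theorem IsLocal.isNet {B : ℕ} {Φ : (ι → α) → ι → α} (h : IsLocal B Φ) : IsNet B 1 Φ :=
  IsNet.step (Ψ := id) h IsNet.refl

theorem IsNet.trans {B d d' : ℕ} {Φ Ψ : (ι → α) → ι → α} (h : IsNet B d Φ) (h' : IsNet B d' Ψ) :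
    IsNet B (d + d') (Ψ ∘ Φ) := by
  induction h with
  | refl => simpa using h'
  | step hl _ ih =>
    rw [Nat.add_right_comm, ← Function.comp_assoc]
    exact IsNet.step hl ih

theorem isLocal_pointwise {B : ℕ} (hB : 1 ≤ B) (f : ι → α → α) :
    IsLocal B (fun x i => f i (x i)) :=
  ⟨id, fun i => by simpa [Finset.filter_eq'] using hB, fun x y i h => congrArg (f i) (h i rfl)⟩

/-- The blocks of Φ are copied along `e`. A slot outside the range of `e` forms a block of its own,
which is where `1 ≤ B` enters. -/
theorem IsLocal.inParallel {B : ℕ} (hB : 1 ≤ B) {e : κ × ι' → ι} (he : Function.Injective e)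
    {Φ : (ι' → α) → ι' → α} (h : IsLocal B Φ) : IsLocal B (inParallel e Φ) := by
  classical
  obtain ⟨blk, hblk, hloc⟩ := h
  set blk2 : ι → ι := fun i =>
    if h : ∃ q, e q = i then e (h.choose.1, blk h.choose.2) else i with hblk2
  have hb1 : ∀ k j, blk2 (e (k, j)) = e (k, blk j) := by
    intro k j
    have h : ∃ q, e q = e (k, j) := ⟨_, rfl⟩
    have h2 : h.choose = (k, j) := he h.choose_spec
    simp only [hblk2]
    rw [dif_pos h, h2]
  have hb2 : ∀ i, (¬ ∃ q, e q = i) → blk2 i = i := fun i h => by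
    simp only [hblk2]
    rw [dif_neg h]
  refine ⟨blk2, fun i => ?_, fun x y i hxy => ?_⟩
  · by_cases h : ∃ q, e q = i
    · obtain ⟨⟨k, j⟩, rfl⟩ := h
      refine le_trans (le_trans (Finset.card_le_card (t := (Finset.univ.filter
        (fun j' => blk j' = j)).image (fun j' => e (k, j'))) ?_) Finset.card_image_le) (hblk j)
      intro i' hi'
      simp only [Finset.mem_filter, Finset.mem_univ, true_and, Finset.mem_image] at hi' ⊢
      by_cases h' : ∃ q, e q = i'
      · obtain ⟨⟨k', j'⟩, rfl⟩ := h'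
        rw [hb1] at hi'
        have := he hi'
        simp only [Prod.mk.injEq] at this
        obtain ⟨rfl, h3⟩ := this
        exact ⟨j', h3, rfl⟩
      · rw [hb2 _ h'] at hi'
        exact absurd ⟨_, hi'.symm⟩ h'
    · refine le_trans (Finset.card_le_card (t := {i}) ?_) (by simpa using hB)
      intro i' hi'
      simp only [Finset.mem_filter, Finset.mem_univ, true_and, Finset.mem_singleton] at hi' ⊢
      by_cases h' : ∃ q, e q = i'
      · obtain ⟨⟨k', j'⟩, rfl⟩ := h'
        rw [hb1] at hi'
        exact absurd ⟨_, hi'⟩ h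
      · rwa [hb2 _ h'] at hi'
  · by_cases h : ∃ q, e q = i
    · obtain ⟨⟨k, j⟩, rfl⟩ := h
      rw [inParallel_apply he, inParallel_apply he]
      refine hloc _ _ _ fun j' hj' => hxy _ ?_
      rw [hb1, hb1, hj']
    · rw [inParallel_of_notMem _ _ h, inParallel_of_notMem _ _ h]
      exact hxy _ rfl

theorem IsNet.inParallel {B d : ℕ} (hB : 1 ≤ B) {e : κ × ι' → ι} (he : Function.Injective e)
    {Φ : (ι' → α) → ι' → α} (h : IsNet B d Φ) : IsNet B d (inParallel e Φ) := by
  induction h with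
  | refl => rw [inParallel_id he]; exact IsNet.refl
  | step hl _ ih =>
    rw [inParallel_comp he]
    exact IsNet.step (hl.inParallel hB he) ih

end Net

/-! ### Sorting networks -/

section SortingNetwork

variable {α : Type}

/-- `Φ` sorts every array by the given key. -/
def IsSorter {r : ℕ} (key : α → ℕ) (Φ : (Fin r → α) → Fin r → α) : Prop :=
  ∀ x, (∃ σ : Equiv.Perm (Fin r), Φ x = x ∘ σ) ∧ Monotone (fun i => key (Φ x i))

/-- A local map is arbitrary inside a block, so an array that fits into one block is sorted by one
layer. -/
theorem exists_isSorter_one (key : α → ℕ) {r B : ℕ} (hr : 0 < r) (hB : r ≤ B) :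
    ∃ Φ : (Fin r → α) → Fin r → α, IsSorter key Φ ∧ IsNet B 1 Φ := by
  refine ⟨fun x => x ∘ Tuple.sort (key ∘ x), fun x => ⟨⟨_, rfl⟩, ?_⟩, IsLocal.isNet ?_⟩
  · exact Tuple.monotone_sort (key ∘ x)
  · refine ⟨fun _ => ⟨0, hr⟩, fun i => (Finset.card_filter_le _ _).trans (by simpa using hB), ?_⟩
    intro x y i h
    have : x = y := funext fun j => h j rfl
    rw [this]

theorem mem_iff_lt_card_of_isLowerSet {r : ℕ} (S : Finset (Fin r))
    (hS : ∀ i j, i ≤ j → j ∈ S → i ∈ S) (i : Fin r) : i ∈ S ↔ i.1 < S.card := by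
  constructor
  · intro h
    have h1 : Finset.Iic i ⊆ S := fun j hj => hS j i (Finset.mem_Iic.1 hj) h
    have := Finset.card_le_card h1
    rw [Fin.card_Iic] at this
    omega
  · intro h
    by_contra hi
    have h1 : S ⊆ Finset.Iio i := by
      intro j hj
      rw [Finset.mem_Iio]
      by_contra hij
      exact hi (hS i j (not_lt.1 hij) hj)
    have := Finset.card_le_card h1
    rw [Fin.card_Iio] at this
    omega

/-- Sorting is analysed one threshold τ at a time, as in the 0-1 principle: a permutation preserves
the number of keys below τ, and monotonicity places them in the first slots. -/
theorem IsSorter.lt_iff {r : ℕ} {key : α → ℕ} {Φ : (Fin r → α) → Fin r → α}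
    (h : IsSorter key Φ) (x : Fin r → α) (τ : ℕ) (i : Fin r) :
    key (Φ x i) < τ ↔ i.1 < (Finset.univ.filter (fun j => key (x j) < τ)).card := by
  obtain ⟨⟨σ, hσ⟩, hm⟩ := h x
  have h1 : (Finset.univ.filter (fun j => key (x j) < τ)).card =
      (Finset.univ.filter (fun j => key (Φ x j) < τ)).card := by
    rw [hσ]
    refine (Finset.card_bij (fun j _ => σ j) ?_ ?_ ?_).symm
    · intro a ha; simpa using ha
    · intro a _ b _ hab; exact σ.injective hab
    · intro b hb; exact ⟨σ.symm b, by simpa using hb, by simp⟩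
  rw [h1, ← mem_iff_lt_card_of_isLowerSet]
  · simp
  · intro a b hab hb
    simp only [Finset.mem_filter, Finset.mem_univ, true_and] at hb ⊢
    exact lt_of_le_of_lt (hm hab) hb

/-- Each copy is permuted separately and the other slots are fixed. Injectivity of `e` makes the
glued map injective, hence a permutation of the finite set of slots. -/
theorem inParallel_perm {κ : Type} {r N : ℕ} {e : κ × Fin r → Fin N} (he : Function.Injective e)
    {Φ : (Fin r → α) → Fin r → α} (h : ∀ x, ∃ σ : Equiv.Perm (Fin r), Φ x = x ∘ σ)
    (x : Fin N → α) : ∃ σ : Equiv.Perm (Fin N), inParallel e Φ x = x ∘ σ := by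
  classical
  choose σ hσ using h
  set τ : Fin N → Fin N := fun i => if h : ∃ q, e q = i then
    e (h.choose.1, σ (fun j => x (e (h.choose.1, j))) h.choose.2) else i with hτ
  have h1 : ∀ k j, τ (e (k, j)) = e (k, σ (fun j => x (e (k, j))) j) := by
    intro k j
    have h : ∃ q, e q = e (k, j) := ⟨_, rfl⟩
    have h2 : h.choose = (k, j) := he h.choose_spec
    simp only [hτ]
    rw [dif_pos h, h2]
  have h2 : ∀ i, (¬ ∃ q, e q = i) → τ i = i := fun i h => by
    simp only [hτ]
    rw [dif_neg h]
  have hinj : Function.Injective τ := by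
    intro a b hab
    by_cases ha : ∃ q, e q = a <;> by_cases hb : ∃ q, e q = b
    · obtain ⟨⟨k, j⟩, rfl⟩ := ha
      obtain ⟨⟨k', j'⟩, rfl⟩ := hb
      rw [h1, h1] at hab
      have := he hab
      simp only [Prod.mk.injEq] at this
      obtain ⟨rfl, h3⟩ := this
      rw [(σ _).injective h3]
    · obtain ⟨⟨k, j⟩, rfl⟩ := ha
      rw [h1, h2 _ hb] at hab
      exact absurd ⟨_, hab⟩ hb
    · obtain ⟨⟨k, j⟩, rfl⟩ := hb
      rw [h1, h2 _ ha] at hab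
      exact absurd ⟨_, hab.symm⟩ ha
    · rwa [h2 _ ha, h2 _ hb] at hab
  refine ⟨Equiv.ofBijective τ (Finite.injective_iff_bijective.1 hinj), funext fun i => ?_⟩
  by_cases h : ∃ q, e q = i
  · obtain ⟨⟨k, j⟩, rfl⟩ := h
    rw [inParallel_apply he, hσ]
    simp [h1]
  · rw [inParallel_of_notMem _ _ h]
    simp [h2 _ h]

/-- Sorting increasing subarrays keeps an initial segment of small keys. -/
theorem inParallel_lt_of_forall {κ : Type} {r N : ℕ} {e : κ × Fin r → Fin N}
    (he : Function.Injective e) (hmono : ∀ k, StrictMono (fun j => e (k, j)))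
    {key : α → ℕ} {Φ : (Fin r → α) → Fin r → α} (hΦ : IsSorter key Φ) {x : Fin N → α} {τ w : ℕ}
    (h : ∀ i : Fin N, i.1 < w → key (x i) < τ) (i : Fin N) (hi : i.1 < w) :
    key (inParallel e Φ x i) < τ := by
  by_cases hq : ∃ q, e q = i
  · obtain ⟨⟨k, j⟩, rfl⟩ := hq
    rw [inParallel_apply he, hΦ.lt_iff]
    have : Finset.Iic j ⊆ Finset.univ.filter (fun j => key (x (e (k, j))) < τ) := by
      intro j' hj'
      simp only [Finset.mem_filter, Finset.mem_univ, true_and]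
      refine h _ (lt_of_le_of_lt ?_ hi)
      exact (hmono k).monotone (Finset.mem_Iic.1 hj')
    have := Finset.card_le_card this
    rw [Fin.card_Iic] at this
    omega
  · rw [inParallel_of_notMem _ _ hq]
    exact h i hi

/-- Sorting increasing subarrays keeps a final segment of large keys. -/
theorem inParallel_not_lt_of_forall {κ : Type} {r N : ℕ} {e : κ × Fin r → Fin N}
    (he : Function.Injective e) (hmono : ∀ k, StrictMono (fun j => e (k, j)))
    {key : α → ℕ} {Φ : (Fin r → α) → Fin r → α} (hΦ : IsSorter key Φ) {x : Fin N → α} {τ w : ℕ}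
    (h : ∀ i : Fin N, w ≤ i.1 → ¬ key (x i) < τ) (i : Fin N) (hi : w ≤ i.1) :
    ¬ key (inParallel e Φ x i) < τ := by
  by_cases hq : ∃ q, e q = i
  · obtain ⟨⟨k, j⟩, rfl⟩ := hq
    rw [inParallel_apply he, hΦ.lt_iff]
    have : Finset.univ.filter (fun j => key (x (e (k, j))) < τ) ⊆ Finset.Iio j := by
      intro j' hj'
      simp only [Finset.mem_filter, Finset.mem_univ, true_and] at hj'
      rw [Finset.mem_Iio]
      by_contra hjj
      refine h _ (hi.trans ?_) hj'
      exact (hmono k).monotone (not_lt.1 hjj)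
    have := Finset.card_le_card this
    rw [Fin.card_Iio] at this
    omega
  · rw [inParallel_of_notMem _ _ hq]
    exact h i hi

open Classical in
/-- If each of `c` consecutive blocks of length `c * q` starts with its elements of `p`, then all
residue classes modulo `c` contain nearly the same number of elements of `p`. -/
theorem residue_count {c q : ℕ} (hq : 0 < q) (z : ℕ → ℕ) (hz : ∀ j < c, z j ≤ c * q) (p : ℕ → Prop)
    (hp : ∀ j < c, ∀ i < c * q, p (j * (c * q) + i) ↔ i < z j) {a : ℕ} (ha : a < c) :
    (∑ j ∈ Finset.range c, z j / c) ≤ ((Finset.range (c * q)).filter (fun u => p (c * u + a))).card ∧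
    ((Finset.range (c * q)).filter (fun u => p (c * u + a))).card ≤
      (∑ j ∈ Finset.range c, z j / c) + c := by
  have hc : 0 < c := by omega
  -- Since blocks have length c * q and a < c, slot c * u + a lies in block u / q. Block j
  -- contributes the v < q with c * v + a < z j, at least z j / c of them and at most one more.
  have hcount := Finset.card_eq_sum_card_fiberwise (f := fun u => u / q)
    (s := (Finset.range (c * q)).filter (fun u => p (c * u + a))) (t := Finset.range c) (by
      intro u hu
      simp only [Finset.coe_filter, Finset.mem_range, Set.mem_ofPred_eq] at hu
      simp only [Finset.coe_range, Set.mem_Iio]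
      exact (Nat.div_lt_iff_lt_mul hq).2 hu.1)
  have key : ∀ j < c, ∀ v < q, (p (c * (j * q + v) + a) ↔ c * v + a < z j) := by
    intro j hj v hv
    have h1 : c * (j * q + v) + a = j * (c * q) + (c * v + a) := by ring
    rw [h1]
    refine hp j hj _ ?_
    calc c * v + a < c * (v + 1) := by rw [mul_add]; omega
      _ ≤ c * q := Nat.mul_le_mul_left _ hv
  rw [hcount]
  have hsum : (∑ j ∈ Finset.range c, z j / c) + c = ∑ j ∈ Finset.range c, (z j / c + 1) := by
    rw [Finset.sum_add_distrib]; simp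
  rw [hsum]
  constructor
  · refine Finset.sum_le_sum fun j hj => ?_
    have hj := Finset.mem_range.1 hj
    have hzq : z j / c ≤ q := Nat.div_le_of_le_mul (hz j hj)
    have : (Finset.range (z j / c)).image (fun v => j * q + v) ⊆ Finset.filter (fun u => u / q = j)
        ((Finset.range (c * q)).filter (fun u => p (c * u + a))) := by
      intro u hu
      obtain ⟨v, hv, rfl⟩ := Finset.mem_image.1 hu
      have hv := Finset.mem_range.1 hv
      have hvq : v < q := by omega
      simp only [Finset.mem_filter, Finset.mem_range]
      refine ⟨⟨?_, (key j hj v hvq).2 ?_⟩, ?_⟩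
      · calc j * q + v < (j + 1) * q := by rw [add_mul]; omega
          _ ≤ c * q := Nat.mul_le_mul_right _ hj
      · calc c * v + a < c * (v + 1) := by rw [mul_add]; omega
          _ ≤ c * (z j / c) := Nat.mul_le_mul_left _ hv
          _ ≤ z j := Nat.mul_div_le _ _
      · rw [add_comm, Nat.add_mul_div_right _ _ hq, Nat.div_eq_of_lt hvq, zero_add]
    have h2 := Finset.card_le_card this
    rwa [Finset.card_image_of_injective _ (add_right_injective _), Finset.card_range] at h2
  · refine Finset.sum_le_sum fun j hj => ?_
    have hj := Finset.mem_range.1 hj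
    have : Finset.filter (fun u => u / q = j)
        ((Finset.range (c * q)).filter (fun u => p (c * u + a))) ⊆
        (Finset.range (z j / c + 1)).image (fun v => j * q + v) := by
      intro u hu
      simp only [Finset.mem_filter, Finset.mem_range] at hu
      obtain ⟨⟨h1, h2⟩, h3⟩ := hu
      have h4 : u = j * q + u % q := by
        rw [← h3, mul_comm]; exact (Nat.div_add_mod u q).symm
      have h5 := Nat.mod_lt u hq
      rw [h4, key j hj _ h5] at h2
      refine Finset.mem_image.2 ⟨u % q, Finset.mem_range.2 ?_, h4.symm⟩
      rw [Nat.lt_succ_iff, Nat.le_div_iff_mul_le hc]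
      rw [mul_comm]; omega
    exact (Finset.card_le_card this).trans (Finset.card_image_le.trans (by simp))

theorem card_filter_fin (r : ℕ) (p : ℕ → Prop) [DecidablePred p] :
    (Finset.univ.filter (fun i : Fin r => p i)).card = ((Finset.range r).filter p).card := by
  refine Finset.card_bij (fun i _ => i.1) ?_ ?_ ?_
  · intro a ha; simpa using ha
  · intro a _ b _ hab; exact Fin.ext hab
  · intro b hb
    simp only [Finset.mem_filter, Finset.mem_range] at hb
    exact ⟨⟨b, hb.1⟩, by simpa using hb.2, rfl⟩

end SortingNetwork

/-! ### Columnsort with consecutive blocks, residue classes and shifted blocks -/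

section Columnsort

variable {α : Type}

/-- The `j`-th block of `r` consecutive slots, starting at slot `h`. -/
def shiftedBlock (h c r N : ℕ) (hN : h + c * r ≤ N) (x : Fin c × Fin r) : Fin N :=
  ⟨h + (x.1.1 * r + x.2.1), by
    have h1 : (x.1.1 + 1) * r ≤ c * r := Nat.mul_le_mul_right _ x.1.2
    have h2 := x.2.2
    rw [add_mul] at h1
    omega⟩

theorem shiftedBlock_injective (h c r N : ℕ) (hN : h + c * r ≤ N) :
    Function.Injective (shiftedBlock h c r N hN) := by
  rintro ⟨a, b⟩ ⟨a', b'⟩ hab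
  have hab := congrArg Fin.val hab
  simp only [shiftedBlock, Nat.add_left_cancel_iff] at hab
  have hr : 0 < r := by have := b.2; omega
  have h1 : a.1 = a'.1 := by
    have := congrArg (· / r) hab
    simpa [mul_comm _ r, Nat.mul_add_div hr, Nat.div_eq_of_lt b.2, Nat.div_eq_of_lt b'.2] using this
  have h2 : b.1 = b'.1 := by rw [h1] at hab; omega
  exact Prod.ext (Fin.ext h1) (Fin.ext h2)

theorem shiftedBlock_strictMono (h c r N : ℕ) (hN : h + c * r ≤ N) (k : Fin c) :
    StrictMono (fun j => shiftedBlock h c r N hN (k, j)) := by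
  intro a b hab
  have : a.1 < b.1 := hab
  change h + (k.1 * r + a.1) < h + (k.1 * r + b.1)
  omega

/-- The slots congruent to `a` modulo `c`. -/
def residueClass (c r : ℕ) (x : Fin c × Fin r) : Fin (c * r) :=
  ⟨c * x.2.1 + x.1.1, by
    have h1 : c * (x.2.1 + 1) ≤ c * r := Nat.mul_le_mul_left _ x.2.2
    have h2 := x.1.2
    rw [mul_add] at h1
    omega⟩

theorem residueClass_injective (c r : ℕ) : Function.Injective (residueClass c r) := by
  rintro ⟨a, b⟩ ⟨a', b'⟩ hab
  have hab := congrArg Fin.val hab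
  simp only [residueClass] at hab
  have hc : 0 < c := by have := a.2; omega
  have h1 : b.1 = b'.1 := by
    have := congrArg (· / c) hab
    simpa [Nat.mul_add_div hc, Nat.div_eq_of_lt a.2, Nat.div_eq_of_lt a'.2] using this
  have h2 : a.1 = a'.1 := by rw [h1] at hab; omega
  exact Prod.ext (Fin.ext h2) (Fin.ext h1)

theorem exists_shiftedBlock_zero {c r : ℕ} (i : Fin (c * r)) :
    ∃ k j, shiftedBlock 0 c r (c * r) (by simp) (k, j) = i := by
  have hr : 0 < r := by
    rcases Nat.eq_zero_or_pos r with rfl | h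
    · exact absurd i.2 (by simp)
    · exact h
  refine ⟨⟨i.1 / r, (Nat.div_lt_iff_lt_mul hr).2 i.2⟩, ⟨i.1 % r, Nat.mod_lt _ hr⟩, Fin.ext ?_⟩
  simp only [shiftedBlock]
  rw [zero_add, mul_comm]
  exact Nat.div_add_mod _ _

theorem exists_residueClass {c r : ℕ} (i : Fin (c * r)) :
    ∃ k j, residueClass c r (k, j) = i := by
  have hc : 0 < c := by
    rcases Nat.eq_zero_or_pos c with rfl | h
    · exact absurd i.2 (by simp)
    · exact h
  refine ⟨⟨i.1 % c, Nat.mod_lt _ hc⟩,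
    ⟨i.1 / c, (Nat.div_lt_iff_lt_mul hc).2 (lt_of_lt_of_eq i.2 (mul_comm c r))⟩, Fin.ext ?_⟩
  simp only [residueClass]
  exact Nat.div_add_mod _ _

/-- After sorting blocks and then residue classes, the small keys form an initial segment up to a
window of `c * c` slots. -/
theorem exists_dirty_window {c q r : ℕ} (hr : r = c * q) (hq : 0 < q) {key : α → ℕ}
    {Φ : (Fin r → α) → Fin r → α} (hΦ : IsSorter key Φ) (x : Fin (c * r) → α)
    (τ : ℕ) : ∃ w, (∀ i : Fin (c * r), i.1 < w →
        key (inParallel (residueClass c r) Φ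
          (inParallel (shiftedBlock 0 c r _ (by simp)) Φ x) i) < τ) ∧
      ∀ i : Fin (c * r), w + c * c ≤ i.1 →
        ¬ key (inParallel (residueClass c r) Φ
          (inParallel (shiftedBlock 0 c r _ (by simp)) Φ x) i) < τ := by
  classical
  set e1 := shiftedBlock 0 c r (c * r) (by simp)
  set x1 := inParallel e1 Φ x with hx1
  have he1 : Function.Injective e1 := shiftedBlock_injective ..
  have he2 := residueClass_injective c r
  -- z j counts the keys below τ in block j; once the block is sorted they fill its first z j slots,
  -- as `residue_count` requires.
  set z : ℕ → ℕ := fun j => if h : j < c then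
    (Finset.univ.filter (fun i => key (x (e1 (⟨j, h⟩, i))) < τ)).card else 0 with hz
  obtain ⟨p, hp⟩ : ∃ p : ℕ → Prop, ∀ l, p l ↔ ∃ h : l < c * r, key (x1 ⟨l, h⟩) < τ :=
    ⟨_, fun _ => Iff.rfl⟩
  have hcount := fun a (ha : a < c) => residue_count hq z (c := c) (a := a) (by
      intro j hj
      simp only [hz, dif_pos hj]
      exact (Finset.card_filter_le _ _).trans (by simp [hr])) p (by
      rw [← hr]
      intro j hj i hi
      have h1 : x1 (e1 (⟨j, hj⟩, ⟨i, hi⟩)) = _ := inParallel_apply he1 Φ x ⟨j, hj⟩ ⟨i, hi⟩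
      have h2 : e1 (⟨j, hj⟩, ⟨i, hi⟩) = ⟨j * r + i, by
        have := (e1 (⟨j, hj⟩, ⟨i, hi⟩)).2
        simpa [e1, shiftedBlock] using this⟩ := Fin.ext (by simp [e1, shiftedBlock])
      have h3 := hΦ.lt_iff (fun i => x (e1 (⟨j, hj⟩, i))) τ ⟨i, hi⟩
      rw [← h1, h2] at h3
      simp only [hz, dif_pos hj]
      rw [← h3, hp]
      constructor
      · rintro ⟨h, h'⟩; exact h'
      · intro h; exact ⟨_, h⟩) ha
  simp only [← hr] at hcount
  have hkey : ∀ a j, key (inParallel (residueClass c r) Φ x1 (residueClass c r (a, j))) < τ ↔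
      j.1 < ((Finset.range r).filter (fun u => p (c * u + a))).card := by
    intro a j
    rw [inParallel_apply he2, hΦ.lt_iff, ← card_filter_fin r (fun u => p (c * u + a))]
    have : ∀ j' : Fin r, key (x1 (residueClass c r (a, j'))) < τ ↔ p (c * j'.1 + a) := by
      intro j'
      rw [hp]
      constructor
      · intro h; exact ⟨(residueClass c r (a, j')).2, h⟩
      · rintro ⟨h, h'⟩; exact h'
    simp only [this]
  -- Write Σ for the sum. Every class has between Σ and Σ + c small keys, so after sorting the
  -- classes slot c * j + a is small for j < Σ and not small for j ≥ Σ + c. This leaves c * c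
  -- undecided slots.
  refine ⟨c * ∑ j ∈ Finset.range c, z j / c, fun i hi => ?_, fun i hi => ?_⟩
  · obtain ⟨a, j, rfl⟩ := exists_residueClass i
    rw [hkey]
    refine lt_of_lt_of_le ?_ (hcount a a.2).1
    simp only [residueClass] at hi
    by_contra hcon
    have := Nat.mul_le_mul_left c (not_lt.1 hcon)
    omega
  · obtain ⟨a, j, rfl⟩ := exists_residueClass i
    rw [hkey]
    have h1 := (hcount a a.2).2
    simp only [residueClass] at hi
    have h2 : c * ((∑ j ∈ Finset.range c, z j / c) + c) < c * (j.1 + 1) := by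
      have := a.2
      rw [mul_add, mul_add]; omega
    have := Nat.lt_of_mul_lt_mul_left h2
    omega

/-- Neighbouring slots of one sorted block cannot be out of order. Inside the dirty window this is
all that the last two sorting phases contribute. -/
theorem block_adjacent {h c r N : ℕ} (hN : h + c * r ≤ N) {key : α → ℕ}
    {Φ : (Fin r → α) → Fin r → α} (hΦ : IsSorter key Φ) (x : Fin N → α) (τ : ℕ) {l j : ℕ}
    (hj : j < c) (h1 : h + j * r ≤ l) (h2 : l + 1 < h + (j + 1) * r) (hl : l + 1 < N)
    (hlt : key (inParallel (shiftedBlock h c r N hN) Φ x ⟨l + 1, hl⟩) < τ) :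
    key (inParallel (shiftedBlock h c r N hN) Φ x ⟨l, by omega⟩) < τ := by
  have he := shiftedBlock_injective h c r N hN
  rw [add_mul] at h2
  have e1 : (⟨l + 1, hl⟩ : Fin N) =
      shiftedBlock h c r N hN (⟨j, hj⟩, ⟨l + 1 - (h + j * r), by omega⟩) :=
    Fin.ext (by simp only [shiftedBlock]; omega)
  have e2 : (⟨l, by omega⟩ : Fin N) =
      shiftedBlock h c r N hN (⟨j, hj⟩, ⟨l - (h + j * r), by omega⟩) :=
    Fin.ext (by simp only [shiftedBlock]; omega)
  rw [e1, inParallel_apply he, hΦ.lt_iff] at hlt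
  rw [e2, inParallel_apply he, hΦ.lt_iff]
  simp only at hlt ⊢
  omega

/-- Columnsort: sorting `c` arrays of length `c * q` in parallel four times sorts an array of length
`c * (c * q)`. -/
theorem IsSorter.columnsort {c q r B d : ℕ} (hc : 0 < c) (hr : r = c * q) (hq : 0 < q) (hcq : 2 * (c * c) ≤ r)
    (hB : 1 ≤ B) {key : α → ℕ} {Φ : (Fin r → α) → Fin r → α} (hΦ : IsSorter key Φ)
    (hnet : IsNet B d Φ) :
    ∃ Ψ : (Fin (c * r) → α) → Fin (c * r) → α, IsSorter key Ψ ∧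
      IsNet B (d + d + d + d) Ψ := by
  have hr0 : 0 < r := hr ▸ Nat.mul_pos hc hq
  have hN3 : r / 2 + (c - 1) * r ≤ (c * r) := by
    have : (c - 1) * r + r = c * r := by
      rw [← Nat.succ_mul]; congr 1; omega
    omega
  set e1 := shiftedBlock 0 c r (c * r) (by simp)
  set e2 := residueClass c r
  set e3 := shiftedBlock (r / 2) (c - 1) r (c * r) hN3
  have he1 : Function.Injective e1 := shiftedBlock_injective ..
  have he2 : Function.Injective e2 := residueClass_injective c r
  have he3 : Function.Injective e3 := shiftedBlock_injective ..
  have hm1 : ∀ k, StrictMono (fun j => e1 (k, j)) := fun k => shiftedBlock_strictMono _ _ _ _ _ k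
  have hm3 : ∀ k, StrictMono (fun j => e3 (k, j)) := fun k => shiftedBlock_strictMono _ _ _ _ _ k
  refine ⟨inParallel e3 Φ ∘ (inParallel e1 Φ ∘ (inParallel e2 Φ ∘ inParallel e1 Φ)),
    fun x => ⟨?_, ?_⟩, ((((hnet.inParallel hB he1).trans (hnet.inParallel hB he2)).trans
      (hnet.inParallel hB he1)).trans (hnet.inParallel hB he3))⟩
  · have hperm := fun x => (hΦ x).1
    obtain ⟨σ1, h1⟩ := inParallel_perm he1 hperm x
    obtain ⟨σ2, h2⟩ := inParallel_perm he2 hperm (inParallel e1 Φ x)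
    obtain ⟨σ3, h3⟩ := inParallel_perm he1 hperm (inParallel e2 Φ (inParallel e1 Φ x))
    obtain ⟨σ4, h4⟩ := inParallel_perm he3 hperm
      (inParallel e1 Φ (inParallel e2 Φ (inParallel e1 Φ x)))
    refine ⟨σ4.trans (σ3.trans (σ2.trans σ1)), ?_⟩
    simp only [Function.comp_apply]
    rw [h4, h3, h2, h1]
    rfl
  · set x2 := inParallel e2 Φ (inParallel e1 Φ x) with hx2
    set x3 := inParallel e1 Φ x2 with hx3
    change Monotone fun i => key (inParallel e3 Φ x3 i)
    have main : ∀ τ l (hl : l + 1 < (c * r)), key (inParallel e3 Φ x3 ⟨l + 1, hl⟩) < τ →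
        key (inParallel e3 Φ x3 ⟨l, by omega⟩) < τ := by
      intro τ l hl hlt
      obtain ⟨w, hw1, hw2⟩ := exists_dirty_window hr hq hΦ x τ
      have hw1' := inParallel_lt_of_forall he1 hm1 hΦ hw1
      have hw2' := inParallel_not_lt_of_forall he1 hm1 hΦ hw2
      by_cases hlw : l < w
      · exact inParallel_lt_of_forall he3 hm3 hΦ hw1' ⟨l, _⟩ hlw
      by_cases hlw2 : w + c * c ≤ l + 1
      · exact absurd hlt (inParallel_not_lt_of_forall he3 hm3 hΦ hw2' ⟨l + 1, _⟩ hlw2)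
      have hwN : w < (c * r) := by omega
      set j := w / r with hj
      have hj1 : j * r ≤ w := Nat.div_mul_le_self _ _
      have hj2 : w < (j + 1) * r := by
        rw [mul_comm]; exact Nat.lt_mul_div_succ w hr0
      have hjc : j < c := (Nat.div_lt_iff_lt_mul hr0).2 hwN
      -- The window has length c * c ≤ r / 2. Either it ends inside the aligned block j that
      -- contains w (or j is the last block), or it crosses the end of block j and then fits into
      -- the block shifted by r / 2 around that boundary.
      by_cases hin : w + c * c ≤ (j + 1) * r ∨ j + 1 = c
      · -- the window lies in an aligned block, so the array is already sorted for this threshold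
        have hjr : (j + 1) * r ≤ (c * r) := Nat.mul_le_mul_right _ hjc
        have adj3 : ∀ l' (hl' : l' + 1 < (c * r)), key (x3 ⟨l' + 1, hl'⟩) < τ →
            key (x3 ⟨l', by omega⟩) < τ := by
          intro l' hl' h'
          by_cases h1 : l' < w
          · exact hw1' ⟨l', _⟩ h1
          by_cases h2 : w + c * c ≤ l' + 1
          · exact absurd h' (hw2' ⟨l' + 1, _⟩ h2)
          exact block_adjacent (by simp) hΦ x2 τ hjc (by omega)
            (by rcases hin with hin | hin <;> [skip; rw [hin]] <;> omega) hl' h'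
        have down : ∀ m l' (hl' : l' + m < (c * r)), key (x3 ⟨l' + m, hl'⟩) < τ →
            key (x3 ⟨l', by omega⟩) < τ := by
          intro m
          induction m with
          | zero => intro l' _ h; exact h
          | succ m ih => intro l' hl' h; exact ih l' (by omega) (adj3 _ hl' h)
        -- For this threshold x3 is sorted already, and the last phase keeps initial segments of
        -- small keys and final segments of large ones.
        by_cases hl3 : key (x3 ⟨l, by omega⟩) < τ
        · refine inParallel_lt_of_forall he3 hm3 hΦ (w := l + 1) ?_ ⟨l, _⟩ (Nat.lt_succ_self l)
          intro i hi
          have : l = i.1 + (l - i.1) := by omega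
          exact down (l - i.1) i.1 (by omega) (by simpa only [← this] using hl3)
        · refine absurd hlt (inParallel_not_lt_of_forall he3 hm3 hΦ (w := l) ?_ ⟨l + 1, _⟩ (Nat.le_succ l))
          intro i hi h
          refine hl3 (down (i.1 - l) l (by have := i.2; omega) ?_)
          have : l + (i.1 - l) = i.1 := by omega
          simpa only [this] using h
      · -- the window crosses a boundary, hence lies in a shifted block
        have hj3 : j + 1 < c := by omega
        have e4 : (j + 1) * r = j * r + r := by rw [add_mul, one_mul]
        exact block_adjacent hN3 hΦ x3 τ (j := j) (by omega) (by omega) (by omega) hl hlt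
    have adj : ∀ m l (hl : l + m < (c * r)), key (inParallel e3 Φ x3 ⟨l, by omega⟩) ≤
        key (inParallel e3 Φ x3 ⟨l + m, hl⟩) := by
      intro m
      induction m with
      | zero => intro l _; exact le_rfl
      | succ m ih =>
        intro l hl
        -- `main` is applied with the threshold one above the key of slot l + m + 1.
        exact (ih l (by omega)).trans (Nat.lt_succ_iff.1 (main _ (l + m) hl (Nat.lt_succ_self _)))
    intro a b hab
    have hab : a.1 ≤ b.1 := hab
    have := adj (b.1 - a.1) a.1 (by have := b.2; omega)
    have e5 : a.1 + (b.1 - a.1) = b.1 := by omega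
    simpa only [e5] using this

/-- Sorting networks of constant depth for arrays of length `b ^ (k + 3)`. -/
theorem exists_isSorter (key : α → ℕ) {b : ℕ} (hb : 2 ≤ b) (k : ℕ) :
    ∀ r, r = b ^ (k + 3) → ∃ Φ : (Fin r → α) → Fin r → α, IsSorter key Φ ∧
      IsNet (b ^ 3) (4 ^ k) Φ := by
  induction k with
  | zero =>
    rintro r rfl
    exact exists_isSorter_one key (by positivity) (by simp)
  | succ k ih =>
    intro r hr
    obtain ⟨Φ, h1, h2⟩ := ih _ rfl
    -- Columnsort with c = b and r = b^(k+4) needs 2 * b^2 ≤ b^(k+4); already 2 * b^2 ≤ b^(k+3),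
    -- this inequality times b^2, is enough for blocks of length b^(k+3).
    have hq : 2 ≤ b ^ (k + 1) := by
      calc 2 ≤ b := hb
        _ = b ^ 1 := (pow_one b).symm
        _ ≤ b ^ (k + 1) := Nat.pow_le_pow_right (by omega) (by omega)
    obtain ⟨Ψ, h3, h4⟩ := h1.columnsort (c := b) (q := b ^ (k + 2)) (B := b ^ 3) (by omega)
      (by ring) (by positivity) (by
        calc 2 * (b * b) ≤ b ^ (k + 1) * (b * b) := Nat.mul_le_mul_right _ hq
          _ = b ^ (k + 3) := by ring) (by exact Nat.one_le_pow _ _ (by omega)) h2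
    have e2 : r = b * b ^ (k + 3) := by rw [hr]; ring
    subst e2
    refine ⟨Ψ, h3, ?_⟩
    have e3 : (4 : ℕ) ^ (k + 1) = 4 ^ k + 4 ^ k + 4 ^ k + 4 ^ k := by ring
    rwa [e3]

end Columnsort

/-! ### Prefix sums -/

section Scan

variable {β M : Type} [AddCommMonoid M]

/-- Combine the prefix sums of `b` consecutive blocks of length `r`: every slot holds the prefix sum
and the total of its block. -/
def scanLayer (N r : ℕ) (x : Fin N → β × M × M) (i : Fin N) : β × M × M :=
  ((x i).1, (x i).2.1 + ∑ j : Fin N, (if j.1 % r = i.1 % r ∧ j < i then (x j).2.2 else 0),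
    ∑ j : Fin N, (if j.1 % r = i.1 % r then (x j).2.2 else 0))

/-- Because every slot stores the total of its block, slot i can read all b totals from the slots
with the same offset modulo r. These b slots are the only ones that have to share a machine. -/
theorem isLocal_scanLayer {b r B : ℕ} (hr : 0 < r) (hB : b ≤ B) :
    IsLocal B (scanLayer (β := β) (M := M) (b * r) r) := by
  refine ⟨fun i => ⟨i.1 % r, (Nat.mod_le _ _).trans_lt i.2⟩, fun i => ?_, fun x y i h => ?_⟩
  · refine le_trans ?_ hB
    have : (Finset.univ.filter (fun j : Fin (b * r) =>
        (⟨j.1 % r, (Nat.mod_le _ _).trans_lt j.2⟩ : Fin (b * r)) = i)).card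
        ≤ (Finset.range b).card := by
      refine Finset.card_le_card_of_injOn (fun j => j.1 / r) ?_ ?_
      · intro j _
        simp only [Finset.coe_range, Set.mem_Iio]
        exact (Nat.div_lt_iff_lt_mul hr).2 j.2
      · intro j hj j' hj' hjj
        simp only [Finset.coe_filter, Finset.mem_univ, true_and, Set.mem_ofPred_eq] at hj hj'
        have h1 := congrArg Fin.val (hj.trans hj'.symm)
        simp only at h1 hjj
        refine Fin.ext ?_
        rw [← Nat.div_add_mod j.1 r, ← Nat.div_add_mod j'.1 r, h1, hjj]
    simpa using this
  · have hx : ∀ j : Fin (b * r), j.1 % r = i.1 % r → x j = y j := fun j hj => h j (Fin.ext hj)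
    simp only [scanLayer]
    rw [hx i rfl]
    congr 2
    · congr 1
      refine Finset.sum_congr rfl fun j _ => ?_
      split_ifs with hj
      · rw [hx j hj.1]
      · rfl
    · refine Finset.sum_congr rfl fun j _ => ?_
      split_ifs with hj
      · rw [hx j hj]
      · rfl

theorem sum_fin_mul {b r : ℕ} (f : Fin (b * r) → M) :
    ∑ i, f i = ∑ v : Fin b, ∑ u : Fin r, f (shiftedBlock 0 b r (b * r) (by simp) (v, u)) := by
  rw [← Fintype.sum_prod_type']
  refine (Fintype.sum_bijective (shiftedBlock 0 b r (b * r) (by simp))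
    ⟨shiftedBlock_injective .., fun i => ?_⟩ _ _ fun _ => rfl).symm
  obtain ⟨k, j, h⟩ := exists_shiftedBlock_zero i
  exact ⟨_, h⟩

theorem shiftedBlock_val {b r N : ℕ} (hN : 0 + b * r ≤ N) (v : Fin b) (u : Fin r) :
    (shiftedBlock 0 b r N hN (v, u)).1 = v.1 * r + u.1 := by simp [shiftedBlock]

theorem shiftedBlock_mod {b r N : ℕ} (hN : 0 + b * r ≤ N) (v : Fin b) (u : Fin r) :
    (shiftedBlock 0 b r N hN (v, u)).1 % r = u.1 := by
  rw [shiftedBlock_val, mul_comm, Nat.mul_add_mod, Nat.mod_eq_of_lt u.2]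

theorem shiftedBlock_lt_iff {b r N : ℕ} (hN : 0 + b * r ≤ N) (v v' : Fin b) (u u' : Fin r) :
    shiftedBlock 0 b r N hN (v', u') < shiftedBlock 0 b r N hN (v, u) ↔
      v' < v ∨ v' = v ∧ u' < u := by
  rw [Fin.lt_def, shiftedBlock_val, shiftedBlock_val]
  have h1 := u.2
  have h2 := u'.2
  constructor
  · intro h
    rcases lt_trichotomy v' v with h3 | h3 | h3
    · exact Or.inl h3
    · subst h3
      exact Or.inr ⟨rfl, by rw [Fin.lt_def]; omega⟩
    · have h4 : (v.1 + 1) * r ≤ v'.1 * r := Nat.mul_le_mul_right _ h3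
      rw [add_mul] at h4
      omega
  · rintro (h3 | ⟨rfl, h3⟩)
    · have h4 : (v'.1 + 1) * r ≤ v.1 * r := Nat.mul_le_mul_right _ h3
      rw [add_mul] at h4
      omega
    · rw [Fin.lt_def] at h3; omega

/-- Prefix sums by a network of constant depth. -/
theorem exists_isNet_scan {b B : ℕ} (hb : 1 ≤ b) (hB : b ≤ B) (k : ℕ) : ∀ r, r = b ^ k →
    ∃ Φ : (Fin r → β × M × M) → Fin r → β × M × M, IsNet B k Φ ∧
      ∀ (y : Fin r → β) (w : Fin r → M) (i : Fin r), Φ (fun j => (y j, 0, w j)) i =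
        (y i, ∑ j, (if j < i then w j else 0), ∑ j, w j) := by
  induction k with
  | zero =>
    rintro r rfl
    refine ⟨id, IsNet.refl, fun y w i => ?_⟩
    have h : ∀ j : Fin (b ^ 0), j = i := fun j => Fin.ext (by
      have h1 := j.2
      have h2 := i.2
      simp only [pow_zero] at h1 h2
      omega)
    have hs : ∀ f : Fin (b ^ 0) → M, ∑ j, f j = f i := fun f =>
      Fintype.sum_eq_single i fun j hj => absurd (h j) hj
    rw [hs, hs, if_neg (lt_irrefl i)]
    rfl
  | succ k ih =>
    intro r hr
    obtain ⟨q, hq⟩ : ∃ q, q = b ^ k := ⟨_, rfl⟩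
    obtain ⟨Φ, h1, h2⟩ := ih q hq
    have e2 : r = b * q := by rw [hr, hq]; ring
    subst e2
    have hq0 : 0 < q := hq ▸ Nat.pow_pos hb
    have he := shiftedBlock_injective 0 b q (b * q) (by simp)
    refine ⟨scanLayer (b * q) q ∘ inParallel (shiftedBlock 0 b q (b * q) (by simp)) Φ,
      (h1.inParallel (hb.trans hB) he).trans (isLocal_scanLayer hq0 hB).isNet, fun y w i => ?_⟩
    have h3 : ∀ v u, inParallel (shiftedBlock 0 b q (b * q) (by simp)) Φ
        (fun j => (y j, 0, w j)) (shiftedBlock 0 b q (b * q) (by simp) (v, u)) = _ := fun v u =>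
      (inParallel_apply he Φ _ v u).trans (h2 _ _ u)
    obtain ⟨v, u, rfl⟩ := exists_shiftedBlock_zero i
    simp only [Function.comp_apply, scanLayer]
    rw [sum_fin_mul, sum_fin_mul, sum_fin_mul, sum_fin_mul]
    simp only [h3, shiftedBlock_mod, shiftedBlock_lt_iff, Fin.val_inj]
    congr 2
    -- The prefix sum before slot u of block v splits into the totals of the blocks before v, all
    -- read at offset u, and the prefix sum inside block v.
    · have hL : ∀ v' : Fin b, (∑ u' : Fin q, if u' = u ∧ (v' < v ∨ v' = v ∧ u' < u) then
          ∑ j, w (shiftedBlock 0 b q (b * q) (by simp) (v', j)) else 0) =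
          if v' < v then ∑ j, w (shiftedBlock 0 b q (b * q) (by simp) (v', j)) else 0 := by
        intro v'
        rw [Fintype.sum_eq_single u (fun u' hu' => if_neg fun h => hu' h.1)]
        refine if_congr ?_ rfl rfl
        simp
      have hR : ∀ v' : Fin b, (∑ u' : Fin q, if v' < v ∨ v' = v ∧ u' < u then
          w (shiftedBlock 0 b q (b * q) (by simp) (v', u')) else 0) =
          (if v' = v then ∑ u' : Fin q, (if u' < u then
            w (shiftedBlock 0 b q (b * q) (by simp) (v', u')) else 0) else 0) +
          if v' < v then ∑ j, w (shiftedBlock 0 b q (b * q) (by simp) (v', j)) else 0 := by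
        intro v'
        by_cases h4 : v' = v
        · subst h4; simp
        · by_cases h5 : v' < v <;> simp [h4, h5]
      simp only [hL, hR, Finset.sum_add_distrib]
      simp
    · refine Finset.sum_congr rfl fun v' _ => ?_
      simp

end Scan

/-! ### Sums over the records with small keys -/

section Dominance

variable {P M : Type} [AddCommMonoid M]

/-- Every entry is updated with the sum of the weights of all entries whose key is smaller than the
threshold of this entry. -/
def dominanceStep {H : ℕ} (κ θ : P → ℕ) (ω : P → M) (upd : P → M → P) (Y : Fin H → P)
    (a : Fin H) : P :=
  upd (Y a) (∑ a', if κ (Y a') < θ (Y a) then ω (Y a') else 0)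

/-- The records stored in the slots with even numbers. -/
def evenSlots {N : ℕ} (x : Fin N → (P × Fin N) × M × M) (a : Fin (N / 2)) : P :=
  (x ⟨2 * a.1, by have := a.2; omega⟩).1.1

theorem sum_odd {N : ℕ} (f : ℕ → M) :
    (∑ j : Fin N, if j.1 % 2 = 1 then f (j.1 / 2) else 0) = ∑ a : Fin (N / 2), f a := by
  rw [← Finset.sum_filter]
  symm
  refine Finset.sum_bij (fun a _ => (⟨2 * a.1 + 1, by have := a.2; omega⟩ : Fin N)) ?_ ?_ ?_ ?_
  · intro a _
    simp only [Finset.mem_filter, Finset.mem_univ, true_and]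
    omega
  · intro a _ a' _ h
    have := congrArg Fin.val h
    simp only at this
    exact Fin.ext (by omega)
  · intro j hj
    simp only [Finset.mem_filter, Finset.mem_univ, true_and] at hj
    have := j.2
    exact ⟨⟨j.1 / 2, by omega⟩, Finset.mem_univ _, Fin.ext (by simp only; omega)⟩
  · intro a _
    congr 1
    simp only
    omega

/-- A monotone permutation is strictly monotone with full range. It follows below that sorting by
original slot number undoes the first sort. -/
theorem eq_id_of_monotone_perm {N : ℕ} (σ : Equiv.Perm (Fin N)) (h : Monotone σ) (i : Fin N) :
    σ i = i := by
  have h1 : StrictMono σ := h.strictMono_of_injective σ.injective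
  have := StrictMono.range_inj h1 (strictMono_id (α := Fin N))
  rw [σ.range_eq_univ, Set.range_id] at this
  rw [this.1 rfl]; rfl

/-- Each record is present twice: in an even slot as a query with key 2θ, in an odd slot as a datum
with key 2κ + 1 and weight ω. After sorting, the prefix sum at a query adds up exactly the weights
with κ < θ, parity excluding ties. Sorting by the original slot number brings the answers back. -/
theorem exists_isNet_dominanceStep {b : ℕ} (hb : 2 ≤ b) (k : ℕ) {N : ℕ} (hN : N = b ^ (k + 3))
    (κ θ : P → ℕ) (ω : P → M) (upd : P → M → P) :
    ∃ Φ : (Fin N → (P × Fin N) × M × M) → Fin N → (P × Fin N) × M × M,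
      IsNet (b ^ 3) (1 + 4 ^ k + 1 + (k + 3) + 4 ^ k + 1) Φ ∧
      ∀ x, evenSlots (Φ x) = dominanceStep κ θ ω upd (evenSlots x) := by
  have hB2 : 2 ≤ b ^ 3 := by
    calc 2 ≤ b := hb
      _ = b ^ 1 := (pow_one b).symm
      _ ≤ b ^ 3 := Nat.pow_le_pow_right (by omega) (by omega)
  have hB1 : 1 ≤ b ^ 3 := by omega
  have hbB : b ≤ b ^ 3 := Nat.le_self_pow (by omega) b
  set key1 : (P × Fin N) × M × M → ℕ := fun q =>
    if q.1.2.1 % 2 = 1 then 2 * κ q.1.1 + 1 else 2 * θ q.1.1 with hkey1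
  obtain ⟨S1, hS1, hn1⟩ := exists_isSorter key1 hb k N hN
  obtain ⟨S2, hS2, hn2⟩ := exists_isSorter (fun q : (P × Fin N) × M × M => q.1.2.1) hb k N hN
  obtain ⟨Sc, hnc, hSc⟩ := exists_isNet_scan (β := P × Fin N) (M := M) (by omega) hbB (k + 3) N hN
  set R : (Fin N → (P × Fin N) × M × M) → Fin N → P :=
    fun x i => (x ⟨2 * (i.1 / 2), by have := i.2; omega⟩).1.1 with hR
  set L1 : (Fin N → (P × Fin N) × M × M) → Fin N → (P × Fin N) × M × M :=
    fun x i => ((R x i, i), 0, 0) with hL1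
  set wt : P → Fin N → M := fun q i => if i.1 % 2 = 1 then ω q else 0 with hwt
  set L3 : (Fin N → (P × Fin N) × M × M) → Fin N → (P × Fin N) × M × M :=
    fun x i => ((x i).1, 0, wt (x i).1.1 (x i).1.2) with hL3
  set L6 : (Fin N → (P × Fin N) × M × M) → Fin N → (P × Fin N) × M × M :=
    fun x i => ((upd (x i).1.1 (x i).2.1, (x i).1.2), (x i).2) with hL6
  have hl1 : IsLocal (b ^ 3) L1 := by
    refine ⟨fun i => ⟨2 * (i.1 / 2), by have := i.2; omega⟩, fun i => le_trans ?_ hB2, ?_⟩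
    · have : (Finset.univ.filter (fun j : Fin N =>
          (⟨2 * (j.1 / 2), by have := j.2; omega⟩ : Fin N) = i)).card
          ≤ (Finset.range 2).card := by
        refine Finset.card_le_card_of_injOn (fun j => j.1 % 2) ?_ ?_
        · intro j _
          simp only [Finset.coe_range, Set.mem_Iio]
          omega
        · intro j hj j' hj' hjj
          simp only [Finset.coe_filter, Finset.mem_univ, true_and, Set.mem_ofPred_eq] at hj hj'
          have h1 := congrArg Fin.val (hj.trans hj'.symm)
          simp only at h1 hjj
          exact Fin.ext (by omega)
      simpa using this
    · intro x y i h
      simp only [hL1, hR]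
      rw [h _ (Fin.ext (by simp))]
  have hl3 : IsLocal (b ^ 3) L3 :=
    isLocal_pointwise hB1 (fun _ (q : (P × Fin N) × M × M) => (q.1, 0, wt q.1.1 q.1.2))
  have hl6 : IsLocal (b ^ 3) L6 :=
    isLocal_pointwise hB1 (fun _ (q : (P × Fin N) × M × M) => ((upd q.1.1 q.2.1, q.1.2), q.2))
  refine ⟨L6 ∘ (S2 ∘ (Sc ∘ (L3 ∘ (S1 ∘ L1)))), ((((hl1.isNet.trans hn1).trans hl3.isNet).trans
    hnc).trans hn2).trans hl6.isNet, fun x => ?_⟩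
  obtain ⟨⟨σ, hσ⟩, hσm⟩ := hS1 (L1 x)
  have h3 : L3 (S1 (L1 x)) = fun l => ((R x (σ l), σ l), 0, wt (R x (σ l)) (σ l)) := by
    rw [hσ]; rfl
  set y4 := Sc (L3 (S1 (L1 x))) with hy4
  have h4 : ∀ l, y4 l = ((R x (σ l), σ l), ∑ l', (if l' < l then wt (R x (σ l')) (σ l') else 0),
      ∑ l', wt (R x (σ l')) (σ l')) := by
    intro l
    rw [hy4, h3, hSc]
  obtain ⟨⟨π, hπ⟩, hπm⟩ := hS2 y4
  have hid : ∀ m, σ (π m) = m := by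
    refine eq_id_of_monotone_perm (π.trans σ) fun a c hac => ?_
    have := hπm hac
    simp only [hπ, Function.comp, h4] at this
    exact this
  funext a
  have ha := a.2
  set m : Fin N := ⟨2 * a.1, by omega⟩ with hm
  have hRm : R x m = evenSlots x a := by
    simp only [hR, evenSlots, hm]
    congr 3
    simp
  have hout : evenSlots ((L6 ∘ (S2 ∘ (Sc ∘ (L3 ∘ (S1 ∘ L1))))) x) a =
      upd (R x m) (∑ l', (if l' < π m then wt (R x (σ l')) (σ l') else 0)) := by
    change upd (S2 y4 m).1.1 (S2 y4 m).2.1 = _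
    rw [hπ, Function.comp, h4, hid]
  rw [hout, dominanceStep, hRm]
  congr 1
  have hlt : ∀ j : Fin N, j.1 % 2 = 1 →
      (σ.symm j < π m ↔ κ (R x j) < θ (evenSlots x a)) := by
    intro j hj
    have hk : ∀ l, key1 (S1 (L1 x) l) = key1 (L1 x (σ l)) := fun l => by rw [hσ]; rfl
    have k1 : key1 (S1 (L1 x) (σ.symm j)) = 2 * κ (R x j) + 1 := by
      rw [hk, σ.apply_symm_apply]; simp [hkey1, hL1, hj]
    have k2 : key1 (S1 (L1 x) (π m)) = 2 * θ (evenSlots x a) := by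
      rw [hk, hid]
      simp only [hkey1, hL1]
      rw [if_neg (by simp [hm]), hRm]
    constructor
    · intro h
      have := hσm h.le
      simp only [k1, k2] at this
      omega
    · intro h
      by_contra hcon
      have := hσm (not_lt.1 hcon)
      simp only [k1, k2] at this
      omega
  rw [← Equiv.sum_comp σ.symm]
  rw [← sum_odd (N := N) (fun c => if h : c < N / 2 then
    (if κ (evenSlots x ⟨c, h⟩) < θ (evenSlots x a) then ω (evenSlots x ⟨c, h⟩) else 0) else 0)
    |>.trans (Finset.sum_congr rfl fun c _ => dif_pos c.2)]
  refine Finset.sum_congr rfl fun j _ => ?_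
  simp only [σ.apply_symm_apply]
  by_cases hj : j.1 % 2 = 1
  · have hj2 : j.1 / 2 < N / 2 := by have := j.2; omega
    have hRj : R x j = evenSlots x ⟨j.1 / 2, hj2⟩ := rfl
    rw [if_pos hj, dif_pos hj2]
    refine if_congr ?_ ?_ rfl
    · rw [hlt j hj, hRj]
    · rw [hRj]; simp [hwt, hj]
  · rw [if_neg hj]
    simp [hwt, hj]

end Dominance

/-! ### Execution of networks by MPC programs -/

section Simulation

variable {α : Type}

/-- The states of a sequence of maps started at `x`. -/
def runLayers {ι : Type} (Ψ : ℕ → (ι → α) → ι → α) (x : ι → α) : ℕ → ι → α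
  | 0 => x
  | t + 1 => Ψ t (runLayers Ψ x t)

theorem runLayers_succ' {ι : Type} (Ψ : ℕ → (ι → α) → ι → α) (x : ι → α) (t : ℕ) :
    runLayers Ψ x (t + 1) = runLayers (fun t => Ψ (t + 1)) (Ψ 0 x) t := by
  induction t with
  | zero => rfl
  | succ t ih => rw [runLayers, ih]; rfl

theorem IsNet.exists_layers {ι : Type} [Fintype ι] [DecidableEq ι] {B d : ℕ}
    {Φ : (ι → α) → ι → α} (h : IsNet B d Φ) :
    ∃ Ψ : ℕ → (ι → α) → ι → α, (∀ t < d, IsLocal B (Ψ t)) ∧ ∀ x, runLayers Ψ x d = Φ x := by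
  induction h with
  | refl => exact ⟨fun _ => id, fun t ht => absurd ht (Nat.not_lt_zero _), fun x => rfl⟩
  | step hl _ ih =>
    rename_i d' Φ' Ψ' _
    obtain ⟨Ψ, h1, h2⟩ := ih
    refine ⟨fun t => Nat.casesOn t Φ' Ψ, fun t ht => ?_, fun x => ?_⟩
    · cases t with
      | zero => exact hl
      | succ t => exact h1 t (by omega)
    · rw [runLayers_succ']
      exact h2 _

/-- The blocks of a local map can be distributed over machines with nearly equal loads. -/
theorem IsLocal.exists_bins {N B Q p : ℕ} (hQ : 0 < Q) (hp : N / Q < p)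
    {Φ : (Fin N → α) → Fin N → α} (h : IsLocal B Φ) :
    ∃ bin : Fin N → Fin p, (∀ m, (Finset.univ.filter (fun j => bin j = m)).card ≤ Q + B) ∧
      ∀ x y i, (∀ j, bin j = bin i → x j = y j) → Φ x i = Φ y i := by
  obtain ⟨blk, hblk, hloc⟩ := h
  -- `pre i` counts the slots in smaller blocks, so the machine `pre i / Q` depends on the block
  -- only. `pos` is the injective rank in the order by block and then by slot, and `pre ≤ pos < pre
  -- + B`. Hence a machine gets ranks from an interval of length Q + B.
  set pre : Fin N → ℕ := fun i => (Finset.univ.filter (fun j => blk j < blk i)).card with hpre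
  set pos : Fin N → ℕ := fun i =>
    (Finset.univ.filter (fun j => blk j < blk i ∨ (blk j = blk i ∧ j < i))).card with hpos
  have hpreN : ∀ i, pre i / Q < p := fun i => lt_of_le_of_lt (Nat.div_le_div_right
    ((Finset.card_filter_le _ _).trans (by simp))) hp
  have h1 : ∀ i, pre i ≤ pos i := fun i => Finset.card_le_card fun j hj => by
    simp only [Finset.mem_filter, Finset.mem_univ, true_and] at hj ⊢
    exact Or.inl hj
  have h2 : ∀ i, pos i < pre i + B := by
    intro i
    have hs : Finset.univ.filter (fun j => blk j < blk i ∨ (blk j = blk i ∧ j < i)) ⊆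
        Finset.univ.filter (fun j => blk j < blk i) ∪
          (Finset.univ.filter (fun j => blk j = blk i)).erase i := by
      intro j hj
      simp only [Finset.mem_filter, Finset.mem_univ, true_and, Finset.mem_union,
        Finset.mem_erase] at hj ⊢
      rcases hj with hj | ⟨hj, hji⟩
      · exact Or.inl hj
      · exact Or.inr ⟨hji.ne, hj⟩
    have h3 := (Finset.card_le_card hs).trans (Finset.card_union_le _ _)
    have hi : i ∈ Finset.univ.filter (fun j => blk j = blk i) := by simp
    have h4 := Finset.card_erase_lt_of_mem hi
    have h5 := hblk (blk i)
    simp only [hpos, hpre]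
    omega
  have key : ∀ i j, (blk i < blk j ∨ (blk i = blk j ∧ i < j)) → pos i < pos j := by
    intro i j hij
    refine Finset.card_lt_card ⟨fun l hl => ?_, fun hsub => ?_⟩
    · simp only [Finset.mem_filter, Finset.mem_univ, true_and] at hl ⊢
      rcases hij with hij | ⟨hij, hij'⟩ <;> rcases hl with hl | ⟨hl, hl'⟩
      · exact Or.inl (hl.trans hij)
      · exact Or.inl (hl ▸ hij)
      · exact Or.inl (hij ▸ hl)
      · exact Or.inr ⟨hl.trans hij, hl'.trans hij'⟩
    · have hi : i ∈ Finset.univ.filter (fun l => blk l < blk j ∨ (blk l = blk j ∧ l < j)) := by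
        simpa using hij
      have := hsub hi
      simp at this
  have hinj : Function.Injective pos := by
    intro i j hij
    by_contra hne
    rcases lt_trichotomy (blk i) (blk j) with h3 | h3 | h3
    · exact absurd hij (key i j (Or.inl h3)).ne
    · rcases lt_or_gt_of_ne hne with h4 | h4
      · exact absurd hij (key i j (Or.inr ⟨h3, h4⟩)).ne
      · exact absurd hij (key j i (Or.inr ⟨h3.symm, h4⟩)).ne'
    · exact absurd hij (key j i (Or.inl h3)).ne'
  refine ⟨fun i => ⟨pre i / Q, hpreN i⟩, fun m => ?_, fun x y i hxy => hloc x y i fun j hj => ?_⟩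
  · have : (Finset.univ.filter (fun j => (⟨pre j / Q, hpreN j⟩ : Fin p) = m)).card ≤
        (Finset.Ico (m.1 * Q) (m.1 * Q + (Q + B))).card := by
      refine Finset.card_le_card_of_injOn pos ?_ hinj.injOn
      intro j hj
      simp only [Finset.coe_filter, Finset.mem_univ, true_and, Set.mem_ofPred_eq] at hj
      have hj : pre j / Q = m.1 := congrArg Fin.val hj
      simp only [Finset.coe_Ico, Set.mem_Ico]
      have a1 := h1 j
      have a2 := h2 j
      have a3 : m.1 * Q ≤ pre j := hj ▸ Nat.div_mul_le_self _ _
      have a4 : pre j < Q * (m.1 + 1) := hj ▸ Nat.lt_mul_div_succ (pre j) hQ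
      rw [mul_add, mul_comm] at a4
      omega
    simpa using this
  · refine hxy j (Fin.ext ?_)
    simp only [hpre, hj]

theorem length_filter_finRange (N : ℕ) (p : Fin N → Prop) [DecidablePred p] :
    ((List.finRange N).filter p).length = (Finset.univ.filter p).card := by
  rw [← List.toFinset_card_of_nodup ((List.nodup_finRange N).filter _)]
  congr 1
  ext i
  simp

/-- The number of the content `a` of the slot `l`, as a word. -/
noncomputable def slotWord {N : ℕ} [Fintype α] (q : Fin N × α) : ℕ :=
  (Fintype.equivFin (Fin N × α) q).1

theorem slotWord_injective {N : ℕ} [Fintype α] :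
    Function.Injective (slotWord (N := N) (α := α)) := fun _ _ h =>
  (Fintype.equivFin _).injective (Fin.ext h)

theorem slotWord_lt {N : ℕ} [Fintype α] (q : Fin N × α) :
    slotWord q < N * Fintype.card α := by
  have := (Fintype.equivFin (Fin N × α) q).2
  simpa [slotWord] using this

open Classical in
/-- The content of the slot `l` according to the words in `M`. -/
noncomputable def readSlot {N : ℕ} [Fintype α] [Inhabited α] (M : List ℕ) (l : Fin N) : α :=
  if h : ∃ a, slotWord (l, a) ∈ M then h.choose else default

/-- The words in `M` describe the contents of the slots in the bin `b`; words for default contents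
may be missing. -/
def HoldsBin {N p : ℕ} [Fintype α] [Inhabited α] (bin : Fin N → Fin p) (x : Fin N → α) (b : Fin p)
    (M : List ℕ) : Prop :=
  (∀ w ∈ M, ∃ l, bin l = b ∧ w = slotWord (l, x l)) ∧
    ∀ l, bin l = b → x l ≠ default → slotWord (l, x l) ∈ M

theorem HoldsBin.readSlot_eq {N p : ℕ} [Fintype α] [Inhabited α] {bin : Fin N → Fin p}
    {x : Fin N → α} {b : Fin p} {M : List ℕ} (h : HoldsBin bin x b M) {l : Fin N}
    (hl : bin l = b) : readSlot M l = x l := by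
  have huniq : ∀ a, slotWord (l, a) ∈ M → a = x l := by
    intro a ha
    obtain ⟨l', _, h2⟩ := h.1 _ ha
    have := slotWord_injective h2
    simp only [Prod.mk.injEq] at this
    rw [this.2, this.1]
  rw [readSlot]
  split_ifs with hex
  · exact huniq _ hex.choose_spec
  · by_contra hne
    exact hex ⟨_, h.2 l hl (Ne.symm hne)⟩

/-- The program that places the input into slots, executes `d` layers, and outputs. -/
noncomputable def layerProgram {N : ℕ} [Fintype α] [Inhabited α] (p s d : ℕ)
    (place : Fin p → List ℕ → List (Fin N × α)) (bin : ℕ → Fin N → Fin p)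
    (Ψ : ℕ → (Fin N → α) → Fin N → α) (outF : Fin N → α → List ℕ) : MPCProgram where
  p := p
  s := s
  send t i M j :=
    if t = 0 then ((place i M).filter (fun q => bin 0 q.1 = j)).map slotWord
    else if t ≤ d then
      ((List.finRange N).filter (fun l => bin (t - 1) l = i ∧ bin t l = j)).map
        (fun l => slotWord (l, Ψ (t - 1) (readSlot M) l))
    else if i = j then
      ((List.finRange N).filter (fun l => bin d l = i)).flatMap (fun l => outF l (readSlot M l))
    else []

theorem sum_map_finRange {p : ℕ} (f : Fin p → ℕ) : ((List.finRange p).map f).sum = ∑ i, f i := by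
  rw [Fin.sum_univ_def]

theorem sum_card_filter_and {N p : ℕ} (f : Fin N → Fin p) (q : Fin N → Prop) [DecidablePred q] :
    ∑ i, (Finset.univ.filter (fun l => f l = i ∧ q l)).card = (Finset.univ.filter q).card := by
  rw [Finset.card_eq_sum_card_fiberwise (f := f) (t := Finset.univ) (fun _ _ => by simp)]
  refine Finset.sum_congr rfl fun i _ => ?_
  rw [Finset.filter_filter]
  simp only [and_comm]

theorem flatMap_finRange_single {p : ℕ} {β : Type} (f : Fin p → List β) (b : Fin p) :
    (List.finRange p).flatMap (fun i => if i = b then f i else []) = f b := by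
  have key : ∀ L : List (Fin p), L.Nodup → L.flatMap (fun i => if i = b then f i else []) =
      if b ∈ L then f b else [] := by
    intro L
    induction L with
    | nil => simp
    | cons a L ih =>
      intro hn
      rw [List.flatMap_cons, ih (List.nodup_cons.1 hn).2]
      by_cases hab : a = b
      · subst hab
        simp [(List.nodup_cons.1 hn).1]
      · simp [hab, Ne.symm hab]
  rw [key _ (List.nodup_finRange p)]
  simp

/-- Round 0 moves the input to the machines of its slots, rounds 1 to d apply one layer each and
redistribute, and round d + 1 writes the output. The invariant is that before layer t every machine
knows the contents of its bin; as a layer looks only inside bins, the new contents are correct.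
Loads are bounded because a slot is described by at most one word. -/
theorem layerProgram_spec {N p s s0 d W o : ℕ} [Fintype α] [Inhabited α]
    {place : Fin p → List ℕ → List (Fin N × α)} {bin : ℕ → Fin N → Fin p}
    {Ψ : ℕ → (Fin N → α) → Fin N → α} {outF : Fin N → α → List ℕ}
    (hbin : ∀ t ≤ d, ∀ b, (Finset.univ.filter (fun l => bin t l = b)).card ≤ s0)
    (hloc : ∀ t < d, ∀ x y l, (∀ l', bin t l' = bin t l → x l' = y l') → Ψ t x l = Ψ t y l)
    (hs0 : s0 ≤ s) (hos : s0 * o ≤ s) (hW : N * Fintype.card α ≤ W)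
    (init : Fin p → List ℕ) (hinit : ∀ i, (init i).length ≤ s) (hinitW : ∀ i, ∀ w ∈ init i, w < W)
    (x : Fin N → α)
    (hx1 : ∀ i, ∀ q ∈ place i (init i), q.2 = x q.1)
    (hx2 : ∀ l, x l ≠ default → ∃ i, (l, x l) ∈ place i (init i))
    (hx3 : (((List.finRange p).flatMap (fun i => place i (init i))).map Prod.fst).Nodup)
    (hx4 : ∀ i, (place i (init i)).length ≤ s)
    (hout : ∀ l, (outF l (runLayers Ψ x d l)).length ≤ o)
    (houtW : ∀ l, ∀ w ∈ outF l (runLayers Ψ x d l), w < W) :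
    (layerProgram p s d place bin Ψ outF).Respects W (d + 2) init ∧
    ∀ b : Fin p, (layerProgram p s d place bin Ψ outF).mem init (d + 2) b =
      ((List.finRange N).filter (fun l => decide (bin d l = b))).flatMap
        (fun l => outF l (runLayers Ψ x d l)) := by
  obtain ⟨mm, hmm⟩ : ∃ mm : ℕ → Fin p → List ℕ,
    mm = (layerProgram p s d place bin Ψ outF).mem init := ⟨_, rfl⟩
  obtain ⟨sd, hsd⟩ : ∃ sd : ℕ → Fin p → List ℕ → Fin p → List ℕ,
    sd = (layerProgram p s d place bin Ψ outF).send := ⟨_, rfl⟩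
  have hstep : ∀ t (b : Fin p), mm (t + 1) b =
      (List.finRange p).flatMap (fun i => sd t i (mm t i) b) := by
    intro t b; rw [hmm, hsd]; rfl
  have hsdS : ∀ t < d, ∀ i M j, sd (t + 1) i M j =
      ((List.finRange N).filter (fun l => bin t l = i ∧ bin (t + 1) l = j)).map
        (fun l => slotWord (l, Ψ t (readSlot M) l)) := by
    intro t ht i M j
    rw [hsd]
    simp [layerProgram, show t + 1 ≤ d from ht]
  have hsdd : ∀ i M j, sd (d + 1) i M j = if i = j then
      ((List.finRange N).filter (fun l => bin d l = i)).flatMap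
        (fun l => outF l (readSlot M l)) else [] := by
    intro i M j
    rw [hsd]
    simp [layerProgram]
  have hmem0 : ∀ b : Fin p, mm 1 b = (List.finRange p).flatMap
      (fun i => ((place i (init i)).filter (fun q => bin 0 q.1 = b)).map slotWord) := by
    intro b; rw [hmm]; rfl
  have hmemS : ∀ t, t < d → ∀ b : Fin p, mm (t + 2) b = (List.finRange p).flatMap
      (fun i => ((List.finRange N).filter (fun l => bin t l = i ∧ bin (t + 1) l = b)).map
        (fun l => slotWord (l, Ψ t (readSlot (mm (t + 1) i)) l))) := by
    intro t ht b
    rw [hstep]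
    simp only [hsdS t ht]
  have inv : ∀ t ≤ d, ∀ b : Fin p,
      HoldsBin (bin t) (runLayers Ψ x t) b (mm (t + 1) b) := by
    intro t
    induction t with
    | zero =>
      intro _ b
      rw [hmem0]
      refine ⟨fun w hw => ?_, fun l hl hne => ?_⟩
      · simp only [List.mem_flatMap, List.mem_map, List.mem_filter] at hw
        obtain ⟨i, -, q, ⟨hq, hqb⟩, rfl⟩ := hw
        refine ⟨q.1, by simpa using hqb, ?_⟩
        have := hx1 i q hq
        rw [runLayers, ← this]
      · obtain ⟨i, hi⟩ := hx2 l hne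
        simp only [List.mem_flatMap, List.mem_map, List.mem_filter]
        exact ⟨i, List.mem_finRange i, _, ⟨hi, by simpa using hl⟩, rfl⟩
    | succ t ih =>
      intro ht b
      have hval : ∀ l, Ψ t (readSlot (mm (t + 1) (bin t l))) l =
          runLayers Ψ x (t + 1) l := by
        intro l
        rw [runLayers]
        exact hloc t (by omega) _ _ l fun l' hl' => (ih (by omega) _).readSlot_eq hl'
      rw [hmemS t (by omega)]
      refine ⟨fun w hw => ?_, fun l hl hne => ?_⟩
      · simp only [List.mem_flatMap, List.mem_map, List.mem_filter, decide_eq_true_eq] at hw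
        obtain ⟨i, -, l, ⟨-, hl, hlb⟩, rfl⟩ := hw
        subst hl
        exact ⟨l, hlb, by rw [hval]⟩
      · simp only [List.mem_flatMap, List.mem_map, List.mem_filter, decide_eq_true_eq]
        exact ⟨bin t l, List.mem_finRange _, l, ⟨List.mem_finRange _, rfl, hl⟩, by rw [hval]⟩
  have hfin : ∀ b : Fin p, mm (d + 2) b =
      ((List.finRange N).filter (fun l => bin d l = b)).flatMap
        (fun l => outF l (runLayers Ψ x d l)) := by
    intro b
    have h1 : mm (d + 2) b = (List.finRange p).flatMap (fun i => if i = b then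
        ((List.finRange N).filter (fun l => bin d l = i)).flatMap
          (fun l => outF l (readSlot (mm (d + 1) i) l)) else []) := by
      rw [hstep]
      simp only [hsdd]
    rw [h1, flatMap_finRange_single (fun i => ((List.finRange N).filter
      (fun l => bin d l = i)).flatMap (fun l => outF l (readSlot (mm (d + 1) i) l)))]
    refine List.flatMap_congr fun l hl => ?_
    simp only [List.mem_filter, decide_eq_true_eq] at hl
    rw [(inv d le_rfl b).readSlot_eq hl.2]
  have houtlen : ∀ b : Fin p, (((List.finRange N).filter (fun l => bin d l = b)).flatMap
        (fun l => outF l (runLayers Ψ x d l))).length ≤ s := by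
    intro b
    refine le_trans ?_ hos
    rw [List.length_flatMap]
    refine le_trans (List.sum_le_card_nsmul _ o ?_) ?_
    · intro m hm
      simp only [List.mem_map] at hm
      obtain ⟨l, _, rfl⟩ := hm
      exact hout l
    · rw [List.length_map, length_filter_finRange, smul_eq_mul]
      exact Nat.mul_le_mul_right _ (hbin d le_rfl b)
  have hlen : ∀ t ≤ d + 2, ∀ b, (mm t b).length ≤ s := by
    intro t ht b
    match t, ht with
    | 0, _ => rw [hmm]; exact hinit b
    | 1, _ =>
      rw [hmem0]
      refine le_trans ?_ ((hbin 0 (Nat.zero_le _) b).trans hs0)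
      have h1 : ((List.finRange p).flatMap
          (fun i => ((place i (init i)).filter (fun q => bin 0 q.1 = b)).map slotWord)).length =
          ((((List.finRange p).flatMap (fun i => place i (init i))).map Prod.fst).filter
            (fun l => decide (bin 0 l = b))).length := by
        rw [List.filter_map, List.length_map, List.filter_flatMap, List.length_flatMap,
          List.length_flatMap]
        simp only [List.length_map]
        rfl
      rw [h1, ← List.toFinset_card_of_nodup (hx3.filter _)]
      refine Finset.card_le_card fun l hl => ?_
      simp only [List.mem_toFinset, List.mem_filter, decide_eq_true_eq] at hl
      simpa using hl.2
    | t + 2, ht =>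
      by_cases htd : t < d
      · rw [hmemS t htd]
        refine le_trans (le_of_eq ?_) ((hbin (t + 1) (by omega) b).trans hs0)
        rw [List.length_flatMap]
        simp only [List.length_map, length_filter_finRange]
        rw [sum_map_finRange]
        exact sum_card_filter_and (bin t) _
      · obtain rfl : t = d := by omega
        rw [hfin]
        exact houtlen b
  have hword : ∀ t ≤ d + 2, ∀ b, ∀ w ∈ mm t b, w < W := by
    intro t ht b w hw
    match t, ht with
    | 0, _ => rw [hmm] at hw; exact hinitW b w hw
    | t + 1, ht =>
      by_cases htd : t ≤ d
      · obtain ⟨l, -, rfl⟩ := (inv t htd b).1 w hw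
        exact (slotWord_lt _).trans_le hW
      · obtain rfl : t = d + 1 := by omega
        rw [hfin] at hw
        obtain ⟨l, -, hl⟩ := List.mem_flatMap.1 hw
        exact houtW l w hl
  have hsent : ∀ t < d + 2, ∀ i, ∑ j, (sd t i (mm t i) j).length ≤ s := by
    intro t ht i
    match t, ht with
    | 0, _ =>
      rw [hsd, hmm]
      change ∑ j : Fin p, (((place i (init i)).filter (fun q => bin 0 q.1 = j)).map
        slotWord).length ≤ s
      refine le_trans (le_of_eq ?_) (hx4 i)
      simp only [List.length_map]
      generalize place i (init i) = L
      induction L with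
      | nil => simp
      | cons a L ih =>
        simp only [List.filter_cons, List.length_cons]
        rw [← ih]
        have : ∀ j, (if decide (bin 0 a.1 = j) = true then
            a :: L.filter (fun q => decide (bin 0 q.1 = j)) else
            L.filter (fun q => decide (bin 0 q.1 = j))).length =
            (L.filter (fun q => decide (bin 0 q.1 = j))).length +
              if bin 0 a.1 = j then 1 else 0 := by
          intro j
          by_cases hj : bin 0 a.1 = j <;> simp [hj]
        simp only [this, Finset.sum_add_distrib]
        simp
    | t + 1, ht =>
      by_cases htd : t < d
      · simp only [hsdS t htd, List.length_map, length_filter_finRange]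
        refine le_trans (le_of_eq ?_) ((hbin t (by omega) i).trans hs0)
        rw [← sum_card_filter_and (bin (t + 1)) (fun l => bin t l = i)]
        simp only [and_comm]
      · obtain rfl : t = d := by omega
        have : ∀ j : Fin p, (sd (t + 1) i (mm (t + 1) i) j).length =
            if i = j then (((List.finRange N).filter (fun l => bin t l = i)).flatMap
              (fun l => outF l (runLayers Ψ x t l))).length else 0 := by
          intro j
          rw [hsdd]
          split_ifs
          · congr 1
            refine List.flatMap_congr fun l hl => ?_
            simp only [List.mem_filter, decide_eq_true_eq] at hl
            rw [(inv t le_rfl i).readSlot_eq hl.2]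
          · rfl
        calc ∑ j : Fin p, (sd (t + 1) i (mm (t + 1) i) j).length
            = ∑ j : Fin p, if i = j then (((List.finRange N).filter
              (fun l => bin t l = i)).flatMap (fun l => outF l (runLayers Ψ x t l))).length else 0 :=
              Finset.sum_congr rfl fun j _ => this j
          _ ≤ s := by
            rw [Finset.sum_ite_eq]
            simpa using houtlen i
  subst hmm hsd
  exact ⟨⟨hlen, hword, hsent⟩, hfin⟩

end Simulation

/-! ### Annotation of records by sums over ranges of keys -/

/-- One step of an annotation program: every record `l` is extended by the sum of the weights `ω r`
of all records `r` with key `lo l ≤ κ r < hi l`. -/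
structure SumStep where
  κ : List ℕ → ℕ
  lo : List ℕ → ℕ
  hi : List ℕ → ℕ
  ω : List ℕ → ℕ
  le : ∀ l, lo l ≤ hi l

/-- The sum that a step computes for the record `l`, among the records `D`. -/
def SumStep.value (s : SumStep) (D : Multiset (List ℕ)) (l : List ℕ) : ℕ :=
  (D.map (fun r => if s.lo l ≤ s.κ r ∧ s.κ r < s.hi l then s.ω r else 0)).sum

/-- Extend a record with zeros to length `5`. -/
def padRecord (r : List ℕ) : List ℕ := r ++ List.replicate (5 - r.length) 0

/-- The record `r`, extended by the results of the first `t` steps on the records `D`. -/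
def annotate (steps : ℕ → SumStep) (D : Multiset (List ℕ)) : ℕ → List ℕ → List ℕ
  | 0, r => padRecord r
  | t + 1, r => annotate steps D t r ++
      [(steps t).value (D.map (annotate steps D t)) (annotate steps D t r)]

theorem length_padRecord {r : List ℕ} (h : r.length ≤ 5) : (padRecord r).length = 5 := by
  simp [padRecord]; omega

theorem length_annotate (steps : ℕ → SumStep) (D : Multiset (List ℕ)) (t : ℕ) {r : List ℕ}
    (h : r.length ≤ 5) : (annotate steps D t r).length = 5 + t := by
  induction t with
  | zero => exact length_padRecord h
  | succ t ih => simp [annotate, ih]; omega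

theorem annotate_prefix (steps : ℕ → SumStep) (D : Multiset (List ℕ)) {t q : ℕ} (h : t ≤ q)
    (r : List ℕ) : annotate steps D t r <+: annotate steps D q r := by
  induction q, h using Nat.le_induction with
  | base => exact List.prefix_refl _
  | succ q _ ih => exact ih.trans (List.prefix_append _ _)

section Annotate

variable {Q ℓ : ℕ}

/-- A list of numbers as a vector of length `ℓ` modulo `Q`. -/
def toVec (Q ℓ : ℕ) (l : List ℕ) (i : Fin ℓ) : ZMod Q := (l.getD i 0 : ℕ)

/-- The first `m` entries of a vector. -/
def ofVec (m : ℕ) (v : Fin ℓ → ZMod Q) : List ℕ := (List.ofFn (fun i => (v i).val)).take m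

theorem ofVec_congr {m : ℕ} {v w : Fin ℓ → ZMod Q} (h : ∀ i : Fin ℓ, i.1 < m → v i = w i) :
    ofVec m v = ofVec m w := by
  refine List.ext_getElem ?_ fun i h1 h2 => ?_
  · simp [ofVec]
  · simp only [ofVec, List.length_take, List.length_ofFn] at h1
    simp only [ofVec, List.getElem_take, List.getElem_ofFn]
    rw [h _ (by simp only; omega)]

theorem ofVec_toVec {l : List ℕ} {m : ℕ} (hl : l.length = m) (hm : m ≤ ℓ)
    (hQ : ∀ a ∈ l, a < Q) : ofVec m (toVec Q ℓ l) = l := by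
  refine List.ext_getElem ?_ fun i h1 h2 => ?_
  · simp [ofVec]; omega
  · simp only [ofVec, List.getElem_take, List.getElem_ofFn, toVec]
    rw [List.getD_eq_getElem _ _ h2, ZMod.val_natCast, Nat.mod_eq_of_lt (hQ _ (List.getElem_mem h2))]

theorem update_toVec {l : List ℕ} (hl : l.length < ℓ) (a : ℕ) :
    Function.update (toVec Q ℓ l) ⟨l.length, hl⟩ (a : ZMod Q) = toVec Q ℓ (l ++ [a]) := by
  funext i
  rcases lt_trichotomy i.1 l.length with h | h | h
  · rw [Function.update_of_ne (by intro h'; rw [h'] at h; simp at h)]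
    simp [toVec, List.getElem?_append_left h]
  · have : i = ⟨l.length, hl⟩ := Fin.ext h
    subst this
    simp [toVec]
  · rw [Function.update_of_ne (by intro h'; rw [h'] at h; simp at h)]
    simp [toVec]
    rw [List.getElem?_eq_none (by omega), List.getElem?_eq_none (by simp; omega)]

/-- The records present in an array. -/
def presentRecords {H : ℕ} (recs : Fin H → Option (List ℕ)) : Multiset (List ℕ) :=
  (Finset.univ : Finset (Fin H)).val.filterMap recs

theorem mem_presentRecords {H : ℕ} {recs : Fin H → Option (List ℕ)} {a : Fin H} {r : List ℕ}
    (h : recs a = some r) : r ∈ presentRecords recs :=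
  (Multiset.mem_filterMap _ _).2 ⟨a, Finset.mem_univ a, h⟩

theorem sum_map_presentRecords {H : ℕ} {M : Type*} [AddCommMonoid M]
    (recs : Fin H → Option (List ℕ)) (φ : List ℕ → M) :
    ((presentRecords recs).map φ).sum = ∑ a, (recs a).elim 0 φ := by
  rw [presentRecords, Finset.sum]
  induction (Finset.univ : Finset (Fin H)).val using Multiset.induction with
  | empty => simp
  | cons a s ih =>
    rcases h : recs a with _ | r
    · rw [Multiset.filterMap_cons_none _ _ h]; simp [h, ih]
    · rw [Multiset.filterMap_cons_some _ _ _ h]; simp [h, ih]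

/-- The depth of the network for one sum. -/
def sumDepth (k : ℕ) : ℕ := 1 + 4 ^ k + 1 + (k + 3) + 4 ^ k + 1

/-- A range sum is the sum below `hi` minus the sum below `lo`. The first dominance pass writes the
negated sum below `lo` into a new coordinate, the second one adds the sum below `hi`. Working modulo
Q keeps the contents finite and gives sense to the intermediate negative value; the bound by Q on
the annotations allows the records to be decoded. -/
theorem exists_isNet_annotate {b : ℕ} (hb : 2 ≤ b) (k : ℕ) {N : ℕ} (hN : N = b ^ (k + 3))
    (steps : ℕ → SumStep) (q : ℕ) (hq : 5 + q ≤ ℓ) :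
    ∃ Φ : (Fin N → (Option (Fin ℓ → ZMod Q) × Fin N) × ZMod Q × ZMod Q) → Fin N →
        (Option (Fin ℓ → ZMod Q) × Fin N) × ZMod Q × ZMod Q,
      IsNet (b ^ 3) (q * (sumDepth k + sumDepth k)) Φ ∧
      ∀ x (recs : Fin (N / 2) → Option (List ℕ)),
        (∀ r ∈ presentRecords recs, r.length ≤ 5 ∧
          ∀ a ∈ annotate steps (presentRecords recs) q r, a < Q) →
        (evenSlots x = fun a => (recs a).map (fun r => toVec Q ℓ (padRecord r))) →
        evenSlots (Φ x) = fun a => (recs a).map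
          (fun r => toVec Q ℓ (annotate steps (presentRecords recs) q r)) := by
  induction q with
  | zero =>
    refine ⟨id, by simpa using IsNet.refl, fun x recs _ h => h⟩
  | succ q ih =>
    obtain ⟨Φ, hΦ, hspec⟩ := ih (by omega)
    set s := steps q with hs
    set κ' : Option (Fin ℓ → ZMod Q) → ℕ := fun o => o.elim 0 (fun v => s.κ (ofVec (5 + q) v))
      with hκ'
    set ω' : Option (Fin ℓ → ZMod Q) → ZMod Q :=
      fun o => o.elim 0 (fun v => (s.ω (ofVec (5 + q) v) : ℕ)) with hω'
    set lo' : Option (Fin ℓ → ZMod Q) → ℕ := fun o => o.elim 0 (fun v => s.lo (ofVec (5 + q) v))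
      with hlo'
    set hi' : Option (Fin ℓ → ZMod Q) → ℕ := fun o => o.elim 0 (fun v => s.hi (ofVec (5 + q) v))
      with hhi'
    have hq' : 5 + q < ℓ := by omega
    obtain ⟨Φ1, hn1, h1⟩ := exists_isNet_dominanceStep hb k hN κ' lo' ω'
      (fun o S => o.map (fun v => Function.update v ⟨5 + q, hq'⟩ (-S)))
    obtain ⟨Φ2, hn2, h2⟩ := exists_isNet_dominanceStep hb k hN κ' hi' ω'
      (fun o S => o.map (fun v => Function.update v ⟨5 + q, hq'⟩ (v ⟨5 + q, hq'⟩ + S)))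
    refine ⟨Φ2 ∘ (Φ1 ∘ Φ), ?_, fun x recs hrec hx => ?_⟩
    · have := (hΦ.trans hn1).trans hn2
      rw [add_mul, one_mul, ← add_assoc]
      exact this
    set D := presentRecords recs with hD
    set A := annotate steps D q with hA
    have hpre : ∀ r, A r <+: annotate steps D (q + 1) r := fun r => annotate_prefix _ _ (by omega) _
    have hx1 : evenSlots (Φ x) = fun a => (recs a).map (fun r => toVec Q ℓ (A r)) := hspec x recs (fun r hr => ⟨(hrec r hr).1, fun a ha =>
      (hrec r hr).2 a ((hpre r).subset ha)⟩) hx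
    have hrt : ∀ r ∈ D, ∀ v : Fin ℓ → ZMod Q, (∀ i : Fin ℓ, i.1 < 5 + q → v i = toVec Q ℓ (A r) i) →
        ofVec (5 + q) v = A r := by
      intro r hr v hv
      rw [ofVec_congr hv]
      exact ofVec_toVec (length_annotate _ _ _ (hrec r hr).1) (by omega)
        fun a ha => (hrec r hr).2 a ((hpre r).subset ha)
    -- `F` is free beyond the first 5 + q coordinates so that one computation serves both passes:
    -- when the second one runs, coordinate 5 + q has been overwritten.
    have hdom : ∀ (F : List ℕ → Fin ℓ → ZMod Q), (∀ r ∈ D, ∀ i : Fin ℓ, i.1 < 5 + q →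
        F r i = toVec Q ℓ (A r) i) → ∀ τ : ℕ,
        (∑ a', if κ' ((recs a').map F) < τ then ω' ((recs a').map F) else 0) =
        (((D.map (fun r => if s.κ (A r) < τ then s.ω (A r) else 0)).sum : ℕ) : ZMod Q) := by
      intro F hF τ
      rw [Nat.cast_multiset_sum, Multiset.map_map, hD, sum_map_presentRecords]
      refine Finset.sum_congr rfl fun a' _ => ?_
      rcases h : recs a' with _ | r
      · simp [hω']
      · have := hrt r (mem_presentRecords h) (F r) (hF r (mem_presentRecords h))
        simp only [Option.map_some, hκ', hω', Option.elim_some, this, Function.comp]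
        split_ifs <;> simp
    have e1 : evenSlots (Φ1 (Φ x)) = fun a => (recs a).map (fun r =>
        Function.update (toVec Q ℓ (A r)) ⟨5 + q, hq'⟩
          (-(((D.map (fun r' => if s.κ (A r') < s.lo (A r) then s.ω (A r') else 0)).sum : ℕ) :
            ZMod Q))) := by
      rw [h1, hx1]
      funext a
      rw [dominanceStep, hdom _ (fun r _ i _ => rfl)]
      rcases h : recs a with _ | r
      · rfl
      · simp only [Option.map_some, hlo', Option.elim_some,
          hrt r (mem_presentRecords h) _ (fun i _ => rfl)]
    have e2 : evenSlots (Φ2 (Φ1 (Φ x))) = _ := h2 _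
    change evenSlots (Φ2 (Φ1 (Φ x))) = _
    rw [e2, e1]
    have hF2 : ∀ r : List ℕ, ∀ c : ZMod Q, ∀ i : Fin ℓ, i.1 < 5 + q →
        Function.update (toVec Q ℓ (A r)) ⟨5 + q, hq'⟩ c i = toVec Q ℓ (A r) i := by
      intro r c i hi
      rw [Function.update_of_ne]
      intro h; rw [h] at hi; simp at hi
    funext a
    rw [dominanceStep, hdom _ (fun r _ i hi => hF2 r _ i hi)]
    rcases h : recs a with _ | r
    · rfl
    · have hr := mem_presentRecords h
      simp only [Option.map_some, hhi', Option.elim_some,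
        hrt r hr _ (fun i hi => hF2 r _ i hi), Function.update_self, Function.update_idem]
      have hlen : (A r).length = 5 + q := length_annotate _ _ _ (hrec r hr).1
      have hval : annotate steps D (q + 1) r = A r ++ [s.value (D.map A) (A r)] := rfl
      rw [hval, ← update_toVec (by omega)]
      congr 1
      have hidx : (⟨5 + q, hq'⟩ : Fin ℓ) = ⟨(A r).length, by omega⟩ := Fin.ext hlen.symm
      rw [hidx]
      congr 1
      -- Since lo ≤ hi, the indicator of κ < hi is that of lo ≤ κ < hi plus that of κ < lo.
      rw [neg_add_eq_sub, sub_eq_iff_eq_add, ← Nat.cast_add]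
      congr 1
      rw [SumStep.value, Multiset.map_map, ← Multiset.sum_map_add]
      congr 1
      refine Multiset.map_congr rfl fun r' _ => ?_
      have := s.le (A r)
      simp only [Function.comp]
      split_ifs <;> omega

end Annotate

/-! ### Programs for annotation -/

/-- The length of the record `r` is determined by its first word. -/
def HasLength (len : ℕ → ℕ) (r : List ℕ) : Prop := ∃ h t, r = h :: t ∧ r.length = len h

/-- The first word of a record fixes its length, so a concatenation of records can be cut in only
one way. -/
theorem eq_of_flatten_eq {len : ℕ → ℕ} : ∀ {L L' : List (List ℕ)}, (∀ r ∈ L, HasLength len r) →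
    (∀ r ∈ L', HasLength len r) → L.flatten = L'.flatten → L = L'
  | [], [], _, _, _ => rfl
  | [], r :: L', _, h', h => by
    obtain ⟨a, t, rfl, -⟩ := h' r (by simp)
    simp at h
  | r :: L, [], h', _, h => by
    obtain ⟨a, t, rfl, -⟩ := h' r (by simp)
    simp at h
  | r :: L, r' :: L', h1, h2, h => by
    obtain ⟨a, t, hr, hl⟩ := h1 r (by simp)
    obtain ⟨a', t', hr', hl'⟩ := h2 r' (by simp)
    simp only [List.flatten_cons] at h
    have ha : a = a' := by
      rw [hr, hr'] at h
      simpa using congrArg List.head? h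
    obtain ⟨e1, e2⟩ := List.append_inj h (by rw [hl, hl', ha])
    rw [e1, eq_of_flatten_eq (fun r hr => h1 r (by simp [hr])) (fun r hr => h2 r (by simp [hr])) e2]

open Classical in
/-- Split a sequence of words into records. -/
noncomputable def parseRecords (len : ℕ → ℕ) (M : List ℕ) : List (List ℕ) :=
  if h : ∃ L : List (List ℕ), (∀ r ∈ L, HasLength len r) ∧ L.flatten = M then h.choose else []

theorem parseRecords_flatten {len : ℕ → ℕ} {L : List (List ℕ)} (h : ∀ r ∈ L, HasLength len r) :
    parseRecords len L.flatten = L := by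
  have hex : ∃ L' : List (List ℕ), (∀ r ∈ L', HasLength len r) ∧ L'.flatten = L.flatten :=
    ⟨L, h, rfl⟩
  rw [parseRecords, dif_pos hex]
  exact eq_of_flatten_eq hex.choose_spec.1 h hex.choose_spec.2

section Program

/-- The `a`-th record of a distributed input, if machine `i` holds the records numbered from
`i * S`. -/
def storedRecord {m : ℕ} (inp : Fin m → List (List ℕ)) (S a : ℕ) : Option (List ℕ) :=
  if h : a / S < m then (inp ⟨a / S, h⟩)[a % S]? else none

theorem sum_getElem?_elim {M : Type*} [AddCommMonoid M] {S : ℕ} (φ : List ℕ → M) :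
    ∀ {l : List (List ℕ)}, l.length ≤ S → ∑ u : Fin S, (l[u.1]?).elim 0 φ = (l.map φ).sum := by
  induction S with
  | zero =>
    intro l hl
    have : l = [] := List.length_eq_zero_iff.1 (by omega)
    simp [this]
  | succ S ih =>
    intro l hl
    cases l with
    | nil => simp
    | cons r l =>
      rw [Fin.sum_univ_succ]
      simp only [Fin.val_zero, List.getElem?_cons_zero, Option.elim_some, Fin.val_succ,
        List.getElem?_cons_succ, List.map_cons, List.sum_cons]
      rw [ih (by simpa using hl)]

theorem presentRecords_storedRecord {m H S : ℕ} (hS : 0 < S) (hH : m * S ≤ H)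
    (inp : Fin m → List (List ℕ)) (hlen : ∀ i, (inp i).length ≤ S) :
    presentRecords (fun a : Fin H => storedRecord inp S a) =
      ∑ i, (inp i : Multiset (List ℕ)) := by
  -- A multiset is the sum of its singletons, so the summation formula with singleton values proves
  -- the equality.
  have h1 := sum_map_presentRecords (fun a : Fin H => storedRecord inp S a)
    (fun r => ({r} : Multiset (List ℕ)))
  rw [Multiset.sum_map_singleton] at h1
  rw [h1]
  have h2 : ∑ a : Fin H, (storedRecord inp S a).elim 0 (fun r => ({r} : Multiset (List ℕ))) =
      ∑ a : Fin (m * S), (storedRecord inp S a).elim 0 (fun r => ({r} : Multiset (List ℕ))) := by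
    rw [Finset.sum_fin_eq_sum_range, Finset.sum_fin_eq_sum_range]
    rw [← Finset.sum_subset (Finset.range_subset_range.2 hH)]
    · refine Finset.sum_congr rfl fun a ha => ?_
      have ha := Finset.mem_range.1 ha
      rw [dif_pos ha, dif_pos (by omega)]
    · intro a _ ha
      have ha : m * S ≤ a := by simpa using ha
      have : ¬ a / S < m := by
        rw [Nat.div_lt_iff_lt_mul hS]; omega
      simp [storedRecord, this]
  rw [h2, sum_fin_mul]
  refine Finset.sum_congr rfl fun i _ => ?_
  have h3 : ∀ u : Fin S, storedRecord inp S (shiftedBlock 0 m S (m * S) (by simp) (i, u)).1 =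
      (inp i)[u.1]? := by
    intro u
    rw [storedRecord, shiftedBlock_mod, shiftedBlock_val]
    have : (i.1 * S + u.1) / S = i.1 := by
      rw [mul_comm, Nat.mul_add_div hS, Nat.div_eq_of_lt u.2, add_zero]
    simp [this]
  simp only [h3]
  rw [sum_getElem?_elim _ (hlen i)]
  exact Multiset.sum_map_singleton (inp i : Multiset (List ℕ))

theorem sum_even {M : Type*} [AddCommMonoid M] {N : ℕ} (f : ℕ → M) :
    (∑ j : Fin N, if j.1 % 2 = 0 ∧ j.1 / 2 < N / 2 then f (j.1 / 2) else 0) =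
      ∑ a : Fin (N / 2), f a := by
  rw [← Finset.sum_filter]
  symm
  refine Finset.sum_bij (fun a _ => (⟨2 * a.1, by have := a.2; omega⟩ : Fin N)) ?_ ?_ ?_ ?_
  · intro a _
    have := a.2
    simp only [Finset.mem_filter, Finset.mem_univ, true_and]
    omega
  · intro a _ a' _ h
    have := congrArg Fin.val h
    simp only at this
    exact Fin.ext (by omega)
  · intro j hj
    simp only [Finset.mem_filter, Finset.mem_univ, true_and] at hj
    exact ⟨⟨j.1 / 2, by omega⟩, Finset.mem_univ _, Fin.ext (by simp only; omega)⟩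
  · intro a _
    congr 1
    simp only
    omega

theorem coe_flatMap_filter_finRange {β : Type*} (N : ℕ) (p : Fin N → Prop) [DecidablePred p]
    (f : Fin N → List β) : (((List.finRange N).filter p).flatMap f : Multiset β) =
      ∑ l ∈ Finset.univ.filter p, (f l : Multiset β) := by
  have h1 : Finset.univ.filter p = (((List.finRange N).filter p).toFinset) := by
    ext i; simp
  rw [h1, List.sum_toFinset _ ((List.nodup_finRange N).filter _)]
  induction (List.finRange N).filter p with
  | nil => rfl
  | cons a L ih =>
    rw [List.flatMap_cons, ← Multiset.coe_add, ih]
    simp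

theorem flatten_flatMap {β γ : Type*} (L : List β) (f : β → List (List γ)) :
    (L.flatMap f).flatten = L.flatMap (fun a => (f a).flatten) := by
  induction L with
  | nil => rfl
  | cons a L ih => simp [List.flatMap_cons, ih]

/-- Record j of machine i is placed in slot 2 * (i * S + j); odd slots are left for the data copies
of the dominance steps. A content is an optional vector of 5 + q residues, a slot number and two
accumulators, so there are (Q^(5+q) + 1) * N * (Q * Q) contents, and a slot together with its
content is one word below W. -/
theorem exists_program_annotate {b k N p s Qm S o W Q q : ℕ} (hb : 2 ≤ b) (hN : N = b ^ (k + 3))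
    (hQm : 0 < Qm) (hp : N / Qm < p) (hs : Qm + b ^ 3 ≤ s) (hos : (Qm + b ^ 3) * o ≤ s)
    (hQ : 0 < Q) (hW : N * ((Q ^ (5 + q) + 1) * N * (Q * Q)) ≤ W) (hQW : Q ≤ W)
    (hS : 0 < S) (hSs : S ≤ s) (len : ℕ → ℕ) (steps : ℕ → SumStep)
    (outRec : List ℕ → List (List ℕ)) :
    ∃ P : MPCProgram, P.p = p ∧ P.s = s ∧ ∀ (m : ℕ) (inp : Fin m → List (List ℕ)), m ≤ p →
      m * S ≤ N / 2 → (∀ i, (inp i).flatten.length < S) →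
      ∀ D : Multiset (List ℕ), D = ∑ i, (inp i : Multiset (List ℕ)) →
      (∀ r ∈ D, HasLength len r ∧ r.length ≤ 5 ∧ ∀ a ∈ annotate steps D q r, a < Q) →
      (∀ r ∈ D, (outRec (annotate steps D q r)).flatten.length ≤ o ∧
        ∀ w ∈ (outRec (annotate steps D q r)).flatten, w < W) →
      P.Respects W (q * (sumDepth k + sumDepth k) + 2) (P.load inp) ∧
      ∃ out : Fin P.p → List (List ℕ),
        (∀ i, P.mem (P.load inp) (q * (sumDepth k + sumDepth k) + 2) i = (out i).flatten) ∧
        ∑ i, (out i : Multiset (List ℕ)) = D.bind (fun r => (outRec (annotate steps D q r) :)) := by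
  classical
  have hN0 : 0 < N := hN ▸ Nat.pow_pos (by omega)
  have : NeZero Q := ⟨hQ.ne'⟩
  set ℓ := 5 + q with hℓ
  set d := q * (sumDepth k + sumDepth k) with hd
  obtain ⟨Φ, hnet, hΦ⟩ := exists_isNet_annotate (Q := Q) (ℓ := ℓ) hb k hN steps q le_rfl
  obtain ⟨Ψ, hloc, hrun⟩ := hnet.exists_layers
  -- There is no layer d, but the final contents still need a distribution for the output round; any
  -- balanced one serves, here one for the identity.
  have hbins : ∀ t, ∃ bin : Fin N → Fin p,
      (∀ m, (Finset.univ.filter (fun j => bin j = m)).card ≤ Qm + b ^ 3) ∧ (t < d →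
      ∀ x y i, (∀ j, bin j = bin i → x j = y j) → Ψ t x i = Ψ t y i) := by
    intro t
    by_cases ht : t < d
    · obtain ⟨bin, h1, h2⟩ := (hloc t ht).exists_bins hQm hp
      exact ⟨bin, h1, fun _ => h2⟩
    · obtain ⟨bin, h1, -⟩ := (isLocal_pointwise (α := Unit) (Nat.one_le_pow 3 b (by omega))
        (fun (_ : Fin N) u => u)).exists_bins hQm hp
      exact ⟨bin, h1, fun h => absurd h ht⟩
  choose bin hbin1 hbin2 using hbins
  let α := (Option (Fin ℓ → ZMod Q) × Fin N) × ZMod Q × ZMod Q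
  let _ : Inhabited α := ⟨((none, ⟨0, hN0⟩), 0, 0)⟩
  let item : Option (List ℕ) → α := fun o =>
    ((o.map (fun r => toVec Q ℓ (padRecord r)), ⟨0, hN0⟩), 0, 0)
  let place : Fin p → List ℕ → List (Fin N × α) := fun i M => (List.range S).filterMap (fun j =>
    ((parseRecords len M)[j]?).bind (fun r => if h : 2 * (i.1 * S + j) < N then
      some (⟨2 * (i.1 * S + j), h⟩, item (some r)) else none))
  let outL : Fin N → α → List (List ℕ) := fun l a => if l.1 % 2 = 0 ∧ l.1 / 2 < N / 2 then
    a.1.1.elim [] (fun v => outRec (ofVec ℓ v)) else []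
  refine ⟨layerProgram p s d place bin Ψ (fun l a => (outL l a).flatten), rfl, rfl, ?_⟩
  intro m inp hmp hmS hlenS D hD hrec hout
  have hmem : ∀ i, ∀ r ∈ inp i, r ∈ D := by
    intro i r hr
    rw [hD]
    exact Multiset.mem_sum.2 ⟨i, Finset.mem_univ i, hr⟩
  have hcount : ∀ i, (inp i).length ≤ S := by
    intro i
    refine le_trans ?_ (hlenS i).le
    rw [List.length_flatten]
    refine (List.card_nsmul_le_sum ((inp i).map List.length) 1 ?_).trans' (by simp)
    intro a ha
    obtain ⟨r, hr, rfl⟩ := List.mem_map.1 ha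
    obtain ⟨h, t, rfl, -⟩ := (hrec r (hmem i r hr)).1
    simp
  have hDp := presentRecords_storedRecord hS hmS inp hcount
  rw [← hD] at hDp
  set recs : Fin (N / 2) → Option (List ℕ) := fun a => storedRecord inp S a with hrecs
  set init : Fin p → List ℕ :=
    (layerProgram p s d place bin Ψ (fun l a => (outL l a).flatten)).load inp with hinit
  have hinit1 : ∀ (i : Fin p) (h : i.1 < m), init i = (inp ⟨i.1, h⟩).flatten := fun i h => by
    rw [hinit]; exact dif_pos h
  have hinit2 : ∀ (i : Fin p), ¬ i.1 < m → init i = [] := fun i h => by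
    rw [hinit]; exact dif_neg h
  have hparse : ∀ (i : Fin p) j, j < S → (parseRecords len (init i))[j]? =
      storedRecord inp S (i.1 * S + j) := by
    intro i j hj
    have e1 : (i.1 * S + j) / S = i.1 := by
      rw [mul_comm, Nat.mul_add_div hS, Nat.div_eq_of_lt hj, add_zero]
    have e2 : (i.1 * S + j) % S = j := by rw [mul_comm, Nat.mul_add_mod, Nat.mod_eq_of_lt hj]
    by_cases h : i.1 < m
    · rw [hinit1 i h, parseRecords_flatten fun r hr => (hrec r (hmem _ r hr)).1]
      simp [storedRecord, e1, e2, h]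
    · rw [hinit2 i h]
      have := parseRecords_flatten (len := len) (L := []) (by simp)
      simp only [List.flatten_nil] at this
      simp [storedRecord, e1, h, this]
  set x : Fin N → α := fun l => item (if l.1 % 2 = 0 then storedRecord inp S (l.1 / 2) else none)
    with hx
  have hplace : ∀ i q', q' ∈ place i (init i) ↔ ∃ j < S, ∃ r,
      storedRecord inp S (i.1 * S + j) = some r ∧ ∃ h : 2 * (i.1 * S + j) < N,
        q' = (⟨2 * (i.1 * S + j), h⟩, item (some r)) := by
    intro i q'
    simp only [place, List.mem_filterMap, List.mem_range]
    refine exists_congr fun j => and_congr_right fun hj => ?_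
    rw [hparse i j hj, Option.bind_eq_some_iff]
    refine exists_congr fun r => and_congr_right fun _ => ?_
    constructor
    · intro h
      split_ifs at h with h'
      exact ⟨h', (Option.some.inj h).symm⟩
    · rintro ⟨h', rfl⟩
      rw [dif_pos h']
  have hx0 : evenSlots x = fun a => (recs a).map (fun r => toVec Q ℓ (padRecord r)) := by
    funext a
    simp [evenSlots, hx, item, hrecs]
  have hfin : evenSlots (runLayers Ψ x d) = fun a => (recs a).map
      (fun r => toVec Q ℓ (annotate steps D q r)) := by
    rw [hrun, ← hDp]
    refine hΦ x recs ?_ hx0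
    rw [hDp]
    exact fun r hr => (hrec r hr).2
  have hstate : ∀ l, outL l (runLayers Ψ x d l) = if l.1 % 2 = 0 ∧ l.1 / 2 < N / 2 then
      (storedRecord inp S (l.1 / 2)).elim [] (fun r => outRec (annotate steps D q r)) else [] := by
    intro l
    simp only [outL]
    split_ifs with h
    · have h1 : (runLayers Ψ x d l).1.1 = evenSlots (runLayers Ψ x d) ⟨l.1 / 2, h.2⟩ := by
        have : (⟨2 * (l.1 / 2), by have := l.2; omega⟩ : Fin N) = l := Fin.ext (by simp only; omega)
        simp only [evenSlots, this]
      rw [h1, hfin]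
      simp only [hrecs]
      rcases hr : storedRecord inp S (l.1 / 2) with _ | r
      · rfl
      · have hrD : r ∈ D := by
          rw [← hDp]
          exact mem_presentRecords (a := ⟨l.1 / 2, h.2⟩) hr
        simp only [Option.map_some, Option.elim_some]
        rw [ofVec_toVec (length_annotate _ _ _ (hrec r hrD).2.1) le_rfl (hrec r hrD).2.2]
    · rfl
  have hstateD : ∀ l, outL l (runLayers Ψ x d l) = [] ∨ ∃ r ∈ D,
      outL l (runLayers Ψ x d l) = outRec (annotate steps D q r) := by
    intro l
    rw [hstate]
    split_ifs with h
    · rcases hr : storedRecord inp S (l.1 / 2) with _ | r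
      · exact Or.inl rfl
      · refine Or.inr ⟨r, ?_, rfl⟩
        rw [← hDp]
        exact mem_presentRecords (a := ⟨l.1 / 2, h.2⟩) hr
    · exact Or.inl rfl
  have hcard : Fintype.card α = (Q ^ ℓ + 1) * N * (Q * Q) := by
    simp [α, ZMod.card]
  have hspec := layerProgram_spec (N := N) (p := p) (s := s) (s0 := Qm + b ^ 3) (d := d) (W := W)
    (o := o) (place := place) (bin := bin) (Ψ := Ψ) (outF := fun l a => (outL l a).flatten)
    (fun t _ => hbin1 t) (fun t ht => hbin2 t ht) hs hos (by rw [hcard]; exact hW) init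
    (by
      intro i
      by_cases h : i.1 < m
      · rw [hinit1 i h]; exact (hlenS _).le.trans hSs
      · rw [hinit2 i h]; simp)
    (by
      intro i w hw
      by_cases h : i.1 < m
      · rw [hinit1 i h] at hw
        obtain ⟨r, hr, hwr⟩ := List.mem_flatten.1 hw
        refine lt_of_lt_of_le ((hrec r (hmem _ r hr)).2.2 w ?_) hQW
        exact (annotate_prefix steps D (Nat.zero_le q) r).subset (List.mem_append_left _ hwr)
      · rw [hinit2 i h] at hw; simp at hw)
    x
    (by
      intro i q' hq'
      obtain ⟨j, hj, r, hr, h, rfl⟩ := (hplace i q').1 hq'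
      simp [hx, hr])
    (by
      intro l hl
      by_cases h2 : l.1 % 2 = 0
      · rcases hr : storedRecord inp S (l.1 / 2) with _ | r
        · refine absurd ?_ hl
          simp only [hx, hr, ite_self]
          rfl
        · have hi : l.1 / 2 / S < m := by
            by_contra h
            rw [storedRecord, dif_neg h] at hr
            simp at hr
          refine ⟨⟨l.1 / 2 / S, hi.trans_le hmp⟩, (hplace _ _).2
            ⟨l.1 / 2 % S, Nat.mod_lt _ hS, r, ?_, ?_, ?_⟩⟩
          · rw [mul_comm, Nat.div_add_mod]; exact hr
          · simp only
            rw [mul_comm _ S, Nat.div_add_mod]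
            have := l.2; omega
          · refine Prod.ext (Fin.ext ?_) ?_
            · simp only
              rw [mul_comm _ S, Nat.div_add_mod]; omega
            · simp only [hx, if_pos h2, hr]
      · refine absurd ?_ hl
        simp only [hx, if_neg h2]
        rfl)
    (by
      have hinj : ∀ (i i' : Fin p) (j j' : ℕ), j < S → j' < S →
          2 * (i.1 * S + j) = 2 * (i'.1 * S + j') → i = i' ∧ j = j' := by
        intro i i' j j' hj hj' h
        have h : i.1 * S + j = i'.1 * S + j' := by omega
        have h1 : i.1 = i'.1 := by
          have := congrArg (· / S) h
          simpa [mul_comm _ S, Nat.mul_add_div hS, Nat.div_eq_of_lt hj, Nat.div_eq_of_lt hj']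
            using this
        refine ⟨Fin.ext h1, ?_⟩
        rw [h1] at h; omega
      rw [List.map_flatMap, List.nodup_flatMap]
      constructor
      · intro i _
        simp only [place]
        rw [List.map_filterMap]
        refine List.Nodup.filterMap ?_ List.nodup_range
        intro j j' y hy hy'
        simp only [Option.mem_def, Option.map_eq_some_iff, Option.bind_eq_some_iff] at hy hy'
        obtain ⟨q1, ⟨r, -, h1⟩, rfl⟩ := hy
        obtain ⟨q2, ⟨r', -, h2⟩, h3⟩ := hy'
        split_ifs at h1 h2
        rw [← Option.some.inj h1, ← Option.some.inj h2] at h3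
        have := congrArg Fin.val h3
        simp only at this
        omega
      · refine (List.nodup_finRange p).imp ?_
        intro i i' hne l hl hl'
        simp only [List.mem_map] at hl hl'
        obtain ⟨q1, h1, rfl⟩ := hl
        obtain ⟨q2, h2, h3⟩ := hl'
        obtain ⟨j, hj, r, -, h, rfl⟩ := (hplace _ _).1 h1
        obtain ⟨j', hj', r', -, h', rfl⟩ := (hplace _ _).1 h2
        exact hne (hinj i i' j j' hj hj' (congrArg Fin.val h3).symm).1)
    (by
      intro i
      simp only [place]
      exact (List.length_filterMap_le _ _).trans (by simpa using hSs))
    (by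
      intro l
      rcases hstateD l with h | ⟨r, hr, h⟩
      · rw [h]; simp
      · rw [h]; exact (hout r hr).1)
    (by
      intro l w hw
      rcases hstateD l with h | ⟨r, hr, h⟩
      · rw [h] at hw; simp at hw
      · rw [h] at hw; exact (hout r hr).2 w hw)
  refine ⟨hspec.1, fun i : Fin p => ((List.finRange N).filter
    (fun l => decide (bin d l = i))).flatMap (fun l => outL l (runLayers Ψ x d l)), ?_, ?_⟩
  · intro i
    rw [flatten_flatMap]
    exact hspec.2 i
  · change ∑ i : Fin p, ((((List.finRange N).filter (fun l => decide (bin d l = i))).flatMap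
      (fun l => outL l (runLayers Ψ x d l)) : List (List ℕ)) : Multiset (List ℕ)) = _
    simp only [coe_flatMap_filter_finRange]
    rw [Finset.sum_fiberwise]
    simp only [hstate]
    have h1 : ∀ l : Fin N, (((if l.1 % 2 = 0 ∧ l.1 / 2 < N / 2 then
        (storedRecord inp S (l.1 / 2)).elim [] (fun r => outRec (annotate steps D q r)) else [] :
        List (List ℕ))) : Multiset (List ℕ)) = if l.1 % 2 = 0 ∧ l.1 / 2 < N / 2 then
        (storedRecord inp S (l.1 / 2)).elim 0
          (fun r => ((outRec (annotate steps D q r) : List (List ℕ)) : Multiset (List ℕ))) else 0 := by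
      intro l
      split_ifs
      · cases storedRecord inp S (l.1 / 2) <;> rfl
      · rfl
    simp only [h1]
    rw [sum_even (fun a => (storedRecord inp S a).elim 0
      (fun r => ((outRec (annotate steps D q r) : List (List ℕ)) : Multiset (List ℕ)))),
      ← sum_map_presentRecords recs, hDp]
    rfl

end Program

/-! ### Choice of the array size, the memory and the number of machines -/

section Parameters

theorem nat_ceil_le_two_mul {x : ℝ} (h : 1 ≤ x) : (⌈x⌉₊ : ℝ) ≤ 2 * x := by
  have := (Nat.ceil_lt_add_one (by linarith : (0 : ℝ) ≤ x)).le
  linarith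

/-- The side length of the slot array: an approximate root of `n` whose cube is at most of order
`n ^ ε`. -/
theorem exists_side (ε : ℝ) (hε : 0 < ε) : ∃ k : ℕ, ∀ n : ℕ, 1 ≤ n → ∃ t : ℕ, 1 ≤ t ∧
    n ≤ t ^ (k + 3) ∧ t ^ (k + 3) ≤ 2 ^ (k + 3) * n ∧ t ^ 3 ≤ 8 * ⌈(n : ℝ) ^ ε⌉₊ := by
  -- If y is the (k + 3)-th root of n, then y^3 ≤ n^ε as soon as 3 ≤ ε * (k + 3). Rounding up to t =
  -- ⌈y⌉ ≤ 2 * y costs the factors 2^(k+3) and 8.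
  refine ⟨⌈3 / ε⌉₊, fun n hn => ?_⟩
  set k := ⌈3 / ε⌉₊ with hk
  have hk1 : 3 / ε ≤ (k : ℝ) := Nat.le_ceil _
  have hk2 : 3 ≤ ε * ((k + 3 : ℕ) : ℝ) := by
    have : 3 ≤ (k : ℝ) * ε := (div_le_iff₀ hε).1 hk1
    push_cast
    nlinarith
  have hn1 : (1 : ℝ) ≤ n := by exact_mod_cast hn
  have hk0 : (0 : ℝ) < ((k + 3 : ℕ) : ℝ) := by positivity
  set y : ℝ := (n : ℝ) ^ (1 / ((k + 3 : ℕ) : ℝ)) with hy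
  have hy1 : 1 ≤ y := Real.one_le_rpow hn1 (by positivity)
  have hyk : y ^ (k + 3) = n := by
    rw [hy, ← Real.rpow_natCast, ← Real.rpow_mul (by linarith), one_div_mul_cancel hk0.ne',
      Real.rpow_one]
  have hy3 : y ^ 3 ≤ (n : ℝ) ^ ε := by
    rw [hy, ← Real.rpow_natCast, ← Real.rpow_mul (by linarith)]
    refine Real.rpow_le_rpow_of_exponent_le hn1 ?_
    rw [one_div_mul_eq_div, div_le_iff₀ hk0]
    exact_mod_cast hk2
  have hc1 : y ≤ (⌈y⌉₊ : ℝ) := Nat.le_ceil _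
  have hc2 := nat_ceil_le_two_mul hy1
  refine ⟨⌈y⌉₊, Nat.one_le_ceil_iff.2 (by linarith), ?_, ?_, ?_⟩
  · have : (n : ℝ) ≤ (⌈y⌉₊ : ℝ) ^ (k + 3) := by
      rw [← hyk]; gcongr
    exact_mod_cast this
  · have : (⌈y⌉₊ : ℝ) ^ (k + 3) ≤ 2 ^ (k + 3) * n := by
      rw [← hyk, ← mul_pow]; gcongr
    exact_mod_cast this
  · have : (⌈y⌉₊ : ℝ) ^ 3 ≤ 8 * (⌈(n : ℝ) ^ ε⌉₊ : ℝ) := by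
      calc (⌈y⌉₊ : ℝ) ^ 3 ≤ (2 * y) ^ 3 := by gcongr
        _ = 8 * y ^ 3 := by ring
        _ ≤ 8 * (n : ℝ) ^ ε := by gcongr
        _ ≤ _ := by gcongr; exact Nat.le_ceil _
    exact_mod_cast this

/-- Annotation programs with a constant number of steps have fully scalable implementations with
constantly many rounds and linear total space. -/
theorem exists_mpc_annotate {ε : ℝ} (hε : 0 < ε) (hε1 : ε < 1) (L q o a : ℕ) :
    ∃ R K : ℕ, ∀ n : ℕ, 1 ≤ n → ∀ (len : ℕ → ℕ) (steps : ℕ → SumStep)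
      (outRec : List ℕ → List (List ℕ)), ∃ P : MPCProgram,
      (P.s : ℝ) ≤ K * (n : ℝ) ^ ε ∧ P.p * P.s ≤ K * n ∧
      ∀ (m : ℕ) (inp : Fin m → List (List ℕ)), m * ⌈(n : ℝ) ^ ε⌉₊ ≤ L * n →
      (∀ i, (inp i).flatten.length ≤ L * ⌈(n : ℝ) ^ ε⌉₊) →
      ∀ D : Multiset (List ℕ), D = ∑ i, (inp i : Multiset (List ℕ)) →
      (∀ r ∈ D, HasLength len r ∧ r.length ≤ 5 ∧ ∀ w ∈ annotate steps D q r, w < (n + 1) ^ a) →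
      (∀ r ∈ D, (outRec (annotate steps D q r)).flatten.length ≤ o ∧
        ∀ w ∈ (outRec (annotate steps D q r)).flatten, w < (n + 1) ^ a) →
      m ≤ P.p ∧ P.Respects ((P.p * P.s + 2) ^ K) R (P.load inp) ∧
      ∃ out : Fin P.p → List (List ℕ),
        (∀ i, P.mem (P.load inp) R i = (out i).flatten) ∧
        ∑ i, (out i : Multiset (List ℕ)) = D.bind (fun r => (outRec (annotate steps D q r) :)) := by
  obtain ⟨k, hside⟩ := exists_side ε hε
  -- Write E for ⌈n^ε⌉. Each of the m input machines reserves room for L * E + 1 records, altogether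
  -- at most (L * L + L) * n; this must be at most N / 2, and N ≥ C * n. The constant G bounds the
  -- block size, b^3 ≤ 8 * C^3 * E, as well as the reserve L * E + 1 ≤ (L + 1) * E.
  obtain ⟨C, hC⟩ : ∃ x, x = 2 * (L * L + L) + 2 := ⟨_, rfl⟩
  obtain ⟨G, hG⟩ : ∃ x, x = 8 * C ^ 3 + L + 1 := ⟨_, rfl⟩
  obtain ⟨K1, hK1⟩ : ∃ x, x = 2 * (o + 1) * (C ^ (k + 3) * 2 ^ (k + 3)) + 2 * G * (o + 1) + 2 * G * (o + 1) * L := ⟨_, rfl⟩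
  obtain ⟨K2, hK2⟩ : ∃ x, x = 4 * G * (o + 1) := ⟨_, rfl⟩
  obtain ⟨K3, hK3⟩ : ∃ x, x = 1 + (a * (5 + q) + 1 + 1 + (a + a)) := ⟨_, rfl⟩
  refine ⟨q * (sumDepth k + sumDepth k) + 2, K1 + K2 + K3, fun n hn len steps outRec => ?_⟩
  obtain ⟨t, ht1, ht2, ht3, ht4⟩ := hside n hn
  have hn1 : (1 : ℝ) ≤ n := by exact_mod_cast hn
  have hnε : (1 : ℝ) ≤ (n : ℝ) ^ ε := Real.one_le_rpow hn1 hε.le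
  have hE1 : 1 ≤ ⌈(n : ℝ) ^ ε⌉₊ := Nat.one_le_ceil_iff.2 (by linarith)
  have hE2 : (⌈(n : ℝ) ^ ε⌉₊ : ℝ) ≤ 2 * (n : ℝ) ^ ε := nat_ceil_le_two_mul hnε
  have hEn : ⌈(n : ℝ) ^ ε⌉₊ ≤ n := by
    refine Nat.ceil_le.2 ?_
    calc (n : ℝ) ^ ε ≤ (n : ℝ) ^ (1 : ℝ) := Real.rpow_le_rpow_of_exponent_le hn1 hε1.le
      _ = n := Real.rpow_one _
  generalize hE : ⌈(n : ℝ) ^ ε⌉₊ = E at *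
  obtain ⟨b, hb⟩ : ∃ x, x = C * t := ⟨_, rfl⟩
  obtain ⟨N, hN⟩ : ∃ x, x = b ^ (k + 3) := ⟨_, rfl⟩
  have hC2 : 2 ≤ C := by omega
  have hb2 : 2 ≤ b := by
    calc 2 = 2 * 1 := rfl
      _ ≤ C * t := Nat.mul_le_mul hC2 ht1
      _ = b := hb.symm
  have hNlow : C * n ≤ N := by
    rw [hN, hb, mul_pow]
    refine Nat.mul_le_mul (Nat.le_self_pow (by omega) C) ht2
  have hNup : N ≤ C ^ (k + 3) * 2 ^ (k + 3) * n := by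
    rw [hN, hb, mul_pow, mul_assoc]
    exact Nat.mul_le_mul_left _ ht3
  have hb3 : b ^ 3 ≤ G * E := by
    calc b ^ 3 = C ^ 3 * t ^ 3 := by rw [hb, mul_pow]
      _ ≤ C ^ 3 * (8 * E) := Nat.mul_le_mul_left _ ht4
      _ = 8 * C ^ 3 * E := by ring
      _ ≤ G * E := Nat.mul_le_mul_right _ (by omega)
  -- A bin has at most Qm + b^3 ≤ 2 * Qm slots, and a slot may yield o output words; this explains
  -- s. The last summand L * n / E of p makes room for all m input machines.
  obtain ⟨Qm, hQm⟩ : ∃ x, x = G * E := ⟨_, rfl⟩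
  have hQm0 : 0 < Qm := hQm ▸ Nat.mul_pos (by omega) hE1
  obtain ⟨s, hs⟩ : ∃ x, x = 2 * (o + 1) * Qm := ⟨_, rfl⟩
  obtain ⟨p, hp⟩ : ∃ x, x = N / Qm + 1 + L * n / E := ⟨_, rfl⟩
  have hps : p * s ≤ K1 * n := by
    have h1 : N / Qm * s ≤ 2 * (o + 1) * N := by
      calc N / Qm * s = 2 * (o + 1) * (N / Qm * Qm) := by rw [hs]; ring
        _ ≤ _ := Nat.mul_le_mul_left _ (Nat.div_mul_le_self _ _)
    have h2 : s ≤ 2 * G * (o + 1) * n := by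
      calc s = 2 * G * (o + 1) * E := by rw [hs, hQm]; ring
        _ ≤ _ := Nat.mul_le_mul_left _ hEn
    have h3 : L * n / E * s ≤ 2 * G * (o + 1) * (L * n) := by
      calc L * n / E * s = 2 * G * (o + 1) * (L * n / E * E) := by rw [hs, hQm]; ring
        _ ≤ _ := Nat.mul_le_mul_left _ (Nat.div_mul_le_self _ _)
    calc p * s = N / Qm * s + s + L * n / E * s := by rw [hp]; ring
      _ ≤ 2 * (o + 1) * (C ^ (k + 3) * 2 ^ (k + 3) * n) + 2 * G * (o + 1) * n +
          2 * G * (o + 1) * (L * n) :=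
        Nat.add_le_add (Nat.add_le_add (h1.trans (Nat.mul_le_mul_left _ hNup)) h2) h3
      _ = K1 * n := by rw [hK1]; ring
  have hsr : (s : ℝ) ≤ K2 * (n : ℝ) ^ ε := by
    have : (s : ℝ) = 2 * G * (o + 1) * (E : ℝ) := by rw [hs, hQm]; push_cast; ring
    rw [this, hK2]
    push_cast
    calc 2 * (G : ℝ) * (o + 1) * E ≤ 2 * G * (o + 1) * (2 * (n : ℝ) ^ ε) := by gcongr
      _ = _ := by ring
  obtain ⟨X, hX⟩ : ∃ x, x = p * s + 2 := ⟨_, rfl⟩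
  have hNX : N ≤ X := by
    have h1 : N < Qm * (N / Qm + 1) := Nat.lt_mul_div_succ N hQm0
    have h2 : Qm * (N / Qm + 1) ≤ p * s := by
      rw [mul_comm]
      refine Nat.mul_le_mul (by rw [hp]; exact Nat.le_add_right _ _) ?_
      rw [hs]
      exact Nat.le_mul_of_pos_left _ (by omega)
    omega
  have hnX : n + 1 ≤ X := by
    have h1 : 2 * n ≤ C * n := Nat.mul_le_mul_right _ hC2
    omega
  have hX2 : 2 ≤ X := by omega
  have hQX : (n + 1) ^ a ≤ X ^ a := Nat.pow_le_pow_left hnX a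
  -- The number of pairs of a slot and a content is polynomial in n, hence at most a fixed power of
  -- X = p * s + 2.
  have hWX : N * ((((n + 1) ^ a) ^ (5 + q) + 1) * N * ((n + 1) ^ a * (n + 1) ^ a)) ≤
      X ^ (K1 + K2 + K3) := by
    have h1 : ((n + 1) ^ a) ^ (5 + q) + 1 ≤ X ^ (a * (5 + q) + 1) := by
      calc ((n + 1) ^ a) ^ (5 + q) + 1 ≤ X ^ (a * (5 + q)) + X ^ (a * (5 + q)) := by
            refine Nat.add_le_add ?_ (Nat.one_le_pow _ _ (by omega))
            rw [pow_mul]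
            exact Nat.pow_le_pow_left hQX _
        _ = X ^ (a * (5 + q)) * 2 := by ring
        _ ≤ X ^ (a * (5 + q)) * X := Nat.mul_le_mul_left _ hX2
        _ = _ := by rw [pow_succ]
    calc _ ≤ X * (X ^ (a * (5 + q) + 1) * X * (X ^ a * X ^ a)) :=
          Nat.mul_le_mul hNX (Nat.mul_le_mul (Nat.mul_le_mul h1 hNX) (Nat.mul_le_mul hQX hQX))
      _ = X ^ K3 := by rw [hK3]; ring
      _ ≤ _ := Nat.pow_le_pow_right (by omega) (by omega)
  have hQW : (n + 1) ^ a ≤ X ^ (K1 + K2 + K3) :=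
    hQX.trans (Nat.pow_le_pow_right (by omega) (by omega))
  have hs2 : Qm + b ^ 3 ≤ 2 * Qm := by rw [← hQm] at hb3; omega
  obtain ⟨P, hPp, hPs, hP⟩ := exists_program_annotate (b := b) (k := k) (N := N) (p := p) (s := s)
    (Qm := Qm) (S := L * E + 1) (o := o) (W := X ^ (K1 + K2 + K3)) (Q := (n + 1) ^ a) (q := q)
    hb2 hN hQm0
    (hp ▸ (Nat.lt_succ_self _).trans_le (Nat.le_add_right _ _)) (by
      refine hs2.trans ?_
      rw [hs]
      exact Nat.mul_le_mul_right _ (by omega)) (by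
      calc (Qm + b ^ 3) * o ≤ 2 * Qm * o := Nat.mul_le_mul_right _ hs2
        _ ≤ 2 * Qm * (o + 1) := Nat.mul_le_mul_left _ (by omega)
        _ = s := by rw [hs]; ring)
    (Nat.pow_pos (by omega)) hWX hQW (by omega) (by
      have h1 : (L + 1) * E ≤ G * E := Nat.mul_le_mul_right _ (by omega)
      have h2 : Qm ≤ s := by rw [hs]; exact Nat.le_mul_of_pos_left _ (by omega)
      rw [add_mul] at h1
      rw [hQm] at h2
      omega) len steps outRec
  refine ⟨P, ?_, ?_, ?_⟩
  · rw [hPs]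
    refine hsr.trans ?_
    have : (K2 : ℝ) ≤ ((K1 + K2 + K3 : ℕ) : ℝ) := by exact_mod_cast (by omega)
    gcongr
  · rw [hPp, hPs]
    exact hps.trans (Nat.mul_le_mul_right _ (by omega))
  · intro m inp hm hlen D hD hrec hout
    have hmE : m ≤ L * n / E := (Nat.le_div_iff_mul_le hE1).2 hm
    have hmn : m ≤ L * n := hmE.trans (Nat.div_le_self _ _)
    have hmp : m ≤ p := by rw [hp]; exact hmE.trans (Nat.le_add_left _ _)
    refine ⟨hPp ▸ hmp, ?_⟩
    have hX' : P.p * P.s + 2 = X := by rw [hPp, hPs, hX]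
    rw [hX']
    refine hP m inp hmp ?_ (fun i => Nat.lt_succ_of_le (hlen i)) D hD hrec
      (fun r hr => ⟨(hout r hr).1, fun w hw => ((hout r hr).2 w hw).trans_le hQW⟩)
    rw [Nat.le_div_iff_mul_le (by norm_num)]
    calc m * (L * E + 1) * 2 = 2 * (L * (m * E) + m) := by ring
      _ ≤ 2 * (L * (L * n) + L * n) :=
        Nat.mul_le_mul_left _ (Nat.add_le_add (Nat.mul_le_mul_left _ hm) hmn)
      _ = 2 * (L * L + L) * n := by ring
      _ ≤ C * n := Nat.mul_le_mul_right _ (by omega)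
      _ ≤ N := hNlow

end Parameters

/-! ### Walks as sequences of directed edges -/

section Walk

variable {α : Type u}

/-- The sequence of directed edges leads from `x` to `y`. -/
def IsWalk : α → List (α × α) → α → Prop
  | x, [], y => x = y
  | x, e :: l, y => e.1 = x ∧ IsWalk e.2 l y

theorem isWalk_append {l l' : List (α × α)} {x y : α} :
    IsWalk x (l ++ l') y ↔ ∃ z, IsWalk x l z ∧ IsWalk z l' y := by
  induction l generalizing x with
  | nil => simp [IsWalk]
  | cons e l ih => simp [IsWalk, ih, and_assoc]

theorem isWalk_iff_of_ne_nil : ∀ {l : List (α × α)} {x y : α} (h : l ≠ []),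
    IsWalk x l y ↔ (l.head h).1 = x ∧
      (∀ (i : ℕ) (hi : i + 1 < l.length), (l[i]).2 = (l[i + 1]).1) ∧ (l.getLast h).2 = y
  | [], _, _, h => absurd rfl h
  | [e], x, y, _ => by simp [IsWalk]
  | e :: e' :: l, x, y, h => by
    have ih := isWalk_iff_of_ne_nil (l := e' :: l) (x := e.2) (y := y) (by simp)
    rw [IsWalk, ih]
    simp only [List.head_cons, List.getLast_cons_cons]
    refine and_congr_right fun _ => ?_
    constructor
    · rintro ⟨h1, h2, h3⟩
      refine ⟨fun i hi => ?_, h3⟩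
      cases i with
      | zero => exact h1.symm
      | succ i => exact h2 i (by simpa using hi)
    · rintro ⟨h2, h3⟩
      exact ⟨(h2 0 (by simp)).symm, fun i hi => h2 (i + 1) (by simpa using hi), h3⟩

/-- The node at which a walk ending at `y` is before its step `i`. -/
def walkAt (l : List (α × α)) (y : α) (i : ℕ) : α := if h : i < l.length then (l[i]).1 else y

theorem IsWalk.take_drop {l : List (α × α)} {x y : α} (h : IsWalk x l y) (i : ℕ) :
    IsWalk x (l.take i) (walkAt l y i) ∧ IsWalk (walkAt l y i) (l.drop i) y := by
  have h' := h
  rw [← List.take_append_drop i l, isWalk_append] at h'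
  obtain ⟨z, h1, h2⟩ := h'
  have hz : z = walkAt l y i := by
    rw [walkAt]
    split_ifs with hi
    · rw [List.drop_eq_getElem_cons hi] at h2
      exact h2.1.symm
    · rw [List.drop_eq_nil_of_le (by omega)] at h2
      exact h2
  exact ⟨hz ▸ h1, hz ▸ h2⟩

theorem walkAt_take {l : List (α × α)} {y : α} {i j : ℕ} (hij : i ≤ j) (hj : j ≤ l.length) :
    walkAt (l.take j) (walkAt l y j) i = walkAt l y i := by
  rw [walkAt]
  split_ifs with h
  · rw [List.length_take] at h
    rw [walkAt, dif_pos (by omega), List.getElem_take]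
  · rw [List.length_take] at h
    have : i = j := by omega
    rw [this]

theorem IsWalk.piece {l : List (α × α)} {x y : α} (h : IsWalk x l y) {i j : ℕ} (hij : i ≤ j)
    (hj : j ≤ l.length) : IsWalk (walkAt l y i) ((l.take j).drop i) (walkAt l y j) := by
  have := ((h.take_drop j).1.take_drop i).2
  rwa [walkAt_take hij hj] at this

theorem IsWalk.rotate {l : List (α × α)} {x : α} (h : IsWalk x l x) (i : ℕ) :
    ∃ y, IsWalk y (l.rotate i) y := by
  rcases Nat.lt_or_ge i l.length with hi | hi
  · rw [List.rotate_eq_drop_append_take hi.le]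
    exact ⟨_, isWalk_append.2 ⟨x, (h.take_drop i).2, (h.take_drop i).1⟩⟩
  · rw [← List.rotate_mod]
    rcases Nat.eq_zero_or_pos l.length with h0 | h0
    · rw [List.length_eq_zero_iff.1 h0]; exact ⟨x, by simp [IsWalk]⟩
    · rw [List.rotate_eq_drop_append_take (Nat.mod_lt _ h0).le]
      exact ⟨_, isWalk_append.2 ⟨x, (h.take_drop _).2, (h.take_drop _).1⟩⟩

theorem IsWalk.startsAt_unique {l : List (α × α)} {x y : α} (h : IsWalk x l x) (hy : StartsAt l y) :
    IsWalk y l y := by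
  cases l with
  | nil => rfl
  | cons e l =>
    have h1 : e.1 = y := hy e (by simp)
    obtain rfl : x = y := h.1.symm.trans h1
    exact h

theorem IsWalk.map {β : Type u} (f : α → β) {l : List (α × α)} {x y : α} (h : IsWalk x l y) :
    IsWalk (f x) (l.map (Prod.map f f)) (f y) := by
  induction l generalizing x with
  | nil => exact congrArg f h
  | cons e l ih => exact ⟨congrArg f h.1, ih h.2⟩

end Walk

/-! ### Euler tours -/

section EntryIdx

variable {α : Type u} [DecidableEq α] {B : List (α × α)}

/-- The position of the first occurrence of the directed edge `e`. -/
def entryIdx (B : List (α × α)) (e : α × α) : ℕ := B.findIdx (fun d => decide (d = e))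

theorem entryIdx_lt_length {e : α × α} (h : e ∈ B) : entryIdx B e < B.length :=
  List.findIdx_lt_length_of_exists ⟨_, h, by simp⟩

theorem getElem_entryIdx {e : α × α} (h : entryIdx B e < B.length) : B[entryIdx B e] = e := by
  have := List.findIdx_getElem (p := fun d : α × α => decide (d = e)) (xs := B) (w := h)
  exact of_decide_eq_true this

theorem entryIdx_getElem (hB : B.Nodup) {i : ℕ} (hi : i < B.length) : entryIdx B B[i] = i := by
  have h := entryIdx_lt_length (List.getElem_mem hi)
  exact List.nodup_iff_injective_getElem.1 hB
    (a₁ := ⟨_, h⟩) (a₂ := ⟨i, hi⟩) (getElem_entryIdx h) |> congrArg Fin.val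

end EntryIdx

section EulerTour

variable {α : Type u} {G : SimpleGraph α} {B : List (α × α)}

theorem IsEulerTour.mem_iff (h : IsEulerTour G B) {x y : α} : (x, y) ∈ B ↔ G.Adj x y := by
  constructor
  · exact fun hm => h.adj _ hm
  · intro hxy
    obtain ⟨i, hi, -⟩ := h.once x y hxy
    exact hi ▸ List.get_mem B i

theorem IsEulerTour.nodup (h : IsEulerTour G B) : B.Nodup := by
  rw [List.nodup_iff_injective_get]
  intro i j hij
  obtain ⟨k, -, hk⟩ := h.once (B.get i).1 (B.get i).2 (h.adj _ (List.get_mem B i))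
  rw [hk i rfl, hk j (by simp only [hij])]

theorem IsEulerTour.getElem_succ (h : IsEulerTour G B) {i : ℕ} (hi : i + 1 < B.length) :
    (B[i]).2 = (B[i + 1]).1 := by
  have := h.cyclic i (by omega)
  simp only [Nat.mod_eq_of_lt hi] at this
  exact this

theorem IsEulerTour.exists_isWalk [Nonempty α] (h : IsEulerTour G B) : ∃ x, IsWalk x B x := by
  by_cases hB : B = []
  · exact ⟨Classical.arbitrary α, by rw [hB]; rfl⟩
  · refine ⟨(B.head hB).1, (isWalk_iff_of_ne_nil hB).2 ⟨rfl, fun i hi => h.getElem_succ hi, ?_⟩⟩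
    have hl : 0 < B.length := List.length_pos_iff.2 hB
    have := h.cyclic (B.length - 1) (by omega)
    have e : (B.length - 1 + 1) % B.length = 0 := by
      rw [Nat.sub_add_cancel hl, Nat.mod_self]
    simp only [e] at this
    rw [List.getLast_eq_getElem, this, List.head_eq_getElem]

theorem IsEulerTour.isWalk [Nonempty α] (h : IsEulerTour G B) {x : α} (hx : StartsAt B x) :
    IsWalk x B x := by
  obtain ⟨y, hy⟩ := h.exists_isWalk
  exact hy.startsAt_unique hx

theorem card_adj_pairs [Fintype α] (hG : G.IsTree) (S : Finset (α × α))
    (hS : ∀ e, e ∈ S ↔ G.Adj e.1 e.2) : S.card = 2 * Nat.card α - 2 := by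
  classical
  have h1 : S.card = Fintype.card G.Dart := by
    rw [← Finset.card_univ]
    symm
    refine Finset.card_bij (fun d _ => d.toProd) ?_ ?_ ?_
    · intro d _; exact (hS _).2 d.adj
    · intro d _ d' _ hd; exact SimpleGraph.Dart.ext _ _ hd
    · intro e he; exact ⟨⟨e, (hS e).1 he⟩, Finset.mem_univ _, rfl⟩
  rw [h1, SimpleGraph.dart_card_eq_twice_card_edges, Nat.card_eq_fintype_card]
  have := hG.card_edgeFinset
  omega

/-- The length condition is automatic: a tree has 2 * |V| − 2 directed edges, and a list without
repetitions of exactly these has that length. Closedness of the walk supplies the cyclic condition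
at the last entry. -/
theorem isEulerTour_of_isWalk [Fintype α] (hG : G.IsTree) (hnd : B.Nodup)
    (hmem : ∀ x y, (x, y) ∈ B ↔ G.Adj x y) {v : α} (hw : IsWalk v B v) : IsEulerTour G B := by
  classical
  refine ⟨?_, fun e he => (hmem _ _).1 he, fun i hi => ?_, fun x y hxy => ?_⟩
  · rw [← List.toFinset_card_of_nodup hnd]
    exact card_adj_pairs hG _ fun e => by rw [List.mem_toFinset]; exact hmem e.1 e.2
  · have hB : B ≠ [] := by rintro rfl; simp at hi
    obtain ⟨h1, h2, h3⟩ := (isWalk_iff_of_ne_nil hB).1 hw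
    by_cases hi' : i + 1 < B.length
    · simp only [Nat.mod_eq_of_lt hi']
      exact h2 i hi'
    · have e : i + 1 = B.length := by omega
      have e' : (i + 1) % B.length = 0 := by rw [e, Nat.mod_self]
      simp only [e']
      rw [← List.head_eq_getElem hB, h1, ← h3, List.getLast_eq_getElem]
      congr 2
      omega
  · obtain ⟨i, hi, hie⟩ := List.getElem_of_mem ((hmem x y).2 hxy)
    refine ⟨⟨i, hi⟩, hie, fun j hj => ?_⟩
    exact List.nodup_iff_injective_get.1 hnd (hj.trans hie.symm)

end EulerTour

/-! ### Rooted trees -/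

/-- `par` is the parent map of the tree `T` with the given root. -/
structure IsParentMap {κ : Type u} (T : SimpleGraph κ) (root : κ) (par : κ → κ) : Prop where
  root_eq : par root = root
  adj : ∀ c, c ≠ root → T.Adj c (par c)
  dist : ∀ c, c ≠ root → T.dist root c = T.dist root (par c) + 1

/-- `x` is a descendant of `c`. -/
def IsDesc {κ : Type u} (par : κ → κ) (c x : κ) : Prop := ∃ k, par^[k] x = c

section Rooted

variable {κ : Type u} {T : SimpleGraph κ} {root : κ} {par : κ → κ}

/-- The parent of c is the second node of a shortest walk from c to the root. -/
theorem exists_isParentMap (hT : T.IsTree) (root : κ) : ∃ par, IsParentMap T root par := by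
  have h : ∀ c, ∃ d, c ≠ root → T.Adj c d ∧ T.dist root c = T.dist root d + 1 := by
    intro c
    by_cases hc : c = root
    · exact ⟨c, fun h => absurd hc h⟩
    · obtain ⟨w, hw⟩ := (hT.connected.preconnected c root).exists_walk_length_eq_dist
      cases w with
      | nil => exact absurd rfl hc
      | cons hadj w =>
        rename_i d
        refine ⟨d, fun _ => ⟨hadj, ?_⟩⟩
        simp only [SimpleGraph.Walk.length_cons] at hw
        have h1 : T.dist d root ≤ w.length := SimpleGraph.dist_le w
        have h2 := hT.connected.dist_triangle (u := c) (v := d) (w := root)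
        have h3 : T.dist c d = 1 := SimpleGraph.dist_eq_one_iff_adj.2 hadj
        rw [SimpleGraph.dist_comm (u := root) (v := c), SimpleGraph.dist_comm (u := root) (v := d)]
        omega
  classical
  choose f hf using h
  refine ⟨fun c => if c = root then root else f c, if_pos rfl, fun c hc => ?_, fun c hc => ?_⟩
  · simp only [if_neg hc]; exact (hf c hc).1
  · simp only [if_neg hc]; exact (hf c hc).2

theorem IsDesc.refl (c : κ) : IsDesc par c c := ⟨0, rfl⟩

theorem IsDesc.of_par {c x : κ} (h : IsDesc par c (par x)) : IsDesc par c x := by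
  obtain ⟨k, hk⟩ := h
  exact ⟨k + 1, hk⟩

theorem IsDesc.to_par {c x : κ} (h : IsDesc par c x) (hne : x ≠ c) : IsDesc par c (par x) := by
  obtain ⟨k, hk⟩ := h
  cases k with
  | zero => exact absurd hk hne
  | succ k => exact ⟨k, hk⟩

theorem IsDesc.trans {a c x : κ} (h : IsDesc par a c) (h' : IsDesc par c x) : IsDesc par a x := by
  obtain ⟨k, rfl⟩ := h
  obtain ⟨l, rfl⟩ := h'
  exact ⟨k + l, Function.iterate_add_apply par k l x⟩

namespace IsParentMap

variable (hp : IsParentMap T root par)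
include hp

theorem isDesc_root_iff {c : κ} : IsDesc par c root ↔ c = root := by
  constructor
  · rintro ⟨k, rfl⟩
    exact Function.iterate_fixed hp.root_eq k
  · rintro rfl
    exact IsDesc.refl _

theorem dist_le {c x : κ} (h : IsDesc par c x) : T.dist root c ≤ T.dist root x := by
  obtain ⟨k, rfl⟩ := h
  induction k with
  | zero => exact le_rfl
  | succ k ih =>
    rw [Function.iterate_succ_apply']
    refine le_trans ?_ ih
    by_cases h : par^[k] x = root
    · rw [h, hp.root_eq]
    · have := hp.dist _ h; omega

theorem isDesc_root (x : κ) : IsDesc par root x := by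
  induction hd : T.dist root x using Nat.strong_induction_on generalizing x with
  | _ n ih =>
    by_cases h : x = root
    · rw [h]; exact IsDesc.refl _
    · refine IsDesc.of_par (ih (T.dist root (par x)) ?_ (par x) rfl)
      have := hp.dist x h; omega

theorem not_isDesc_par {r : κ} (hr : r ≠ root) : ¬ IsDesc par r (par r) := by
  intro h
  have h1 := hp.dist_le h
  have h2 := hp.dist r hr
  omega

theorem not_isDesc_sibling {a b : κ} (ha : a ≠ root) (hab : a ≠ b) (h : par a = par b) :
    ¬ IsDesc par a b := fun hd => hp.not_isDesc_par ha (h ▸ hd.to_par hab.symm)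

theorem par_ne {c : κ} (hc : c ≠ root) : par c ≠ c := (hp.adj c hc).ne'

/-- Every edge joins a node to its parent. -/
theorem adj_cases [Fintype κ] (hT : T.IsTree) {x y : κ} (h : T.Adj x y) :
    (x ≠ root ∧ par x = y) ∨ (y ≠ root ∧ par y = x) := by
  classical
  -- The edges s(c, par c) with c ≠ root are distinct, since otherwise two nodes would each be
  -- farther from the root than the other. There are as many of them as T has edges, so they exhaust
  -- T.
  let f : κ → Sym2 κ := fun c => s(c, par c)
  have hinj : Set.InjOn f (Finset.univ.erase root : Finset κ) := by
    intro a ha b hb hab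
    have ha : a ≠ root := by simpa using ha
    have hb : b ≠ root := by simpa using hb
    simp only [f, Sym2.eq_iff] at hab
    rcases hab with ⟨h1, -⟩ | ⟨h1, h2⟩
    · exact h1
    · have d1 := hp.dist a ha
      have d2 := hp.dist b hb
      rw [h2] at d1
      rw [← h1] at d2
      omega
  have himg : (Finset.univ.erase root).image f = T.edgeFinset := by
    refine Finset.eq_of_subset_of_card_le ?_ ?_
    · intro e he
      obtain ⟨c, hc, rfl⟩ := Finset.mem_image.1 he
      rw [SimpleGraph.mem_edgeFinset]
      exact hp.adj c (by simpa using hc)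
    · rw [Finset.card_image_of_injOn hinj, Finset.card_erase_of_mem (Finset.mem_univ _),
        Finset.card_univ]
      have := hT.card_edgeFinset
      omega
  have hm : s(x, y) ∈ T.edgeFinset := by rw [SimpleGraph.mem_edgeFinset]; exact h
  rw [← himg] at hm
  obtain ⟨c, hc, hce⟩ := Finset.mem_image.1 hm
  have hc : c ≠ root := by simpa using hc
  simp only [f, Sym2.eq_iff] at hce
  rcases hce with ⟨rfl, h2⟩ | ⟨rfl, h2⟩
  · exact Or.inl ⟨hc, h2⟩
  · exact Or.inr ⟨hc, h2⟩

variable [Fintype κ] [DecidableEq κ] {B : List (κ × κ)} (hT : T.IsTree) (hB : IsEulerTour T B)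
  (hs : StartsAt B root)
include hT hB hs

/-- An Euler tour from the root visits the descendants of a node `c` exactly between its two passes
through the edge from `c` to the parent of `c`. -/
theorem source_isDesc_iff {c : κ} (hc : c ≠ root) {t : ℕ} (ht : t < B.length) :
    IsDesc par c (B[t]).1 ↔ entryIdx B (par c, c) < t ∧ t ≤ entryIdx B (c, par c) := by
  have hU : entryIdx B (c, par c) < B.length :=
    entryIdx_lt_length (hB.mem_iff.2 (hp.adj c hc))
  have hUe : B[entryIdx B (c, par c)] = (c, par c) := getElem_entryIdx hU
  -- The tour starts at the root, outside the subtree of c. Being inside changes only along the edge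
  -- between c and its parent, and each direction is used once.
  induction t using Nat.strong_induction_on with
  | _ t ih =>
    cases t with
    | zero =>
      have h0 : (B[0]).1 = root := hs _ (by rw [List.head?_eq_getElem?]; simp [ht])
      rw [h0, hp.isDesc_root_iff]
      exact ⟨fun h => absurd h hc, fun h => absurd h.1 (Nat.not_lt_zero _)⟩
    | succ t =>
      have ht' : t < B.length := by omega
      have iht := ih t (Nat.lt_succ_self t) ht'
      rw [← hB.getElem_succ ht]
      have hadj := hB.adj _ (List.getElem_mem ht')
      have hidx : ∀ e, B[t] = e → entryIdx B e = t := fun e he => by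
        rw [← he]; exact entryIdx_getElem hB.nodup ht'
      have hidx' : ∀ e, e ∈ B → entryIdx B e = t → B[t] = e := fun e hm he => by
        have := getElem_entryIdx (entryIdx_lt_length hm)
        simpa only [he] using this
      by_cases hin : IsDesc par c (B[t]).1
      · have hr := iht.1 hin
        by_cases hout : IsDesc par c (B[t]).2
        · refine iff_of_true hout ⟨by omega, ?_⟩
          rcases Nat.lt_or_ge t (entryIdx B (c, par c)) with h | h
          · exact h
          · have := hidx' _ (hB.mem_iff.2 (hp.adj c hc)) (by omega : _ = t)
            rw [this] at hout
            exact absurd hout (hp.not_isDesc_par hc)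
        · refine iff_of_false hout fun h => ?_
          rcases hp.adj_cases hT hadj with ⟨h1, h2⟩ | ⟨h1, h2⟩
          · have h3 : (B[t]).1 = c := by
              by_contra hne
              exact hout (h2 ▸ hin.to_par hne)
            have := hidx (c, par c) (Prod.ext h3 (by rw [← h2, h3]))
            omega
          · rw [← h2] at hin
            exact hout hin.of_par
      · have hr : ¬ (entryIdx B (par c, c) < t ∧ t ≤ entryIdx B (c, par c)) := fun h => hin (iht.2 h)
        by_cases hout : IsDesc par c (B[t]).2
        · refine iff_of_true hout ?_
          have hD : entryIdx B (par c, c) = t := by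
            rcases hp.adj_cases hT hadj with ⟨h1, h2⟩ | ⟨h1, h2⟩
            · rw [← h2] at hout
              exact absurd hout.of_par hin
            · have h3 : (B[t]).2 = c := by
                by_contra hne
                exact hin (h2 ▸ hout.to_par hne)
              exact hidx (par c, c) (Prod.ext (by rw [← h2, h3]) h3)
          refine ⟨by omega, ?_⟩
          by_contra hcon
          -- An earlier upward pass is impossible: its source is c, so the induction hypothesis at
          -- that position would place it after the downward pass.
          rcases Nat.lt_or_ge (entryIdx B (c, par c)) t with h | h
          · have := (ih _ (by omega) hU).1 (by rw [hUe]; exact IsDesc.refl c)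
            omega
          · have h4 : entryIdx B (c, par c) = t := by omega
            have h5 := hidx' _ (hB.mem_iff.2 (hp.adj c hc)) h4
            have h6 := hidx' _ (hB.mem_iff.2 (hp.adj c hc).symm) hD
            rw [h5] at h6
            exact hp.par_ne hc (congrArg Prod.fst h6).symm
        · refine iff_of_false hout fun h => ?_
          have hD : entryIdx B (par c, c) = t := by omega
          have h6 := hidx' _ (hB.mem_iff.2 (hp.adj c hc).symm) hD
          exact hout (by rw [h6]; exact IsDesc.refl c)

theorem idxOf_down_lt_up {c : κ} (hc : c ≠ root) : entryIdx B (par c, c) < entryIdx B (c, par c) := by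
  have hU : entryIdx B (c, par c) < B.length :=
    entryIdx_lt_length (hB.mem_iff.2 (hp.adj c hc))
  have hUe : B[entryIdx B (c, par c)] = (c, par c) := getElem_entryIdx hU
  exact ((hp.source_isDesc_iff hT hB hs hc hU).1 (by rw [hUe]; exact IsDesc.refl c)).1

theorem target_isDesc_iff {c : κ} (hc : c ≠ root) {t : ℕ} (ht : t < B.length) :
    IsDesc par c (B[t]).2 ↔ entryIdx B (par c, c) ≤ t ∧ t < entryIdx B (c, par c) := by
  have hU : entryIdx B (c, par c) < B.length :=
    entryIdx_lt_length (hB.mem_iff.2 (hp.adj c hc))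
  by_cases h : t + 1 < B.length
  · rw [hB.getElem_succ h, hp.source_isDesc_iff hT hB hs hc h]
    omega
  · have h1 : (B[t]).2 = root := by
      have hw := @IsEulerTour.isWalk _ _ _ ⟨root⟩ hB _ hs
      have hne : B ≠ [] := by rintro rfl; simp at ht
      have := ((isWalk_iff_of_ne_nil hne).1 hw).2.2
      rw [List.getLast_eq_getElem] at this
      have e : B.length - 1 = t := by omega
      simpa only [e] using this
    rw [h1, hp.isDesc_root_iff]
    exact ⟨fun h => absurd h hc, fun h => by omega⟩

/-- The sibling b is not a descendant of a, so the entry into b lies outside the interval between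
the two passes through the edge above a. -/
theorem idxOf_up_lt_down {a b : κ} (ha : a ≠ root) (hb : b ≠ root) (hab : par a = par b)
    (h : entryIdx B (par a, a) < entryIdx B (par b, b)) :
    entryIdx B (a, par a) < entryIdx B (par b, b) := by
  have hne : a ≠ b := by rintro rfl; omega
  have hD : entryIdx B (par b, b) < B.length :=
    entryIdx_lt_length (hB.mem_iff.2 (hp.adj b hb).symm)
  have hDe : B[entryIdx B (par b, b)] = (par b, b) := getElem_entryIdx hD
  have h1 := (hp.target_isDesc_iff hT hB hs ha hD).not.1 (by
    rw [hDe]; exact hp.not_isDesc_sibling ha hne hab)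
  have h2 : entryIdx B (a, par a) ≠ entryIdx B (par b, b) := by
    intro h3
    have h4 : B[entryIdx B (a, par a)]'(h3 ▸ hD) = (a, par a) := getElem_entryIdx _
    simp only [h3, hDe, Prod.mk.injEq] at h4
    exact hp.par_ne ha (hab.trans h4.1)
  omega

/-- Every departure from a has a descendant of a as its source, hence comes after the entry into a
from its parent, and the very next entry is such a departure. -/
theorem firstPos_eq {a : κ} (ha : a ≠ root) : firstPos B a = entryIdx B (par a, a) + 1 := by
  have hlt := hp.idxOf_down_lt_up hT hB hs ha
  have hU : entryIdx B (a, par a) < B.length :=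
    entryIdx_lt_length (hB.mem_iff.2 (hp.adj a ha))
  have hD : entryIdx B (par a, a) < B.length := by omega
  have hDe : B[entryIdx B (par a, a)] = (par a, a) := getElem_entryIdx hD
  rw [firstPos, List.findIdx_eq (by omega)]
  constructor
  · rw [← hB.getElem_succ (by omega), hDe]
    simp
  · intro j hj
    simp only [decide_eq_false_iff_not]
    intro h
    have := (hp.source_isDesc_iff hT hB hs ha (t := j) (by omega)).1 (by rw [h]; exact IsDesc.refl a)
    omega

end IsParentMap

end Rooted

/-! ### The joined tree -/

namespace JoinInstance

section Basic

variable {V : Type u} {I : JoinInstance V}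

theorem mem_tourOn {c : Cluster I.leader} {x y : V} : (x, y) ∈ I.tourOn c ↔
    ∃ (hx : I.leader x = c.1) (hy : I.leader y = c.1), (I.tree c).Adj ⟨x, hx⟩ ⟨y, hy⟩ := by
  rw [JoinInstance.tourOn, List.mem_map]
  constructor
  · rintro ⟨⟨a, b⟩, hm, he⟩
    simp only [Prod.map_apply, Prod.mk.injEq] at he
    obtain ⟨rfl, rfl⟩ := he
    exact ⟨a.2, b.2, (I.tour_isEulerTour c).mem_iff.1 hm⟩
  · rintro ⟨hx, hy, h⟩
    exact ⟨(⟨x, hx⟩, ⟨y, hy⟩), (I.tour_isEulerTour c).mem_iff.2 h, rfl⟩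

theorem nodup_tourOn (c : Cluster I.leader) : (I.tourOn c).Nodup :=
  (I.tour_isEulerTour c).nodup.map 
    (Function.Injective.prodMap Subtype.val_injective Subtype.val_injective)

theorem exists_isWalk_tourOn (c : Cluster I.leader) : ∃ x, IsWalk x (I.tourOn c) x := by
  have : Nonempty (Members I.leader c) := ⟨⟨c.1, c.2⟩⟩
  obtain ⟨x, hx⟩ := (I.tour_isEulerTour c).exists_isWalk
  exact ⟨_, hx.map Subtype.val⟩

theorem clusterOf_eq {x : V} {c : Cluster I.leader} (h : I.leader x = c.1) : I.clusterOf x = c :=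
  Subtype.ext h

end Basic

variable {V : Type u} (I : JoinInstance V)

theorem g_fst_ne_snd {a b : Cluster I.leader} (h : I.T.Adj a b) : (I.g a b).1 ≠ (I.g a b).2 := by
  intro he
  have h1 := (I.g_mem a b h).1
  rw [he, (I.g_mem a b h).2] at h1
  exact h.ne (Subtype.ext h1.symm)

theorem not_isDiag_of_mem {e : Sym2 V} (h : e ∈ I.joinedEdges) : ¬ e.IsDiag := by
  rcases h with ⟨a, b, hab, rfl⟩ | h
  · exact I.g_fst_ne_snd hab
  · simp only [Set.mem_iUnion, Set.mem_image] at h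
    obtain ⟨c, e, he, rfl⟩ := h
    induction e using Sym2.ind with
    | _ x y =>
      simp only [Sym2.map_mk, Sym2.mk_isDiag_iff]
      exact fun h => (I.tree c).ne_of_adj he (Subtype.ext h)

theorem edgeSet_joinedTree : I.joinedTree.edgeSet = I.joinedEdges := by
  rw [joinedTree, SimpleGraph.edgeSet_fromEdgeSet]
  ext e
  exact ⟨fun h => h.1, fun h => ⟨h, I.not_isDiag_of_mem h⟩⟩

theorem joinedTree_adj_iff {x y : V} : I.joinedTree.Adj x y ↔
    (∃ a b, I.T.Adj a b ∧ I.g a b = (x, y)) ∨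
    ∃ c, ∃ (hx : I.leader x = c.1) (hy : I.leader y = c.1), (I.tree c).Adj ⟨x, hx⟩ ⟨y, hy⟩ := by
  rw [← SimpleGraph.mem_edgeSet, edgeSet_joinedTree]
  constructor
  · rintro (⟨a, b, hab, he⟩ | h)
    · left
      rw [Sym2.eq_iff] at he
      rcases he with ⟨rfl, rfl⟩ | ⟨rfl, rfl⟩
      · exact ⟨a, b, hab, rfl⟩
      · exact ⟨b, a, hab.symm, I.g_symm a b hab⟩
    · right
      simp only [Set.mem_iUnion, Set.mem_image] at h
      obtain ⟨c, e, he, hxy⟩ := h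
      induction e using Sym2.ind with
      | _ x' y' =>
        rw [Sym2.map_mk, Sym2.eq_iff] at hxy
        rcases hxy with ⟨rfl, rfl⟩ | ⟨rfl, rfl⟩
        · exact ⟨c, x'.2, y'.2, he⟩
        · exact ⟨c, y'.2, x'.2, SimpleGraph.Adj.symm (G := I.tree c) he⟩
  · rintro (⟨a, b, hab, he⟩ | ⟨c, hx, hy, h⟩)
    · left
      exact ⟨a, b, hab, by rw [he]⟩
    · right
      simp only [Set.mem_iUnion, Set.mem_image]
      exact ⟨c, s(⟨x, hx⟩, ⟨y, hy⟩), h, rfl⟩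

theorem reachable_of_leader_eq {c : Cluster I.leader} {x y : V} (hx : I.leader x = c.1)
    (hy : I.leader y = c.1) : I.joinedTree.Reachable x y := by
  let φ : I.tree c →g I.joinedTree :=
    ⟨Subtype.val, fun {a b} h => I.joinedTree_adj_iff.2 (Or.inr ⟨c, a.2, b.2, h⟩)⟩
  exact ((I.tree_isTree c).connected.preconnected ⟨x, hx⟩ ⟨y, hy⟩).map φ

/-- Walks of T lift: inside a cluster its tree connects any two nodes, and g turns a step of the
walk into an edge between clusters. -/
theorem connected_joinedTree : I.joinedTree.Connected := by
  have key : ∀ (a b : Cluster I.leader), I.T.Walk a b → ∀ x y, I.leader x = a.1 →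
      I.leader y = b.1 → I.joinedTree.Reachable x y := by
    intro a b w
    induction w with
    | nil => intro x y hx hy; exact I.reachable_of_leader_eq hx hy
    | cons h _ ih =>
      rename_i a' b' _ _
      intro x y hx hy
      have hm := I.g_mem _ _ h
      refine (I.reachable_of_leader_eq hx hm.1).trans (SimpleGraph.Reachable.trans ?_
        (ih _ y hm.2 hy))
      exact (I.joinedTree_adj_iff.2 (Or.inl ⟨_, _, h, rfl⟩)).reachable
  obtain ⟨c⟩ := I.T_isTree.connected.nonempty
  have : Nonempty V := ⟨c.1⟩
  refine ⟨fun x y => ?_⟩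
  obtain ⟨w⟩ := I.T_isTree.connected.preconnected (I.clusterOf x) (I.clusterOf y)
  exact key _ _ w x y rfl rfl

theorem sum_card_members [Fintype V] [DecidableEq V] :
    ∑ c : Cluster I.leader, Fintype.card (Members I.leader c) = Fintype.card V := by
  rw [← Fintype.card_sigma]
  exact Fintype.card_congr ⟨fun q => q.2.1, fun v => ⟨I.clusterOf v, v, rfl⟩, fun ⟨c, v, hv⟩ => by
    obtain rfl : c = I.clusterOf v := Subtype.ext hv.symm
    rfl, fun v => rfl⟩

/-- A connected graph has at least |V| − 1 edges. Here there are at most (k − 1) + Σ (|C| − 1) = |V|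
− 1: one for each nonroot cluster, and those of the cluster trees. -/
theorem isTree_joinedTree [Fintype V] [DecidableEq V] : I.joinedTree.IsTree := by
  classical
  rw [SimpleGraph.isTree_iff_connected_and_card]
  refine ⟨I.connected_joinedTree, ?_⟩
  have hge := I.connected_joinedTree.card_vert_le_card_edgeSet_add_one
  refine le_antisymm ?_ hge
  obtain ⟨root⟩ := I.T_isTree.connected.nonempty
  obtain ⟨par, hp⟩ := exists_isParentMap I.T_isTree root
  let f : {c : Cluster I.leader // c ≠ root} ⊕ (Σ c, (I.tree c).edgeSet) → Sym2 V :=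
    Sum.elim (fun c => s((I.g c.1 (par c.1)).1, (I.g c.1 (par c.1)).2))
      (fun q => Sym2.map Subtype.val q.2.1)
  have hsub : I.joinedTree.edgeSet ⊆ Set.range f := by
    rw [edgeSet_joinedTree]
    rintro e (⟨a, b, hab, rfl⟩ | h)
    · rcases hp.adj_cases I.T_isTree hab with ⟨h1, h2⟩ | ⟨h1, h2⟩
      · exact ⟨Sum.inl ⟨a, h1⟩, by simp [f, h2]⟩
      · refine ⟨Sum.inl ⟨b, h1⟩, ?_⟩
        simp only [f, Sum.elim_inl, h2, I.g_symm a b hab]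
        exact Sym2.eq_swap
    · simp only [Set.mem_iUnion, Set.mem_image] at h
      obtain ⟨c, e, he, rfl⟩ := h
      exact ⟨Sum.inr ⟨c, e, he⟩, rfl⟩
  have h1 : Nat.card I.joinedTree.edgeSet ≤
      Nat.card ({c : Cluster I.leader // c ≠ root} ⊕ (Σ c, (I.tree c).edgeSet)) := by
    rw [Nat.card_coe_set_eq]
    refine (Set.ncard_le_ncard hsub (Set.toFinite _)).trans ?_
    rw [← Set.image_univ]
    exact (Set.ncard_image_le (Set.toFinite _)).trans (by rw [Set.ncard_univ])
  have h2 : ∀ c, Fintype.card (I.tree c).edgeSet + 1 = Fintype.card (Members I.leader c) := by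
    intro c
    rw [← (I.tree_isTree c).card_edgeFinset, ← SimpleGraph.edgeFinset_card]
  have h3 := I.sum_card_members
  simp only [← h2, Finset.sum_add_distrib] at h3
  rw [Nat.card_eq_fintype_card (α := _ ⊕ _), Fintype.card_sum, Fintype.card_sigma,
    Fintype.card_subtype_compl, Fintype.card_subtype_eq] at h1
  have h4 : 0 < Fintype.card (Cluster I.leader) := Fintype.card_pos_iff.2 ⟨root⟩
  rw [Nat.card_eq_fintype_card (α := V)]
  simp only [Finset.sum_const, Finset.card_univ, smul_eq_mul, mul_one] at h3
  omega

end JoinInstance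

/-! ### Pieces of a tour and their insertion -/

section Pieces

variable {V : Type u} [DecidableEq V]

theorem firstPos_le_length (L : List (V × V)) (x : V) : firstPos L x ≤ L.length :=
  List.findIdx_le_length

theorem getElem_firstPos {L : List (V × V)} {x : V} (h : firstPos L x < L.length) :
    (L[firstPos L x]).1 = x := by
  have := List.findIdx_getElem (p := fun e : V × V => decide (e.1 = x)) (xs := L) (w := h)
  exact of_decide_eq_true this

theorem firstPos_lt_length {L : List (V × V)} {x y : V} (h : (x, y) ∈ L) :
    firstPos L x < L.length :=
  List.findIdx_lt_length_of_exists ⟨_, h, by simp⟩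

theorem firstPos_eq_zero {L : List (V × V)} {x : V} (h : StartsAt L x) : firstPos L x = 0 := by
  cases L with
  | nil => rfl
  | cons e l => simp [firstPos, List.findIdx_cons, h e (by simp)]

theorem tourPiece_eq {H : Set V} {L : List (V × V)} {x : V} {e : ℕ} (h1 : firstPos L x < e)
    (h2 : e = L.length ∨ ∃ y ∈ H, e = firstPos L y) (h3 : ∀ z ∈ H, firstPos L x < firstPos L z →
      e ≤ firstPos L z) : tourPiece H L x = (L.take e).drop (firstPos L x) := by
  rw [tourPiece]
  congr 2
  refine IsLeast.csInf_eq ⟨⟨h1, h2⟩, fun j hj => ?_⟩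
  obtain ⟨hj1, rfl | ⟨z, hz, rfl⟩⟩ := hj
  · rcases h2 with h | ⟨y, -, rfl⟩
    · exact h.le
    · exact firstPos_le_length L y
  · exact h3 z hz hj1

theorem exists_tourPiece_eq (H : Set V) {L : List (V × V)} {x : V} (h : firstPos L x < L.length) :
    ∃ e ≤ L.length, firstPos L x < e ∧ (e = L.length ∨ ∃ y ∈ H, e = firstPos L y) ∧
      (∀ z ∈ H, firstPos L x < firstPos L z → e ≤ firstPos L z) ∧
      tourPiece H L x = (L.take e).drop (firstPos L x) := by
  have hm := Nat.sInf_mem (s := {j | firstPos L x < j ∧ (j = L.length ∨ ∃ y ∈ H, j = firstPos L y)})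
    ⟨L.length, h, Or.inl rfl⟩
  refine ⟨sInf {j | firstPos L x < j ∧ (j = L.length ∨ ∃ y ∈ H, j = firstPos L y)}, Nat.sInf_le ?_,
    hm.1, hm.2, fun z hz hlt => Nat.sInf_le ?_, rfl⟩
  · exact ⟨h, Or.inl rfl⟩
  · exact ⟨hlt, Or.inr ⟨z, hz, rfl⟩⟩

theorem tourPiece_eq_nil {H : Set V} {L : List (V × V)} {x : V} (h : ¬ firstPos L x < L.length) :
    tourPiece H L x = [] := by
  rw [tourPiece, List.drop_eq_nil_of_le]
  rw [List.length_take]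
  exact (Nat.min_le_right _ _).trans (by omega)

theorem mem_tourPiece {H : Set V} {L : List (V × V)} {x : V} {d : V × V} :
    d ∈ tourPiece H L x ↔ ∃ (i : ℕ) (hi : i < L.length), L[i] = d ∧ firstPos L x ≤ i ∧
      ∀ z ∈ H, firstPos L x < firstPos L z → i < firstPos L z := by
  by_cases h : firstPos L x < L.length
  · obtain ⟨e, hel, h1, h2, h3, h4⟩ := exists_tourPiece_eq H h
    rw [h4, List.mem_iff_getElem]
    constructor
    · rintro ⟨j, hj, rfl⟩
      rw [List.length_drop, List.length_take] at hj
      refine ⟨firstPos L x + j, by omega, by simp, by omega, fun z hz hlt => ?_⟩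
      have := h3 z hz hlt
      omega
    · rintro ⟨i, hi, rfl, h5, h6⟩
      have hie : i < e := by
        rcases h2 with rfl | ⟨y, hy, rfl⟩
        · exact hi
        · exact h6 y hy h1
      refine ⟨i - firstPos L x, ?_, ?_⟩
      · rw [List.length_drop, List.length_take]; omega
      · simp [Nat.add_sub_cancel' h5]
  · rw [tourPiece_eq_nil h]
    constructor
    · simp
    · rintro ⟨i, hi, -, h5, -⟩
      omega

theorem tourPiece_sublist (H : Set V) (L : List (V × V)) (x : V) : (tourPiece H L x).Sublist L :=
  (List.drop_sublist _ _).trans (List.take_sublist _ _)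

theorem mem_insertAfterLast {seg : V → List (V × V)} {l : List (V × V)} {e : V × V} :
    e ∈ insertAfterLast seg l ↔ e ∈ l ∨ ∃ d ∈ l, e ∈ seg d.2 := by
  induction l with
  | nil => simp [insertAfterLast]
  | cons a l ih =>
    rw [insertAfterLast, List.mem_cons, List.mem_append, ih]
    split_ifs with h
    · obtain ⟨d, hd, hda⟩ := h
      simp only [List.not_mem_nil, false_or, List.mem_cons, exists_eq_or_imp]
      constructor
      · tauto
      · rintro ((h | h) | h | h)
        · exact Or.inl h
        · exact Or.inr (Or.inl h)
        · exact Or.inr (Or.inr ⟨d, hd, hda ▸ h⟩)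
        · exact Or.inr (Or.inr h)
    · simp only [List.mem_cons, exists_eq_or_imp]
      tauto

theorem pairwise_entryIdx {L : List (V × V)} (h : L.Nodup) :
    L.Pairwise (fun a b => entryIdx L a < entryIdx L b) := by
  rw [List.pairwise_iff_getElem]
  intro i j hi hj hij
  rw [entryIdx_getElem h hi, entryIdx_getElem h hj]
  exact hij

end Pieces

/-! ### Correctness of the algorithm -/

namespace JoinRun

open JoinInstance

variable {V : Type u} [DecidableEq V] {I : JoinInstance V} (r : JoinRun I)

theorem isParentMap : IsParentMap I.T r.root r.par :=
  ⟨r.par_root, fun c hc => (r.par_adj c hc).1, fun c hc => (r.par_adj c hc).2⟩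

theorem leader_base (c : Cluster I.leader) : I.leader (r.base c) = c.1 := by
  by_cases h : c = r.root
  · rw [h]; exact r.base_root.2
  · rw [r.base_eq c h]
    exact (I.g_mem _ _ (r.par_adj c h).1).1

theorem mem_localTour {c : Cluster I.leader} {x y : V} : (x, y) ∈ r.localTour c ↔
    ∃ (hx : I.leader x = c.1) (hy : I.leader y = c.1), (I.tree c).Adj ⟨x, hx⟩ ⟨y, hy⟩ := by
  rw [(r.localTour_isRotated c).mem_iff, mem_tourOn]

theorem nodup_localTour (c : Cluster I.leader) : (r.localTour c).Nodup :=
  (r.localTour_isRotated c).nodup_iff.2 (nodup_tourOn c)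

theorem isWalk_localTour (c : Cluster I.leader) :
    IsWalk (r.base c) (r.localTour c) (r.base c) := by
  obtain ⟨x, hx⟩ := exists_isWalk_tourOn (I := I) c
  obtain ⟨k, hk⟩ := (r.localTour_isRotated c).symm
  obtain ⟨y, hy⟩ := hx.rotate k
  rw [hk] at hy
  exact hy.startsAt_unique (r.localTour_startsAt c)

/-- The first position of the node `x` in the shifted tour of its cluster. -/
def pos (x : V) : ℕ := firstPos (r.localTour (I.clusterOf x)) x

theorem clusterOf_base (c : Cluster I.leader) : I.clusterOf (r.base c) = c :=
  clusterOf_eq (r.leader_base c)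

theorem pos_base (c : Cluster I.leader) : r.pos (r.base c) = 0 := by
  rw [pos, clusterOf_base]
  exact firstPos_eq_zero (r.localTour_startsAt c)

theorem pos_le_length (x : V) : r.pos x ≤ (r.localTour (I.clusterOf x)).length :=
  firstPos_le_length _ _

/-- Unless x is the base, its cluster has two nodes, so x has a neighbour and is the source of some
entry. At the base the position is 0, even if the tour is empty. Consequently positions separate the
nodes of a cluster. -/
theorem walkAt_pos [Finite V] (x : V) :
    walkAt (r.localTour (I.clusterOf x)) (r.base (I.clusterOf x)) (r.pos x) = x := by
  obtain ⟨c, hc⟩ : ∃ c, c = I.clusterOf x := ⟨_, rfl⟩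
  have hxc : I.leader x = c.1 := by rw [hc]; rfl
  by_cases hx : x = r.base c
  · have h0 : r.pos x = 0 := by rw [hx]; exact r.pos_base c
    rw [h0, ← hc, walkAt]
    split_ifs with h
    · have := r.localTour_startsAt c (r.localTour c)[0] (by
        rw [List.head?_eq_getElem?]; simp [h])
      rw [this, hx]
    · exact hx.symm
  · have : Nontrivial (Members I.leader c) :=
      ⟨⟨x, hxc⟩, ⟨r.base c, r.leader_base c⟩, fun h => hx (congrArg Subtype.val h)⟩
    obtain ⟨y, hy⟩ := (I.tree_isTree c).connected.preconnected.exists_adj_of_nontrivial ⟨x, hxc⟩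
    have hm : (x, y.1) ∈ r.localTour c := r.mem_localTour.2 ⟨hxc, y.2, hy⟩
    have hlt := firstPos_lt_length hm
    rw [pos, ← hc, walkAt, dif_pos hlt]
    exact getElem_firstPos hlt

theorem eq_of_pos_eq [Finite V] {x y : V} (hc : I.clusterOf x = I.clusterOf y)
    (h : r.pos x = r.pos y) : x = y := by
  rw [← r.walkAt_pos x, ← r.walkAt_pos y, h, hc]

/-- The edge that replaces entry `t` of the new tour of `T` ends at `x`. -/
def Arrives (t : ℕ) (x : V) : Prop :=
  ∃ h : t < r.newA.length, (I.g (r.newA[t]).1 (r.newA[t]).2).2 = x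

theorem adj_newA {t : ℕ} (h : t < r.newA.length) : I.T.Adj (r.newA[t]).1 (r.newA[t]).2 :=
  r.newA_isEulerTour.adj _ (List.getElem_mem h)

variable {r} in
theorem Arrives.cluster {t : ℕ} {x : V} (h : r.Arrives t x) :
    (r.newA[t]'h.1).2 = I.clusterOf x := by
  obtain ⟨ht, rfl⟩ := h
  exact (clusterOf_eq (I.g_mem _ _ (r.adj_newA ht)).2).symm

theorem arrives_idxOf {a b : Cluster I.leader} (h : I.T.Adj a b) :
    r.Arrives (entryIdx r.newA (a, b)) (I.g a b).2 := by
  have hlt := entryIdx_lt_length (r.newA_isEulerTour.mem_iff.2 h)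
  exact ⟨hlt, by rw [getElem_entryIdx hlt]⟩

/-- The tour of T uses every edge in both directions, so both endpoints of a crossing edge are ends
of replaced entries. -/
theorem mem_terminals_iff {x : V} : x ∈ I.terminals ↔ ∃ t, r.Arrives t x := by
  constructor
  · rintro ⟨y, a, b, hab, he⟩
    rw [Sym2.eq_iff] at he
    rcases he with ⟨h1, -⟩ | ⟨h1, -⟩
    · have := r.arrives_idxOf hab.symm
      rw [I.g_symm a b hab] at this
      exact ⟨_, by rw [h1]; exact this⟩
    · exact ⟨_, h1 ▸ r.arrives_idxOf hab⟩
  · rintro ⟨t, ht, rfl⟩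
    exact ⟨_, _, _, r.adj_newA ht, Sym2.eq_swap⟩

theorem base_mem_terminals (c : Cluster I.leader) : r.base c ∈ I.terminals := by
  by_cases h : c = r.root
  · rw [h]; exact r.base_root.1
  · rw [r.base_eq c h]
    exact ⟨_, _, _, (r.par_adj c h).1, rfl⟩

variable {r} in
theorem Arrives.idxOf {t : ℕ} {x : V} (h : r.Arrives t x) {a b : Cluster I.leader}
    (he : r.newA[t]'h.1 = (a, b)) : entryIdx r.newA (a, b) = t := by
  rw [← he]
  exact entryIdx_getElem r.newA_isEulerTour.nodup h.1

section Order

variable [Fintype V]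

/-- An edge into the cluster of `x` comes from the parent or from a child. -/
theorem arrives_cases {t : ℕ} {x : V} (h : r.Arrives t x) :
    (I.clusterOf x ≠ r.root ∧ entryIdx r.newA (r.par (I.clusterOf x), I.clusterOf x) = t ∧
      x = r.base (I.clusterOf x)) ∨
    ∃ q, q ≠ r.root ∧ r.par q = I.clusterOf x ∧ entryIdx r.newA (q, r.par q) = t ∧
      x = (I.g (r.par q) q).1 := by
  have hadj := r.adj_newA h.1
  have hcl := h.cluster
  have hx := h.2
  have hpair : ∀ a b, (r.newA[t]'h.1).1 = a → (r.newA[t]'h.1).2 = b →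
      r.newA[t]'h.1 = (a, b) := fun a b h1 h2 => Prod.ext h1 h2
  rcases r.isParentMap.adj_cases I.T_isTree hadj with ⟨h1, h2⟩ | ⟨h1, h2⟩
  · right
    refine ⟨_, h1, h2.trans hcl, h.idxOf (hpair _ _ rfl h2.symm), ?_⟩
    rw [I.g_symm _ _ (r.par_adj _ h1).1, h2]
    exact hx.symm
  · left
    rw [hcl] at h1 h2
    refine ⟨h1, h.idxOf (hpair _ _ h2.symm hcl), ?_⟩
    rw [r.base_eq _ h1, I.g_symm _ _ (r.par_adj _ h1).1.symm, h2]
    exact hx.symm.trans (by rw [hcl]; rfl)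

/-- This is the heart of correctness. An arrival from the parent hits the base, at position 0, and
precedes all arrivals from children. Children are visited by increasing rank, and ranks respect the
positions of the terminals. -/
theorem pos_le_of_arrives {t t' : ℕ} {x x' : V} (h : r.Arrives t x) (h' : r.Arrives t' x')
    (hc : I.clusterOf x = I.clusterOf x') (htt : t ≤ t') : r.pos x ≤ r.pos x' := by
  have hp := r.isParentMap
  have hB := r.newA_isEulerTour
  rcases r.arrives_cases h with ⟨-, -, h3⟩ | ⟨q, hq, hqp, hqi, hqx⟩
  · rw [h3, r.pos_base]; exact Nat.zero_le _
  · rcases r.arrives_cases h' with ⟨h1, h2, h3⟩ | ⟨q', hq', hqp', hqi', hqx'⟩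
    -- No arrival at a cluster precedes the one from its parent, so here t = t'.
    · have := (hp.target_isDesc_iff I.T_isTree hB r.newA_startsAt h1 h.1).1 (by
        rw [h.cluster, hc]; exact IsDesc.refl _)
      obtain rfl : t = t' := by omega
      rw [← h.2, ← h'.2]
    · by_contra hlt
      have hpp : r.par q = r.par q' := by rw [hqp, hqp', hc]
      have hf : ∀ z, I.clusterOf z = r.par q → firstPos (r.localTour (r.par q)) z = r.pos z := by
        intro z hz; rw [pos, hz]
      have hlt' := r.rank_lt q' q hq' hq hpp.symm (by
        rw [← hqx, ← hqx', ← hpp, hf _ hqp.symm, hf _ (hc ▸ hqp.symm)]; omega)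
      have := r.newA_ordered q' q hq' hq hpp.symm hlt'
      rw [hp.firstPos_eq I.T_isTree hB r.newA_startsAt hq,
        hp.firstPos_eq I.T_isTree hB r.newA_startsAt hq'] at this
      have h5 := hp.idxOf_up_lt_down I.T_isTree hB r.newA_startsAt hq' hq hpp.symm (by omega)
      have h6 := hp.idxOf_down_lt_up I.T_isTree hB r.newA_startsAt hq
      omega

/-- After an arrival at a cluster, either the next edge leaves for a child, from the node at which
the cluster is entered next, or the cluster is not entered again and is left through its base. -/
theorem next_departure {t : ℕ} {x : V} (h : r.Arrives t x) :
    (∃ (h1 : t + 1 < r.newA.length) (u : ℕ) (z : V),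
      (I.g (r.newA[t + 1]).1 (r.newA[t + 1]).2).1 = z ∧ r.Arrives u z ∧ t < u ∧
      I.clusterOf z = I.clusterOf x ∧
      ∀ u' z', r.Arrives u' z' → I.clusterOf z' = I.clusterOf x → t < u' → u ≤ u') ∨
    ((if h1 : t + 1 < r.newA.length then (I.g (r.newA[t + 1]).1 (r.newA[t + 1]).2).1
        else r.base r.root) = r.base (I.clusterOf x) ∧
      ∀ u' z', r.Arrives u' z' → I.clusterOf z' = I.clusterOf x → u' ≤ t) := by
  have hp := r.isParentMap
  have hB := r.newA_isEulerTour
  have hcl := h.cluster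
  by_cases h1 : t + 1 < r.newA.length
  · rw [hB.getElem_succ h1] at hcl
    have hadj := r.adj_newA h1
    have hidx : ∀ a b, (r.newA[t + 1]).1 = a → (r.newA[t + 1]).2 = b →
        entryIdx r.newA (a, b) = t + 1 := fun a b h2 h3 => by
      rw [← (Prod.ext h2 h3 : r.newA[t + 1] = (a, b))]
      exact entryIdx_getElem hB.nodup h1
    rcases hp.adj_cases I.T_isTree hadj with ⟨h2, h3⟩ | ⟨h2, h3⟩
    · right
      rw [dif_pos h1]
      rw [hcl] at h2 h3
      have hi := hidx _ _ hcl h3.symm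
      refine ⟨by rw [r.base_eq _ h2, hcl, h3], fun u' z' hu hz => ?_⟩
      have := (hp.target_isDesc_iff I.T_isTree hB r.newA_startsAt h2 hu.1).1 (by
        rw [hu.cluster, hz]; exact IsDesc.refl _)
      omega
    · left
      obtain ⟨q, hqe⟩ : ∃ q, (r.newA[t + 1]).2 = q := ⟨_, rfl⟩
      rw [hqe] at h2 h3
      have hi := hidx _ _ h3.symm hqe
      have hud := hp.idxOf_down_lt_up I.T_isTree hB r.newA_startsAt h2
      have ha := r.arrives_idxOf (r.par_adj q h2).1
      have hgs : (I.g q (r.par q)).2 = (I.g (r.newA[t + 1]).1 (r.newA[t + 1]).2).1 := by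
        rw [hqe, ← h3, I.g_symm _ _ (r.par_adj q h2).1]; rfl
      refine ⟨h1, _, _, rfl, hgs ▸ ha, by omega, ?_, fun u' z' hu hz htu => ?_⟩
      · rw [← hcl]; exact clusterOf_eq (I.g_mem _ _ hadj).1
      · have := (hp.target_isDesc_iff I.T_isTree hB r.newA_startsAt h2 hu.1).not.1 (by
          rw [hu.cluster, hz, ← hcl, ← h3]; exact hp.not_isDesc_par h2)
        omega
  · right
    rw [dif_neg h1]
    have hroot : (r.newA[t]'h.1).2 = r.root := by
      have hw := @IsEulerTour.isWalk _ _ _ ⟨r.root⟩ hB _ r.newA_startsAt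
      have hne : r.newA ≠ [] := by
        intro h0
        have := h.1
        rw [h0] at this
        simp at this
      have := ((isWalk_iff_of_ne_nil hne).1 hw).2.2
      rw [List.getLast_eq_getElem] at this
      have hlt := h.1
      have e : r.newA.length - 1 = t := by omega
      simpa only [e] using this
    refine ⟨by rw [← hcl, hroot], fun u' z' hu _ => ?_⟩
    have := hu.1
    omega

open Classical in
/-- What is inserted after entry `t` leads to the start of the next entry. -/
theorem isWalk_inserted {t : ℕ} {x : V} (h : r.Arrives t x) :
    IsWalk x (if ∃ u, t < u ∧ r.Arrives u x then [] else
        tourPiece I.terminals (r.localTour (I.clusterOf x)) x)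
      (if h1 : t + 1 < r.newA.length then (I.g (r.newA[t + 1]).1 (r.newA[t + 1]).2).1
        else r.base r.root) := by
  have hwalk := r.isWalk_localTour (I.clusterOf x)
  rcases r.next_departure h with ⟨h1, u, z, hz, hu, htu, hzc, hmin⟩ | ⟨h1, hlast⟩
  · rw [dif_pos h1, hz]
    split_ifs with hlater
    -- Nothing is inserted because x is reached again later. Then pos x ≤ pos z ≤ pos x, so the
    -- departure is from x itself.
    · obtain ⟨u', htu', hu'⟩ := hlater
      have e1 := r.pos_le_of_arrives h hu hzc.symm htu.le
      have e2 := r.pos_le_of_arrives hu hu' hzc (hmin _ _ hu' rfl htu')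
      exact r.eq_of_pos_eq hzc.symm (le_antisymm e1 e2)
    -- After the last arrival at x the next terminal on the local tour is z, so the piece of x stops
    -- exactly where that tour first stands at z.
    · have hlt : r.pos x < r.pos z := by
        refine lt_of_le_of_ne (r.pos_le_of_arrives h hu hzc.symm htu.le) fun he => hlater ⟨u, htu, ?_⟩
        rwa [r.eq_of_pos_eq hzc.symm he]
      have hpz : firstPos (r.localTour (I.clusterOf x)) z = r.pos z := by rw [pos, hzc]
      rw [tourPiece_eq (e := r.pos z) hlt
        (Or.inr ⟨z, r.mem_terminals_iff.2 ⟨u, hu⟩, hpz.symm⟩)]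
      · have h2 := hwalk.piece hlt.le (hzc ▸ r.pos_le_length z)
        have h3 := r.walkAt_pos z
        rw [hzc] at h3
        rw [r.walkAt_pos x, h3] at h2
        exact h2
      · intro w hw hxw
        by_cases hwc : I.clusterOf w = I.clusterOf x
        · obtain ⟨u', hu'⟩ := r.mem_terminals_iff.1 hw
          have hpw : firstPos (r.localTour (I.clusterOf x)) w = r.pos w := by rw [pos, hwc]
          rw [hpw] at hxw ⊢
          have hxw : r.pos x < r.pos w := hxw
          have htu' : t < u' := by
            by_contra hcon
            have := r.pos_le_of_arrives hu' h hwc (by omega)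
            omega
          exact r.pos_le_of_arrives hu hu' (hzc.trans hwc.symm) (hmin _ _ hu' hwc htu')
        -- A terminal of another cluster does not occur in this tour, and its first position has the
        -- default value, the length.
        · have : firstPos (r.localTour (I.clusterOf x)) w = (r.localTour (I.clusterOf x)).length := by
            by_contra hne
            have hlt2 := lt_of_le_of_ne (firstPos_le_length (r.localTour (I.clusterOf x)) w) hne
            have := getElem_firstPos hlt2
            obtain ⟨hm, -⟩ := r.mem_localTour.1 (List.getElem_mem hlt2)
            rw [List.get_eq_getElem, this] at hm
            exact hwc (clusterOf_eq hm)
          rw [this, ← hpz]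
          exact firstPos_le_length _ _
  · rw [h1, if_neg]
    -- No terminal of the cluster has a larger position, so the piece runs to the end of the local
    -- tour, back to the base. If nothing is left of the tour, x is the base.
    · by_cases hlt : r.pos x < (r.localTour (I.clusterOf x)).length
      · rw [tourPiece_eq (e := (r.localTour (I.clusterOf x)).length) hlt (Or.inl rfl)]
        · have h2 := hwalk.piece hlt.le le_rfl
          rw [r.walkAt_pos x] at h2
          have h3 : walkAt (r.localTour (I.clusterOf x)) (r.base (I.clusterOf x))
              (r.localTour (I.clusterOf x)).length = r.base (I.clusterOf x) := by
            rw [walkAt, dif_neg (lt_irrefl _)]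
          rw [h3] at h2
          exact h2
        · intro w hw hxw
          by_contra hcon
          have hlt2 : firstPos (r.localTour (I.clusterOf x)) w <
              (r.localTour (I.clusterOf x)).length := by omega
          have := getElem_firstPos hlt2
          obtain ⟨hm, -⟩ := r.mem_localTour.1 (List.getElem_mem hlt2)
          rw [List.get_eq_getElem, this] at hm
          have hwc : I.clusterOf w = I.clusterOf x := clusterOf_eq hm
          obtain ⟨u', hu'⟩ := r.mem_terminals_iff.1 hw
          have h5 := r.pos_le_of_arrives hu' h hwc (hlast _ _ hu' hwc)
          have hpw : firstPos (r.localTour (I.clusterOf x)) w = r.pos w := by rw [pos, hwc]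
          rw [hpw] at hxw
          have hxw : r.pos x < r.pos w := hxw
          omega
      · rw [tourPiece_eq_nil hlt]
        have h3 := r.walkAt_pos x
        rw [walkAt, dif_neg hlt] at h3
        exact h3.symm
    · rintro ⟨u, htu, hu⟩
      have := hlast u x hu rfl
      omega

/-- The images under `g` of the entries of the new tour of `T`. -/
def cross : List (V × V) := r.newA.map (fun e => I.g e.1 e.2)

/-- The piece that belongs to the node `x`. -/
noncomputable def segment (x : V) : List (V × V) :=
  tourPiece I.terminals (r.localTour (I.clusterOf x)) x

omit [Fintype V] in
theorem output_eq : r.output = insertAfterLast r.segment r.cross := rfl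

omit [Fintype V] in
theorem exists_drop_iff {t : ℕ} {x : V} :
    (∃ d ∈ r.cross.drop t, d.2 = x) ↔ ∃ u, t ≤ u ∧ r.Arrives u x := by
  constructor
  · rintro ⟨d, hd, rfl⟩
    obtain ⟨j, hj, rfl⟩ := List.mem_iff_getElem.1 hd
    rw [List.length_drop, cross, List.length_map] at hj
    exact ⟨t + j, by omega, by omega, by simp [cross]⟩
  · rintro ⟨u, htu, hu, rfl⟩
    refine ⟨I.g (r.newA[u]).1 (r.newA[u]).2, List.mem_iff_getElem.2 ⟨u - t, ?_, ?_⟩, rfl⟩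
    · rw [List.length_drop, cross, List.length_map]; omega
    · simp [cross, Nat.add_sub_cancel' htu]

omit [Fintype V] in
open Classical in
theorem insertAfterLast_drop {t : ℕ} (ht : t < r.newA.length) :
    insertAfterLast r.segment (r.cross.drop t) =
      I.g (r.newA[t]).1 (r.newA[t]).2 ::
        ((if ∃ u, t < u ∧ r.Arrives u (I.g (r.newA[t]).1 (r.newA[t]).2).2 then [] else
          r.segment (I.g (r.newA[t]).1 (r.newA[t]).2).2) ++
            insertAfterLast r.segment (r.cross.drop (t + 1))) := by
  have hl : t < r.cross.length := by rw [cross, List.length_map]; exact ht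
  have he : r.cross[t] = I.g (r.newA[t]).1 (r.newA[t]).2 := by simp [cross]
  rw [List.drop_eq_getElem_cons hl, insertAfterLast, he]
  congr 2
  exact if_congr r.exists_drop_iff rfl rfl

theorem isWalk_output [Nontrivial (Cluster I.leader)] :
    ∃ v, IsWalk v r.output v := by
  classical
  have hB := r.newA_isEulerTour
  -- Induction from the end: the part of the output from entry t on leads from the source of that
  -- entry to the base of the root cluster.
  have key : ∀ k t, t + k = r.newA.length → IsWalk (if h1 : t < r.newA.length then
      (I.g (r.newA[t]).1 (r.newA[t]).2).1 else r.base r.root)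
      (insertAfterLast r.segment (r.cross.drop t)) (r.base r.root) := by
    intro k
    induction k with
    | zero =>
      intro t ht
      rw [dif_neg (by omega), List.drop_eq_nil_of_le (by rw [cross, List.length_map]; omega)]
      rfl
    | succ k ih =>
      intro t ht
      have htl : t < r.newA.length := by omega
      rw [dif_pos htl, r.insertAfterLast_drop htl]
      exact ⟨rfl, isWalk_append.2 ⟨_, r.isWalk_inserted ⟨htl, rfl⟩, ih (t + 1) (by omega)⟩⟩
  have h0 := key r.newA.length 0 (by omega)
  rw [List.drop_zero] at h0
  rw [output_eq]
  have hlen : 0 < r.newA.length := by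
    rw [hB.length_eq]
    have := Finite.one_lt_card (α := Cluster I.leader)
    omega
  rw [dif_pos hlen] at h0
  refine ⟨r.base r.root, ?_⟩
  -- It remains that the first edge leaves from this base. The return from the first child is the
  -- first arrival at the root cluster; the base, a terminal, is reached at some time, and its
  -- position 0 bounds the position of the first arrival.
  convert h0 using 1
  have hp := r.isParentMap
  have hr0 : (r.newA[0]).1 = r.root := r.newA_startsAt _ (by
    rw [List.head?_eq_getElem?]; simp [hlen])
  have hadj := r.adj_newA hlen
  rcases hp.adj_cases I.T_isTree hadj with ⟨h1, -⟩ | ⟨hq, hpq⟩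
  · exact absurd hr0 h1
  obtain ⟨q, hqe⟩ : ∃ q, (r.newA[0]).2 = q := ⟨_, rfl⟩
  rw [hqe] at hq hpq hadj
  have hi : entryIdx r.newA (r.par q, q) = 0 := by
    rw [← (Prod.ext hpq.symm hqe : r.newA[0] = (r.par q, q))]
    exact entryIdx_getElem hB.nodup hlen
  have ha := r.arrives_idxOf hadj.symm
  rw [I.g_symm _ _ hadj] at ha
  obtain ⟨u, hu⟩ := r.mem_terminals_iff.1 (r.base_mem_terminals r.root)
  have hc : I.clusterOf (I.g (r.newA[0]).1 q).1 = I.clusterOf (r.base r.root) := by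
    rw [clusterOf_base, ← hr0]
    exact clusterOf_eq (I.g_mem _ _ hadj).1
  have hle : entryIdx r.newA (q, (r.newA[0]).1) ≤ u := by
    have := (hp.target_isDesc_iff I.T_isTree hB r.newA_startsAt hq hu.1).not.1 (by
      rw [hu.cluster, clusterOf_base, hp.isDesc_root_iff]; exact hq)
    rw [← hpq]
    omega
  have hpos := r.pos_le_of_arrives ha hu hc hle
  rw [r.pos_base] at hpos
  rw [hqe]
  exact (r.eq_of_pos_eq hc (by rw [r.pos_base]; exact Nat.le_zero.1 hpos)).symm

/-- The output lists the edges by increasing keys, where the key of the edge that replaces entry `t`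
of the new tour is `(t + 1, 0)`, and the key of entry `i` of the tour of a cluster is
`(t + 1, i + 1)` for the last arrival `t` at a node of this cluster whose position is at most `i`. -/
theorem pairwise_output (K : V × V → ℕ ×ₗ ℕ)
    (hcross : ∀ (t : ℕ) (h : t < r.newA.length),
      K (I.g (r.newA[t]).1 (r.newA[t]).2) = toLex (t + 1, 0))
    (hlocal : ∀ (c : Cluster I.leader) (i : ℕ) (hi : i < (r.localTour c).length) (t : ℕ) (x : V),
      r.Arrives t x → I.clusterOf x = c → r.pos x ≤ i →
      (∀ t' x', r.Arrives t' x' → I.clusterOf x' = c → r.pos x' ≤ i → t' ≤ t) →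
      K (r.localTour c)[i] = toLex (t + 1, i + 1)) :
    r.output.Pairwise (fun e e' => K e < K e') := by
  classical
  have key : ∀ k t, t + k = r.newA.length →
      (insertAfterLast r.segment (r.cross.drop t)).Pairwise (fun e e' => K e < K e') ∧
      ∀ e ∈ insertAfterLast r.segment (r.cross.drop t), toLex (t + 1, 0) ≤ K e := by
    intro k
    induction k with
    | zero =>
      intro t ht
      rw [List.drop_eq_nil_of_le (by rw [cross, List.length_map]; omega)]
      simp [insertAfterLast]
    | succ k ih =>
      intro t ht
      have htl : t < r.newA.length := by omega
      obtain ⟨ih1, ih2⟩ := ih (t + 1) (by omega)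
      have hK := hcross t htl
      obtain ⟨x, hx⟩ : ∃ x, x = (I.g (r.newA[t]).1 (r.newA[t]).2).2 := ⟨_, rfl⟩
      have ha : r.Arrives t x := ⟨htl, hx.symm⟩
      -- For an entry with index i in the piece of x, the last admissible arrival is t: a later
      -- arrival in the cluster is at a node x' ≠ x with a larger position, and the piece of x ends
      -- before that position.
      have hmid : ∀ d ∈ (if ∃ u, t < u ∧ r.Arrives u x then [] else r.segment x),
          K d = toLex (t + 1, entryIdx (r.localTour (I.clusterOf x)) d + 1) := by
        intro d hd
        split_ifs at hd with hlater
        · simp at hd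
        · obtain ⟨i, hi, rfl, h1, h2⟩ := mem_tourPiece.1 hd
          rw [entryIdx_getElem (r.nodup_localTour _) hi]
          refine hlocal _ i hi t x ha rfl h1 fun t' x' ha' hc' hp' => ?_
          by_contra hlt
          have h3 := r.pos_le_of_arrives ha ha' hc'.symm (by omega)
          have h4 : r.pos x ≠ r.pos x' := fun he => hlater ⟨t', by omega, by
            rwa [r.eq_of_pos_eq hc'.symm he]⟩
          have hpx : firstPos (r.localTour (I.clusterOf x)) x' = r.pos x' := by rw [pos, hc']
          have h5 := h2 x' (r.mem_terminals_iff.2 ⟨t', ha'⟩) (by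
            rw [hpx]; exact lt_of_le_of_ne h3 h4)
          omega
      rw [r.insertAfterLast_drop htl, ← hx]
      refine ⟨?_, ?_⟩
      · rw [List.pairwise_cons, List.pairwise_append]
        refine ⟨fun d hd => ?_, ?_, ih1, fun d hd d' hd' => ?_⟩
        · rw [hK]
          rcases List.mem_append.1 hd with hd | hd
          · rw [hmid d hd]; exact Prod.Lex.toLex_lt_toLex.2 (Or.inr ⟨rfl, Nat.succ_pos _⟩)
          · exact lt_of_lt_of_le (Prod.Lex.toLex_lt_toLex.2 (Or.inl (Nat.lt_succ_self _)))
              (ih2 d hd)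
        · have hsub : (if ∃ u, t < u ∧ r.Arrives u x then [] else r.segment x).Sublist
              (r.localTour (I.clusterOf x)) := by
            split_ifs
            · exact List.nil_sublist _
            · exact tourPiece_sublist _ _ _
          refine ((pairwise_entryIdx (r.nodup_localTour _)).sublist hsub).imp_of_mem ?_
          intro d d' hd hd' hlt
          rw [hmid d hd, hmid d' hd']
          exact Prod.Lex.toLex_lt_toLex.2 (Or.inr ⟨rfl, Nat.succ_lt_succ hlt⟩)
        · refine lt_of_lt_of_le ?_ (ih2 d' hd')
          rw [hmid d hd]
          exact Prod.Lex.toLex_lt_toLex.2 (Or.inl (Nat.lt_succ_self _))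
      · intro d hd
        rcases List.mem_cons.1 hd with rfl | hd
        · exact hK.ge
        · rcases List.mem_append.1 hd with hd | hd
          · rw [hmid d hd]; exact Prod.Lex.toLex_le_toLex.2 (Or.inr ⟨rfl, Nat.zero_le _⟩)
          · exact le_trans (Prod.Lex.toLex_le_toLex.2 (Or.inl (Nat.lt_succ_self _))) (ih2 d hd)
  have := (key r.newA.length 0 (by omega)).1
  rwa [List.drop_zero] at this

/-- An entry of a local tour lies in the piece of the terminal with the largest position not
exceeding its index. There is one because the base is a terminal with position 0. -/
theorem mem_output {e : V × V} :
    e ∈ r.output ↔ e ∈ r.cross ∨ ∃ c, e ∈ r.localTour c := by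
  rw [output_eq, mem_insertAfterLast]
  refine or_congr_right ⟨?_, ?_⟩
  · rintro ⟨d, -, hd⟩
    exact ⟨_, (tourPiece_sublist _ _ _).mem hd⟩
  · rintro ⟨c, hm⟩
    obtain ⟨i, hi, rfl⟩ := List.mem_iff_getElem.1 hm
    obtain ⟨x, hx, hmax⟩ := Set.exists_max_image
      {x | x ∈ I.terminals ∧ I.clusterOf x = c ∧ r.pos x ≤ i} r.pos (Set.toFinite _)
      ⟨r.base c, r.base_mem_terminals c, r.clusterOf_base c, by rw [r.pos_base]; exact Nat.zero_le _⟩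
    obtain ⟨hxt, hxc, hxi⟩ := hx
    obtain ⟨t, ht⟩ := r.mem_terminals_iff.1 hxt
    obtain ⟨d, hd, rfl⟩ := r.exists_drop_iff.2 ⟨t, Nat.zero_le t, ht⟩
    rw [List.drop_zero] at hd
    refine ⟨d, hd, mem_tourPiece.2 ?_⟩
    rw [hxc]
    have hpd : firstPos (r.localTour c) d.2 = r.pos d.2 := by rw [pos, hxc]
    refine ⟨i, hi, rfl, by rw [hpd]; exact hxi, fun z hz hlt => ?_⟩
    by_contra hcon
    have hzl : firstPos (r.localTour c) z < (r.localTour c).length := by omega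
    have hz1 := getElem_firstPos hzl
    obtain ⟨hm, -⟩ := r.mem_localTour.1 (List.getElem_mem hzl)
    rw [List.get_eq_getElem, hz1] at hm
    have hzc : I.clusterOf z = c := clusterOf_eq hm
    have hpz : firstPos (r.localTour c) z = r.pos z := by rw [pos, hzc]
    have := hmax z ⟨hz, hzc, by omega⟩
    omega

omit [Fintype V] in
theorem mem_cross_iff {x y : V} : (x, y) ∈ r.cross ↔ ∃ a b, I.T.Adj a b ∧ I.g a b = (x, y) := by
  rw [cross, List.mem_map]
  constructor
  · rintro ⟨⟨a, b⟩, hm, he⟩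
    exact ⟨a, b, r.newA_isEulerTour.mem_iff.1 hm, he⟩
  · rintro ⟨a, b, hab, he⟩
    exact ⟨(a, b), r.newA_isEulerTour.mem_iff.2 hab, he⟩

theorem mem_output_iff_adj {x y : V} : (x, y) ∈ r.output ↔ I.joinedTree.Adj x y := by
  rw [mem_output, I.joinedTree_adj_iff, mem_cross_iff]
  simp only [mem_localTour]

omit [Fintype V] in
theorem exists_last_arrival (c : Cluster I.leader) (i : ℕ) :
    ∃ t x, r.Arrives t x ∧ I.clusterOf x = c ∧ r.pos x ≤ i ∧
      ∀ t' x', r.Arrives t' x' → I.clusterOf x' = c → r.pos x' ≤ i → t' ≤ t := by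
  obtain ⟨u, hu⟩ := r.mem_terminals_iff.1 (r.base_mem_terminals c)
  obtain ⟨t, ⟨x, hx⟩, hmax⟩ := Set.exists_max_image
    {t | ∃ x, r.Arrives t x ∧ I.clusterOf x = c ∧ r.pos x ≤ i} id
    ((Set.finite_lt_nat r.newA.length).subset fun t ⟨x, hx, _⟩ => hx.1)
    ⟨u, r.base c, hu, r.clusterOf_base c, by rw [r.pos_base]; exact Nat.zero_le _⟩
  exact ⟨t, x, hx.1, hx.2.1, hx.2.2, fun t' x' h1 h2 h3 => hmax t' ⟨x', h1, h2, h3⟩⟩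

/-- The keys of `pairwise_output` can be computed from the pair alone, whose endpoints reveal its
cluster or its edge of T. Strictly increasing keys exclude repetitions. -/
theorem nodup_output : r.output.Nodup := by
  choose lt hlt using r.exists_last_arrival
  have hdist : ∀ c i (hi : i < (r.localTour c).length),
      I.clusterOf ((r.localTour c)[i]).1 = c ∧ I.clusterOf ((r.localTour c)[i]).2 = c := by
    intro c i hi
    obtain ⟨h1, h2, -⟩ := r.mem_localTour.1 (List.getElem_mem hi)
    exact ⟨clusterOf_eq h1, clusterOf_eq h2⟩
  let K : V × V → ℕ ×ₗ ℕ := fun e =>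
    if I.clusterOf e.1 = I.clusterOf e.2 then
      toLex (lt (I.clusterOf e.1) (entryIdx (r.localTour (I.clusterOf e.1)) e) + 1,
        entryIdx (r.localTour (I.clusterOf e.1)) e + 1)
    else toLex (entryIdx r.newA (I.clusterOf e.1, I.clusterOf e.2) + 1, 0)
  refine (r.pairwise_output K ?_ ?_).imp fun {a b} h hab => by rw [hab] at h; exact lt_irrefl _ h
  · intro t ht
    have hadj := r.adj_newA ht
    have h1 := clusterOf_eq (I.g_mem _ _ hadj).1
    have h2 := clusterOf_eq (I.g_mem _ _ hadj).2
    simp only [K]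
    rw [if_neg (by rw [h1, h2]; exact hadj.ne), h1, h2]
    rw [show ((r.newA[t]).1, (r.newA[t]).2) = r.newA[t] from rfl,
      entryIdx_getElem r.newA_isEulerTour.nodup ht]
  · intro c i hi t x ha hc hp hmax
    simp only [K]
    rw [(hdist c i hi).1, (hdist c i hi).2, if_pos rfl, entryIdx_getElem (r.nodup_localTour c) hi]
    obtain ⟨x', hx', hc', hp', hmax'⟩ := hlt c i
    rw [le_antisymm (hmax _ _ hx' hc' hp') (hmax' _ _ ha hc hp)]

theorem isEulerTour_output [Nontrivial (Cluster I.leader)] : IsEulerTour I.joinedTree r.output := by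
  obtain ⟨v, hv⟩ := r.isWalk_output
  exact isEulerTour_of_isWalk I.isTree_joinedTree r.nodup_output (fun x y => r.mem_output_iff_adj) hv

end Order

end JoinRun

namespace JoinInstance

variable {V : Type u} [Fintype V] [DecidableEq V] (I : JoinInstance V)

theorem isEulerTour_tourOn {c : Cluster I.leader} (hc : ∀ d, d = c) :
    IsEulerTour I.joinedTree (I.tourOn c) := by
  obtain ⟨x, hx⟩ := exists_isWalk_tourOn (I := I) c
  refine isEulerTour_of_isWalk I.isTree_joinedTree (nodup_tourOn c) (fun x y => ?_) hx
  rw [mem_tourOn, I.joinedTree_adj_iff]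
  constructor
  · exact fun h => Or.inr ⟨c, h⟩
  · rintro (⟨a, b, hab, -⟩ | ⟨d, h⟩)
    · exact absurd ((hc a).trans (hc b).symm) hab.ne
    · rwa [hc d] at h

theorem isEulerTour_of_isOutput {B : List (V × V)} (h : I.IsOutput B) :
    IsEulerTour I.joinedTree B := by
  rcases h with ⟨c, hc, rfl⟩ | ⟨_, r, rfl⟩
  · exact I.isEulerTour_tourOn hc
  · exact r.isEulerTour_output

end JoinInstance

/-! ### Ordered tours of a rooted tree -/

section OrderedTour

variable {κ : Type u} [Fintype κ]

open Classical in
/-- The number of entries of a tour between the two passes, inclusively, through the edge from `c` to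
its parent. -/
noncomputable def subtreeLen (par : κ → κ) (c : κ) : ℕ :=
  2 * (Finset.univ.filter (fun x => IsDesc par c x)).card

open Classical in
/-- The position of the first entry that enters `c`, counted from the entry into its parent, in a
tour that visits siblings by increasing rank. -/
noncomputable def siblingOffset (root : κ) (par : κ → κ) (rank : κ → ℕ) (c : κ) : ℕ :=
  1 + ∑ s ∈ Finset.univ.filter (fun s => s ≠ root ∧ par s = par c ∧ rank s < rank c),
    subtreeLen par s

open Classical in
/-- The position, from `1`, of the entry that enters `c` in a tour that visits siblings by increasing
rank. -/
noncomputable def enterTime (root : κ) (par : κ → κ) (rank : κ → ℕ) (c : κ) : ℕ :=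
  ∑ a ∈ Finset.univ.filter (fun a => a ≠ root ∧ IsDesc par a c), siblingOffset root par rank a

variable {T : SimpleGraph κ} {root : κ} {par : κ → κ} {rank : κ → ℕ}

theorem siblingOffset_eq (c : κ)
    [DecidablePred fun s => s ≠ root ∧ par s = par c ∧ rank s < rank c] :
    siblingOffset root par rank c = 1 + ∑ s ∈ Finset.univ.filter
      (fun s => s ≠ root ∧ par s = par c ∧ rank s < rank c), subtreeLen par s := by
  rw [siblingOffset]
  congr!

theorem two_le_subtreeLen (c : κ) : 2 ≤ subtreeLen par c := by
  classical
  rw [subtreeLen]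
  refine Nat.mul_le_mul_left 2 (Finset.card_pos.2 ⟨c, ?_⟩)
  simpa using IsDesc.refl (par := par) c

namespace IsParentMap

variable (hp : IsParentMap T root par)
include hp

omit [Fintype κ] in
theorem exists_child {c x : κ} (h : IsDesc par c x) (hne : x ≠ c) :
    ∃ q, q ≠ root ∧ par q = c ∧ IsDesc par q x := by
  obtain ⟨k, hk⟩ := h
  induction k generalizing x with
  | zero => exact absurd hk hne
  | succ k ih =>
    by_cases h : par x = c
    · refine ⟨x, ?_, h, IsDesc.refl x⟩
      rintro rfl
      exact hne (hp.root_eq.symm.trans h)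
    · obtain ⟨q, h1, h2, h3⟩ := ih h hk
      exact ⟨q, h1, h2, h3.of_par⟩

omit [Fintype κ] in
theorem eq_of_isDesc_of_par_eq {q q' x : κ} (hq : q ≠ root) (hq' : q' ≠ root)
    (h : par q = par q') (h1 : IsDesc par q x) (h2 : IsDesc par q' x) : q = q' := by
  by_contra hne
  obtain ⟨i, rfl⟩ := h1
  obtain ⟨j, rfl⟩ := h2
  rcases le_total i j with hij | hij
  · refine hp.not_isDesc_sibling hq' (Ne.symm hne) h.symm ⟨j - i, ?_⟩
    rw [← Function.iterate_add_apply, Nat.sub_add_cancel hij]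
  · refine hp.not_isDesc_sibling hq hne h ⟨i - j, ?_⟩
    rw [← Function.iterate_add_apply, Nat.sub_add_cancel hij]

-- Besides the two passes through the edge above c, the count consists of the subtrees of the
-- children, which are disjoint.
open Classical in
theorem subtreeLen_eq (c : κ) : subtreeLen par c =
    2 + ∑ q ∈ Finset.univ.filter (fun q => q ≠ root ∧ par q = c), subtreeLen par q := by
  have h : Finset.univ.filter (fun x => IsDesc par c x) =
      insert c ((Finset.univ.filter (fun q => q ≠ root ∧ par q = c)).biUnion
        fun q => Finset.univ.filter (fun x => IsDesc par q x)) := by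
    ext x
    simp only [Finset.mem_filter, Finset.mem_univ, true_and, Finset.mem_insert, Finset.mem_biUnion]
    constructor
    · intro hx
      by_cases hxc : x = c
      · exact Or.inl hxc
      · obtain ⟨q, h1, h2, h3⟩ := hp.exists_child hx hxc
        exact Or.inr ⟨q, ⟨h1, h2⟩, h3⟩
    · rintro (rfl | ⟨q, ⟨_, rfl⟩, h3⟩)
      · exact IsDesc.refl _
      · exact IsDesc.trans ⟨1, rfl⟩ h3
  rw [subtreeLen, h, Finset.card_insert_of_notMem, Finset.card_biUnion, mul_add, Finset.mul_sum,
    add_comm]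
  · rfl
  · intro q hq q' hq' hne
    rw [Finset.mem_coe, Finset.mem_filter] at hq hq'
    replace hq := hq.2
    replace hq' := hq'.2
    rw [Function.onFun, Finset.disjoint_left]
    intro x hx hx'
    simp only [Finset.mem_filter, Finset.mem_univ, true_and] at hx hx'
    exact hne (hp.eq_of_isDesc_of_par_eq hq.1 hq'.1 (hq.2.trans hq'.2.symm) hx hx')
  · intro hm
    simp only [Finset.mem_biUnion, Finset.mem_filter, Finset.mem_univ, true_and] at hm
    obtain ⟨q, ⟨hq, rfl⟩, h⟩ := hm
    exact hp.not_isDesc_par hq h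

theorem enterTime_root : enterTime root par rank root = 0 := by
  classical
  refine Finset.sum_eq_zero fun a ha => ?_
  simp only [Finset.mem_filter, Finset.mem_univ, true_and] at ha
  exact absurd (hp.isDesc_root_iff.1 ha.2) ha.1

theorem enterTime_eq {c : κ} (hc : c ≠ root) : enterTime root par rank c =
    enterTime root par rank (par c) + siblingOffset root par rank c := by
  classical
  have h : Finset.univ.filter (fun a => a ≠ root ∧ IsDesc par a c) =
      insert c (Finset.univ.filter (fun a => a ≠ root ∧ IsDesc par a (par c))) := by
    ext a
    simp only [Finset.mem_filter, Finset.mem_univ, true_and, Finset.mem_insert]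
    constructor
    · rintro ⟨h1, h2⟩
      by_cases hca : c = a
      · exact Or.inl hca.symm
      · exact Or.inr ⟨h1, h2.to_par hca⟩
    · rintro (rfl | ⟨h1, h2⟩)
      · exact ⟨hc, IsDesc.refl _⟩
      · exact ⟨h1, h2.of_par⟩
  have h2 : c ∉ Finset.univ.filter (fun a => a ≠ root ∧ IsDesc par a (par c)) := by
    simp only [Finset.mem_filter, Finset.mem_univ, true_and, not_and]
    exact fun _ => hp.not_isDesc_par hc
  unfold enterTime
  convert (congrArg (fun S => ∑ a ∈ S, siblingOffset root par rank a) h).trans ?_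
  rw [Finset.sum_insert h2, add_comm]

omit hp in
theorem siblingOffset_lt {a b : κ} (ha : a ≠ root) (hab : par a = par b) (h : rank a < rank b) :
    siblingOffset root par rank a + subtreeLen par a ≤ siblingOffset root par rank b := by
  classical
  rw [siblingOffset, siblingOffset, add_assoc]
  refine Nat.add_le_add_left ?_ 1
  rw [add_comm, ← Finset.sum_insert (s := Finset.univ.filter
    (fun s => s ≠ root ∧ par s = par a ∧ rank s < rank a)) (by simp)]
  refine Finset.sum_le_sum_of_subset ?_
  intro s hs
  simp only [Finset.mem_filter, Finset.mem_univ, true_and, Finset.mem_insert] at hs ⊢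
  rcases hs with rfl | ⟨h1, h2, h3⟩
  · exact ⟨ha, hab, h⟩
  · exact ⟨h1, h2.trans hab, h3.trans h⟩

variable (hrank : ∀ a b, a ≠ root → b ≠ root → par a = par b → rank a = rank b → a = b)
include hrank

omit hp in
/-- The offset of the next sibling. -/
theorem siblingOffset_next {c s : κ} (hc : c ≠ root) (hs : par s = par c)
    (hlt : rank c < rank s) (hmin : ∀ s', s' ≠ root → par s' = par c → rank c < rank s' →
      rank s ≤ rank s') :
    siblingOffset root par rank s = siblingOffset root par rank c + subtreeLen par c := by
  classical
  rw [siblingOffset, siblingOffset, add_assoc]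
  congr 1
  rw [add_comm (Finset.sum _ _), ← Finset.sum_insert (s := Finset.univ.filter
    (fun s => s ≠ root ∧ par s = par c ∧ rank s < rank c)) (by simp)]
  refine Finset.sum_congr ?_ fun _ _ => rfl
  ext a
  simp only [Finset.mem_filter, Finset.mem_univ, true_and, Finset.mem_insert]
  constructor
  · rintro ⟨h1, h2, h3⟩
    rw [hs] at h2
    rcases lt_trichotomy (rank a) (rank c) with h | h | h
    · exact Or.inr ⟨h1, h2, h⟩
    · exact Or.inl (hrank a c h1 hc h2 h)
    · have := hmin a h1 h2 h; omega
  · rintro (rfl | ⟨h1, h2, h3⟩)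
    · exact ⟨hc, hs.symm, hlt⟩
    · exact ⟨h1, h2.trans hs.symm, h3.trans hlt⟩

/-- The offset of the last sibling. -/
theorem siblingOffset_last {c : κ} (hc : c ≠ root)
    (hmax : ∀ s, s ≠ root → par s = par c → ¬ rank c < rank s) :
    siblingOffset root par rank c + subtreeLen par c + 1 = subtreeLen par (par c) := by
  classical
  rw [siblingOffset, hp.subtreeLen_eq (par c)]
  have : Finset.univ.filter (fun q => q ≠ root ∧ par q = par c) = insert c (Finset.univ.filter
      (fun s => s ≠ root ∧ par s = par c ∧ rank s < rank c)) := by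
    ext a
    simp only [Finset.mem_filter, Finset.mem_univ, true_and, Finset.mem_insert]
    constructor
    · rintro ⟨h1, h2⟩
      rcases lt_trichotomy (rank a) (rank c) with h | h | h
      · exact Or.inr ⟨h1, h2, h⟩
      · exact Or.inl (hrank a c h1 hc h2 h)
      · exact absurd h (hmax a h1 h2)
    · rintro (rfl | ⟨h1, h2, -⟩)
      · exact ⟨hc, rfl⟩
      · exact ⟨h1, h2⟩
  rw [this, Finset.sum_insert (by simp)]
  omega

omit hrank in
theorem enterTime_first {c s : κ} (hs : s ≠ root) (hsc : par s = c)
    (hmin : ∀ s', s' ≠ root → par s' = c → rank s ≤ rank s') :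
    enterTime root par rank s = enterTime root par rank c + 1 := by
  classical
  have h0 : siblingOffset root par rank s = 1 + 0 := by
    refine congrArg (1 + ·) (Finset.sum_eq_zero fun a ha => ?_)
    simp only [Finset.mem_filter, Finset.mem_univ, true_and] at ha
    have := hmin a ha.1 (ha.2.1.trans hsc)
    omega
  rw [hp.enterTime_eq hs, hsc, h0]

omit hrank in
theorem siblingOffset_add_le {c : κ} (hc : c ≠ root) :
    siblingOffset root par rank c + subtreeLen par c + 1 ≤ subtreeLen par (par c) := by
  classical
  rw [siblingOffset, hp.subtreeLen_eq (par c)]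
  have : insert c (Finset.univ.filter (fun s => s ≠ root ∧ par s = par c ∧ rank s < rank c)) ⊆
      Finset.univ.filter (fun q => q ≠ root ∧ par q = par c) := by
    intro a ha
    simp only [Finset.mem_filter, Finset.mem_univ, true_and, Finset.mem_insert] at ha ⊢
    rcases ha with rfl | ⟨h1, h2, -⟩
    · exact ⟨hc, rfl⟩
    · exact ⟨h1, h2⟩
  have h2 := Finset.sum_le_sum_of_subset (f := subtreeLen par) this
  rw [Finset.sum_insert (by simp)] at h2
  omega

-- Induction towards the root: the subtree of c fits into that of its parent before the closing
-- pass. Hence no computed position exceeds the length of the tour.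
omit hrank in
theorem enterTime_add_le {c : κ} (hc : c ≠ root) :
    enterTime root par rank c + subtreeLen par c + 1 ≤ subtreeLen par root := by
  induction hd : T.dist root c using Nat.strong_induction_on generalizing c with
  | _ n ih =>
    have h1 := hp.enterTime_eq (rank := rank) hc
    have h2 := hp.siblingOffset_add_le (rank := rank) hc
    by_cases h : par c = root
    · rw [h, hp.enterTime_root] at h1
      rw [h] at h2
      omega
    · have h3 := hp.dist c hc
      have := ih _ (by omega) h rfl
      omega

/-- There is a tour in which the edge to and from `c` has the computed positions. -/
theorem exists_orderedTour [DecidableEq κ] [Nontrivial κ] (hT : T.IsTree) :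
    ∃ B, IsEulerTour T B ∧ StartsAt B root ∧ ∀ c, c ≠ root →
      entryIdx B (par c, c) + 1 = enterTime root par rank c ∧
      entryIdx B (c, par c) + 2 = enterTime root par rank c + subtreeLen par c := by
  classical
  obtain ⟨N, hN⟩ : ∃ N, N = 2 * Nat.card κ - 2 := ⟨_, rfl⟩
  have hcard : 1 < Nat.card κ := Finite.one_lt_card
  have hroot : subtreeLen par root = N + 2 := by
    rw [subtreeLen, Finset.filter_true_of_mem fun x _ => hp.isDesc_root x, Finset.card_univ,
      ← Nat.card_eq_fintype_card]
    omega
  -- `IsKey e k` says that the formulas assign position k to the directed edge e. The tour is built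
  -- by following the keys 1, 2, …, N.
  let IsKey : κ × κ → ℕ → Prop := fun e k => ∃ c, c ≠ root ∧
    ((e = (par c, c) ∧ k = enterTime root par rank c) ∨
      (e = (c, par c) ∧ k + 1 = enterTime root par rank c + subtreeLen par c))
  have hfirst : ∀ c, (∃ q, q ≠ root ∧ par q = c) → ∃ e, e.1 = c ∧
      IsKey e (enterTime root par rank c + 1) := by
    rintro c ⟨q, hq, hqc⟩
    obtain ⟨s, ⟨hs1, hs2⟩, hs3⟩ := Set.exists_min_image {q | q ≠ root ∧ par q = c} rank
      (Set.toFinite _) ⟨q, hq, hqc⟩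
    exact ⟨(par s, s), hs2, s, hs1, Or.inl ⟨rfl, (hp.enterTime_first hs1 hs2 fun s' h1 h2 =>
      hs3 s' ⟨h1, h2⟩).symm⟩⟩
  -- After entering c comes its first child or, at a leaf, the way back. After leaving c comes its
  -- next sibling or else the upward pass of its parent. The key grows by one each time, and the
  -- tour stops at the root with key N.
  have hnext : ∀ e k, IsKey e k → (k = N ∧ e.2 = root) ∨ ∃ e', e'.1 = e.2 ∧ IsKey e' (k + 1) := by
    rintro e k ⟨c, hc, ⟨rfl, rfl⟩ | ⟨rfl, hk⟩⟩
    · right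
      by_cases hch : ∃ q, q ≠ root ∧ par q = c
      · exact hfirst c hch
      · refine ⟨(c, par c), rfl, c, hc, Or.inr ⟨rfl, ?_⟩⟩
        rw [hp.subtreeLen_eq c]
        refine congrArg (fun m => enterTime root par rank c + (2 + m))
          (Finset.sum_eq_zero fun q hq => ?_).symm
        simp only [Finset.mem_filter] at hq
        exact absurd ⟨q, hq.2⟩ hch
    · have h2 := two_le_subtreeLen (par := par) c
      by_cases hsib : ∃ s, s ≠ root ∧ par s = par c ∧ rank c < rank s
      · right
        obtain ⟨s, ⟨hs1, hs2, hs3⟩, hs4⟩ := Set.exists_min_image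
          {s | s ≠ root ∧ par s = par c ∧ rank c < rank s} rank (Set.toFinite _) hsib
        refine ⟨(par s, s), hs2, s, hs1, Or.inl ⟨rfl, ?_⟩⟩
        rw [hp.enterTime_eq hs1, siblingOffset_next hrank hc hs2 hs3 fun s' h1 h2 h3 =>
          hs4 s' ⟨h1, h2, h3⟩, hs2, hk, hp.enterTime_eq hc]
        omega
      · have hl := hp.siblingOffset_last hrank hc fun s h1 h2 h3 => hsib ⟨s, h1, h2, h3⟩
        have he := hp.enterTime_eq (rank := rank) hc
        by_cases hpr : par c = root
        · left
          rw [hpr, hroot] at hl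
          rw [hpr, hp.enterTime_root] at he
          exact ⟨by omega, hpr⟩
        · right
          exact ⟨(par c, par (par c)), rfl, par c, hpr, Or.inr ⟨rfl, by omega⟩⟩
  have hadjkey : ∀ e k, IsKey e k → T.Adj e.1 e.2 := by
    rintro e k ⟨c, hc, ⟨rfl, -⟩ | ⟨rfl, -⟩⟩
    · exact (hp.adj c hc).symm
    · exact hp.adj c hc
  have build : ∀ j k x, j + k = N → (k = N → x = root) →
      (k < N → ∃ e, e.1 = x ∧ IsKey e (k + 1)) →
      ∃ B : List (κ × κ), B.length = j ∧ IsWalk x B root ∧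
        ∀ (i : ℕ) (hi : i < B.length), IsKey B[i] (k + i + 1) := by
    intro j
    induction j with
    | zero =>
      intro k x hk h _
      exact ⟨[], rfl, h (by omega), fun i hi => absurd hi (Nat.not_lt_zero _)⟩
    | succ j ih =>
      intro k x hk _ h
      obtain ⟨e, he, hek⟩ := h (by omega)
      obtain ⟨B, hB1, hB2, hB3⟩ := ih (k + 1) e.2 (by omega) (fun hkN => by
        rcases hnext e _ hek with ⟨-, h⟩ | ⟨e', he', c, hc, hcase⟩
        · exact h
        -- A continuation would have key N + 1, beyond all computed positions.
        · exfalso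
          have hle : enterTime root par rank c + subtreeLen par c ≤ N + 1 := by
            have := hp.enterTime_add_le (rank := rank) hc
            omega
          have := two_le_subtreeLen (par := par) c
          rcases hcase with ⟨-, h⟩ | ⟨-, h⟩ <;> omega) (fun hkN => by
        rcases hnext e _ hek with ⟨h, -⟩ | h
        · omega
        · exact h)
      refine ⟨e :: B, by simp [hB1], ⟨he, hB2⟩, fun i hi => ?_⟩
      cases i with
      | zero => exact hek
      | succ i =>
        have := hB3 i (by simpa using hi)
        rw [List.getElem_cons_succ]
        convert this using 1
        omega
  obtain ⟨x, hx⟩ := exists_ne root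
  obtain ⟨q, hq, hqr, -⟩ := hp.exists_child (hp.isDesc_root x) hx
  obtain ⟨B, hB1, hB2, hB3⟩ := build N 0 root (by omega) (fun _ => rfl) (fun _ => by
    have := hfirst root ⟨q, hq, hqr⟩
    rwa [hp.enterTime_root] at this)
  have huniq : ∀ e k k', IsKey e k → IsKey e k' → k = k' := by
    have hpp : ∀ c c', c ≠ root → c' ≠ root → c = par c' → par c = c' → False := by
      intro c c' hc hc' h1 h2
      have d1 := hp.dist c hc
      have d2 := hp.dist c' hc'
      rw [h2] at d1
      rw [← h1] at d2
      omega
    rintro e k k' ⟨c, hc, ⟨rfl, h1⟩ | ⟨rfl, h1⟩⟩ ⟨c', hc', ⟨h2, h3⟩ | ⟨h2, h3⟩⟩ <;>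
      simp only [Prod.mk.injEq] at h2
    · rw [h1, h3, h2.2]
    · exact (hpp c c' hc hc' h2.2 h2.1).elim
    · exact (hpp c c' hc hc' h2.1 h2.2).elim
    · rw [h2.1] at h1
      omega
  have hnd : B.Nodup := by
    rw [List.nodup_iff_injective_getElem]
    intro i j hij
    have h1 := hB3 i i.2
    have h2 := hB3 j j.2
    simp only at hij
    rw [hij] at h1
    have := huniq _ _ _ h1 h2
    exact Fin.ext (by omega)
  -- B has N distinct entries, all of them edges of T, and T has exactly N directed edges.
  have hall : ∀ x y, (x, y) ∈ B ↔ T.Adj x y := by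
    let S : Finset (κ × κ) := Finset.univ.filter fun e => T.Adj e.1 e.2
    have hsub : B.toFinset ⊆ S := by
      intro e he
      obtain ⟨i, hi, rfl⟩ := List.mem_iff_getElem.1 (List.mem_toFinset.1 he)
      simpa [S] using hadjkey _ _ (hB3 i hi)
    have hS : S.card = N := (card_adj_pairs hT S fun e => by simp [S]).trans hN.symm
    have heq := Finset.eq_of_subset_of_card_le hsub (by
      rw [List.toFinset_card_of_nodup hnd, hS, hB1])
    intro x y
    rw [← List.mem_toFinset, heq]
    simp [S]
  have hidx : ∀ e k, IsKey e k → entryIdx B e + 1 = k := by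
    intro e k hk
    have hl := entryIdx_lt_length ((hall e.1 e.2).2 (hadjkey e k hk))
    have h1 := hB3 _ hl
    rw [getElem_entryIdx hl] at h1
    have := huniq e (0 + entryIdx B e + 1) k h1 hk
    omega
  refine ⟨B, isEulerTour_of_isWalk hT hnd hall hB2, ?_, fun c hc => ⟨hidx _ _ ⟨c, hc, Or.inl
    ⟨rfl, rfl⟩⟩, ?_⟩⟩
  · intro e he
    cases B with
    | nil => simp at he
    | cons a B =>
      simp only [List.head?_cons, Option.mem_def, Option.some.injEq] at he
      rw [← he]
      exact hB2.1
  · have h2 := two_le_subtreeLen (par := par) c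
    have := hidx (c, par c) (enterTime root par rank c + subtreeLen par c - 1) ⟨c, hc, Or.inr
      ⟨rfl, by omega⟩⟩
    omega

end IsParentMap

end OrderedTour

/-! ### Existence of executions -/

namespace JoinInstance

variable {V : Type u} [Fintype V] [DecidableEq V] (I : JoinInstance V)

omit [Fintype V] in
theorem startsAt_rotate [Finite V] {c : Cluster I.leader} {x : V} (hx : I.leader x = c.1) :
    StartsAt ((I.tourOn c).rotate (firstPos (I.tourOn c) x)) x := by
  intro e he
  have hne : I.tourOn c ≠ [] := by
    intro h
    rw [h] at he
    simp at he
  obtain ⟨d, hd⟩ := List.exists_mem_of_ne_nil _ hne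
  obtain ⟨h1, h2, h3⟩ := mem_tourOn.1 hd
  have : Nontrivial (Members I.leader c) := ⟨_, _, h3.ne⟩
  obtain ⟨y, hy⟩ := (I.tree_isTree c).connected.preconnected.exists_adj_of_nontrivial ⟨x, hx⟩
  have hlt := firstPos_lt_length (mem_tourOn.2 ⟨hx, y.2, hy⟩)
  rw [List.head?_eq_getElem?, List.getElem?_rotate (by omega), zero_add, Nat.mod_eq_of_lt hlt,
    List.getElem?_eq_getElem hlt, Option.mem_def, Option.some.injEq] at he
  rw [← he]
  exact getElem_firstPos hlt

/-- An execution in which the given tour of the clusters determines the root and breaks ties between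
siblings, and the new tour is the one with the computed positions. -/
structure _root_.JoinRun.IsCanonical {I : JoinInstance V} (r : JoinRun I) (Q : ℕ) : Prop where
  startsAt : StartsAt I.A r.root
  base_root : ∀ e ∈ I.A.head?, r.base r.root = (I.g e.1 e.2).1
  localTour_eq : ∀ c, r.localTour c = (I.tourOn c).rotate (firstPos (I.tourOn c) (r.base c))
  rank_eq : ∀ c, r.rank c = firstPos (r.localTour (r.par c)) (I.g (r.par c) c).1 * Q +
    (entryIdx I.A (r.par c, c) + 1)
  entryIdx_newA : ∀ c, c ≠ r.root →
    entryIdx r.newA (r.par c, c) + 1 = enterTime r.root r.par r.rank c ∧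
    entryIdx r.newA (c, r.par c) + 2 = enterTime r.root r.par r.rank c + subtreeLen r.par c

/-- With the source of the first entry of A as root, A needs no shift. A rank has two digits in base
Q: the position of the terminal, as the algorithm demands, and the position in A, which is below Q,
determines the child and so breaks ties. -/
theorem exists_isCanonical [Nontrivial (Cluster I.leader)] {Q : ℕ} (hQ : I.A.length < Q) :
    ∃ r : JoinRun I, r.IsCanonical Q := by
  have hA := I.A_isEulerTour
  have hlen : 0 < I.A.length := by
    rw [hA.length_eq]
    have := Finite.one_lt_card (α := Cluster I.leader)
    omega
  obtain ⟨e₀, he₀⟩ : ∃ e, e = I.A[0] := ⟨_, rfl⟩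
  have hhead : I.A.head? = some e₀ := by rw [List.head?_eq_getElem?, he₀]; simp [hlen]
  have hadj : I.T.Adj e₀.1 e₀.2 := he₀ ▸ hA.adj _ (List.getElem_mem hlen)
  obtain ⟨root, hroot⟩ : ∃ root, root = e₀.1 := ⟨_, rfl⟩
  have hst : StartsAt I.A root := by
    intro e he
    rw [hhead, Option.mem_def, Option.some.injEq] at he
    rw [hroot, he]
  obtain ⟨par, hp⟩ := exists_isParentMap I.T_isTree root
  obtain ⟨base, hbase⟩ : ∃ base : Cluster I.leader → V, ∀ c, base c =
      if c = root then (I.g e₀.1 e₀.2).1 else (I.g c (par c)).1 := ⟨_, fun _ => rfl⟩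
  have hbl : ∀ c, I.leader (base c) = c.1 := by
    intro c
    rw [hbase]
    split_ifs with h
    · rw [h, hroot]; exact (I.g_mem _ _ hadj).1
    · exact (I.g_mem _ _ (hp.adj c h)).1
  obtain ⟨tour, htour⟩ : ∃ tour : Cluster I.leader → List (V × V), ∀ c, tour c =
      (I.tourOn c).rotate (firstPos (I.tourOn c) (base c)) := ⟨_, fun _ => rfl⟩
  obtain ⟨rank, hrank⟩ : ∃ rank : Cluster I.leader → ℕ, ∀ c, rank c =
      firstPos (tour (par c)) (I.g (par c) c).1 * Q + (entryIdx I.A (par c, c) + 1) :=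
    ⟨_, fun _ => rfl⟩
  have hidx : ∀ c, c ≠ root → entryIdx I.A (par c, c) < I.A.length := fun c hc =>
    entryIdx_lt_length (hA.mem_iff.2 (hp.adj c hc).symm)
  have hinj : ∀ a b, a ≠ root → b ≠ root → par a = par b → rank a = rank b → a = b := by
    intro a b ha hb hab h
    rw [hrank, hrank] at h
    have h1 := hidx a ha
    have h2 := hidx b hb
    have h3 : (entryIdx I.A (par a, a) + 1) % Q = (entryIdx I.A (par b, b) + 1) % Q := by
      have := congrArg (· % Q) h
      simpa only [Nat.mul_add_mod_self_right] using this
    rw [Nat.mod_eq_of_lt (by omega), Nat.mod_eq_of_lt (by omega)] at h3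
    have h4 := getElem_entryIdx h1
    have h5 := getElem_entryIdx h2
    have h6 : entryIdx I.A (par a, a) = entryIdx I.A (par b, b) := by omega
    simp only [h6] at h4
    exact congrArg Prod.snd (h4.symm.trans h5)
  obtain ⟨B, hB, hBs, hBi⟩ := hp.exists_orderedTour hinj I.T_isTree
  refine ⟨{
    root := root
    shiftedA := I.A
    shiftedA_isRotated := List.IsRotated.refl _
    shiftedA_startsAt := hst
    par := par
    par_root := hp.root_eq
    par_adj := fun c hc => ⟨hp.adj c hc, hp.dist c hc⟩
    base := base
    base_eq := fun c hc => by rw [hbase, if_neg hc]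
    base_root := ⟨by
      rw [hbase, if_pos rfl]
      exact ⟨_, _, _, hadj, rfl⟩, hbl root⟩
    localTour := tour
    localTour_isRotated := fun c => by
      rw [htour]; exact (List.IsRotated.symm ⟨_, rfl⟩)
    localTour_startsAt := fun c => by
      rw [htour]; exact I.startsAt_rotate (hbl c)
    rank := rank
    rank_injective := hinj
    rank_lt := fun a b ha hb hab h => by
      rw [hrank, hrank]
      have h1 := hidx a ha
      have h2 := Nat.mul_le_mul_right Q (Nat.succ_le_of_lt h)
      rw [Nat.succ_mul] at h2
      omega
    newA := B
    newA_isEulerTour := hB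
    newA_startsAt := hBs
    newA_ordered := fun a b ha hb hab h => by
      rw [hp.firstPos_eq I.T_isTree hB hBs ha, hp.firstPos_eq I.T_isTree hB hBs hb,
        (hBi a ha).1, (hBi b hb).1, hp.enterTime_eq ha, hp.enterTime_eq hb, hab]
      have := IsParentMap.siblingOffset_lt (rank := rank) ha hab h
      have := two_le_subtreeLen (par := par) a
      omega }, ⟨hst, ?_, htour, hrank, hBi⟩⟩
  intro e he
  rw [hhead, Option.mem_def, Option.some.injEq] at he
  rw [← he]
  exact (hbase root).trans (if_pos rfl)

theorem exists_isOutput : ∃ B, I.IsOutput B := by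
  rcases subsingleton_or_nontrivial (Cluster I.leader) with h | h
  · obtain ⟨c⟩ := I.T_isTree.connected.nonempty
    exact ⟨_, Or.inl ⟨c, fun d => Subsingleton.elim d c, rfl⟩⟩
  · obtain ⟨r, -⟩ := I.exists_isCanonical (Nat.lt_succ_self _)
    exact ⟨_, Or.inr ⟨h, r, rfl⟩⟩

end JoinInstance

/-! ### The annotation program of the join algorithm -/

/-- The sum of the weights of the indices whose keys lie in the range of width `wd` from `lo`. -/
def sumIn {ι : Type u} [Fintype ι] (κ ω : ι → ℕ) (lo wd : ℕ) : ℕ :=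
  ∑ i, if lo ≤ κ i ∧ κ i < lo + wd then ω i else 0

/-- The numbers in the input records: the entries `(pos, src, dst)` of the tour of the clusters, the
edges `(a, b)` between clusters with their images `(x, y)`, and the entries `(t, u, v)` of the tours
of the clusters `c`. Pairs of numbers are encoded in base `Q`. -/
structure JoinTables (α : Type) (β γ : Type u) where
  Q : ℕ
  (pos src dst : α → ℕ)
  (a b x y : β → ℕ)
  (c t u v : γ → ℕ)

namespace JoinTables

variable {α : Type} {β γ : Type u} [Fintype α] [Fintype β] [Fintype γ] (S : JoinTables α β γ)

/-- The position of `(a, b)` in the tour of the clusters. -/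
def posFwd (e : β) : ℕ := sumIn (fun s => S.src s * S.Q + S.dst s) S.pos (S.a e * S.Q + S.b e) 1

/-- The position of `(b, a)` in the tour of the clusters. -/
def posBwd (e : β) : ℕ := sumIn (fun s => S.src s * S.Q + S.dst s) S.pos (S.b e * S.Q + S.a e) 1

/-- The position of the downward pass through an edge. -/
def down (e : β) : ℕ := min (S.posFwd e) (S.posBwd e)

/-- The position of the upward pass through an edge. -/
def up (e : β) : ℕ := max (S.posFwd e) (S.posBwd e)

/-- The parent cluster of an edge. -/
def parent (e : β) : ℕ := if S.posFwd e < S.posBwd e then S.a e else S.b e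

/-- The child cluster of an edge. -/
def child (e : β) : ℕ := if S.posFwd e < S.posBwd e then S.b e else S.a e

/-- The terminal of an edge in the parent cluster. -/
def parentNode (e : β) : ℕ := if S.posFwd e < S.posBwd e then S.x e else S.y e

/-- The terminal of an edge in the child cluster. -/
def childNode (e : β) : ℕ := if S.posFwd e < S.posBwd e then S.y e else S.x e

/-- The length of the tour of the subtree below an edge. -/
def len (e : β) : ℕ := sumIn S.down (fun _ => 2) (S.down e) (S.up e + 1 - S.down e)

/-- The successor of the base of a nonroot cluster, else `0`. -/
def baseBelow (z : γ) : ℕ := sumIn S.child (fun e => S.childNode e + 1) (S.c z) 1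

/-- The successor of the base of the root cluster, else `0`. -/
def baseRoot (z : γ) : ℕ :=
  sumIn S.parent (fun e => if S.down e = 1 then S.parentNode e + 1 else 0) (S.c z) 1

/-- The successor of the base of a cluster. -/
def base (z : γ) : ℕ := S.baseBelow z + S.baseRoot z

/-- The number of earlier entries of a cluster tour with the same source. -/
def earlier (z : γ) : ℕ := sumIn (fun z => S.u z * S.Q + S.t z) (fun _ => 1) (S.u z * S.Q) (S.t z)

/-- The position of the first entry of the shifted cluster tour. -/
def start (z : γ) : ℕ :=
  sumIn S.c (fun z => if S.earlier z = 0 ∧ S.u z + 1 = S.base z then S.t z else 0) (S.c z) 1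

/-- The length of a cluster tour. -/
def tourLen (z : γ) : ℕ := sumIn S.c (fun _ => 1) (S.c z) 1

/-- The position of an entry, from `0`, in the shifted cluster tour. -/
def shifted (z : γ) : ℕ :=
  if S.start z = 0 then S.t z - 1 else if S.start z ≤ S.t z then S.t z - S.start z else
    S.t z + S.tourLen z - S.start z

/-- The number of earlier entries of a shifted cluster tour with the same source. -/
def earlierShifted (z : γ) : ℕ :=
  sumIn (fun z => S.u z * S.Q + S.shifted z) (fun _ => 1) (S.u z * S.Q) (S.shifted z)

/-- The first position of the parent terminal of an edge in its shifted cluster tour. -/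
def nodePos (e : β) : ℕ :=
  sumIn S.u (fun z => if S.earlierShifted z = 0 then S.shifted z else 0) (S.parentNode e) 1

/-- The total length of the subtrees of the preceding siblings. -/
def before (e : β) : ℕ :=
  sumIn (fun e => (S.parent e * S.Q + S.nodePos e) * S.Q + S.down e) S.len
    (S.parent e * S.Q * S.Q) (S.nodePos e * S.Q + S.down e)

/-- The offset of an edge from the entry into its parent cluster. -/
def offset (e : β) : ℕ := 1 + S.before e

/-- The sum of the offsets of all edges that have been entered. -/
def sumEntered (e : β) : ℕ := sumIn S.down S.offset 0 (S.down e + 1)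

/-- The sum of the offsets of all edges that have been left. -/
def sumLeft (e : β) : ℕ := sumIn S.up S.offset 0 (S.down e)

/-- The position of the downward pass in the new tour. -/
def newDown (e : β) : ℕ := S.sumEntered e - S.sumLeft e

/-- The position of the upward pass in the new tour. -/
def newUp (e : β) : ℕ := S.newDown e + S.len e - 1

/-- The position of the entry into a cluster in the new tour. -/
def enter (z : γ) : ℕ := sumIn S.child S.newDown (S.c z) 1

/-- The total length of the subtrees visited from a cluster before an entry of its tour. -/
def visited (z : γ) : ℕ :=
  sumIn (fun e => S.parent e * S.Q + S.nodePos e) S.len (S.c z * S.Q) (S.shifted z + 1)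

/-- The position in the new tour of the last arrival before an entry of a cluster tour. -/
def arrival (z : γ) : ℕ := S.enter z + S.visited z

/-- The number of entries of cluster tours that precede a given one in the output. -/
def localBefore (z : γ) : ℕ :=
  sumIn (fun z => S.arrival z * S.Q + S.shifted z) (fun _ => 1) 0
    (S.arrival z * S.Q + S.shifted z)

/-- The number of entries of cluster tours that precede the downward pass in the output. -/
def beforeDown (e : β) : ℕ :=
  sumIn (fun z => S.arrival z * S.Q + S.shifted z) (fun _ => 1) 0 (S.newDown e * S.Q)

/-- The number of entries of cluster tours that precede the upward pass in the output. -/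
def beforeUp (e : β) : ℕ :=
  sumIn (fun z => S.arrival z * S.Q + S.shifted z) (fun _ => 1) 0 (S.newUp e * S.Q)

end JoinTables

/-! ### Its steps on annotated records -/

namespace JoinSteps

/-- A step in which the records of kind `dst` collect weights of the records of kind `src`. -/
def kindStep (src dst : ℕ) (κ ω lo wd : List ℕ → ℕ) : SumStep where
  κ := κ
  lo := lo
  hi l := lo l + if l.getD 0 0 = dst then wd l else 0
  ω r := if r.getD 0 0 = src then ω r else 0
  le _ := Nat.le_add_right _ _

/-- Entry `k` of a record. -/
def fld (k : ℕ) (r : List ℕ) : ℕ := r.getD k 0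

/-- Fields 0 to 4 hold the padded input record, field 5 + j the result of step j: 5 `posFwd`, 6
`posBwd`, 7 `len`, 8 `baseBelow`, 9 `baseRoot`, 10 `earlier`, 11 `start`, 12 `tourLen`, 13
`earlierShifted`, 14 `nodePos`, 15 `before`, 16 `sumEntered`, 17 `sumLeft`, 18 `enter`, 19
`visited`, 20 `localBefore`, 21 `beforeDown`, 22 `beforeUp`. -/
def down (r : List ℕ) : ℕ := min (fld 5 r) (fld 6 r)
def up (r : List ℕ) : ℕ := max (fld 5 r) (fld 6 r)
def parent (r : List ℕ) : ℕ := if fld 5 r < fld 6 r then fld 1 r else fld 2 r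
def child (r : List ℕ) : ℕ := if fld 5 r < fld 6 r then fld 2 r else fld 1 r
def parentNode (r : List ℕ) : ℕ := if fld 5 r < fld 6 r then fld 3 r else fld 4 r
def childNode (r : List ℕ) : ℕ := if fld 5 r < fld 6 r then fld 4 r else fld 3 r
def shifted (r : List ℕ) : ℕ :=
  if fld 11 r = 0 then fld 2 r - 1 else if fld 11 r ≤ fld 2 r then fld 2 r - fld 11 r else
    fld 2 r + fld 12 r - fld 11 r
def newDown (r : List ℕ) : ℕ := fld 16 r - fld 17 r
def newUp (r : List ℕ) : ℕ := newDown r + fld 7 r - 1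
def arrival (r : List ℕ) : ℕ := fld 18 r + fld 19 r

/-- The steps of the annotation program. -/
def steps (Q : ℕ) (j : ℕ) : SumStep :=
  [kindStep 2 3 (fun r => fld 2 r * Q + fld 3 r) (fld 1) (fun r => fld 1 r * Q + fld 2 r) fun _ => 1,
   kindStep 2 3 (fun r => fld 2 r * Q + fld 3 r) (fld 1) (fun r => fld 2 r * Q + fld 1 r) fun _ => 1,
   kindStep 3 3 down (fun _ => 2) down (fun r => up r + 1 - down r),
   kindStep 3 5 child (fun r => childNode r + 1) (fld 1) fun _ => 1,
   kindStep 3 5 parent (fun r => if down r = 1 then parentNode r + 1 else 0) (fld 1) fun _ => 1,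
   kindStep 5 5 (fun r => fld 3 r * Q + fld 2 r) (fun _ => 1) (fun r => fld 3 r * Q) (fld 2),
   kindStep 5 5 (fld 1)
     (fun r => if fld 10 r = 0 ∧ fld 3 r + 1 = fld 8 r + fld 9 r then fld 2 r else 0)
     (fld 1) fun _ => 1,
   kindStep 5 5 (fld 1) (fun _ => 1) (fld 1) fun _ => 1,
   kindStep 5 5 (fun r => fld 3 r * Q + shifted r) (fun _ => 1) (fun r => fld 3 r * Q) shifted,
   kindStep 5 3 (fld 3) (fun r => if fld 13 r = 0 then shifted r else 0) parentNode fun _ => 1,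
   kindStep 3 3 (fun r => (parent r * Q + fld 14 r) * Q + down r) (fld 7)
     (fun r => parent r * Q * Q) (fun r => fld 14 r * Q + down r),
   kindStep 3 3 down (fun r => 1 + fld 15 r) (fun _ => 0) (fun r => down r + 1),
   kindStep 3 3 up (fun r => 1 + fld 15 r) (fun _ => 0) down,
   kindStep 3 5 child newDown (fld 1) fun _ => 1,
   kindStep 3 5 (fun r => parent r * Q + fld 14 r) (fld 7) (fun r => fld 1 r * Q)
     (fun r => shifted r + 1),
   kindStep 5 5 (fun r => arrival r * Q + shifted r) (fun _ => 1) (fun _ => 0)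
     (fun r => arrival r * Q + shifted r),
   kindStep 5 3 (fun r => arrival r * Q + shifted r) (fun _ => 1) (fun _ => 0)
     (fun r => newDown r * Q),
   kindStep 5 3 (fun r => arrival r * Q + shifted r) (fun _ => 1) (fun _ => 0)
     (fun r => newUp r * Q)].getD j
    (kindStep 0 0 (fun _ => 0) (fun _ => 0) (fun _ => 0) fun _ => 0)

/-- The output records made from an annotated record. -/
def outRec (r : List ℕ) : List (List ℕ) :=
  if fld 0 r = 3 then [[6, fld 3 r, fld 4 r],
    [7, newDown r + fld 21 r, parentNode r, childNode r],
    [7, newUp r + fld 22 r, childNode r, parentNode r]]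
  else if fld 0 r = 4 then [[6, fld 2 r, fld 3 r]]
  else if fld 0 r = 5 then [[7, arrival r + fld 20 r + 1, fld 3 r, fld 4 r]]
  else []

end JoinSteps

namespace JoinTables

open JoinSteps

variable {α : Type} {β γ : Type u} (S : JoinTables α β γ)

def encα (s : α) : List ℕ := [2, S.pos s, S.src s, S.dst s]
def encβ (e : β) : List ℕ := [3, S.a e, S.b e, S.x e, S.y e]
def encγ (z : γ) : List ℕ := [5, S.c z, S.t z, S.u z, S.v z]

variable [Fintype α] [Fintype β] [Fintype γ]

/-- In the fully annotated rows the zeros stand for steps addressed to another kind of record, for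
which the range of summation is empty. -/
def rowα (s : α) : List ℕ := [2, S.pos s, S.src s, S.dst s, 0,
  0, 0, 0, 0, 0, 0, 0, 0, 0, 0, 0, 0, 0, 0, 0, 0, 0, 0]

def rowβ (e : β) : List ℕ := [3, S.a e, S.b e, S.x e, S.y e, S.posFwd e, S.posBwd e, S.len e,
  0, 0, 0, 0, 0, 0, S.nodePos e, S.before e, S.sumEntered e, S.sumLeft e, 0, 0, 0,
  S.beforeDown e, S.beforeUp e]

def rowγ (z : γ) : List ℕ := [5, S.c z, S.t z, S.u z, S.v z, 0, 0, 0, S.baseBelow z, S.baseRoot z,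
  S.earlier z, S.start z, S.tourLen z, S.earlierShifted z, 0, 0, 0, 0, S.enter z, S.visited z,
  S.localBefore z, 0, 0]

/-- The records of the tables, together with the records `E` of other kinds. -/
def records (E : Multiset (List ℕ)) : Multiset (List ℕ) :=
  E + Finset.univ.val.map S.encα + Finset.univ.val.map S.encβ + Finset.univ.val.map S.encγ

theorem value_of_dst_ne {src dst : ℕ} {κ ω lo wd : List ℕ → ℕ} {D : Multiset (List ℕ)} {l : List ℕ}
    (h : l.getD 0 0 ≠ dst) : (kindStep src dst κ ω lo wd).value D l = 0 := by
  refine Multiset.sum_eq_zero fun m hm => ?_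
  obtain ⟨r, -, rfl⟩ := Multiset.mem_map.1 hm
  refine if_neg fun hr => ?_
  simp only [kindStep, if_neg h] at hr
  omega

theorem value_add (s : SumStep) (D D' : Multiset (List ℕ)) (l : List ℕ) :
    s.value (D + D') l = s.value D l + s.value D' l := by
  simp [SumStep.value]

theorem value_map {ι : Type u} [Fintype ι] {src dst : ℕ} {κ ω lo wd : List ℕ → ℕ} {l : List ℕ}
    (R : ι → List ℕ) (h : ∀ i, (R i).getD 0 0 = src) (hl : l.getD 0 0 = dst) :
    (kindStep src dst κ ω lo wd).value (Finset.univ.val.map R) l =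
      sumIn (fun i => κ (R i)) (fun i => ω (R i)) (lo l) (wd l) := by
  rw [SumStep.value, Multiset.map_map]
  refine Finset.sum_congr rfl fun i _ => ?_
  simp only [kindStep, Function.comp, if_pos (h i), if_pos hl]

theorem value_of_src_ne {src dst : ℕ} {κ ω lo wd : List ℕ → ℕ} {D : Multiset (List ℕ)} {l : List ℕ}
    (h : ∀ r ∈ D, r.getD 0 0 ≠ src) : (kindStep src dst κ ω lo wd).value D l = 0 := by
  refine Multiset.sum_eq_zero fun m hm => ?_
  obtain ⟨r, hr, rfl⟩ := Multiset.mem_map.1 hm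
  simp only [kindStep, if_neg (h r hr), ite_self]

/-- The sum computed by a step from the records of kind `src` after `j` steps. -/
def columnSum (j src : ℕ) (κ ω lo wd : List ℕ → ℕ) (l : List ℕ) : ℕ :=
  if src = 2 then sumIn (fun s => κ ((S.rowα s).take (5 + j)))
    (fun s => ω ((S.rowα s).take (5 + j))) (lo l) (wd l)
  else if src = 3 then sumIn (fun e => κ ((S.rowβ e).take (5 + j)))
    (fun e => ω ((S.rowβ e).take (5 + j))) (lo l) (wd l)
  else sumIn (fun z => κ ((S.rowγ z).take (5 + j)))
    (fun z => ω ((S.rowγ z).take (5 + j))) (lo l) (wd l)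

theorem kind_ne_of_mem_map {ι : Type u} [Fintype ι] {R : ι → List ℕ} {k src : ℕ}
    (h : ∀ i, (R i).getD 0 0 = k) (hne : k ≠ src) :
    ∀ r ∈ Finset.univ.val.map R, r.getD 0 0 ≠ src := by
  intro r hr
  obtain ⟨i, -, rfl⟩ := Multiset.mem_map.1 hr
  rw [h i]
  exact hne

/-- The annotated records hold the columns of the tables. -/
theorem annotate_eq {E : Multiset (List ℕ)}
    (hE : ∀ r ∈ E, r.getD 0 0 = 0 ∨ r.getD 0 0 = 1 ∨ r.getD 0 0 = 4) (j : ℕ) (hj : j ≤ 18) :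
    (∀ r ∈ E, annotate (steps S.Q) (S.records E) j r = padRecord r ++ List.replicate j 0) ∧
    (∀ s, annotate (steps S.Q) (S.records E) j (S.encα s) = (S.rowα s).take (5 + j)) ∧
    (∀ e, annotate (steps S.Q) (S.records E) j (S.encβ e) = (S.rowβ e).take (5 + j)) ∧
    (∀ z, annotate (steps S.Q) (S.records E) j (S.encγ z) = (S.rowγ z).take (5 + j)) := by
  induction j with
  | zero => exact ⟨fun r _ => by simp [annotate], fun _ => rfl, fun _ => rfl, fun _ => rfl⟩
  | succ j ih =>
    obtain ⟨ihE, ihα, ihβ, ihγ⟩ := ih (by omega)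
    obtain ⟨E', hE'⟩ : ∃ E', E' = E.map (annotate (steps S.Q) (S.records E) j) := ⟨_, rfl⟩
    have hkind : ∀ r ∈ E, (padRecord r ++ List.replicate j 0).getD 0 0 = r.getD 0 0 := by
      intro r hr
      cases r with
      | nil => simp [padRecord]
      | cons a r => simp [padRecord]
    have hEk : ∀ k, k ≠ 0 → k ≠ 1 → k ≠ 4 → ∀ r ∈ E', r.getD 0 0 ≠ k := by
      intro k h0 h1 h4 r hr
      rw [hE'] at hr
      obtain ⟨r, hrE, rfl⟩ := Multiset.mem_map.1 hr
      rw [ihE r hrE, hkind r hrE]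
      rcases hE r hrE with h | h | h <;> omega
    have hD : (S.records E).map (annotate (steps S.Q) (S.records E) j) =
        E' + Finset.univ.val.map (fun s => (S.rowα s).take (5 + j)) +
          Finset.univ.val.map (fun e => (S.rowβ e).take (5 + j)) +
          Finset.univ.val.map (fun z => (S.rowγ z).take (5 + j)) := by
      conv_lhs => arg 2; rw [records]
      simp only [Multiset.map_add, Multiset.map_map, Function.comp_def, ihα, ihβ, ihγ, hE']
    have hα : ∀ s, ((S.rowα s).take (5 + j)).getD 0 0 = 2 := fun s => by
      simp [rowα, add_comm 5 j]
    have hβ : ∀ e, ((S.rowβ e).take (5 + j)).getD 0 0 = 3 := fun e => by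
      simp [rowβ, add_comm 5 j]
    have hγ : ∀ z, ((S.rowγ z).take (5 + j)).getD 0 0 = 5 := fun z => by
      simp [rowγ, add_comm 5 j]
    have hvalue : ∀ src dst κ ω lo wd l, (src = 2 ∨ src = 3 ∨ src = 5) → l.getD 0 0 = dst →
        (kindStep src dst κ ω lo wd).value
          ((S.records E).map (annotate (steps S.Q) (S.records E) j)) l = S.columnSum j src κ ω lo wd l := by
      intro src dst κ ω lo wd l hsrc hl
      rw [hD, value_add, value_add, value_add]
      rcases hsrc with rfl | rfl | rfl
      · rw [value_of_src_ne (hEk 2 (by omega) (by omega) (by omega)), value_map _ hα hl,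
          value_of_src_ne (kind_ne_of_mem_map hβ (by omega)), value_of_src_ne (kind_ne_of_mem_map hγ (by omega))]
        simp [columnSum]
      · rw [value_of_src_ne (hEk 3 (by omega) (by omega) (by omega)), value_map _ hβ hl,
          value_of_src_ne (kind_ne_of_mem_map hα (by omega)), value_of_src_ne (kind_ne_of_mem_map hγ (by omega))]
        simp [columnSum]
      · rw [value_of_src_ne (hEk 5 (by omega) (by omega) (by omega)), value_map _ hγ hl,
          value_of_src_ne (kind_ne_of_mem_map hα (by omega)), value_of_src_ne (kind_ne_of_mem_map hβ (by omega))]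
        simp [columnSum]
    have htake : ∀ l : List ℕ, l.length = 23 → l.take (5 + j) ++ [l.getD (5 + j) 0] =
        l.take (5 + (j + 1)) := by
      intro l hl
      rw [← add_assoc, List.take_add_one, List.getElem?_eq_getElem (by omega),
        List.getD_eq_getElem _ _ (by omega)]
      rfl
    have finish : ∀ src dst κ ω lo wd, steps S.Q j = kindStep src dst κ ω lo wd →
        (src = 2 ∨ src = 3 ∨ src = 5) → (dst = 3 ∨ dst = 5) →
        (∀ s, (S.rowα s).getD (5 + j) 0 = 0) →
        (∀ e, (S.rowβ e).getD (5 + j) 0 =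
          if dst = 3 then S.columnSum j src κ ω lo wd ((S.rowβ e).take (5 + j)) else 0) →
        (∀ z, (S.rowγ z).getD (5 + j) 0 =
          if dst = 5 then S.columnSum j src κ ω lo wd ((S.rowγ z).take (5 + j)) else 0) →
        (∀ r ∈ E, annotate (steps S.Q) (S.records E) (j + 1) r =
          padRecord r ++ List.replicate (j + 1) 0) ∧
        (∀ s, annotate (steps S.Q) (S.records E) (j + 1) (S.encα s) =
          (S.rowα s).take (5 + (j + 1))) ∧
        (∀ e, annotate (steps S.Q) (S.records E) (j + 1) (S.encβ e) =
          (S.rowβ e).take (5 + (j + 1))) ∧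
        (∀ z, annotate (steps S.Q) (S.records E) (j + 1) (S.encγ z) =
          (S.rowγ z).take (5 + (j + 1))) := by
      intro src dst κ ω lo wd hs hsrc hdst h2 h3 h5
      refine ⟨fun r hr => ?_, fun s => ?_, fun e => ?_, fun z => ?_⟩
      · rw [annotate, ihE r hr, hs, value_of_dst_ne, List.replicate_succ', List.append_assoc]
        rw [hkind r hr]
        rcases hE r hr with h | h | h <;> omega
      · rw [annotate, ihα, hs, value_of_dst_ne, ← h2 s, htake _ rfl]
        rw [hα]
        omega
      · rw [annotate, ihβ, hs, ← htake _ rfl, h3]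
        split_ifs with hd
        · rw [hvalue _ _ _ _ _ _ _ hsrc ((hβ e).trans hd.symm)]
        · rw [value_of_dst_ne (by rw [hβ]; omega)]
      · rw [annotate, ihγ, hs, ← htake _ rfl, h5]
        split_ifs with hd
        · rw [hvalue _ _ _ _ _ _ _ hsrc ((hγ z).trans hd.symm)]
        · rw [value_of_dst_ne (by rw [hγ]; omega)]
    have hj18 : j < 18 := hj
    clear hvalue htake hD hkind hEk hα hβ hγ
    -- The columns of `JoinTables` are defined by the formulas of the steps, so in each of the 18
    -- cases only unfolding remains.
    interval_cases j
    · exact finish 2 3 _ _ _ _ rfl (by omega) (by omega) (fun _ => rfl) (fun _ => rfl) fun _ => rfl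
    · exact finish 2 3 _ _ _ _ rfl (by omega) (by omega) (fun _ => rfl) (fun _ => rfl) fun _ => rfl
    · exact finish 3 3 _ _ _ _ rfl (by omega) (by omega) (fun _ => rfl) (fun _ => rfl) fun _ => rfl
    · exact finish 3 5 _ _ _ _ rfl (by omega) (by omega) (fun _ => rfl) (fun _ => rfl) fun _ => rfl
    · exact finish 3 5 _ _ _ _ rfl (by omega) (by omega) (fun _ => rfl) (fun _ => rfl) fun _ => rfl
    · exact finish 5 5 _ _ _ _ rfl (by omega) (by omega) (fun _ => rfl) (fun _ => rfl) fun _ => rfl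
    · exact finish 5 5 _ _ _ _ rfl (by omega) (by omega) (fun _ => rfl) (fun _ => rfl) fun _ => rfl
    · exact finish 5 5 _ _ _ _ rfl (by omega) (by omega) (fun _ => rfl) (fun _ => rfl) fun _ => rfl
    · exact finish 5 5 _ _ _ _ rfl (by omega) (by omega) (fun _ => rfl) (fun _ => rfl) fun _ => rfl
    · exact finish 5 3 _ _ _ _ rfl (by omega) (by omega) (fun _ => rfl) (fun _ => rfl) fun _ => rfl
    · exact finish 3 3 _ _ _ _ rfl (by omega) (by omega) (fun _ => rfl) (fun _ => rfl) fun _ => rfl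
    · exact finish 3 3 _ _ _ _ rfl (by omega) (by omega) (fun _ => rfl) (fun _ => rfl) fun _ => rfl
    · exact finish 3 3 _ _ _ _ rfl (by omega) (by omega) (fun _ => rfl) (fun _ => rfl) fun _ => rfl
    · exact finish 3 5 _ _ _ _ rfl (by omega) (by omega) (fun _ => rfl) (fun _ => rfl) fun _ => rfl
    · exact finish 3 5 _ _ _ _ rfl (by omega) (by omega) (fun _ => rfl) (fun _ => rfl) fun _ => rfl
    · exact finish 5 5 _ _ _ _ rfl (by omega) (by omega) (fun _ => rfl) (fun _ => rfl) fun _ => rfl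
    · exact finish 5 3 _ _ _ _ rfl (by omega) (by omega) (fun _ => rfl) (fun _ => rfl) fun _ => rfl
    · exact finish 5 3 _ _ _ _ rfl (by omega) (by omega) (fun _ => rfl) (fun _ => rfl) fun _ => rfl

end JoinTables

/-! ### Bounds for the columns -/

theorem sumIn_le {ι : Type u} [Fintype ι] {κ ω : ι → ℕ} {lo wd m B : ℕ} (hm : Fintype.card ι ≤ m)
    (hω : ∀ i, ω i ≤ B) : sumIn κ ω lo wd ≤ m * B := by
  refine le_trans ?_ (Nat.mul_le_mul_right B hm)
  rw [sumIn, ← Finset.card_univ, ← smul_eq_mul]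
  refine Finset.sum_le_card_nsmul _ _ _ fun i _ => ?_
  split_ifs
  · exact hω i
  · exact Nat.zero_le _

theorem sumIn_le_pow {ι : Type u} [Fintype ι] {κ ω : ι → ℕ} {lo wd M : ℕ} (j : ℕ)
    (hm : Fintype.card ι ≤ M ^ 2) (hω : ∀ i, ω i ≤ M ^ j) : sumIn κ ω lo wd ≤ M ^ (j + 2) := by
  rw [pow_add, mul_comm]
  exact sumIn_le hm hω

theorem sumIn_one_le {ι : Type u} [Fintype ι] {κ : ι → ℕ} {lo wd M : ℕ}
    (hm : Fintype.card ι ≤ M ^ 2) : sumIn κ (fun _ => 1) lo wd ≤ M ^ 2 :=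
  sumIn_le_pow 0 hm fun _ => le_of_eq (pow_zero M).symm

namespace JoinTables

open JoinSteps

variable {α : Type} {β γ : Type u} [Fintype α] [Fintype β] [Fintype γ] (S : JoinTables α β γ)

/-- All numbers in the tables are at most `M ^ k`, and the tables have at most `M ^ 2` rows. -/
structure Bounded (M k : ℕ) : Prop where
  two_le : 2 ≤ M
  two_le_exp : 2 ≤ k
  cardα : Fintype.card α ≤ M ^ 2
  cardβ : Fintype.card β ≤ M ^ 2
  cardγ : Fintype.card γ ≤ M ^ 2
  boundα : ∀ s, S.pos s ≤ M ^ k ∧ S.src s ≤ M ^ k ∧ S.dst s ≤ M ^ k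
  boundβ : ∀ e, S.a e ≤ M ^ k ∧ S.b e ≤ M ^ k ∧ S.x e ≤ M ^ k ∧ S.y e ≤ M ^ k
  boundγ : ∀ z, S.c z ≤ M ^ k ∧ S.t z ≤ M ^ k ∧ S.u z ≤ M ^ k ∧ S.v z ≤ M ^ k

namespace Bounded

variable {S} {M k : ℕ} (h : S.Bounded M k)
include h

theorem pow_le {i j : ℕ} (hij : i ≤ j) : M ^ i ≤ M ^ j :=
  Nat.pow_le_pow_right (by have := h.two_le; omega) hij

theorem two_mul_le (i j : ℕ) (hij : i < j) : 2 * M ^ i ≤ M ^ j := by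
  refine le_trans ?_ (h.pow_le hij)
  rw [pow_succ, mul_comm]
  exact Nat.mul_le_mul_left _ h.two_le

theorem one_le_pow (i : ℕ) : 1 ≤ M ^ i := Nat.one_le_pow _ _ (by have := h.two_le; omega)

theorem posFwd_le (e : β) : S.posFwd e ≤ M ^ (k + 2) :=
  sumIn_le_pow k h.cardα fun s => (h.boundα s).1

theorem posBwd_le (e : β) : S.posBwd e ≤ M ^ (k + 2) :=
  sumIn_le_pow k h.cardα fun s => (h.boundα s).1

theorem parentNode_le (e : β) : S.parentNode e ≤ M ^ k := by
  rw [parentNode]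
  split_ifs
  exacts [(h.boundβ e).2.2.1, (h.boundβ e).2.2.2]

theorem childNode_le (e : β) : S.childNode e ≤ M ^ k := by
  rw [childNode]
  split_ifs
  exacts [(h.boundβ e).2.2.2, (h.boundβ e).2.2.1]

theorem len_le (e : β) : S.len e ≤ M ^ 3 :=
  sumIn_le_pow 1 h.cardβ fun _ => by rw [pow_one]; exact h.two_le

theorem baseBelow_le (z : γ) : S.baseBelow z ≤ M ^ (k + 3) := by
  refine sumIn_le_pow (k + 1) h.cardβ fun e => ?_
  have := h.childNode_le e
  have := h.two_mul_le k (k + 1) (by omega)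
  have := h.one_le_pow k
  omega

theorem baseRoot_le (z : γ) : S.baseRoot z ≤ M ^ (k + 3) := by
  refine sumIn_le_pow (k + 1) h.cardβ fun e => ?_
  have := h.parentNode_le e
  have := h.two_mul_le k (k + 1) (by omega)
  have := h.one_le_pow k
  split_ifs <;> omega

theorem earlier_le (z : γ) : S.earlier z ≤ M ^ 2 := sumIn_one_le h.cardγ

theorem start_le (z : γ) : S.start z ≤ M ^ (k + 2) := by
  refine sumIn_le_pow k h.cardγ fun z => ?_
  split_ifs
  exacts [(h.boundγ z).2.1, Nat.zero_le _]

theorem tourLen_le (z : γ) : S.tourLen z ≤ M ^ 2 := sumIn_one_le h.cardγ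

theorem shifted_le (z : γ) : S.shifted z ≤ M ^ (k + 1) := by
  have h1 := (h.boundγ z).2.1
  have h2 := h.tourLen_le z
  have h3 := h.pow_le h.two_le_exp
  have h4 := h.two_mul_le k (k + 1) (by omega)
  rw [shifted]
  split_ifs <;> omega

theorem earlierShifted_le (z : γ) : S.earlierShifted z ≤ M ^ 2 := sumIn_one_le h.cardγ

theorem nodePos_le (e : β) : S.nodePos e ≤ M ^ (k + 3) := by
  refine sumIn_le_pow (k + 1) h.cardγ fun z => ?_
  split_ifs
  exacts [h.shifted_le z, Nat.zero_le _]

theorem before_le (e : β) : S.before e ≤ M ^ 5 := sumIn_le_pow 3 h.cardβ h.len_le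

theorem offset_le (e : β) : S.offset e ≤ M ^ 6 := by
  have := h.before_le e
  have := h.two_mul_le 5 6 (by omega)
  have := h.one_le_pow 5
  rw [offset]
  omega

theorem sumEntered_le (e : β) : S.sumEntered e ≤ M ^ 8 := sumIn_le_pow 6 h.cardβ h.offset_le

theorem sumLeft_le (e : β) : S.sumLeft e ≤ M ^ 8 := sumIn_le_pow 6 h.cardβ h.offset_le

theorem newDown_le (e : β) : S.newDown e ≤ M ^ 8 := (Nat.sub_le _ _).trans (h.sumEntered_le e)

theorem newUp_le (e : β) : S.newUp e ≤ M ^ 9 := by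
  have := h.newDown_le e
  have := h.len_le e
  have := h.pow_le (show 3 ≤ 8 by omega)
  have := h.two_mul_le 8 9 (by omega)
  rw [newUp]
  omega

theorem enter_le (z : γ) : S.enter z ≤ M ^ 10 := sumIn_le_pow 8 h.cardβ h.newDown_le

theorem visited_le (z : γ) : S.visited z ≤ M ^ 5 := sumIn_le_pow 3 h.cardβ h.len_le

theorem arrival_le (z : γ) : S.arrival z ≤ M ^ 11 := by
  have := h.enter_le z
  have := h.visited_le z
  have := h.pow_le (show 5 ≤ 10 by omega)
  have := h.two_mul_le 10 11 (by omega)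
  rw [arrival]
  omega

theorem localBefore_le (z : γ) : S.localBefore z ≤ M ^ 2 := sumIn_one_le h.cardγ

theorem beforeDown_le (e : β) : S.beforeDown e ≤ M ^ 2 := sumIn_one_le h.cardγ

theorem beforeUp_le (e : β) : S.beforeUp e ≤ M ^ 2 := sumIn_one_le h.cardγ

/-- Crude polynomial bounds suffice: each stored number is at most M^i for some i ≤ k + 13, which
leaves room for strictness at M^(k+14). -/
theorem le_of_le {i w : ℕ} (hi : i ≤ k + 13) (hw : w ≤ M ^ i) : w < M ^ (k + 14) := by
  have := h.pow_le hi
  have := h.two_mul_le (k + 13) (k + 14) (by omega)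
  have := h.one_le_pow (k + 13)
  omega

theorem small_lt {w : ℕ} (hw : w ≤ 8) : w < M ^ (k + 14) :=
  h.le_of_le (i := 3) (by omega) (hw.trans (by
    have := Nat.pow_le_pow_left h.two_le 3
    omega))

theorem rowα_lt (s : α) : ∀ w ∈ S.rowα s, w < M ^ (k + 14) := by
  have h0 := h.small_lt (w := 0) (by omega)
  obtain ⟨h1, h2, h3⟩ := h.boundα s
  simp only [rowα, List.forall_mem_cons, h0, true_and]
  exact ⟨h.small_lt (by omega), h.le_of_le (by omega) h1, h.le_of_le (by omega) h2,
    h.le_of_le (by omega) h3, by simp⟩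

theorem rowβ_lt (e : β) : ∀ w ∈ S.rowβ e, w < M ^ (k + 14) := by
  have h0 := h.small_lt (w := 0) (by omega)
  obtain ⟨h1, h2, h3, h4⟩ := h.boundβ e
  simp only [rowβ, List.forall_mem_cons, h0, true_and]
  exact ⟨h.small_lt (by omega), h.le_of_le (by omega) h1, h.le_of_le (by omega) h2,
    h.le_of_le (by omega) h3, h.le_of_le (by omega) h4, h.le_of_le (by omega) (h.posFwd_le e),
    h.le_of_le (by omega) (h.posBwd_le e), h.le_of_le (by omega) (h.len_le e),
    h.le_of_le (by omega) (h.nodePos_le e), h.le_of_le (by omega) (h.before_le e),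
    h.le_of_le (by omega) (h.sumEntered_le e), h.le_of_le (by omega) (h.sumLeft_le e),
    h.le_of_le (by omega) (h.beforeDown_le e), h.le_of_le (by omega) (h.beforeUp_le e), by simp⟩

theorem rowγ_lt (z : γ) : ∀ w ∈ S.rowγ z, w < M ^ (k + 14) := by
  have h0 := h.small_lt (w := 0) (by omega)
  obtain ⟨h1, h2, h3, h4⟩ := h.boundγ z
  simp only [rowγ, List.forall_mem_cons, h0, true_and]
  exact ⟨h.small_lt (by omega), h.le_of_le (by omega) h1, h.le_of_le (by omega) h2,
    h.le_of_le (by omega) h3, h.le_of_le (by omega) h4, h.le_of_le (by omega) (h.baseBelow_le z),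
    h.le_of_le (by omega) (h.baseRoot_le z), h.le_of_le (by omega) (h.earlier_le z),
    h.le_of_le (by omega) (h.start_le z), h.le_of_le (by omega) (h.tourLen_le z),
    h.le_of_le (by omega) (h.earlierShifted_le z), h.le_of_le (by omega) (h.enter_le z),
    h.le_of_le (by omega) (h.visited_le z), h.le_of_le (by omega) (h.localBefore_le z), by simp⟩

end Bounded

theorem outRec_rowβ (e : β) : outRec (S.rowβ e) = [[6, S.x e, S.y e],
    [7, S.newDown e + S.beforeDown e, S.parentNode e, S.childNode e],
    [7, S.newUp e + S.beforeUp e, S.childNode e, S.parentNode e]] := rfl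

theorem outRec_rowγ (z : γ) :
    outRec (S.rowγ z) = [[7, S.arrival z + S.localBefore z + 1, S.u z, S.v z]] := rfl

namespace Bounded

variable {S} {M k : ℕ} (h : S.Bounded M k)
include h

theorem outRec_rowβ_lt (e : β) : ∀ w ∈ (outRec (S.rowβ e)).flatten, w < M ^ (k + 14) := by
  obtain ⟨h1, h2, h3, h4⟩ := h.boundβ e
  have e1 := h.newDown_le e
  have e2 := h.newUp_le e
  have e3 := h.beforeDown_le e
  have e4 := h.beforeUp_le e
  have e5 := h.pow_le (show 2 ≤ 9 by omega)
  have e6 := h.pow_le (show 8 ≤ 9 by omega)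
  have e7 := h.two_mul_le 9 10 (by omega)
  have e8 := h.parentNode_le e
  have e9 := h.childNode_le e
  rw [outRec_rowβ]
  simp only [List.flatten_cons, List.flatten_nil, List.append_nil, List.cons_append, List.nil_append,
    List.forall_mem_cons]
  exact ⟨h.small_lt (by omega), h.le_of_le (by omega) h3, h.le_of_le (by omega) h4,
    h.small_lt (by omega), h.le_of_le (i := 10) (by omega) (by omega), h.le_of_le (by omega) e8,
    h.le_of_le (by omega) e9, h.small_lt (by omega), h.le_of_le (i := 10) (by omega) (by omega),
    h.le_of_le (by omega) e9, h.le_of_le (by omega) e8, by simp⟩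

theorem outRec_rowγ_lt (z : γ) : ∀ w ∈ (outRec (S.rowγ z)).flatten, w < M ^ (k + 14) := by
  obtain ⟨h1, h2, h3, h4⟩ := h.boundγ z
  have e1 := h.arrival_le z
  have e2 := h.localBefore_le z
  have e3 := h.pow_le (show 2 ≤ 11 by omega)
  have e4 := h.two_mul_le 11 12 (by omega)
  have e5 := h.two_mul_le 12 13 (by omega)
  have e6 := h.one_le_pow 12
  rw [outRec_rowγ]
  simp only [List.flatten_cons, List.flatten_nil, List.append_nil, List.forall_mem_cons]
  exact ⟨h.small_lt (by omega), h.le_of_le (i := 13) (by omega) (by omega), h.le_of_le (by omega) h3,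
    h.le_of_le (by omega) h4, by simp⟩

end Bounded

end JoinTables

/-! ### The meaning of the columns -/

section SumIn

variable {ι : Type u} [Fintype ι] {κ ω : ι → ℕ} {lo wd : ℕ}

/-- With width 1 a range sum is a table lookup. Other records may share the key if their weight is
0, so a condition in the weight can select one of them. -/
theorem sumIn_eq_single (i : ι) (hi : κ i = lo) (h : ∀ j, κ j = lo → j ≠ i → ω j = 0) :
    sumIn κ ω lo 1 = ω i := by
  classical
  rw [sumIn, Finset.sum_eq_single i]
  · rw [if_pos (by omega)]
  · intro j _ hj
    by_cases hk : κ j = lo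
    · rw [h j hk hj, ite_self]
    · rw [if_neg (by omega)]
  · intro h'
    exact absurd (Finset.mem_univ i) h'

theorem sumIn_eq_zero (h : ∀ j, lo ≤ κ j → κ j < lo + wd → ω j = 0) : sumIn κ ω lo wd = 0 :=
  Finset.sum_eq_zero fun j _ => by
    split_ifs with hj
    · exact h j hj.1 hj.2
    · rfl

theorem sumIn_count_eq_zero_iff :
    sumIn κ (fun _ => 1) lo wd = 0 ↔ ∀ j, lo ≤ κ j → lo + wd ≤ κ j := by
  rw [sumIn, Finset.sum_eq_zero_iff]
  constructor
  · intro h j hj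
    by_contra hcon
    have := h j (Finset.mem_univ j)
    rw [if_pos ⟨hj, by omega⟩] at this
    omega
  · intro h j _
    rw [if_neg fun hj => by have := h j hj.1; omega]

end SumIn

theorem pair_code_inj {Q a b a' b' : ℕ} (hb : b < Q) (hb' : b' < Q)
    (h : a * Q + b = a' * Q + b') : a = a' ∧ b = b' := by
  have hQ : 0 < Q := by omega
  have h1 : (a * Q + b) / Q = a := by
    rw [mul_comm, Nat.mul_add_div hQ, Nat.div_eq_of_lt hb, add_zero]
  have h2 : (a' * Q + b') / Q = a' := by
    rw [mul_comm, Nat.mul_add_div hQ, Nat.div_eq_of_lt hb', add_zero]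
  have : a = a' := by rw [← h1, ← h2, h]
  subst this
  exact ⟨rfl, by omega⟩

/-- Codes in base Q compare lexicographically, so an interval of codes with a fixed first digit
confines a sum to one node or one cluster. -/
theorem pair_code_lt_iff {Q a b a' b' : ℕ} (hb : b < Q) (hb' : b' < Q) :
    a * Q + b < a' * Q + b' ↔ a < a' ∨ (a = a' ∧ b < b') := by
  rcases lt_trichotomy a a' with h | h | h
  · have := Nat.mul_le_mul_right Q (Nat.succ_le_of_lt h)
    rw [Nat.succ_mul] at this
    exact iff_of_true (by omega) (Or.inl h)
  · subst h
    simp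
  · have := Nat.mul_le_mul_right Q (Nat.succ_le_of_lt h)
    rw [Nat.succ_mul] at this
    exact iff_of_false (by omega) (by omega)

theorem firstPos_le_entryIdx {V : Type u} [DecidableEq V] {l : List (V × V)} {d : V × V}
    (hd : d ∈ l) : firstPos l d.1 ≤ entryIdx l d := by
  by_contra hlt
  have h1 := entryIdx_lt_length hd
  have h2 := List.not_of_lt_findIdx (p := fun e : V × V => decide (e.1 = d.1)) (xs := l)
    (i := entryIdx l d) (by rw [← firstPos]; omega)
  rw [getElem_entryIdx h1] at h2
  simp at h2

theorem entryIdx_eq_firstPos_iff {V : Type u} [DecidableEq V] {l : List (V × V)} (hl : l.Nodup)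
    {d : V × V} (hd : d ∈ l) : entryIdx l d = firstPos l d.1 ↔
      ∀ d' ∈ l, d'.1 = d.1 → entryIdx l d ≤ entryIdx l d' := by
  constructor
  · intro h d' hd' he
    rw [h, ← he]
    exact firstPos_le_entryIdx hd'
  · intro h
    refine le_antisymm ?_ (firstPos_le_entryIdx hd)
    have hlt : firstPos l d.1 < l.length := firstPos_lt_length (y := d.2) hd
    have := h _ (List.getElem_mem hlt) (getElem_firstPos hlt)
    rwa [entryIdx_getElem hl hlt] at this

namespace JoinInstance

variable {V : Type u} [Fintype V] [DecidableEq V] (I : JoinInstance V) (name : V ↪ ℕ) (Q : ℕ)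
  {root : Cluster I.leader} {par : Cluster I.leader → Cluster I.leader}
  (ends : {c : Cluster I.leader // c ≠ root} → Cluster I.leader × Cluster I.leader)

/-- The tables of an instance, where the edge from `c` to its parent is given in the orientation
`ends c`. -/
def tables : JoinTables (Fin I.A.length) {c : Cluster I.leader // c ≠ root}
    (Σ c, Fin (I.tourOn c).length) where
  Q := Q
  pos s := s + 1
  src s := name (I.A[s]).1.1
  dst s := name (I.A[s]).2.1
  a e := name (ends e).1.1
  b e := name (ends e).2.1
  x e := name (I.g (ends e).1 (ends e).2).1
  y e := name (I.g (ends e).1 (ends e).2).2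
  c z := name z.1.1
  t z := z.2 + 1
  u z := name ((I.tourOn z.1)[z.2]).1
  v z := name ((I.tourOn z.1)[z.2]).2

section Columns

variable {I name Q ends}
variable (hp : IsParentMap I.T root par) (hst : StartsAt I.A root) (hQ : ∀ v, name v < Q)
  (hends : ∀ e, ends e = (par e.1, e.1) ∨ ends e = (e.1, par e.1))

-- A tour contains each directed edge once, so the code of its two names is a unique key and the sum
-- looks up its position, counted from 1.
omit [Fintype V] in
include hQ in
theorem sumIn_entryIdx {a b : Cluster I.leader} (h : I.T.Adj a b) :
    sumIn (fun s => (I.tables name Q ends).src s * Q + (I.tables name Q ends).dst s)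
      (I.tables name Q ends).pos (name a.1 * Q + name b.1) 1 = entryIdx I.A (a, b) + 1 := by
  have hlt := entryIdx_lt_length (I.A_isEulerTour.mem_iff.2 h)
  have he := getElem_entryIdx hlt
  rw [sumIn_eq_single ⟨_, hlt⟩]
  · rfl
  · simp only [tables, Fin.getElem_fin, he]
  · intro j hj hne
    obtain ⟨h1, h2⟩ := pair_code_inj (hQ _) (hQ _) hj
    refine absurd (Fin.ext ?_) hne
    have : I.A[j] = (a, b) :=
      Prod.ext (Subtype.ext (name.injective h1)) (Subtype.ext (name.injective h2))
    exact (entryIdx_getElem I.A_isEulerTour.nodup j.2).symm.trans (congrArg (entryIdx I.A) this)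

include hp hst hQ hends

/-- A tour from the root passes an edge downwards before upwards. Comparing the two positions finds
the parent, whichever way the edge is recorded. -/
theorem orientation (e : {c : Cluster I.leader // c ≠ root}) :
    (I.tables name Q ends).down e = entryIdx I.A (par e.1, e.1) + 1 ∧
    (I.tables name Q ends).up e = entryIdx I.A (e.1, par e.1) + 1 ∧
    (I.tables name Q ends).parent e = name (par e.1).1 ∧
    (I.tables name Q ends).child e = name e.1.1 ∧
    (I.tables name Q ends).parentNode e = name (I.g (par e.1) e.1).1 ∧
    (I.tables name Q ends).childNode e = name (I.g (par e.1) e.1).2 := by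
  have hlt := hp.idxOf_down_lt_up I.T_isTree I.A_isEulerTour hst e.2
  have hadj := hp.adj e.1 e.2
  have hdn := sumIn_entryIdx (ends := ends) hQ hadj.symm
  have hup := sumIn_entryIdx (ends := ends) hQ hadj
  rcases hends e with h | h
  · have h1 : (I.tables name Q ends).posFwd e = entryIdx I.A (par e.1, e.1) + 1 := by
      rw [← hdn]
      simp only [JoinTables.posFwd, tables, h]
    have h2 : (I.tables name Q ends).posBwd e = entryIdx I.A (e.1, par e.1) + 1 := by
      rw [← hup]
      simp only [JoinTables.posBwd, tables, h]
    have h3 : (I.tables name Q ends).posFwd e < (I.tables name Q ends).posBwd e := by omega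
    refine ⟨?_, ?_, ?_, ?_, ?_, ?_⟩
    · rw [JoinTables.down]; omega
    · rw [JoinTables.up]; omega
    · rw [JoinTables.parent, if_pos h3]; simp only [tables, h]
    · rw [JoinTables.child, if_pos h3]; simp only [tables, h]
    · rw [JoinTables.parentNode, if_pos h3]; simp only [tables, h]
    · rw [JoinTables.childNode, if_pos h3]; simp only [tables, h]
  · have h1 : (I.tables name Q ends).posFwd e = entryIdx I.A (e.1, par e.1) + 1 := by
      rw [← hup]
      simp only [JoinTables.posFwd, tables, h]
    have h2 : (I.tables name Q ends).posBwd e = entryIdx I.A (par e.1, e.1) + 1 := by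
      rw [← hdn]
      simp only [JoinTables.posBwd, tables, h]
    have h3 : ¬ (I.tables name Q ends).posFwd e < (I.tables name Q ends).posBwd e := by omega
    have h4 := I.g_symm _ _ hadj
    refine ⟨?_, ?_, ?_, ?_, ?_, ?_⟩
    · rw [JoinTables.down]; omega
    · rw [JoinTables.up]; omega
    · rw [JoinTables.parent, if_neg h3]; simp only [tables, h]
    · rw [JoinTables.child, if_neg h3]; simp only [tables, h]
    · rw [JoinTables.parentNode, if_neg h3]; simp only [tables, h, h4, Prod.fst_swap]
    · rw [JoinTables.childNode, if_neg h3]; simp only [tables, h, h4, Prod.snd_swap]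

/-- The nodes entered between the downward and the upward pass of e are exactly its descendants,
itself included. The weight 2 counts the two passes through the edge above each. -/
theorem len_eq (e : {c : Cluster I.leader // c ≠ root}) :
    (I.tables name Q ends).len e = subtreeLen par e.1 := by
  classical
  have hor := orientation hp hst hQ hends
  have hkey : ∀ e' : {c : Cluster I.leader // c ≠ root},
      ((I.tables name Q ends).down e ≤ (I.tables name Q ends).down e' ∧
        (I.tables name Q ends).down e' < (I.tables name Q ends).down e +
          ((I.tables name Q ends).up e + 1 - (I.tables name Q ends).down e)) ↔
      IsDesc par e.1 e'.1 := by
    intro e'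
    have hlt := hp.idxOf_down_lt_up I.T_isTree I.A_isEulerTour hst e.2
    have hD : entryIdx I.A (par e'.1, e'.1) < I.A.length :=
      entryIdx_lt_length (I.A_isEulerTour.mem_iff.2 (hp.adj e'.1 e'.2).symm)
    have hU : entryIdx I.A (e.1, par e.1) < I.A.length :=
      entryIdx_lt_length (I.A_isEulerTour.mem_iff.2 (hp.adj e.1 e.2))
    have hiff := hp.target_isDesc_iff I.T_isTree I.A_isEulerTour hst e.2 hD
    have hDe := getElem_entryIdx hD
    rw [hDe] at hiff
    rw [hiff, (hor e).1, (hor e').1, (hor e).2.1]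
    -- A downward pass is never an upward one, as distances from the root show, so including the
    -- endpoint of the interval adds nothing.
    have hne : entryIdx I.A (par e'.1, e'.1) ≠ entryIdx I.A (e.1, par e.1) := by
      intro heq
      have hUe := getElem_entryIdx hU
      simp only [← heq, hDe, Prod.mk.injEq] at hUe
      have d1 := hp.dist e.1 e.2
      have d2 := hp.dist e'.1 e'.2
      rw [← hUe.2] at d1
      rw [hUe.1] at d2
      omega
    omega
  rw [JoinTables.len, sumIn]
  simp only [hkey]
  rw [← Finset.sum_filter, Finset.sum_const, smul_eq_mul, mul_comm, subtreeLen]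
  congr 1
  refine Finset.card_bij (fun e' _ => e'.1) ?_ ?_ ?_
  · intro e' he'
    simpa using he'
  · intro a _ b _ hab
    exact Subtype.ext hab
  · intro x hx
    simp only [Finset.mem_filter, Finset.mem_univ, true_and] at hx
    refine ⟨⟨x, ?_⟩, by simpa using hx, rfl⟩
    rintro rfl
    exact e.2 (hp.isDesc_root_iff.1 hx)

end Columns

end JoinInstance

/-! ### Rotated cluster tours in terms of columns -/

namespace JoinInstance

variable {V : Type u} [Fintype V] [DecidableEq V] {I : JoinInstance V} {name : V ↪ ℕ} {Q : ℕ}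
  {root : Cluster I.leader} {par : Cluster I.leader → Cluster I.leader}
  {ends : {c : Cluster I.leader // c ≠ root} → Cluster I.leader × Cluster I.leader}

omit [Fintype V] in
variable (I) in
/-- The entry of the tour of a cluster with the given index. -/
def entry (z : Σ c, Fin (I.tourOn c).length) : V × V := (I.tourOn z.1)[z.2]

omit [Fintype V] [DecidableEq V] in
theorem entry_mem (z : Σ c, Fin (I.tourOn c).length) : I.entry z ∈ I.tourOn z.1 :=
  List.getElem_mem z.2.2

omit [Fintype V] [DecidableEq V] in
theorem leader_entry (z : Σ c, Fin (I.tourOn c).length) : I.leader (I.entry z).1 = z.1.1 :=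
  (mem_tourOn.1 (entry_mem z)).1

omit [Fintype V] [DecidableEq V] in
theorem cluster_eq_of_entry {z z' : Σ c, Fin (I.tourOn c).length}
    (h : (I.entry z).1 = (I.entry z').1) : z.1 = z'.1 :=
  Subtype.ext (by rw [← leader_entry z, ← leader_entry z', h])

omit [Fintype V] [DecidableEq V] in
theorem exists_entry {c : Cluster I.leader} {d : V × V} (h : d ∈ I.tourOn c) :
    ∃ z : Σ c, Fin (I.tourOn c).length, z.1 = c ∧ I.entry z = d := by
  obtain ⟨i, hi, rfl⟩ := List.mem_iff_getElem.1 h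
  exact ⟨⟨c, i, hi⟩, rfl, rfl⟩

omit [Fintype V] in
theorem entryIdx_entry (z : Σ c, Fin (I.tourOn c).length) :
    entryIdx (I.tourOn z.1) (I.entry z) = z.2 :=
  entryIdx_getElem (nodup_tourOn _) z.2.2

omit [Fintype V] [DecidableEq V] in
theorem entry_injective : Function.Injective I.entry := by
  classical
  intro z z' h
  have h1 := cluster_eq_of_entry (congrArg Prod.fst h)
  obtain ⟨c, i⟩ := z
  obtain ⟨c', i'⟩ := z'
  obtain rfl : c = c' := h1
  have h2 := entryIdx_entry ⟨c, i⟩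
  have h3 := entryIdx_entry ⟨c, i'⟩
  rw [h] at h2
  exact congrArg (Sigma.mk c) (Fin.ext (h2.symm.trans h3))

theorem tourLen_eq (z : Σ c, Fin (I.tourOn c).length) :
    (I.tables name Q ends).tourLen z = (I.tourOn z.1).length := by
  rw [JoinTables.tourLen, sumIn, Fintype.sum_sigma, Finset.sum_eq_single z.1]
  · simp only [tables, le_refl, Nat.lt_succ_self, and_self, if_true, Finset.sum_const,
      Finset.card_univ, Fintype.card_fin, smul_eq_mul, mul_one]
  · intro c _ hc
    refine Finset.sum_eq_zero fun i _ => if_neg ?_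
    simp only [tables]
    intro h
    exact hc (Subtype.ext (name.injective (by omega)))
  · intro h
    exact absurd (Finset.mem_univ _) h

/-- Entries with the same source are not earlier if and only if the source occurs for the first
time. -/
theorem earliest_iff {l : Cluster I.leader → List (V × V)} (hl : ∀ c, (l c).Nodup)
    (hm : ∀ c d, d ∈ l c ↔ d ∈ I.tourOn c) {τ : (Σ c, Fin (I.tourOn c).length) → ℕ} {k : ℕ}
    (hτ : ∀ z, τ z = entryIdx (l z.1) (I.entry z) + k) (hQ : ∀ z, τ z < Q)
    (z : Σ c, Fin (I.tourOn c).length) :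
    sumIn (fun z => (I.tables name Q ends).u z * Q + τ z) (fun _ => 1)
      ((I.tables name Q ends).u z * Q) (τ z) = 0 ↔
    entryIdx (l z.1) (I.entry z) = firstPos (l z.1) (I.entry z).1 := by
  rw [sumIn_count_eq_zero_iff, entryIdx_eq_firstPos_iff (hl z.1) ((hm _ _).2 (entry_mem z))]
  have hu : ∀ z, (I.tables name Q ends).u z = name (I.entry z).1 := fun _ => rfl
  constructor
  · intro h d' hd' he
    obtain ⟨z', hz', rfl⟩ := exists_entry ((hm _ _).1 hd')
    have h1 := h z' (by rw [hu, hu, he]; exact Nat.le_add_right _ _)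
    rw [hu, hu, he, hτ, hτ, hz'] at h1
    omega
  · intro h z' hz'
    simp only [hu] at hz' ⊢
    have hlt := hQ z
    rcases lt_trichotomy (name (I.entry z').1) (name (I.entry z).1) with h1 | h1 | h1
    · have := Nat.mul_le_mul_right Q (Nat.succ_le_of_lt h1)
      rw [Nat.succ_mul] at this
      have := hQ z'
      omega
    · have h2 := name.injective h1
      have h3 := cluster_eq_of_entry h2
      have h4 := h (I.entry z') (by rw [← h3]; exact (hm _ _).2 (entry_mem z')) h2
      rw [h1, hτ, hτ, h3]
      omega
    · have := Nat.mul_le_mul_right Q (Nat.succ_le_of_lt h1)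
      rw [Nat.succ_mul] at this
      omega

theorem earlier_eq_zero_iff (hQt : ∀ c, (I.tourOn c).length < Q) (z : Σ c, Fin (I.tourOn c).length) :
    (I.tables name Q ends).earlier z = 0 ↔ z.2 = firstPos (I.tourOn z.1) (I.entry z).1 := by
  have := earliest_iff (name := name) (Q := Q) (ends := ends) (l := I.tourOn) nodup_tourOn
    (fun _ _ => Iff.rfl) (τ := fun z => z.2 + 1) (k := 1) (fun z => by rw [entryIdx_entry])
    (fun z => by have := hQt z.1; have := z.2.2; omega) z
  rw [entryIdx_entry] at this
  exact this

/-- The shifted tours that the columns describe. -/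
def IsShift (I : JoinInstance V) (S : (Σ c, Fin (I.tourOn c).length) → ℕ)
    (l : Cluster I.leader → List (V × V)) : Prop :=
  ∃ sh : Cluster I.leader → ℕ, (∀ c, l c = (I.tourOn c).rotate (sh c)) ∧
    ∀ z, sh z.1 < (I.tourOn z.1).length ∧ (S z = sh z.1 + 1 ∨ (S z = 0 ∧ sh z.1 = 0))

section Shift

variable {l : Cluster I.leader → List (V × V)}
  (hl : IsShift I (I.tables name Q ends).start l)
include hl

theorem IsShift.nodup (c : Cluster I.leader) : (l c).Nodup := by
  obtain ⟨sh, h, -⟩ := hl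
  rw [h, List.nodup_rotate]
  exact nodup_tourOn c

theorem IsShift.mem_iff (c : Cluster I.leader) (d : V × V) : d ∈ l c ↔ d ∈ I.tourOn c := by
  obtain ⟨sh, h, -⟩ := hl
  rw [h, List.mem_rotate]

/-- The column j solves (j + shift) mod length = index of z, which inverts the rotation. The value 0
of `start` stands for an unrotated tour. -/
theorem shifted_eq (z : Σ c, Fin (I.tourOn c).length) :
    (I.tables name Q ends).shifted z = entryIdx (l z.1) (I.entry z) := by
  have hnd := hl.nodup z.1
  obtain ⟨sh, h, hs⟩ := hl
  obtain ⟨hlt, hcase⟩ := hs z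
  have hi := z.2.2
  have ht : (I.tables name Q ends).t z = z.2 + 1 := rfl
  have hlen := tourLen_eq (name := name) (Q := Q) (ends := ends) z
  obtain ⟨j, hj⟩ : ∃ j, j = (I.tables name Q ends).shifted z := ⟨_, rfl⟩
  have hj2 : j < (I.tourOn z.1).length ∧ (j + sh z.1) % (I.tourOn z.1).length = z.2 := by
    rw [JoinTables.shifted, ht, hlen] at hj
    rcases hcase with hc | ⟨hc, h0⟩
    · rw [hc, if_neg (by omega)] at hj
      split_ifs at hj
      · refine ⟨by omega, ?_⟩
        rw [show j + sh z.1 = z.2 by omega, Nat.mod_eq_of_lt hi]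
      · refine ⟨by omega, ?_⟩
        rw [show j + sh z.1 = z.2 + (I.tourOn z.1).length by omega, Nat.add_mod_right,
          Nat.mod_eq_of_lt hi]
    · rw [hc, if_pos rfl] at hj
      refine ⟨by omega, ?_⟩
      rw [show j + sh z.1 = z.2 by omega, Nat.mod_eq_of_lt hi]
  rw [← hj]
  have hjl : j < (l z.1).length := by rw [h, List.length_rotate]; exact hj2.1
  have : (l z.1)[j] = I.entry z := by
    simp only [h, List.getElem_rotate, hj2.2]
    rfl
  rw [← this]
  exact (entryIdx_getElem hnd hjl).symm

theorem IsShift.length_eq (c : Cluster I.leader) : (l c).length = (I.tourOn c).length := by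
  obtain ⟨sh, h, -⟩ := hl
  rw [h, List.length_rotate]

theorem shifted_lt (z : Σ c, Fin (I.tourOn c).length) :
    (I.tables name Q ends).shifted z < (I.tourOn z.1).length := by
  rw [shifted_eq hl, ← hl.length_eq z.1]
  exact entryIdx_lt_length ((hl.mem_iff _ _).2 (entry_mem z))

theorem earlierShifted_eq_zero_iff (hQt : ∀ c, (I.tourOn c).length < Q)
    (z : Σ c, Fin (I.tourOn c).length) :
    (I.tables name Q ends).earlierShifted z = 0 ↔
      (I.tables name Q ends).shifted z = firstPos (l z.1) (I.entry z).1 := by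
  have := earliest_iff (name := name) (Q := Q) (ends := ends) (l := l) hl.nodup
    hl.mem_iff (τ := (I.tables name Q ends).shifted) (k := 0) (fun z => by
      rw [shifted_eq hl, add_zero])
    (fun z => by have := hQt z.1; have := shifted_lt hl z; omega) z
  rw [shifted_eq hl]
  exact this

/-- Exactly one entry with source x has no predecessor with this source, and its column `shifted` is
the first position of x. A cluster with one node has no entries, and both sides are 0. -/
theorem nodePos_eq (hp : IsParentMap I.T root par) (hst : StartsAt I.A root)
    (hQ : ∀ v, name v < Q)
    (hends : ∀ e, ends e = (par e.1, e.1) ∨ ends e = (e.1, par e.1))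
    (hQt : ∀ c, (I.tourOn c).length < Q) (e : {c : Cluster I.leader // c ≠ root}) :
    (I.tables name Q ends).nodePos e = firstPos (l (par e.1)) (I.g (par e.1) e.1).1 := by
  have hx := (orientation hp hst hQ hends e).2.2.2.2.1
  have hadj := hp.adj e.1 e.2
  have hlead := (I.g_mem _ _ hadj.symm).1
  obtain ⟨x, hxe⟩ : ∃ x, x = (I.g (par e.1) e.1).1 := ⟨_, rfl⟩
  rw [← hxe] at hx hlead ⊢
  rw [JoinTables.nodePos, hx]
  have hu : ∀ z, (I.tables name Q ends).u z = name (I.entry z).1 := fun _ => rfl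
  by_cases hne : I.tourOn (par e.1) = []
  · have hl0 : l (par e.1) = [] := by
      rw [← List.length_eq_zero_iff, hl.length_eq, hne]
      rfl
    rw [hl0, sumIn_eq_zero]
    · rfl
    · intro z h1 h2
      rw [hu] at h1 h2
      have h3 : (I.entry z).1 = x := name.injective (by omega)
      have h4 : z.1 = par e.1 := Subtype.ext (by rw [← leader_entry z, h3, hlead])
      have h5 := entry_mem z
      rw [h4, hne] at h5
      simp at h5
  · obtain ⟨d, hd⟩ := List.exists_mem_of_ne_nil _ hne
    obtain ⟨h1, h2, h3⟩ := mem_tourOn.1 hd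
    have : Nontrivial (Members I.leader (par e.1)) := ⟨_, _, h3.ne⟩
    obtain ⟨y, hy⟩ :=
      (I.tree_isTree (par e.1)).connected.preconnected.exists_adj_of_nontrivial ⟨x, hlead⟩
    have hlt := firstPos_lt_length ((hl.mem_iff _ _).2 (mem_tourOn.2 ⟨hlead, y.2, hy⟩))
    obtain ⟨z, hz1, hz2⟩ := exists_entry ((hl.mem_iff _ _).1 (List.getElem_mem hlt))
    have hz3 : (I.entry z).1 = x := by rw [hz2]; exact getElem_firstPos hlt
    have hz4 : (I.tables name Q ends).shifted z = firstPos (l (par e.1)) x := by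
      rw [shifted_eq hl, hz1, hz2]
      exact entryIdx_getElem (hl.nodup _) hlt
    rw [sumIn_eq_single z (by rw [hu, hz3])]
    · rw [if_pos, hz4]
      rw [earlierShifted_eq_zero_iff hl hQt, hz4, hz3, hz1]
    · intro z' hz' hne'
      rw [hu] at hz'
      have h5 : (I.entry z').1 = x := name.injective hz'
      have h6 : z'.1 = par e.1 := Subtype.ext (by rw [← leader_entry z', h5, hlead])
      refine if_neg fun h0 => hne' (entry_injective ?_)
      rw [earlierShifted_eq_zero_iff hl hQt, shifted_eq hl, h5, h6] at h0
      have h7 := getElem_entryIdx (entryIdx_lt_length ((hl.mem_iff _ _).2 (h6 ▸ entry_mem z')))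
      simp only [h0] at h7
      rw [← h7, hz2]

end Shift

end JoinInstance

theorem sum_subtype_ne {κ : Type u} [Fintype κ] {root : κ} [Fintype {c : κ // c ≠ root}]
    (p : κ → Prop) [∀ c, Decidable (p c)] [DecidablePred fun c => c ≠ root ∧ p c] (f : κ → ℕ) :
    ∑ e : {c : κ // c ≠ root}, (if p e.1 then f e.1 else 0) =
      ∑ c ∈ Finset.univ.filter (fun c => c ≠ root ∧ p c), f c := by
  rw [← Finset.sum_filter]
  refine Finset.sum_bij (fun e _ => e.1) ?_ ?_ ?_ fun _ _ => rfl
  · intro e he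
    simp only [Finset.mem_filter, Finset.mem_univ, true_and] at he ⊢
    exact ⟨e.2, he⟩
  · intro a _ b _ hab
    exact Subtype.ext hab
  · intro c hc
    simp only [Finset.mem_filter, Finset.mem_univ, true_and] at hc
    exact ⟨⟨c, hc.1⟩, by simpa using hc.2, rfl⟩

/-! ### Columns of the canonical execution -/

namespace JoinRun

open JoinInstance

variable {V : Type u} [Fintype V] [DecidableEq V] {I : JoinInstance V} {name : V ↪ ℕ} {Q : ℕ}
  {r : JoinRun I}
  {ends : {c : Cluster I.leader // c ≠ r.root} → Cluster I.leader × Cluster I.leader}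

/-- The assumptions on the base `Q` and on the orientations `ends` of the edges. -/
structure IsEncoded (r : JoinRun I) (name : V ↪ ℕ) (Q : ℕ)
    (ends : {c : Cluster I.leader // c ≠ r.root} → Cluster I.leader × Cluster I.leader) : Prop where
  canonical : r.IsCanonical Q
  ends_eq : ∀ e, ends e = (r.par e.1, e.1) ∨ ends e = (e.1, r.par e.1)
  name_lt : ∀ v, name v < Q
  length_lt : I.A.length < Q
  tour_lt : ∀ c, (I.tourOn c).length < Q

namespace IsEncoded

variable (h : r.IsEncoded name Q ends)
include h

theorem orientation (e : {c : Cluster I.leader // c ≠ r.root}) :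
    (I.tables name Q ends).down e = entryIdx I.A (r.par e.1, e.1) + 1 ∧
    (I.tables name Q ends).up e = entryIdx I.A (e.1, r.par e.1) + 1 ∧
    (I.tables name Q ends).parent e = name (r.par e.1).1 ∧
    (I.tables name Q ends).child e = name e.1.1 ∧
    (I.tables name Q ends).parentNode e = name (I.g (r.par e.1) e.1).1 ∧
    (I.tables name Q ends).childNode e = name (I.g (r.par e.1) e.1).2 :=
  JoinInstance.orientation r.isParentMap h.canonical.startsAt h.name_lt h.ends_eq e

theorem len_eq (e : {c : Cluster I.leader // c ≠ r.root}) :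
    (I.tables name Q ends).len e = subtreeLen r.par e.1 :=
  JoinInstance.len_eq r.isParentMap h.canonical.startsAt h.name_lt h.ends_eq e

theorem baseBelow_eq (z : Σ c, Fin (I.tourOn c).length) :
    (I.tables name Q ends).baseBelow z = if z.1 = r.root then 0 else name (r.base z.1) + 1 := by
  have hc : (I.tables name Q ends).c z = name z.1.1 := rfl
  rw [JoinTables.baseBelow, hc]
  split_ifs with hr
  · refine sumIn_eq_zero fun e h1 h2 => ?_
    rw [(h.orientation e).2.2.2.1] at h1 h2
    have : e.1 = z.1 := Subtype.ext (name.injective (by omega))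
    exact absurd (this.trans hr) e.2
  · rw [sumIn_eq_single ⟨z.1, hr⟩ (h.orientation _).2.2.2.1]
    · rw [(h.orientation _).2.2.2.2.2, r.base_eq _ hr, I.g_symm _ _ (r.par_adj _ hr).1]
      rfl
    · intro e he hne
      rw [(h.orientation e).2.2.2.1] at he
      exact absurd (Subtype.ext (Subtype.ext (name.injective he))) hne

/-- Only the edge of the first entry of A has its downward pass at position 1, and its parent
terminal is the base chosen for the root cluster. All other weights vanish. -/
theorem baseRoot_eq (z : Σ c, Fin (I.tourOn c).length) [Nontrivial (Cluster I.leader)] :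
    (I.tables name Q ends).baseRoot z = if z.1 = r.root then name (r.base z.1) + 1 else 0 := by
  have hc : (I.tables name Q ends).c z = name z.1.1 := rfl
  have hA := I.A_isEulerTour
  have hlen : 0 < I.A.length := by
    rw [hA.length_eq]
    have := Finite.one_lt_card (α := Cluster I.leader)
    omega
  have hhead : I.A.head? = some I.A[0] := by rw [List.head?_eq_getElem?]; simp [hlen]
  have h0 : (I.A[0]).1 = r.root := h.canonical.startsAt _ (by rw [hhead]; rfl)
  have hadj := hA.adj _ (List.getElem_mem hlen)
  have hfirst : ∀ e : {c : Cluster I.leader // c ≠ r.root}, (I.tables name Q ends).down e = 1 →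
      I.A[0] = (r.par e.1, e.1) := by
    intro e he
    rw [(h.orientation e).1] at he
    have h1 := getElem_entryIdx (entryIdx_lt_length (hA.mem_iff.2 (r.par_adj e.1 e.2).1.symm))
    have h2 : entryIdx I.A (r.par e.1, e.1) = 0 := by omega
    simp only [h2] at h1
    exact h1
  rw [JoinTables.baseRoot, hc]
  split_ifs with hr
  · rcases r.isParentMap.adj_cases I.T_isTree hadj with ⟨h1, -⟩ | ⟨hq, hpq⟩
    · exact absurd h0 h1
    · have hpair : I.A[0] = (r.par (I.A[0]).2, (I.A[0]).2) := Prod.ext hpq.symm rfl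
      have hdown : (I.tables name Q ends).down ⟨(I.A[0]).2, hq⟩ = 1 := by
        rw [(h.orientation _).1]
        simp only
        rw [← hpair, entryIdx_getElem hA.nodup hlen]
      rw [sumIn_eq_single ⟨(I.A[0]).2, hq⟩]
      · rw [if_pos hdown, (h.orientation _).2.2.2.2.1, hr, h.canonical.base_root _ (by
          rw [hhead]; rfl)]
        simp only [hpq]
      · rw [(h.orientation _).2.2.1]
        simp only [hpq, h0, hr]
      · intro e _ hne
        refine if_neg fun hd => hne (Subtype.ext ?_)
        exact (congrArg Prod.snd (hfirst e hd)).symm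
  · refine sumIn_eq_zero fun e h1 h2 => if_neg fun hd => ?_
    rw [(h.orientation e).2.2.1] at h1 h2
    have h3 : r.par e.1 = z.1 := Subtype.ext (name.injective (by omega))
    have h4 := congrArg Prod.fst (hfirst e hd)
    exact hr (h3.symm.trans (h4.symm.trans h0))

theorem base_eq (z : Σ c, Fin (I.tourOn c).length) [Nontrivial (Cluster I.leader)] :
    (I.tables name Q ends).base z = name (r.base z.1) + 1 := by
  rw [JoinTables.base, h.baseBelow_eq, h.baseRoot_eq]
  split_ifs <;> omega

/-- In this cluster only the first entry that leaves the base has nonzero weight. It exists: having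
an entry, the cluster has two nodes, so the base has a neighbour. -/
theorem start_eq (z : Σ c, Fin (I.tourOn c).length) [Nontrivial (Cluster I.leader)] :
    firstPos (I.tourOn z.1) (r.base z.1) < (I.tourOn z.1).length ∧
    (I.tables name Q ends).start z = firstPos (I.tourOn z.1) (r.base z.1) + 1 := by
  have hlead := r.leader_base z.1
  obtain ⟨h1, h2, h3⟩ := mem_tourOn.1 (entry_mem z)
  have : Nontrivial (Members I.leader z.1) := ⟨_, _, h3.ne⟩
  obtain ⟨y, hy⟩ :=
    (I.tree_isTree z.1).connected.preconnected.exists_adj_of_nontrivial ⟨r.base z.1, hlead⟩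
  have hlt := firstPos_lt_length (mem_tourOn.2 ⟨hlead, y.2, hy⟩)
  refine ⟨hlt, ?_⟩
  obtain ⟨z', hz1, hz2⟩ : ∃ z' : Σ c, Fin (I.tourOn c).length, z'.1 = z.1 ∧
      z'.2.1 = firstPos (I.tourOn z.1) (r.base z.1) := ⟨⟨z.1, _, hlt⟩, rfl, rfl⟩
  have hc : ∀ z, (I.tables name Q ends).c z = name z.1.1 := fun _ => rfl
  have hu : ∀ z, (I.tables name Q ends).u z = name (I.entry z).1 := fun _ => rfl
  have ht : ∀ z, (I.tables name Q ends).t z = z.2 + 1 := fun _ => rfl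
  have hentry : ∀ z' : Σ c, Fin (I.tourOn c).length, z'.1 = z.1 →
      z'.2.1 = firstPos (I.tourOn z.1) (r.base z.1) → (I.entry z').1 = r.base z.1 := by
    rintro ⟨c, i⟩ rfl hi
    have := getElem_firstPos hlt
    simp only [entry, Fin.getElem_fin]
    simp only at hi
    simp only [hi, this]
  rw [JoinTables.start, hc, sumIn_eq_single z' (by rw [hc, hz1])]
  · rw [if_pos, ht, hz2]
    rw [earlier_eq_zero_iff h.tour_lt, h.base_eq, hu, hentry z' hz1 hz2, hz2, hz1]
    exact ⟨rfl, rfl⟩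
  · intro w hw hne
    refine if_neg fun hcond => hne ?_
    rw [earlier_eq_zero_iff h.tour_lt, h.base_eq, hu] at hcond
    have hw1 : w.1 = z.1 := Subtype.ext (name.injective hw)
    have hw2 : (I.entry w).1 = r.base w.1 := name.injective (by omega)
    have hw3 : w.2.1 = z'.2.1 := by
      rw [hcond.1, hw2, hw1, hz2]
    obtain ⟨c, i⟩ := w
    obtain ⟨c', i'⟩ := z'
    obtain rfl : c = c' := hw1.trans hz1.symm
    exact congrArg (Sigma.mk c) (Fin.ext hw3)

variable [Nontrivial (Cluster I.leader)]

theorem isShift : IsShift I (I.tables name Q ends).start r.localTour :=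
  ⟨_, h.canonical.localTour_eq, fun z => ⟨(h.start_eq z).1, Or.inl (h.start_eq z).2⟩⟩

theorem nodePos_eq (e : {c : Cluster I.leader // c ≠ r.root}) :
    (I.tables name Q ends).nodePos e = firstPos (r.localTour (r.par e.1)) (I.g (r.par e.1) e.1).1 :=
  JoinInstance.nodePos_eq h.isShift r.isParentMap h.canonical.startsAt h.name_lt h.ends_eq
    h.tour_lt e

theorem rank_eq (e : {c : Cluster I.leader // c ≠ r.root}) :
    (I.tables name Q ends).nodePos e * Q + (I.tables name Q ends).down e = r.rank e.1 := by
  rw [h.canonical.rank_eq, h.nodePos_eq, (h.orientation e).1]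

theorem nodePos_lt (e : {c : Cluster I.leader // c ≠ r.root}) :
    (I.tables name Q ends).nodePos e < Q := by
  rw [h.nodePos_eq]
  refine lt_of_le_of_lt (firstPos_le_length _ _) ?_
  rw [h.isShift.length_eq]
  exact h.tour_lt _

theorem rank_lt_sq (e : {c : Cluster I.leader // c ≠ r.root}) : r.rank e.1 < Q * Q := by
  rw [← h.rank_eq]
  have h1 := h.nodePos_lt e
  have h2 := entryIdx_lt_length (I.A_isEulerTour.mem_iff.2 (r.par_adj e.1 e.2).1.symm)
  have h3 := h.length_lt
  have h4 := Nat.mul_le_mul_right Q (Nat.succ_le_of_lt h1)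
  rw [Nat.succ_mul] at h4
  rw [(h.orientation e).1]
  omega

/-- The key of an edge is the pair (parent, rank) coded in base Q * Q, so the range collects the
siblings of smaller rank. -/
theorem offset_eq (e : {c : Cluster I.leader // c ≠ r.root}) :
    (I.tables name Q ends).offset e = siblingOffset r.root r.par r.rank e.1 := by
  classical
  rw [JoinTables.offset, siblingOffset, JoinTables.before, sumIn]
  congr 1
  rw [← sum_subtype_ne]
  refine Finset.sum_congr rfl fun e' _ => ?_
  rw [h.len_eq]
  refine if_congr ?_ rfl rfl
  have e1 : (I.tables name Q ends).Q = Q := rfl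
  have e2 : ∀ e, ((I.tables name Q ends).parent e * Q + (I.tables name Q ends).nodePos e) * Q +
      (I.tables name Q ends).down e = name (r.par e.1).1 * (Q * Q) + r.rank e.1 := by
    intro e
    rw [← h.rank_eq, (h.orientation e).2.2.1]
    ring
  rw [e1, e2, h.rank_eq, (h.orientation e).2.2.1, mul_assoc]
  have h1 := pair_code_lt_iff (a := name (r.par e'.1).1) (a' := name (r.par e.1).1)
    (h.rank_lt_sq e') (h.rank_lt_sq e)
  have h2 := pair_code_lt_iff (a := name (r.par e'.1).1) (a' := name (r.par e.1).1) (b' := 0)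
    (h.rank_lt_sq e') (lt_of_le_of_lt (Nat.zero_le _) (h.rank_lt_sq e))
  rw [h1, ← not_lt]
  rw [add_zero] at h2
  rw [h2]
  have h3 : name (r.par e'.1).1 = name (r.par e.1).1 ↔ r.par e'.1 = r.par e.1 :=
    ⟨fun h => Subtype.ext (name.injective h), fun h => by rw [h]⟩
  rw [← h3]
  omega

/-- `enterTime` adds the offsets of the ancestors of e, itself included. By the bracket structure of
A these are the edges entered no later than e and not left before, so the sum over the edges left is
subtracted from the sum over those entered. -/
theorem newDown_eq (e : {c : Cluster I.leader // c ≠ r.root}) :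
    (I.tables name Q ends).newDown e = enterTime r.root r.par r.rank e.1 := by
  classical
  have hp := r.isParentMap
  have hA := I.A_isEulerTour
  have hkey : (I.tables name Q ends).sumEntered e =
      enterTime r.root r.par r.rank e.1 + (I.tables name Q ends).sumLeft e := by
    rw [JoinTables.sumEntered, JoinTables.sumLeft, enterTime, sumIn, sumIn, ← sum_subtype_ne,
      ← Finset.sum_add_distrib]
    refine Finset.sum_congr rfl fun e' _ => ?_
    rw [h.offset_eq, (h.orientation e').1, (h.orientation e').2.1, (h.orientation e).1]
    have hD : entryIdx I.A (r.par e.1, e.1) < I.A.length :=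
      entryIdx_lt_length (hA.mem_iff.2 (hp.adj e.1 e.2).symm)
    have hU : entryIdx I.A (e'.1, r.par e'.1) < I.A.length :=
      entryIdx_lt_length (hA.mem_iff.2 (hp.adj e'.1 e'.2))
    have hlt := hp.idxOf_down_lt_up I.T_isTree hA h.canonical.startsAt e'.2
    have hiff := hp.target_isDesc_iff I.T_isTree hA h.canonical.startsAt e'.2 hD
    have hDe := getElem_entryIdx hD
    rw [hDe] at hiff
    simp only [hiff]
    have hne : entryIdx I.A (r.par e.1, e.1) ≠ entryIdx I.A (e'.1, r.par e'.1) := by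
      intro heq
      have hUe := getElem_entryIdx hU
      simp only [← heq, hDe, Prod.mk.injEq] at hUe
      have d1 := hp.dist e.1 e.2
      have d2 := hp.dist e'.1 e'.2
      rw [hUe.1] at d1
      rw [← hUe.2] at d2
      omega
    split_ifs <;> omega
  rw [JoinTables.newDown, hkey, Nat.add_sub_cancel]

theorem newUp_eq (e : {c : Cluster I.leader // c ≠ r.root}) :
    (I.tables name Q ends).newUp e = entryIdx r.newA (e.1, r.par e.1) + 1 := by
  have := (h.canonical.entryIdx_newA e.1 e.2).2
  rw [JoinTables.newUp, h.newDown_eq, h.len_eq]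
  omega

theorem enter_eq (z : Σ c, Fin (I.tourOn c).length) :
    (I.tables name Q ends).enter z = enterTime r.root r.par r.rank z.1 := by
  have hc : (I.tables name Q ends).c z = name z.1.1 := rfl
  rw [JoinTables.enter, hc]
  by_cases hr : z.1 = r.root
  · rw [hr, r.isParentMap.enterTime_root]
    refine sumIn_eq_zero fun e h1 h2 => ?_
    rw [(h.orientation e).2.2.2.1] at h1 h2
    exact absurd (Subtype.ext (name.injective (by omega))) e.2
  · rw [sumIn_eq_single ⟨z.1, hr⟩ (h.orientation _).2.2.2.1, h.newDown_eq]
    intro e he hne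
    rw [(h.orientation e).2.2.2.1] at he
    exact absurd (Subtype.ext (Subtype.ext (name.injective he))) hne

open Classical in
theorem visited_eq (z : Σ c, Fin (I.tourOn c).length) :
    (I.tables name Q ends).visited z = ∑ q ∈ Finset.univ.filter (fun q => q ≠ r.root ∧
      r.par q = z.1 ∧ r.pos (I.g (r.par q) q).1 ≤ (I.tables name Q ends).shifted z),
      subtreeLen r.par q := by
  rw [JoinTables.visited, sumIn, ← sum_subtype_ne]
  refine Finset.sum_congr rfl fun e _ => ?_
  rw [h.len_eq]
  refine if_congr ?_ rfl rfl
  have e1 : (I.tables name Q ends).Q = Q := rfl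
  have e2 : (I.tables name Q ends).c z = name z.1.1 := rfl
  have e3 : (I.tables name Q ends).nodePos e = r.pos (I.g (r.par e.1) e.1).1 := by
    rw [h.nodePos_eq, pos, clusterOf_eq (I.g_mem _ _ (r.par_adj e.1 e.2).1.symm).1]
  have h1 := h.nodePos_lt e
  have h2 := shifted_lt h.isShift z
  have h3 := h.tour_lt z.1
  have h4 := pair_code_lt_iff (a := name (r.par e.1).1) (a' := name z.1.1)
    (b' := (I.tables name Q ends).shifted z + 1) h1 (by omega)
  have h5 := pair_code_lt_iff (a := name (r.par e.1).1) (a' := name z.1.1)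
    (b' := 0) h1 (by omega)
  have h6 : name (r.par e.1).1 = name z.1.1 ↔ r.par e.1 = z.1 :=
    ⟨fun h => Subtype.ext (name.injective h), fun h => by rw [h]⟩
  rw [add_zero] at h5
  rw [e1, e2, (h.orientation e).2.2.1, h4, ← not_lt, h5, ← h6, ← e3]
  omega

/-- The arrival column is the position of the last arrival. -/
theorem arrival_eq (z : Σ c, Fin (I.tourOn c).length) {t : ℕ} {x : V} (ha : r.Arrives t x)
    (hc : I.clusterOf x = z.1) (hx : r.pos x ≤ (I.tables name Q ends).shifted z)
    (hmax : ∀ t' x', r.Arrives t' x' → I.clusterOf x' = z.1 →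
      r.pos x' ≤ (I.tables name Q ends).shifted z → t' ≤ t) :
    (I.tables name Q ends).arrival z = t + 1 := by
  classical
  have hp := r.isParentMap
  have hB := r.newA_isEulerTour
  rw [JoinTables.arrival, h.enter_eq, h.visited_eq]
  have hchild : ∀ q, q ≠ r.root → r.par q = z.1 →
      r.pos (I.g (r.par q) q).1 ≤ (I.tables name Q ends).shifted z →
      entryIdx r.newA (q, r.par q) ≤ t := by
    intro q hq hqz hpos
    have hadj := (r.par_adj q hq).1
    have h1 := r.arrives_idxOf hadj
    have h2 : (I.g q (r.par q)).2 = (I.g (r.par q) q).1 := by rw [I.g_symm _ _ hadj]; rfl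
    rw [h2] at h1
    exact hmax _ _ h1 ((clusterOf_eq (I.g_mem _ _ hadj.symm).1).trans hqz) hpos
  rcases r.arrives_cases ha with ⟨h1, h2, -⟩ | ⟨q, hq, hqp, hqi, hqx⟩
  -- If the last arrival comes from the parent, no child terminal has a position up to `shifted z`:
  -- its arrival would have to precede the one from the parent.
  · rw [Finset.sum_eq_zero, add_zero, ← hc, ← (h.canonical.entryIdx_newA _ h1).1, h2]
    intro q hq
    simp only [Finset.mem_filter, Finset.mem_univ, true_and] at hq
    exfalso
    have h3 := hchild q hq.1 hq.2.1 hq.2.2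
    have hl : entryIdx r.newA (q, r.par q) < r.newA.length :=
      entryIdx_lt_length (hB.mem_iff.2 (hp.adj q hq.1))
    have h4 := (hp.target_isDesc_iff I.T_isTree hB r.newA_startsAt h1 hl).1 (by
      rw [getElem_entryIdx hl, hc, ← hq.2.1]; exact IsDesc.refl _)
    have h5 : entryIdx r.newA (q, r.par q) = t := by omega
    have h6 := getElem_entryIdx hl
    have hl' : entryIdx r.newA (r.par (I.clusterOf x), I.clusterOf x) < r.newA.length := by omega
    have h7 := getElem_entryIdx hl'
    simp only [h5] at h6
    simp only [h2] at h7
    have h8 := h6.symm.trans h7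
    simp only [Prod.mk.injEq] at h8
    have d1 := hp.dist q hq.1
    have d2 := hp.dist _ h1
    rw [h8.2] at d1
    rw [← h8.1] at d2
    omega
  -- If it comes from the child q, the children counted are q and its siblings of smaller rank, so
  -- their total length leads from the entry into the cluster to the upward pass of q.
  · have hset : Finset.univ.filter (fun q => q ≠ r.root ∧
        r.par q = z.1 ∧ r.pos (I.g (r.par q) q).1 ≤ (I.tables name Q ends).shifted z) =
        insert q (Finset.univ.filter
          (fun s => s ≠ r.root ∧ r.par s = r.par q ∧ r.rank s < r.rank q)) := by
      ext s
      simp only [Finset.mem_filter, Finset.mem_univ, true_and, Finset.mem_insert]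
      constructor
      · rintro ⟨h1, h2, h3⟩
        by_cases hsq : s = q
        · exact Or.inl hsq
        · right
          have hpp : r.par s = r.par q := by rw [h2, hqp, hc]
          refine ⟨h1, hpp, ?_⟩
          by_contra hcon
          have hlt : r.rank q < r.rank s := lt_of_le_of_ne (by omega) fun he =>
            hsq (r.rank_injective s q h1 hq hpp he.symm)
          have h4 := r.newA_ordered q s hq h1 hpp.symm hlt
          rw [hp.firstPos_eq I.T_isTree hB r.newA_startsAt hq,
            hp.firstPos_eq I.T_isTree hB r.newA_startsAt h1] at h4
          have h5 := hp.idxOf_up_lt_down I.T_isTree hB r.newA_startsAt hq h1 hpp.symm (by omega)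
          have h6 := hp.idxOf_down_lt_up I.T_isTree hB r.newA_startsAt h1
          have h7 := hchild s h1 h2 h3
          omega
      · rintro (rfl | ⟨h1, h2, h3⟩)
        · exact ⟨hq, hqp.trans hc, by rw [← hqx]; exact hx⟩
        · refine ⟨h1, h2.trans (hqp.trans hc), ?_⟩
          by_contra hcon
          rw [hqx] at hx
          have hpos : ∀ a, a ≠ r.root → firstPos (r.localTour (r.par a)) (I.g (r.par a) a).1 =
              r.pos (I.g (r.par a) a).1 := by
            intro a ha
            rw [pos, clusterOf_eq (I.g_mem _ _ (r.par_adj a ha).1.symm).1]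
          have := r.rank_lt q s hq h1 h2.symm (by rw [hpos q hq, hpos s h1]; omega)
          omega
    rw [hset, Finset.sum_insert (by simp)]
    have h1 := (h.canonical.entryIdx_newA q hq).2
    have h2 := hp.enterTime_eq (rank := r.rank) hq
    rw [siblingOffset_eq] at h2
    rw [← hc, ← hqp]
    omega

end IsEncoded

end JoinRun

/-! ### The output records -/

section Counting

variable {V : Type u} [DecidableEq V]

/-- In a strictly sorted list exactly the preceding entries have smaller keys. Positions in the
output thus become counts, which range sums can compute. -/
theorem entryIdx_eq_countP {δ : Type} [LinearOrder δ] {L : List (V × V)} {K : V × V → δ}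
    (hL : L.Pairwise (fun d d' => K d < K d')) {d : V × V} (hd : d ∈ L) :
    entryIdx L d = L.countP (fun d' => K d' < K d) := by
  obtain ⟨i, hi, rfl⟩ := List.mem_iff_getElem.1 hd
  have hnd : L.Nodup := hL.imp fun {a b} h hab => by rw [hab] at h; exact lt_irrefl _ h
  rw [entryIdx_getElem hnd hi]
  rw [List.pairwise_iff_getElem] at hL
  have h1 : (L.take i).countP (fun d' => K d' < K L[i]) = i := by
    rw [List.countP_eq_length.2]
    · rw [List.length_take]; omega
    · intro a ha
      obtain ⟨j, hj, rfl⟩ := List.mem_iff_getElem.1 ha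
      rw [List.length_take] at hj
      rw [List.getElem_take]
      exact decide_eq_true (hL j i (by omega) hi (by omega))
  have h2 : (L.drop i).countP (fun d' => K d' < K L[i]) = 0 := by
    rw [List.countP_eq_zero]
    intro a ha
    obtain ⟨j, hj, rfl⟩ := List.mem_iff_getElem.1 ha
    rw [List.length_drop] at hj
    rw [List.getElem_drop]
    simp only [decide_eq_true_eq, not_lt]
    rcases Nat.eq_zero_or_pos j with rfl | h0
    · simp
    · exact (hL i (i + j) hi (by omega) (by omega)).le
  have h3 := List.countP_append (p := fun d' => decide (K d' < K L[i])) (l₁ := L.take i)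
    (l₂ := L.drop i)
  rw [List.take_append_drop, h1, h2] at h3
  exact h3.symm

theorem zipIdx_map_eq {L : List (V × V)} (hL : L.Nodup) (f : (V × V) × ℕ → List ℕ) :
    (L.zipIdx 1).map f = L.map (fun d => f (d, entryIdx L d + 1)) := by
  refine List.ext_getElem (by simp) fun i h1 h2 => ?_
  rw [List.length_map] at h2
  simp only [List.getElem_map, List.getElem_zipIdx, entryIdx_getElem hL h2]
  rw [add_comm]

theorem countP_map_univ {ι δ : Type u} [Fintype ι] (f : ι → δ) (p : δ → Prop) [DecidablePred p] :
    (Finset.univ.val.map f).countP p = ∑ i, if p (f i) then 1 else 0 := by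
  rw [Multiset.countP_map, Finset.sum_boole]
  rfl

end Counting

namespace JoinInstance

variable {V : Type u} [Fintype V] [DecidableEq V] {I : JoinInstance V}

theorem nodup_map_entry : (Finset.univ.val.map I.entry).Nodup :=
  Finset.univ.nodup.map entry_injective

omit [DecidableEq V] [Fintype V] in
theorem mem_entries {d : V × V} [Fintype (Σ c, Fin (I.tourOn c).length)] :
    d ∈ Finset.univ.val.map I.entry ↔ ∃ c, d ∈ I.tourOn c := by
  rw [Multiset.mem_map]
  constructor
  · rintro ⟨z, -, rfl⟩
    exact ⟨_, entry_mem z⟩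
  · rintro ⟨c, hc⟩
    obtain ⟨z, -, rfl⟩ := exists_entry hc
    exact ⟨z, Finset.mem_univ z, rfl⟩

end JoinInstance

/-! ### Final positions of the output entries -/

namespace JoinRun

open JoinInstance

variable {V : Type u} [Fintype V] [DecidableEq V] {I : JoinInstance V} {name : V ↪ ℕ} {Q : ℕ}
  {r : JoinRun I}
  {ends : {c : Cluster I.leader // c ≠ r.root} → Cluster I.leader × Cluster I.leader}

omit [Fintype V] in
theorem clusterOf_of_mem_cross {d : V × V} (h : d ∈ r.cross) :
    I.clusterOf d.1 ≠ I.clusterOf d.2 := by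
  obtain ⟨a, b, hab, he⟩ := r.mem_cross_iff.1 h
  rw [show d = I.g a b from he.symm, clusterOf_eq (I.g_mem _ _ hab).1,
    clusterOf_eq (I.g_mem _ _ hab).2]
  exact hab.ne

omit [Fintype V] [DecidableEq V] in
theorem clusterOf_entry (z : Σ c, Fin (I.tourOn c).length) :
    I.clusterOf (I.entry z).1 = I.clusterOf (I.entry z).2 := by
  obtain ⟨h1, h2, -⟩ := mem_tourOn.1 (entry_mem z)
  exact (clusterOf_eq h1).trans (clusterOf_eq h2).symm

omit [Fintype V] in
theorem nodup_cross : r.cross.Nodup := by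
  refine List.Nodup.map_on ?_ r.newA_isEulerTour.nodup
  intro e he e' he' h
  have h1 := r.newA_isEulerTour.adj e he
  have h2 := r.newA_isEulerTour.adj e' he'
  refine Prod.ext ?_ ?_
  · exact (clusterOf_eq (I.g_mem _ _ h1).1).symm.trans (h ▸ clusterOf_eq (I.g_mem _ _ h2).1)
  · exact (clusterOf_eq (I.g_mem _ _ h1).2).symm.trans (h ▸ clusterOf_eq (I.g_mem _ _ h2).2)

/-- Neither side has repetitions, since crossing edges join different clusters and local ones do
not; so it is enough to compare members. -/
theorem coe_output : (r.output : Multiset (V × V)) =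
    (r.cross : Multiset (V × V)) + Finset.univ.val.map I.entry := by
  rw [Multiset.Nodup.ext (Multiset.coe_nodup.2 r.nodup_output)]
  · intro d
    rw [Multiset.mem_coe, r.mem_output, Multiset.mem_add, Multiset.mem_coe, mem_entries]
    simp only [(r.localTour_isRotated _).mem_iff]
  · rw [Multiset.nodup_add]
    refine ⟨Multiset.coe_nodup.2 nodup_cross, nodup_map_entry, ?_⟩
    rw [Multiset.disjoint_left]
    intro d hd hd'
    obtain ⟨z, -, rfl⟩ := Multiset.mem_map.1 hd'
    exact clusterOf_of_mem_cross (Multiset.mem_coe.1 hd) (clusterOf_entry z)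

theorem coe_newA : (r.newA : Multiset (Cluster I.leader × Cluster I.leader)) =
    Finset.univ.val.map (fun e : {c : Cluster I.leader // c ≠ r.root} => (r.par e.1, e.1)) +
    Finset.univ.val.map (fun e : {c : Cluster I.leader // c ≠ r.root} => (e.1, r.par e.1)) := by
  have hp := r.isParentMap
  rw [Multiset.Nodup.ext (Multiset.coe_nodup.2 r.newA_isEulerTour.nodup)]
  · rintro ⟨a, b⟩
    rw [Multiset.mem_coe, r.newA_isEulerTour.mem_iff, Multiset.mem_add, Multiset.mem_map,
      Multiset.mem_map]
    constructor
    · intro hab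
      rcases hp.adj_cases I.T_isTree hab with ⟨h1, h2⟩ | ⟨h1, h2⟩
      · exact Or.inr ⟨⟨a, h1⟩, Finset.mem_univ _, by rw [← h2]⟩
      · exact Or.inl ⟨⟨b, h1⟩, Finset.mem_univ _, by rw [← h2]⟩
    · rintro (⟨e, -, he⟩ | ⟨e, -, he⟩) <;> simp only [Prod.mk.injEq] at he <;>
        rw [← he.1, ← he.2]
      · exact (hp.adj _ e.2).symm
      · exact hp.adj _ e.2
  · rw [Multiset.nodup_add]
    refine ⟨Finset.univ.nodup.map fun a b h => Subtype.ext (congrArg Prod.snd h),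
      Finset.univ.nodup.map fun a b h => Subtype.ext (congrArg Prod.fst h), ?_⟩
    rw [Multiset.disjoint_left]
    intro d hd hd'
    obtain ⟨e, -, rfl⟩ := Multiset.mem_map.1 hd
    obtain ⟨e', -, he⟩ := Multiset.mem_map.1 hd'
    simp only [Prod.mk.injEq] at he
    have d1 := hp.dist _ e.2
    have d2 := hp.dist _ e'.2
    rw [he.2] at d2
    rw [← he.1] at d1
    omega

-- In the order of the new tour the crossing edges have the keys (1, 0), (2, 0), …, so those below a
-- given key form an initial segment.
omit [Fintype V] in
theorem countP_cross {K : V × V → ℕ ×ₗ ℕ} (hK : ∀ (t : ℕ) (ht : t < r.newA.length),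
    K (I.g (r.newA[t]).1 (r.newA[t]).2) = toLex (t + 1, 0)) (k : ℕ ×ₗ ℕ) (m : ℕ)
    (hm : m ≤ r.newA.length) (hkm : ∀ t, toLex (t + 1, 0) < k ↔ t < m) :
    r.cross.countP (fun d => K d < k) = m := by
  have hlen : r.cross.length = r.newA.length := List.length_map _
  have hget : ∀ (t : ℕ) (ht : t < r.cross.length), (K r.cross[t] < k ↔ t < m) := by
    intro t ht
    rw [← hkm t, ← hK t (by omega)]
    simp [cross]
  rw [← List.take_append_drop m r.cross, List.countP_append, List.countP_eq_length.2,
    List.countP_eq_zero.2, List.length_take, add_zero]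
  · omega
  · intro d hd
    obtain ⟨j, hj, rfl⟩ := List.mem_iff_getElem.1 hd
    rw [List.length_drop] at hj
    simp only [decide_eq_true_eq, List.getElem_drop]
    rw [hget]
    omega
  · intro d hd
    obtain ⟨j, hj, rfl⟩ := List.mem_iff_getElem.1 hd
    rw [List.length_take] at hj
    simp only [decide_eq_true_eq, List.getElem_take]
    rw [hget]
    omega

theorem entryIdx_output {d : V × V} (hd : d ∈ r.output) {K : V × V → ℕ ×ₗ ℕ}
    (hpw : r.output.Pairwise (fun d d' => K d < K d')) :
    entryIdx r.output d = r.cross.countP (fun d' => K d' < K d) +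
      ∑ z, if K (I.entry z) < K d then 1 else 0 := by
  rw [entryIdx_eq_countP hpw hd]
  have := congrArg (Multiset.countP (fun d' => K d' < K d)) r.coe_output
  rw [Multiset.countP_add, countP_map_univ, Multiset.coe_countP, Multiset.coe_countP] at this
  exact this

namespace IsEncoded

variable (h : r.IsEncoded name Q ends) [Nontrivial (Cluster I.leader)]
include h

/-- The output is sorted by the columns. -/
theorem exists_key : ∃ K : V × V → ℕ ×ₗ ℕ, r.output.Pairwise (fun d d' => K d < K d') ∧
    (∀ (t : ℕ) (ht : t < r.newA.length),
      K (I.g (r.newA[t]).1 (r.newA[t]).2) = toLex (t + 1, 0)) ∧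
    ∀ z, K (I.entry z) = toLex ((I.tables name Q ends).arrival z,
      (I.tables name Q ends).shifted z + 1) := by
  classical
  let K : V × V → ℕ ×ₗ ℕ := fun d =>
    if hd : ∃ z, I.entry z = d then toLex ((I.tables name Q ends).arrival hd.choose,
      (I.tables name Q ends).shifted hd.choose + 1)
    else toLex (entryIdx r.newA (I.clusterOf d.1, I.clusterOf d.2) + 1, 0)
  have hK1 : ∀ (t : ℕ) (ht : t < r.newA.length),
      K (I.g (r.newA[t]).1 (r.newA[t]).2) = toLex (t + 1, 0) := by
    intro t ht
    have hadj := r.adj_newA ht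
    have h1 := clusterOf_eq (I.g_mem _ _ hadj).1
    have h2 := clusterOf_eq (I.g_mem _ _ hadj).2
    have hn : ¬ ∃ z, I.entry z = I.g (r.newA[t]).1 (r.newA[t]).2 := by
      rintro ⟨z, hz⟩
      have := clusterOf_entry z
      rw [hz, h1, h2] at this
      exact hadj.ne this
    simp only [K]
    rw [dif_neg hn, h1, h2, show ((r.newA[t]).1, (r.newA[t]).2) = r.newA[t] from rfl,
      entryIdx_getElem r.newA_isEulerTour.nodup ht]
  have hK2 : ∀ z, K (I.entry z) = toLex ((I.tables name Q ends).arrival z,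
      (I.tables name Q ends).shifted z + 1) := by
    intro z
    have hz : ∃ z', I.entry z' = I.entry z := ⟨z, rfl⟩
    simp only [K]
    rw [dif_pos hz, entry_injective hz.choose_spec]
  refine ⟨K, r.pairwise_output K hK1 ?_, hK1, hK2⟩
  intro c i hi t x ha hc hx hmax
  obtain ⟨z, hz1, hz2⟩ := exists_entry ((h.isShift.mem_iff _ _).1 (List.getElem_mem hi))
  have hsh : (I.tables name Q ends).shifted z = i := by
    rw [shifted_eq h.isShift, hz1, hz2]
    exact entryIdx_getElem (h.isShift.nodup c) hi
  rw [← hz2, hK2, hsh, h.arrival_eq z ha (hc.trans hz1.symm) (by rw [hsh]; exact hx) (by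
    rw [hsh, hz1]; exact hmax)]

theorem arrival_le (z : Σ c, Fin (I.tourOn c).length) :
    (I.tables name Q ends).arrival z ≤ r.newA.length := by
  obtain ⟨t, x, ha, hc, hx, hmax⟩ := r.exists_last_arrival z.1 ((I.tables name Q ends).shifted z)
  rw [h.arrival_eq z ha hc hx hmax]
  exact ha.1

/-- Exactly `arrival z` crossing edges come first: the key (t + 1, 0) lies below (arrival z, shifted
z + 1) also for t + 1 = arrival z, owing to the second component. -/
theorem entryIdx_entry (z : Σ c, Fin (I.tourOn c).length) :
    entryIdx r.output (I.entry z) =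
      (I.tables name Q ends).arrival z + (I.tables name Q ends).localBefore z := by
  obtain ⟨K, hpw, hK1, hK2⟩ := h.exists_key
  have hsl : ∀ z, (I.tables name Q ends).shifted z < Q := fun z =>
    (shifted_lt h.isShift z).trans (h.tour_lt _)
  rw [entryIdx_output ?_ hpw, countP_cross hK1 _ _ (h.arrival_le z)]
  · rw [JoinTables.localBefore, sumIn]
    congr 1
    refine Finset.sum_congr rfl fun z' _ => if_congr ?_ rfl rfl
    rw [hK2, hK2, Prod.Lex.toLex_lt_toLex, zero_add]
    have := pair_code_lt_iff (a := (I.tables name Q ends).arrival z')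
      (a' := (I.tables name Q ends).arrival z) (hsl z') (hsl z)
    simp only [Nat.zero_le, true_and]
    rw [show (I.tables name Q ends).Q = Q from rfl, this]
    omega
  · intro t
    rw [hK2, Prod.Lex.toLex_lt_toLex]
    simp only
    omega
  · rw [r.mem_output]
    exact Or.inr ⟨z.1, (h.isShift.mem_iff _ _).2 (entry_mem z)⟩

theorem entryIdx_cross {a b : Cluster I.leader} (hab : I.T.Adj a b) {m : ℕ}
    (hm : entryIdx r.newA (a, b) + 1 = m) : entryIdx r.output (I.g a b) + 1 =
      m + sumIn (fun z => (I.tables name Q ends).arrival z * Q + (I.tables name Q ends).shifted z)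
        (fun _ => 1) 0 (m * Q) := by
  obtain ⟨K, hpw, hK1, hK2⟩ := h.exists_key
  have hsl : ∀ z, (I.tables name Q ends).shifted z < Q := fun z =>
    (shifted_lt h.isShift z).trans (h.tour_lt _)
  have hlt := entryIdx_lt_length (r.newA_isEulerTour.mem_iff.2 hab)
  have hget := getElem_entryIdx hlt
  have hKd : K (I.g a b) = toLex (m, 0) := by
    have := hK1 _ hlt
    rw [hget, hm] at this
    exact this
  -- The m-th crossing edge is preceded by m − 1 others and by exactly the local entries whose
  -- arrival is below m.
  rw [entryIdx_output ?_ hpw, countP_cross hK1 _ (m - 1) (by omega)]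
  · rw [sumIn, add_right_comm, Nat.sub_add_cancel (by omega)]
    congr 1
    refine Finset.sum_congr rfl fun z' _ => if_congr ?_ rfl rfl
    rw [hK2, hKd, Prod.Lex.toLex_lt_toLex, zero_add]
    have hQ0 := hsl z'
    have := pair_code_lt_iff (a := (I.tables name Q ends).arrival z')
      (a' := m) (b' := 0) (hsl z') (by omega)
    rw [add_zero] at this
    rw [this]
    simp
  · intro t
    rw [hKd, Prod.Lex.toLex_lt_toLex]
    simp only
    omega
  · rw [r.mem_output]
    exact Or.inl (r.mem_cross_iff.2 ⟨a, b, hab, rfl⟩)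

/-- The records of the output tour. -/
theorem output_records :
    (((r.output.zipIdx 1).map (fun q => [7, q.2, name q.1.1, name q.1.2]) : List (List ℕ)) :
      Multiset (List ℕ)) =
    Finset.univ.val.map (fun e => [7, (I.tables name Q ends).newDown e +
      (I.tables name Q ends).beforeDown e, (I.tables name Q ends).parentNode e,
      (I.tables name Q ends).childNode e]) +
    Finset.univ.val.map (fun e => [7, (I.tables name Q ends).newUp e +
      (I.tables name Q ends).beforeUp e, (I.tables name Q ends).childNode e,
      (I.tables name Q ends).parentNode e]) +
    Finset.univ.val.map (fun z => [7, (I.tables name Q ends).arrival z +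
      (I.tables name Q ends).localBefore z + 1, (I.tables name Q ends).u z,
      (I.tables name Q ends).v z]) := by
  rw [zipIdx_map_eq r.nodup_output, ← Multiset.map_coe, r.coe_output, Multiset.map_add,
    Multiset.map_map, cross, ← Multiset.map_coe, Multiset.map_map, r.coe_newA, Multiset.map_add,
    Multiset.map_map, Multiset.map_map]
  congr 1
  · congr 1
    · refine Multiset.map_congr rfl fun e _ => ?_
      have hadj := (r.par_adj e.1 e.2).1
      simp only [Function.comp]
      rw [(h.orientation e).2.2.2.2.1, (h.orientation e).2.2.2.2.2,
        h.entryIdx_cross hadj.symm (m := (I.tables name Q ends).newDown e) (by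
          rw [h.newDown_eq]; exact (h.canonical.entryIdx_newA e.1 e.2).1)]
      rfl
    · refine Multiset.map_congr rfl fun e _ => ?_
      have hadj := (r.par_adj e.1 e.2).1
      simp only [Function.comp]
      rw [(h.orientation e).2.2.2.2.1, (h.orientation e).2.2.2.2.2,
        h.entryIdx_cross hadj (m := (I.tables name Q ends).newUp e) (h.newUp_eq e).symm,
        I.g_symm _ _ hadj]
      rfl
  · refine Multiset.map_congr rfl fun z _ => ?_
    simp only [Function.comp]
    rw [h.entryIdx_entry z]
    rfl

end IsEncoded

end JoinRun

/-! ### The case of a single cluster -/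

namespace JoinInstance

open JoinSteps

variable {V : Type u} [Fintype V] [DecidableEq V] {I : JoinInstance V} {name : V ↪ ℕ} {Q : ℕ}

section OneCluster

variable {c : Cluster I.leader}
  {ends : {d : Cluster I.leader // d ≠ c} → Cluster I.leader × Cluster I.leader}
  (hc : ∀ d, d = c)
include hc

omit [Fintype V] [DecidableEq V] in
theorem sumIn_eq_zero_of_forall_eq [Fintype {d : Cluster I.leader // d ≠ c}]
    (κ ω : {d : Cluster I.leader // d ≠ c} → ℕ) (lo wd : ℕ) : sumIn κ ω lo wd = 0 :=
  sumIn_eq_zero fun e _ _ => absurd (hc e.1) e.2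

theorem isShift_tourOn : IsShift I (I.tables name Q ends).start I.tourOn := by
  refine ⟨fun _ => 0, fun d => (List.rotate_zero _).symm, fun z => ⟨?_, Or.inr ⟨?_, rfl⟩⟩⟩
  · exact lt_of_le_of_lt (Nat.zero_le _) z.2.2
  · rw [JoinTables.start]
    refine sumIn_eq_zero fun z' _ _ => if_neg fun h => ?_
    rw [JoinTables.base, JoinTables.baseBelow, JoinTables.baseRoot,
      sumIn_eq_zero_of_forall_eq hc, sumIn_eq_zero_of_forall_eq hc] at h
    omega

/-- Without edges between clusters all sums over edges vanish: `start` and `arrival` are 0,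
`shifted` is the original index, and the same program reproduces the given tour. -/
theorem tourOn_records :
    ((((I.tourOn c).zipIdx 1).map (fun q => [7, q.2, name q.1.1, name q.1.2]) : List (List ℕ)) :
      Multiset (List ℕ)) =
    Finset.univ.val.map (fun e => [7, (I.tables name Q ends).newDown e +
      (I.tables name Q ends).beforeDown e, (I.tables name Q ends).parentNode e,
      (I.tables name Q ends).childNode e]) +
    Finset.univ.val.map (fun e => [7, (I.tables name Q ends).newUp e +
      (I.tables name Q ends).beforeUp e, (I.tables name Q ends).childNode e,
      (I.tables name Q ends).parentNode e]) +
    Finset.univ.val.map (fun z => [7, (I.tables name Q ends).arrival z +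
      (I.tables name Q ends).localBefore z + 1, (I.tables name Q ends).u z,
      (I.tables name Q ends).v z]) := by
  have hemp : (Finset.univ : Finset {d : Cluster I.leader // d ≠ c}) = ∅ :=
    Finset.eq_empty_of_forall_notMem fun e _ => e.2 (hc e.1)
  have hsh := isShift_tourOn (name := name) (Q := Q) (ends := ends) hc
  have hcoe : (I.tourOn c : Multiset (V × V)) = Finset.univ.val.map I.entry := by
    rw [Multiset.Nodup.ext (Multiset.coe_nodup.2 (nodup_tourOn c)) nodup_map_entry]
    intro d
    rw [mem_entries, Multiset.mem_coe]
    exact ⟨fun h => ⟨c, h⟩, fun ⟨c', h⟩ => hc c' ▸ h⟩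
  rw [hemp]
  simp only [Finset.empty_val, Multiset.map_zero, zero_add]
  rw [zipIdx_map_eq (nodup_tourOn c), ← Multiset.map_coe, hcoe, Multiset.map_map]
  refine Multiset.map_congr rfl fun z _ => ?_
  have harr : ∀ z, (I.tables name Q ends).arrival z = 0 := fun z => by
    rw [JoinTables.arrival, JoinTables.enter, JoinTables.visited, sumIn_eq_zero_of_forall_eq hc,
      sumIn_eq_zero_of_forall_eq hc]
  have hloc : (I.tables name Q ends).localBefore z = entryIdx (I.tourOn c) (I.entry z) := by
    rw [entryIdx_eq_countP (pairwise_entryIdx (nodup_tourOn c)) (hc z.1 ▸ entry_mem z),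
      ← Multiset.coe_countP, hcoe, countP_map_univ, JoinTables.localBefore, sumIn]
    refine Finset.sum_congr rfl fun z' _ => if_congr ?_ rfl rfl
    rw [harr, harr, shifted_eq hsh, shifted_eq hsh, hc z.1, hc z'.1]
    simp
  simp only [Function.comp]
  rw [harr, hloc, zero_add]
  rfl

end OneCluster

/-! ### Decoding the input -/

theorem coe_zipIdx_map {α : Type u} (l : List α) (f : α × ℕ → List ℕ) :
    (((l.zipIdx 1).map f : List (List ℕ)) : Multiset (List ℕ)) =
      Finset.univ.val.map (fun i : Fin l.length => f (l[i], i + 1)) := by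
  rw [Fin.univ_val_map]
  congr 1
  refine List.ext_getElem (by simp) fun i h1 h2 => ?_
  simp [add_comm]

theorem map_univ_eq_sum {κ : Type u} [Fintype κ] (f : κ → List ℕ) :
    Finset.univ.val.map f = ∑ k, ({f k} : Multiset (List ℕ)) := by
  rw [Finset.sum, ← Multiset.sum_map_singleton (Finset.univ.val.map f), Multiset.map_map]
  rfl

theorem map_univ_sigma {ι : Type u} [Fintype ι] {F : ι → Type} [∀ i, Fintype (F i)]
    (f : (Σ i, F i) → List ℕ) :
    (Finset.univ.val.map f : Multiset (List ℕ)) =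
      ∑ i, Finset.univ.val.map (fun j : F i => f ⟨i, j⟩) := by
  rw [map_univ_eq_sum, Fintype.sum_sigma]
  exact Finset.sum_congr rfl fun i _ => (map_univ_eq_sum _).symm

/-- A list of the edges of a rooted tree is given by the orientations of its edges. -/
theorem exists_ends {κ : Type u} [Fintype κ] {T : SimpleGraph κ} {root : κ} {par : κ → κ}
    [Fintype {c : κ // c ≠ root}] (hT : T.IsTree)
    (hp : IsParentMap T root par) {l : List (κ × κ)} (hl : IsEdgeList T l) :
    ∃ ends : {c : κ // c ≠ root} → κ × κ,
      (∀ e, ends e = (par e.1, e.1) ∨ ends e = (e.1, par e.1)) ∧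
      (l : Multiset (κ × κ)) = Finset.univ.val.map ends := by
  have hex : ∀ e : {c : κ // c ≠ root}, ∃ d ∈ l, s(d.1, d.2) = s(par e.1, e.1) := by
    intro e
    obtain ⟨d, hd, he⟩ := List.mem_map.1 ((hl.2 s(par e.1, e.1)).2 (hp.adj e.1 e.2).symm)
    exact ⟨d, hd, he⟩
  choose ends hmem hends using hex
  have hinj : ∀ e e' : {c : κ // c ≠ root}, s(par e.1, e.1) = s(par e'.1, e'.1) → e = e' := by
    intro e e' h
    rw [Sym2.eq_iff] at h
    rcases h with ⟨-, h⟩ | ⟨h1, h2⟩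
    · exact Subtype.ext h
    · have d1 := hp.dist _ e.2
      have d2 := hp.dist _ e'.2
      rw [h1] at d1
      rw [← h2] at d2
      omega
  refine ⟨ends, fun e => ?_, ?_⟩
  · have := hends e
    rw [Sym2.eq_iff] at this
    rcases this with ⟨h1, h2⟩ | ⟨h1, h2⟩
    · exact Or.inl (Prod.ext h1 h2)
    · exact Or.inr (Prod.ext h1 h2)
  · have hinj2 : Function.Injective ends := fun e e' h => hinj e e' (by
      rw [← hends e, ← hends e', h])
    rw [Multiset.Nodup.ext (Multiset.coe_nodup.2 hl.1.of_map) (Finset.univ.nodup.map hinj2)]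
    intro d
    rw [Multiset.mem_coe, Multiset.mem_map]
    constructor
    · intro hd
      have hadj : T.Adj d.1 d.2 := (hl.2 s(d.1, d.2)).1 (List.mem_map.2 ⟨d, hd, rfl⟩)
      obtain ⟨e, he⟩ : ∃ e : {c : κ // c ≠ root}, s(par e.1, e.1) = s(d.1, d.2) := by
        rcases hp.adj_cases hT hadj with ⟨h1, h2⟩ | ⟨h1, h2⟩
        · exact ⟨⟨d.1, h1⟩, by rw [h2]; exact Sym2.eq_swap⟩
        · exact ⟨⟨d.2, h1⟩, by rw [h2]⟩
      refine ⟨e, Finset.mem_univ e, List.inj_on_of_nodup_map hl.1 (hmem e) hd ?_⟩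
      exact (hends e).trans he
    · rintro ⟨e, -, rfl⟩
      exact hmem e

/-- The records of the kinds that are not annotated. -/
def otherRecords (name : V ↪ ℕ) (eT : List (Cluster I.leader × Cluster I.leader))
    (el : (c : Cluster I.leader) → List (Members I.leader c × Members I.leader c)) :
    Multiset (List ℕ) :=
  (Finset.univ : Finset V).val.map (fun v => [0, name v, name (I.leader v)])
    + (eT.map (fun e => [1, name e.1.1, name e.2.1]) : List (List ℕ))
    + ∑ c : Cluster I.leader,
      (((el c).map (fun e => [4, name c.1, name e.1.1, name e.2.1]) : List (List ℕ)) :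
        Multiset (List ℕ))

theorem mem_otherRecords {eT : List (Cluster I.leader × Cluster I.leader)}
    {el : (c : Cluster I.leader) → List (Members I.leader c × Members I.leader c)} {r : List ℕ}
    (h : r ∈ otherRecords name eT el) :
    (∃ v w, r = [0, name v, name w]) ∨ (∃ v w, r = [1, name v, name w]) ∨
      ∃ c v w, r = [4, name c, name v, name w] := by
  rw [otherRecords, Multiset.mem_add, Multiset.mem_add, Multiset.mem_map, Multiset.mem_coe,
    List.mem_map, Multiset.mem_sum] at h
  rcases h with (⟨v, -, rfl⟩ | ⟨e, -, rfl⟩) | ⟨c, -, h⟩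
  · exact Or.inl ⟨_, _, rfl⟩
  · exact Or.inr (Or.inl ⟨_, _, rfl⟩)
  · rw [Multiset.mem_coe, List.mem_map] at h
    obtain ⟨e, -, rfl⟩ := h
    exact Or.inr (Or.inr ⟨_, _, _, rfl⟩)

/-- Only kinds 2, 3 and 5 enter the sums. Kinds 0 and 1 are ignored, and kind 4 is merely copied to
the output. -/
theorem inputData_eq_records {root : Cluster I.leader}
    {ends : {c : Cluster I.leader // c ≠ root} → Cluster I.leader × Cluster I.leader}
    {eT eg : List (Cluster I.leader × Cluster I.leader)}
    {el : (c : Cluster I.leader) → List (Members I.leader c × Members I.leader c)}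
    (heg : (eg : Multiset (Cluster I.leader × Cluster I.leader)) = Finset.univ.val.map ends) :
    (Finset.univ : Finset V).val.map (fun v => [0, name v, name (I.leader v)])
      + (eT.map (fun e => [1, name e.1.1, name e.2.1]) : List (List ℕ))
      + ((I.A.zipIdx 1).map (fun q => [2, q.2, name q.1.1.1, name q.1.2.1]) : List (List ℕ))
      + (eg.map (fun e => [3, name e.1.1, name e.2.1,
          name (I.g e.1 e.2).1, name (I.g e.1 e.2).2]) : List (List ℕ))
      + ∑ c : Cluster I.leader,
          (((el c).map (fun e => [4, name c.1, name e.1.1, name e.2.1]) : List (List ℕ)) :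
            Multiset (List ℕ))
      + ∑ c : Cluster I.leader,
          ((((I.tour c).zipIdx 1).map
            (fun q => [5, name c.1, q.2, name q.1.1.1, name q.1.2.1]) : List (List ℕ)) :
            Multiset (List ℕ)) =
    (I.tables name Q ends).records (otherRecords name eT el) := by
  have h1 : (((I.A.zipIdx 1).map (fun q => [2, q.2, name q.1.1.1, name q.1.2.1]) : List (List ℕ)) :
      Multiset (List ℕ)) = Finset.univ.val.map (I.tables name Q ends).encα := by
    rw [coe_zipIdx_map]
    rfl
  have h2 : ((eg.map (fun e => [3, name e.1.1, name e.2.1,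
      name (I.g e.1 e.2).1, name (I.g e.1 e.2).2]) : List (List ℕ)) : Multiset (List ℕ)) =
      Finset.univ.val.map (I.tables name Q ends).encβ := by
    rw [← Multiset.map_coe, heg, Multiset.map_map]
    rfl
  have h3 : ∑ c : Cluster I.leader, ((((I.tour c).zipIdx 1).map
      (fun q => [5, name c.1, q.2, name q.1.1.1, name q.1.2.1]) : List (List ℕ)) :
      Multiset (List ℕ)) = Finset.univ.val.map (I.tables name Q ends).encγ := by
    rw [map_univ_sigma]
    refine Finset.sum_congr rfl fun c _ => ?_
    have : ((I.tour c).zipIdx 1).map (fun q => [5, name c.1, q.2, name q.1.1.1, name q.1.2.1]) =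
        ((I.tourOn c).zipIdx 1).map (fun q => [5, name c.1, q.2, name q.1.1, name q.1.2]) := by
      refine List.ext_getElem (by simp [tourOn]) fun i h1 h2 => ?_
      simp [tourOn]
    rw [this, coe_zipIdx_map]
    rfl
  rw [h1, h2, h3, JoinTables.records, otherRecords]
  abel

end JoinInstance

/-! ### Decoding the output -/

namespace JoinTables

open JoinSteps

variable {α : Type} {β γ : Type u} [Fintype α] [Fintype β] [Fintype γ] (S : JoinTables α β γ)

/-- The output records are those of the two tables and of the records of kind `4`. -/
theorem bind_outRec {E : Multiset (List ℕ)}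
    (hE : ∀ r ∈ E, r.getD 0 0 = 0 ∨ r.getD 0 0 = 1 ∨ r.getD 0 0 = 4) :
    (S.records E).bind (fun r => (outRec (annotate (steps S.Q) (S.records E) 18 r) :)) =
      E.bind (fun r => (outRec (padRecord r ++ List.replicate 18 0) :)) +
      (Finset.univ.val.map (fun e => [6, S.x e, S.y e]) +
      (Finset.univ.val.map (fun e =>
        [7, S.newDown e + S.beforeDown e, S.parentNode e, S.childNode e]) +
      Finset.univ.val.map (fun e =>
        [7, S.newUp e + S.beforeUp e, S.childNode e, S.parentNode e]) +
      Finset.univ.val.map (fun z => [7, S.arrival z + S.localBefore z + 1, S.u z, S.v z]))) := by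
  obtain ⟨hE', hα, hβ, hγ⟩ := S.annotate_eq hE 18 le_rfl
  have h : ∀ F : List ℕ → Multiset (List ℕ), (S.records E).bind F =
      E.bind F + (Finset.univ.val.bind fun s => F (S.encα s)) +
        (Finset.univ.val.bind fun e => F (S.encβ e)) +
        (Finset.univ.val.bind fun z => F (S.encγ z)) := fun F => by
    simp only [records, Multiset.add_bind, Multiset.bind_map]
  rw [h]
  have h1 : (E.bind fun r => (outRec (annotate (steps S.Q) (S.records E) 18 r) :
      Multiset (List ℕ))) = E.bind (fun r => (outRec (padRecord r ++ List.replicate 18 0) :)) :=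
    Multiset.bind_congr fun r hr => by rw [hE' r hr]
  have h2 : ∀ s, (outRec (annotate (steps S.Q) (S.records E) 18 (S.encα s)) :
      Multiset (List ℕ)) = 0 := fun s => by
    rw [hα s]
    rfl
  have h3 : ∀ e, (outRec (annotate (steps S.Q) (S.records E) 18 (S.encβ e)) :
      Multiset (List ℕ)) = {[6, S.x e, S.y e]} +
        ({[7, S.newDown e + S.beforeDown e, S.parentNode e, S.childNode e]} +
        {[7, S.newUp e + S.beforeUp e, S.childNode e, S.parentNode e]}) := fun e => by
    rw [hβ e]
    exact congrArg _ (S.outRec_rowβ e)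
  have h4 : ∀ z, (outRec (annotate (steps S.Q) (S.records E) 18 (S.encγ z)) :
      Multiset (List ℕ)) = {[7, S.arrival z + S.localBefore z + 1, S.u z, S.v z]} := fun z => by
    rw [hγ z]
    exact congrArg _ (S.outRec_rowγ z)
  simp only [h1, h2, h3, h4, Multiset.bind_zero, Multiset.bind_add, Multiset.bind_singleton]
  abel

end JoinTables

namespace JoinInstance

open JoinSteps

variable {V : Type u} [Fintype V] [DecidableEq V] {I : JoinInstance V} {name : V ↪ ℕ} {Q : ℕ}

theorem bind_otherRecords {eT : List (Cluster I.leader × Cluster I.leader)}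
    {el : (c : Cluster I.leader) → List (Members I.leader c × Members I.leader c)} :
    (otherRecords name eT el).bind
        (fun r => (outRec (padRecord r ++ List.replicate 18 0) : Multiset (List ℕ))) =
      (((Finset.univ.toList.flatMap fun c => (el c).map (Prod.map Subtype.val Subtype.val)).map
        (fun e : V × V => [6, name e.1, name e.2]) : List (List ℕ)) : Multiset (List ℕ)) := by
  obtain ⟨F, hF⟩ : ∃ F : List ℕ → Multiset (List ℕ),
    F = fun r => (outRec (padRecord r ++ List.replicate 18 0) : Multiset (List ℕ)) := ⟨_, rfl⟩
  have h0 : ∀ v w, F [0, v, w] = 0 := fun v w => by rw [hF]; rfl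
  have h1 : ∀ v w, F [1, v, w] = 0 := fun v w => by rw [hF]; rfl
  have h4 : ∀ c v w, F [4, c, v, w] = {[6, v, w]} := fun c v w => by rw [hF]; rfl
  have hsum : ∀ G : Cluster I.leader → Multiset (List ℕ),
      (∑ c, G c).bind F = Finset.univ.val.bind fun c => (G c).bind F := fun G => by
    rw [Finset.sum, ← Multiset.bind_assoc]
    rfl
  rw [← hF, otherRecords, Multiset.add_bind, Multiset.add_bind, hsum, Multiset.bind_map,
    ← Multiset.map_coe, Multiset.bind_map]
  simp only [h0, h1, Multiset.bind_zero, zero_add]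
  rw [List.map_flatMap, ← Multiset.coe_bind, Finset.coe_toList]
  refine Multiset.bind_congr fun c _ => ?_
  rw [← Multiset.map_coe, Multiset.bind_map]
  simp only [h4, Multiset.bind_singleton, Multiset.map_coe, List.map_map]
  rfl

/-- The images of the edges between the clusters and the edges of the cluster trees form a list of
the edges of the joined tree. -/
theorem isEdgeList_joinedTree {eg : List (Cluster I.leader × Cluster I.leader)}
    {el : (c : Cluster I.leader) → List (Members I.leader c × Members I.leader c)}
    (hg : IsEdgeList I.T eg) (hl : ∀ c, IsEdgeList (I.tree c) (el c)) :
    IsEdgeList I.joinedTree ((eg.map fun e => I.g e.1 e.2) ++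
      Finset.univ.toList.flatMap fun c => (el c).map (Prod.map Subtype.val Subtype.val)) := by
  have hadj : ∀ e ∈ eg, I.T.Adj e.1 e.2 := fun e he => (hg.2 s(e.1, e.2)).1
    (List.mem_map.2 ⟨e, he, rfl⟩)
  have hcross : ∀ e ∈ eg, Sym2.map I.clusterOf s((I.g e.1 e.2).1, (I.g e.1 e.2).2) =
      s(e.1, e.2) := fun e he => by
    obtain ⟨h1, h2⟩ := I.g_mem _ _ (hadj e he)
    rw [Sym2.map_mk, clusterOf_eq h1, clusterOf_eq h2]
  have hlocal : ∀ c, ∀ e : Members I.leader c × Members I.leader c,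
      Sym2.map I.clusterOf s((e.1 : V), (e.2 : V)) = s(c, c) := fun c e => by
    rw [Sym2.map_mk, clusterOf_eq e.1.2, clusterOf_eq e.2.2]
  rw [IsEdgeList, List.map_append, List.map_map, List.map_flatMap]
  simp only [List.map_map]
  constructor
  · rw [List.nodup_append']
    -- Projection to the clusters tells the edges apart: a crossing edge goes to its edge of T, an
    -- edge of the tree of c to the loop s(c, c).
    refine ⟨List.Nodup.of_map (Sym2.map I.clusterOf) ?_, ?_, ?_⟩
    · rw [List.map_map]
      exact (congrArg List.Nodup (List.map_congr_left (g := fun e => s(e.1, e.2)) hcross)).mpr hg.1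
    · rw [List.nodup_flatMap]
      constructor
      · intro c _
        have : ((fun e : V × V => s(e.1, e.2)) ∘ Prod.map Subtype.val Subtype.val) =
            Sym2.map Subtype.val ∘ fun e : Members I.leader c × Members I.leader c =>
              s(e.1, e.2) := rfl
        rw [this, ← List.map_map]
        exact (hl c).1.map (Sym2.map.injective Subtype.val_injective)
      · refine (Finset.nodup_toList _).imp fun {c c'} hne => ?_
        refine List.disjoint_left.2 fun d hd hd' => hne ?_
        obtain ⟨e, -, rfl⟩ := List.mem_map.1 hd
        obtain ⟨e', -, h⟩ := List.mem_map.1 hd'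
        have := (hlocal c e).symm.trans ((congrArg (Sym2.map I.clusterOf) h.symm).trans
          (hlocal c' e'))
        simpa using this
    · refine List.disjoint_left.2 fun d hd hd' => ?_
      obtain ⟨e, he, rfl⟩ := List.mem_map.1 hd
      obtain ⟨c, -, hc⟩ := List.mem_flatMap.1 hd'
      obtain ⟨e', -, h⟩ := List.mem_map.1 hc
      have := (hcross e he).symm.trans ((congrArg (Sym2.map I.clusterOf) h.symm).trans
          (hlocal c e'))
      have hne := (hadj e he).ne
      rw [Sym2.eq_iff] at this
      rcases this with ⟨h1, h2⟩ | ⟨h1, h2⟩ <;> exact hne (h1.trans h2.symm)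
  · intro d
    rw [edgeSet_joinedTree, joinedEdges, List.mem_append, Set.mem_union]
    refine or_congr ⟨?_, ?_⟩ ?_
    · intro hd
      obtain ⟨e, he, rfl⟩ := List.mem_map.1 hd
      exact ⟨_, _, hadj e he, rfl⟩
    · rintro ⟨a, b, hab, rfl⟩
      obtain ⟨e, he, h⟩ := List.mem_map.1 ((hg.2 s(a, b)).2 hab)
      refine List.mem_map.2 ⟨e, he, ?_⟩
      rw [Sym2.eq_iff] at h
      rcases h with ⟨h1, h2⟩ | ⟨h1, h2⟩
      · rw [Function.comp, h1, h2]
      · rw [Function.comp, h1, h2, I.g_symm a b hab]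
        exact Sym2.eq_swap
    · rw [List.mem_flatMap, Set.mem_iUnion]
      refine exists_congr fun c => ?_
      rw [List.mem_map]
      constructor
      · rintro ⟨-, e, he, rfl⟩
        exact ⟨s(e.1, e.2), ((hl c).2 _).1 (List.mem_map.2 ⟨e, he, rfl⟩), rfl⟩
      · rintro ⟨f, hf, rfl⟩
        obtain ⟨e, he, rfl⟩ := List.mem_map.1 (((hl c).2 f).2 hf)
        exact ⟨Finset.mem_toList.2 (Finset.mem_univ c), e, he, rfl⟩

theorem kind_otherRecords {eT : List (Cluster I.leader × Cluster I.leader)}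
    {el : (c : Cluster I.leader) → List (Members I.leader c × Members I.leader c)} :
    ∀ r ∈ otherRecords name eT el, r.getD 0 0 = 0 ∨ r.getD 0 0 = 1 ∨ r.getD 0 0 = 4 := by
  intro r hr
  rcases mem_otherRecords hr with ⟨v, w, rfl⟩ | ⟨v, w, rfl⟩ | ⟨c, v, w, rfl⟩ <;> simp

/-- The output records made from the annotated input represent the joined tree and the tour. -/
theorem isOutputData_bind {root : Cluster I.leader}
    {ends : {c : Cluster I.leader // c ≠ root} → Cluster I.leader × Cluster I.leader}
    {eT eg : List (Cluster I.leader × Cluster I.leader)}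
    {el : (c : Cluster I.leader) → List (Members I.leader c × Members I.leader c)}
    (heg : (eg : Multiset (Cluster I.leader × Cluster I.leader)) = Finset.univ.val.map ends)
    (hg : IsEdgeList I.T eg) (hl : ∀ c, IsEdgeList (I.tree c) (el c)) {B : List (V × V)}
    (hB : (((B.zipIdx 1).map (fun q => [7, q.2, name q.1.1, name q.1.2]) : List (List ℕ)) :
        Multiset (List ℕ)) =
      Finset.univ.val.map (fun e => [7, (I.tables name Q ends).newDown e +
        (I.tables name Q ends).beforeDown e, (I.tables name Q ends).parentNode e,
        (I.tables name Q ends).childNode e]) +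
      Finset.univ.val.map (fun e => [7, (I.tables name Q ends).newUp e +
        (I.tables name Q ends).beforeUp e, (I.tables name Q ends).childNode e,
        (I.tables name Q ends).parentNode e]) +
      Finset.univ.val.map (fun z => [7, (I.tables name Q ends).arrival z +
        (I.tables name Q ends).localBefore z + 1, (I.tables name Q ends).u z,
        (I.tables name Q ends).v z])) :
    I.IsOutputData name B (((I.tables name Q ends).records (otherRecords name eT el)).bind
      (fun r => (outRec (annotate (steps Q)
        ((I.tables name Q ends).records (otherRecords name eT el)) 18 r) :))) := by
  refine ⟨_, isEdgeList_joinedTree hg hl, ?_⟩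
  refine ((I.tables name Q ends).bind_outRec kind_otherRecords).trans ?_
  rw [← hB, bind_otherRecords, List.map_append, ← Multiset.coe_add, List.map_map,
    ← Multiset.map_coe _ eg, heg, Multiset.map_map, ← add_assoc]
  congr 1
  exact add_comm _ _

end JoinInstance

/-! ### The implementation -/

namespace JoinInstance

open JoinSteps

variable {V : Type u} [Fintype V] [DecidableEq V] {I : JoinInstance V} {name : V ↪ ℕ} {Q : ℕ}

theorem card_cluster_le : Fintype.card (Cluster I.leader) ≤ Fintype.card V :=
  Fintype.card_subtype_le _

theorem length_A_le : I.A.length ≤ 2 * Fintype.card V := by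
  have := card_cluster_le (I := I)
  rw [I.A_isEulerTour.length_eq, Nat.card_eq_fintype_card]
  omega

theorem length_tourOn_le (c : Cluster I.leader) :
    (I.tourOn c).length ≤ 2 * Fintype.card (Members I.leader c) := by
  rw [tourOn, List.length_map, (I.tour_isEulerTour c).length_eq, Nat.card_eq_fintype_card]
  omega

theorem card_entries_le : Fintype.card (Σ c, Fin (I.tourOn c).length) ≤ 2 * Fintype.card V := by
  rw [Fintype.card_sigma, ← I.sum_card_members, Finset.mul_sum]
  exact Finset.sum_le_sum fun c _ => by simpa using length_tourOn_le c

theorem length_tourOn_le_card (c : Cluster I.leader) :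
    (I.tourOn c).length ≤ 2 * Fintype.card V :=
  (length_tourOn_le c).trans (Nat.mul_le_mul_left 2 (Fintype.card_subtype_le _))

/-- Tours have altogether at most 2 * n ≤ (n + 1)^2 entries, which bounds the rows and the recorded
positions; the exponent c + 2 covers the names too. -/
theorem bounded_tables {root : Cluster I.leader}
    {ends : {c : Cluster I.leader // c ≠ root} → Cluster I.leader × Cluster I.leader} {n c : ℕ}
    (hn : Fintype.card V = n) (hname : ∀ v, name v < (n + 1) ^ c) :
    (I.tables name Q ends).Bounded (n + 1) (c + 2) := by
  have h1 : 1 ≤ n := hn ▸ Fintype.card_pos_iff.2 ⟨root.1⟩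
  have h2 : 2 * n ≤ (n + 1) ^ 2 := by nlinarith
  have h3 : (n + 1) ^ 2 ≤ (n + 1) ^ (c + 2) := Nat.pow_le_pow_right (by omega) (by omega)
  have hv : ∀ v, name v ≤ (n + 1) ^ (c + 2) := fun v =>
    (hname v).le.trans (Nat.pow_le_pow_right (by omega) (by omega))
  have hA : I.A.length ≤ 2 * n := hn ▸ length_A_le
  refine ⟨by omega, by omega, ?_, ?_, ?_, fun s => ⟨?_, hv _, hv _⟩,
    fun e => ⟨hv _, hv _, hv _, hv _⟩, fun z => ⟨hv _, ?_, hv _, hv _⟩⟩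
  · rw [Fintype.card_fin]
    omega
  · refine (Fintype.card_subtype_le _).trans (card_cluster_le.trans ?_)
    omega
  · exact card_entries_le.trans (hn ▸ h2)
  · have : (s : ℕ) + 1 ≤ I.A.length := s.2
    exact this.trans (by omega)
  · have e1 : (z.2 : ℕ) + 1 ≤ (I.tourOn z.1).length := z.2.2
    have e2 := length_tourOn_le_card (I := I) z.1
    rw [hn] at e2
    exact e1.trans (by omega)

/-- The number of words in a record of the given kind. -/
def recordLength (k : ℕ) : ℕ := [3, 3, 4, 5, 4, 5].getD k 0

/-- Edges between clusters yield the longest output, 3 + 4 + 4 = 11 words. Keys, which involve Q,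
are never stored, so the bound on words does not depend on Q. -/
theorem annotate_bounds {root : Cluster I.leader}
    {ends : {c : Cluster I.leader // c ≠ root} → Cluster I.leader × Cluster I.leader}
    {eT : List (Cluster I.leader × Cluster I.leader)}
    {el : (c : Cluster I.leader) → List (Members I.leader c × Members I.leader c)} {n c : ℕ}
    (hn : Fintype.card V = n) (hname : ∀ v, name v < (n + 1) ^ c) {D : Multiset (List ℕ)}
    (hD : D = (I.tables name Q ends).records (otherRecords name eT el)) :
    (∀ r ∈ D, HasLength recordLength r ∧ r.length ≤ 5 ∧
      ∀ w ∈ annotate (steps Q) D 18 r, w < (n + 1) ^ (c + 2 + 14)) ∧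
    ∀ r ∈ D, (outRec (annotate (steps Q) D 18 r)).flatten.length ≤ 11 ∧
      ∀ w ∈ (outRec (annotate (steps Q) D 18 r)).flatten, w < (n + 1) ^ (c + 2 + 14) := by
  have hb := bounded_tables (I := I) (Q := Q) (ends := ends) hn hname
  obtain ⟨hE, hα, hβ, hγ⟩ := (I.tables name Q ends).annotate_eq
    (kind_otherRecords (name := name) (eT := eT) (el := el)) 18 le_rfl
  rw [← hD] at hE hα hβ hγ
  obtain ⟨S, hS⟩ : ∃ S, S = I.tables name Q ends := ⟨_, rfl⟩
  have hQ : Q = S.Q := by rw [hS]; rfl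
  rw [← hS] at hb hE hα hβ hγ hD
  rw [hQ]
  have hv : ∀ v, name v < (n + 1) ^ (c + 2 + 14) := fun v =>
    (hname v).trans_le (Nat.pow_le_pow_right (by omega) (by omega))
  have hs : ∀ w, w ≤ 8 → w < (n + 1) ^ (c + 2 + 14) := fun w hw => hb.small_lt hw
  have key : ∀ r ∈ D, (HasLength recordLength r ∧ r.length ≤ 5 ∧
      ∀ w ∈ annotate (steps S.Q) D 18 r, w < (n + 1) ^ (c + 2 + 14)) ∧
      (outRec (annotate (steps S.Q) D 18 r)).flatten.length ≤ 11 ∧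
      ∀ w ∈ (outRec (annotate (steps S.Q) D 18 r)).flatten, w < (n + 1) ^ (c + 2 + 14) := by
    intro r hr
    rw [hD, JoinTables.records, Multiset.mem_add, Multiset.mem_add, Multiset.mem_add,
      Multiset.mem_map, Multiset.mem_map, Multiset.mem_map] at hr
    rcases hr with ((hr | ⟨s, -, rfl⟩) | ⟨e, -, rfl⟩) | ⟨z, -, rfl⟩
    · rw [hE r hr]
      rcases mem_otherRecords hr with ⟨v, w, rfl⟩ | ⟨v, w, rfl⟩ | ⟨d, v, w, rfl⟩
      · refine ⟨⟨⟨_, _, rfl, rfl⟩, by simp, ?_⟩, by simp [padRecord, outRec, fld], ?_⟩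
        · simp [padRecord, hv, hs]
        · simp [padRecord, outRec, fld]
      · refine ⟨⟨⟨_, _, rfl, rfl⟩, by simp, ?_⟩, by simp [padRecord, outRec, fld], ?_⟩
        · simp [padRecord, hv, hs]
        · simp [padRecord, outRec, fld]
      · refine ⟨⟨⟨_, _, rfl, rfl⟩, by simp, ?_⟩, by simp [padRecord, outRec, fld], ?_⟩
        · simp [padRecord, hv, hs]
        · simp [padRecord, outRec, fld, hv, hs]
    · rw [hα s]
      refine ⟨⟨⟨_, _, rfl, rfl⟩, by simp [JoinTables.encα], hb.rowα_lt s⟩, ?_, ?_⟩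
      · exact Nat.zero_le 11
      · exact fun w hw => absurd hw List.not_mem_nil
    · rw [hβ e]
      exact ⟨⟨⟨_, _, rfl, rfl⟩, by simp [JoinTables.encβ], hb.rowβ_lt e⟩,
        (congrArg (fun l => l.flatten.length) (S.outRec_rowβ e)).le, hb.outRec_rowβ_lt e⟩
    · rw [hγ z]
      exact ⟨⟨⟨_, _, rfl, rfl⟩, by simp [JoinTables.encγ], hb.rowγ_lt z⟩,
        (congrArg (fun l => l.flatten.length) (S.outRec_rowγ z)).le.trans (by simp),
        hb.outRec_rowγ_lt z⟩
  exact ⟨fun r hr => (key r hr).1, fun r hr => (key r hr).2⟩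

/-- The annotation program solves the join problem. -/
theorem exists_isOutput_isOutputData {n c : ℕ} (hn : Fintype.card V = n)
    (hname : ∀ v, name v < (n + 1) ^ c) (hQ : Q = (n + 1) ^ c + 2 * n + 2)
    {D : Multiset (List ℕ)} (hD : I.IsInputData name D) :
    ((∀ r ∈ D, HasLength recordLength r ∧ r.length ≤ 5 ∧
      ∀ w ∈ annotate (steps Q) D 18 r, w < (n + 1) ^ (c + 2 + 14)) ∧
    ∀ r ∈ D, (outRec (annotate (steps Q) D 18 r)).flatten.length ≤ 11 ∧
      ∀ w ∈ (outRec (annotate (steps Q) D 18 r)).flatten, w < (n + 1) ^ (c + 2 + 14)) ∧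
    ∃ B, I.IsOutput B ∧
      I.IsOutputData name B (D.bind fun r => (outRec (annotate (steps Q) D 18 r) :)) := by
  obtain ⟨eT, eg, el, -, hg, hl, hD⟩ := hD
  -- Q is chosen above all names and tour lengths, as the codes of pairs require.
  have hA : I.A.length < Q := by
    have := length_A_le (I := I)
    omega
  have hnQ : ∀ v, name v < Q := fun v => by
    have := hname v
    omega
  obtain ⟨d⟩ := I.T_isTree.connected.nonempty
  rcases subsingleton_or_nontrivial (Cluster I.leader) with h | h
  · obtain ⟨par, hp⟩ := exists_isParentMap I.T_isTree d
    obtain ⟨ends, -, heg⟩ := exists_ends I.T_isTree hp hg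
    have hD' := hD.trans (inputData_eq_records (Q := Q) heg)
    have hd : ∀ d', d' = d := fun d' => Subsingleton.elim _ _
    refine ⟨annotate_bounds hn hname hD', I.tourOn d, Or.inl ⟨d, hd, rfl⟩, ?_⟩
    rw [hD']
    exact isOutputData_bind heg hg hl (tourOn_records hd)
  · obtain ⟨r, hr⟩ := I.exists_isCanonical hA
    obtain ⟨ends, hends, heg⟩ := exists_ends I.T_isTree r.isParentMap hg
    have hD' := hD.trans (inputData_eq_records (Q := Q) heg)
    have henc : r.IsEncoded name Q ends := ⟨hr, hends, hnQ, hA, fun c => by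
      have := length_tourOn_le_card c
      omega⟩
    refine ⟨annotate_bounds hn hname hD', r.output, Or.inr ⟨h, r, rfl⟩, ?_⟩
    rw [hD']
    exact isOutputData_bind heg hg hl henc.output_records

end JoinInstance

theorem mainTheorem6 :
    -- correctness of the algorithm, for all choices it can make
    (∀ (V : Type u) [Fintype V] [DecidableEq V] (I : JoinInstance V),
      I.joinedTree.IsTree ∧ I.joinedTree.edgeSet = I.joinedEdges ∧
      (∃ B, I.IsOutput B) ∧
      ∀ B, I.IsOutput B → IsEulerTour I.joinedTree B) ∧
    -- implementation in the MPC model: fully scalable, constantly many rounds, linear total space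
    (∀ ε : ℝ, 0 < ε → ε < 1 → ∀ c L : ℕ, ∃ (R K : ℕ) (alg : ℕ → MPCProgram),
      ∀ n : ℕ, 1 ≤ n →
        ((alg n).s : ℝ) ≤ K * (n : ℝ) ^ ε ∧
        (alg n).p * (alg n).s ≤ K * n ∧
        ∀ (V : Type u) [Fintype V] [DecidableEq V] (I : JoinInstance V) (name : V ↪ ℕ),
          Fintype.card V = n → (∀ v, name v < (n + 1) ^ c) →
          ∀ (m : ℕ) (inp : Fin m → List (List ℕ)),
            m * ⌈(n : ℝ) ^ ε⌉₊ ≤ L * n →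
            (∀ i, (inp i).flatten.length ≤ L * ⌈(n : ℝ) ^ ε⌉₊) →
            I.IsInputData name (∑ i, (inp i : Multiset (List ℕ))) →
            m ≤ (alg n).p ∧
            (alg n).Respects (((alg n).p * (alg n).s + 2) ^ K) R ((alg n).load inp) ∧
            ∃ (B : List (V × V)) (out : Fin (alg n).p → List (List ℕ)),
              I.IsOutput B ∧
              (∀ i, (alg n).mem ((alg n).load inp) R i = (out i).flatten) ∧
              I.IsOutputData name B (∑ i, (out i : Multiset (List ℕ)))) := by
  refine ⟨fun V _ _ I => ⟨I.isTree_joinedTree, I.edgeSet_joinedTree, I.exists_isOutput,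
    fun B hB => I.isEulerTour_of_isOutput hB⟩, fun ε hε hε1 c L => ?_⟩
  -- There are 18 steps, at most 11 output words per record, and all words are below (n + 1)^(c + 2
  -- + 14).
  obtain ⟨R, K, h⟩ := exists_mpc_annotate hε hε1 L 18 11 (c + 2 + 14)
  -- For n = 0 nothing is claimed, and an empty program serves as default.
  have h' : ∀ n : ℕ, ∃ P : MPCProgram, 1 ≤ n → _ := fun n =>
    if hn : 1 ≤ n then
      let ⟨P, hP⟩ := h n hn JoinInstance.recordLength (JoinSteps.steps ((n + 1) ^ c + 2 * n + 2))
        JoinSteps.outRec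
      ⟨P, fun _ => hP⟩
    else ⟨⟨0, 0, fun _ _ _ _ => []⟩, fun hn' => absurd hn' hn⟩
  choose alg halg using h'
  refine ⟨R, K, alg, fun n hn => ?_⟩
  obtain ⟨hs, hp, halg⟩ := halg n hn
  refine ⟨hs, hp, fun V _ _ I name hcard hname m inp hm hinp hD => ?_⟩
  obtain ⟨⟨hlen, hout⟩, B, hB, hBD⟩ :=
    JoinInstance.exists_isOutput_isOutputData hcard hname rfl hD
  obtain ⟨hmp, hres, out, hmem, hsum⟩ := halg m inp hm hinp _ rfl hlen hout
  exact ⟨hmp, hres, B, out, hB, hmem, hsum ▸ hBD⟩
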